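/- **Setting.** *Programs.* A method is an instruction array $I$ with an exception handler array $H$ of entries $(b,e,L,c)$; instructions are instanceof, aload, astore, athrow, dup, getfield, getstatic, putstatic, goto, iconst, ldc, if_icmpeq, ifeq, invoke, return, System.exit, and, in inlined code only, sections [EVALUATE $g$] (push $1$ or $0$ according to the guard $g$) and [EXECUTE $u$] (perform the simultaneous assignment $u$ to the static fields of a reserved monitor class). A program consists of a single-inheritance class hierarchy, a list of API methods ordered bottom-up, and methods. A target program is one whose methods are non-empty, whose jumps, fall-through and handlers stay inside the code, and which contains no monitor sections and no putstatic to the monitor class. *Assertions* are built from $\mathit{tt},\mathit{ff},e=e,e\bowtie e,\wedge,\neg,e:c$ over expressions built from constants, instance fields $e.f$, static fields $c.f$, stack positions $\mathrm s_i$, locals $\mathrm l_i$, ghost variables, $e\circ e$, $(a\to e\mid e)$, $(e,e)$ and $\bot$; as usual $a\Rightarrow b$ is $\neg(a\wedge\neg b)$. The theory is *freely generated*: distinct constants are distinct, but the operators $\circ$ and the relations $\bowtie$ other than equality satisfy no laws, so an assertion is *valid* if it holds in all type-safe configurations under every interpretation of these symbols. *Contracts* consist of security state variables and, for API methods, optional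 before / after / exceptional lists of guarded simultaneous assignments; a contract is well formed if its clauses use only declared state variables and existing arguments, and the returned value only in after clauses. For each security relevant call the ghost monitor saves target and arguments in ghost variables and updates the ghost state ${\bf ms}^g$ before the call, after normal return, and at the start of the handler for the call: it dispatches on the class of the saved target, bottom-up, applies the first clause whose guard holds, and sets the state to $\bot$ if there is none. The ghost monitor can be embedded in a program if each security relevant call at $L$ has a handler $(L,L+1,L',\mathrm{Throwable})$ which is the first one covering $L$ and whose target $L'$ is shared with no other handler. *Adherence proofs.* An adherence proof for $P'$ and $\mathcal C$ assigns to each method of $P'$, with embedded ghost monitor, an assertion array $A$ with $|A|=|I|$ such that with $\mathit{pre}=\mathit{post}=({\bf ms}={\bf ms}^g)$ the verification conditions $\mathit{pre}\Rightarrow A_0$ and $A_L\Rightarrow \mathit{wp}(L)$, $0\le L<|I|$, are valid (local validity). Here $\mathit{wp}(L)$ is the weakest precondition of the ghost updates at $L$ followed by the instruction at $L$: for invoke $c.m$ it is the conjunction of $\mathit{pre}$ over the classes $c'$ with $c<:c'$ that define $m$, for return it is $\mathit{post}$, for System.exit it is $\mathit{tt}$, for athrow it selects, among the handlers covering $L$,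 the assertion at the target of the first whose class matches, and $\mathit{post}$ if there is none, and for all other instructions it is the usual substitution instance (for conditional jumps: conditional combination) of the assertions at the successor positions. *Inlining and proof generation.* The inliner replaces each security relevant call by a block that stores and reloads target and arguments, runs the before clauses of the class of the target, calls the method under a new handler, and runs the after (respectively exceptional) clauses, rethrowing the exception in the latter case; it calls System.exit if no guard holds. The generated proof assigns ${\bf ms}={\bf ms}^g$ to all instructions outside the blocks, to the first instruction of each block and to the rethrow. With $J$ the conjunction of ${\bf ms}={\bf ms}^g$ and the equality of the stored target and arguments with the saved ones, it assigns $J$ to the first instruction after the call and to the first of the handler, and $J$ taken back through the ghost updates to the call. All other inlined instructions get their weakest preconditions. *Rewriting.* A rewrite step applies somewhere in a formula one of the rules $e=e\to\mathit{tt}$; $(\psi\Rightarrow\phi)\wedge(\neg\psi\Rightarrow\phi)\to\phi$ (case merging); $(\psi\Rightarrow\phi)\to(\psi\Rightarrow\phi[\mathit{tt}/\psi])$; $(\neg\psi\Rightarrow\phi)\to(\neg\psi\Rightarrow\phi[\mathit{ff}/\psi])$; $(a\wedge b\Rightarrow\phi)\to(a\Rightarrow(b\Rightarrow\phi))$; $((a\to1\mid0)=0)\to\neg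 a$; $\neg\neg a\to a$; evaluation of $\neg,\wedge$ and conditional expressions at $\mathit{tt},\mathit{ff}$; or, to the whole formula, $(x=y\Rightarrow\phi)\to\phi[z/x][z/y]$ for variables $x,y$ (stack positions, locals, static fields, ghost variables) and a fresh variable $z$. *Algorithms* are programs of a fixed first-order language over binary trees with number leaves and structural recursion, in which each elementary operation costs the size (in bits) of its input and output, so that Turing machines simulate them with polynomial overhead. Programs, contracts and assertion arrays are encoded as trees in a standard way. **Theorem (Efficient Recognition).** There are an algorithm $R$ and a polynomial $p$ such that: 1. on every input consisting of a program $P'$, a contract $\mathcal C$ and an assertion array for each of a list of methods, $R$ runs in time at most $p(\text{size of the encoded input})$; 2. if $R$ accepts such an input, then the given arrays form an adherence proof for $P'$ and $\mathcal C$, and each of its verification conditions $\varphi$ rewrites to $\mathit{tt}$ in at most $p(|\varphi|)$ steps, where $|\varphi|$ is the number of symbols of $\varphi$; 3. for every target program $P$ and every well-formed contract $\mathcal C$ (over the freely generated theory), $R$ accepts the program resulting from inlining $P$ with $\mathcal C$, together with $\mathcal C$ and the adherence proof generated for it. -/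

import Mathlib

namespace IRM

/-! ### Expressions and assertions

Class, method and field names, local-variable indices, operator and relation symbols, and constants
are natural numbers (the constants `0` and `1` are the integers zero and one). -/

/-- Ghost variables: the components of the ghost monitor state, the saved call target, the saved call
arguments and the saved return value of the call. `tmp n` are logical variables, which occur in no
program, contract or ghost monitor and serve as fresh variables in rewriting. -/
inductive GVar where
  | ms (i : ℕ)
  | target
  | arg (j : ℕ)
  | result
  | tmp (n : ℕ)
deriving DecidableEq

mutual
/-- `e ::= v | e.f | c.f | sᵢ | lᵢ | x^g | e ∘ e | (a → e | e) | (e, e) | ⊥`. -/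
inductive Expr where
  | lit (v : ℕ)
  | field (e : Expr) (f : ℕ)
  | static (c f : ℕ)
  | stack (i : ℕ)
  | loc (i : ℕ)
  | ghost (x : GVar)
  | op (o : ℕ) (e₁ e₂ : Expr)
  | cond (a : Assertion) (e₁ e₂ : Expr)
  | pair (e₁ e₂ : Expr)
  | bot
deriving DecidableEq
/-- `a ::= tt | ff | e = e | e ⋈ e | a ∧ a | ¬ a | e : c`. -/
inductive Assertion where
  | tt
  | ff
  | eq (e₁ e₂ : Expr)
  | rel (r : ℕ) (e₁ e₂ : Expr)
  | and (a₁ a₂ : Assertion)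
  | not (a : Assertion)
  | hasType (e : Expr) (c : ℕ)
deriving DecidableEq
end

namespace Assertion

/-- Implication, as usual, from `∧` and `¬`. -/
def imp (a b : Assertion) : Assertion := .not (.and a (.not b))

/-- `IF(a₀, a₁, a₂) = (a₀ ⇒ a₁) ∧ (¬ a₀ ⇒ a₂)`. -/
def ite (a₀ a₁ a₂ : Assertion) : Assertion := .and (imp a₀ a₁) (imp (.not a₀) a₂)

/-- `SELECT`: the generalized conditional, given by its list of (guard, branch) pairs. -/
def select (l : List (Assertion × Assertion)) (els : Assertion) : Assertion :=
  l.foldr (fun p r => ite p.1 p.2 r) els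

/-- Finite conjunctions. -/
def conj : List Assertion → Assertion
  | [] => .tt
  | [a] => a
  | a :: b :: l => .and a (conj (b :: l))

end Assertion

mutual
/-- Number of symbols. -/
def Expr.size : Expr → ℕ
  | .field e _ => e.size + 1
  | .op _ e₁ e₂ => e₁.size + e₂.size + 1
  | .cond a e₁ e₂ => a.size + e₁.size + e₂.size + 1
  | .pair e₁ e₂ => e₁.size + e₂.size + 1
  | .lit _ => 1
  | .static _ _ => 1
  | .stack _ => 1
  | .loc _ => 1
  | .ghost _ => 1
  | .bot => 1
/-- Number of symbols. -/
def Assertion.size : Assertion → ℕ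
  | .tt => 1
  | .ff => 1
  | .eq e₁ e₂ => e₁.size + e₂.size + 1
  | .rel _ e₁ e₂ => e₁.size + e₂.size + 1
  | .and a b => a.size + b.size + 1
  | .not a => a.size + 1
  | .hasType e _ => e.size + 1
end

/-! ### Substitution -/

/-- A simultaneous substitution for the variables: operand stack positions, local variables, static
fields and ghost variables. -/
structure Subst where
  stack : ℕ → Expr := .stack
  loc : ℕ → Expr := .loc
  static : ℕ → ℕ → Expr := .static
  ghost : GVar → Expr := .ghost

mutual
def Expr.subst (σ : Subst) : Expr → Expr
  | .lit v => .lit v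
  | .field e f => .field (e.subst σ) f
  | .static c f => σ.static c f
  | .stack i => σ.stack i
  | .loc i => σ.loc i
  | .ghost x => σ.ghost x
  | .op o e₁ e₂ => .op o (e₁.subst σ) (e₂.subst σ)
  | .cond a e₁ e₂ => .cond (a.subst σ) (e₁.subst σ) (e₂.subst σ)
  | .pair e₁ e₂ => .pair (e₁.subst σ) (e₂.subst σ)
  | .bot => .bot
def Assertion.subst (σ : Subst) : Assertion → Assertion
  | .tt => .tt
  | .ff => .ff
  | .eq e₁ e₂ => .eq (e₁.subst σ) (e₂.subst σ)
  | .rel r e₁ e₂ => .rel r (e₁.subst σ) (e₂.subst σ)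
  | .and a b => .and (a.subst σ) (b.subst σ)
  | .not a => .not (a.subst σ)
  | .hasType e c => .hasType (e.subst σ) c
end

/-- `[z/x]` for a variable `x`. -/
def Subst.single (x z : Expr) : Subst where
  stack i := if Expr.stack i = x then z else .stack i
  loc i := if Expr.loc i = x then z else .loc i
  static c f := if Expr.static c f = x then z else .static c f
  ghost y := if Expr.ghost y = x then z else .ghost y

/-- The stack part of the substitution for an instruction that pushes the value of `e`:
`unshift (_[e/s₀])`. -/
def pushStack (e : Expr) : ℕ → Expr
  | 0 => e
  | i + 1 => .stack i

/-- The stack part of the substitution for an instruction that replaces the top of the stack by the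
value of `e`: `_[e/s₀]`. -/
def replaceTop (e : Expr) : ℕ → Expr
  | 0 => e
  | i + 1 => .stack (i + 1)

/-- `shiftᵏ`: increments every stack index by `k` (the instruction pops `k` values). -/
def popStack (k : ℕ) : ℕ → Expr := fun i => .stack (i + k)

/-! ### Semantics -/

/-- An interpretation of the data types. In a freely generated theory there are no equations between
operators: nothing is required of the operators and of the relation symbols other than equality, and
validity (below) is truth under every interpretation. Operators may be partial. -/
structure DataAlgebra where
  Val : Type
  lit : ℕ → Val
  lit_injective : Function.Injective lit
  bot : Val
  pair : Val → Val → Val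
  op : ℕ → Val → Val → Option Val
  rel : ℕ → Val → Val → Prop

/-- The part of a configuration that assertions can refer to: the operand stack and local variables of
the top activation record, the heap (static fields, instance fields, typing of values), and the
ghost variables. `none` means undefined. -/
structure Config (D : DataAlgebra) where
  stack : List D.Val
  loc : ℕ → Option D.Val
  static : ℕ → ℕ → Option D.Val
  field : D.Val → ℕ → Option D.Val
  typing : D.Val → ℕ → Prop
  ghost : GVar → Option D.Val

open Classical in
mutual
/-- `⟦e⟧C`; expressions are partial. -/
noncomputable def Expr.sem {D : DataAlgebra} (C : Config D) : Expr → Option D.Val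
  | .lit v => some (D.lit v)
  | .field e f => (e.sem C).bind fun v => C.field v f
  | .static c f => C.static c f
  | .stack i => C.stack[i]?
  | .loc i => C.loc i
  | .ghost x => C.ghost x
  | .op o e₁ e₂ => (e₁.sem C).bind fun v => (e₂.sem C).bind fun w => D.op o v w
  | .cond a e₁ e₂ => if a.sem C then e₁.sem C else e₂.sem C
  | .pair e₁ e₂ => (e₁.sem C).bind fun v => (e₂.sem C).map fun w => D.pair v w
  | .bot => some D.bot
/-- `⟦a⟧C`. Equality is Kleene equality: both sides undefined, or both defined and equal. -/
noncomputable def Assertion.sem {D : DataAlgebra} (C : Config D) : Assertion → Prop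
  | .tt => True
  | .ff => False
  | .eq e₁ e₂ => e₁.sem C = e₂.sem C
  | .rel r e₁ e₂ => ∃ v w, e₁.sem C = some v ∧ e₂.sem C = some w ∧ D.rel r v w
  | .and a b => a.sem C ∧ b.sem C
  | .not a => ¬ a.sem C
  | .hasType e c => ∃ v, e.sem C = some v ∧ C.typing v c
end

/-! ### Programs -/

/-- The class `Throwable`, which catches every exception. -/
def throwable : ℕ := 1

/-- The final class whose static fields hold the embedded monitor state. -/
def monitorClass : ℕ := 0

/-- Bytecode instructions. Jump targets are positions in the instruction array. An `invoke` carries the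
class, the name and the number of arguments of the method (the target object not counted).
`evalGuard g` and `execUpdate u` are the sections of monitor code [EVALUATE g], which pushes `1` or `0`
according to the truth of `g`, and [EXECUTE u], which performs the simultaneous assignment `u` to
static fields of the monitor class. -/
inductive Instr where
  | instanceof (c : ℕ)
  | aload (n : ℕ)
  | astore (n : ℕ)
  | athrow
  | dup
  | getfield (f : ℕ)
  | getstatic (c f : ℕ)
  | putstatic (c f : ℕ)
  | goto (L : ℕ)
  | iconst (n : ℕ)
  | ldc (v : ℕ)
  | ificmpeq (L : ℕ)
  | ifeq (L : ℕ)
  | invoke (c m n : ℕ)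
  | ret
  | exit
  | evalGuard (g : Assertion)
  | execUpdate (u : List (ℕ × Expr))
deriving DecidableEq

/-- An exception handler `(b, e, L, c)`. -/
structure Handler where
  b : ℕ
  e : ℕ
  target : ℕ
  cls : ℕ
deriving DecidableEq

/-- The handler range contains position `L`. -/
def Handler.covers (h : Handler) (L : ℕ) : Bool := decide (h.b ≤ L) && decide (L < h.e)

/-- A method: its class, name and arity, and its definition `(I, H)`. -/
structure Method where
  cls : ℕ
  name : ℕ
  arity : ℕ
  code : List Instr
  handlers : List Handler

/-- A program: its classes, each with its direct superclass if it has one; the API methods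
(class, name, arity) in bottom-up order, i.e. subclasses listed before superclasses; and its own
methods. -/
structure Program where
  supers : List (ℕ × ℕ)
  api : List (ℕ × ℕ × ℕ)
  methods : List Method

/-- The class `c` and its superclasses, up to `k` levels. -/
def superChain (supers : List (ℕ × ℕ)) : ℕ → ℕ → List ℕ
  | 0, c => [c]
  | k + 1, c => c :: (match supers.lookup c with
      | none => []
      | some d => superChain supers k d)

/-- `c <: d`. -/
def Program.subclass (P : Program) (c d : ℕ) : Bool :=
  (superChain P.supers P.supers.length c).contains d

/-- The classes `c'` with `c <: c'` that define the method `m` of arity `n`. -/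
def Program.defs (P : Program) (c m n : ℕ) : List ℕ :=
  (P.api ++ P.methods.map fun M => (M.cls, M.name, M.arity)).filterMap fun q =>
    if q.2 = (m, n) ∧ P.subclass c q.1 = true then some q.1 else none

/-- Type safe configurations: typing respects the class hierarchy, and the artificial error value `⊥`
occurs only in ghost variables. -/
structure Config.TypeSafe {D : DataAlgebra} (P : Program) (C : Config D) : Prop where
  typing_mono : ∀ v c d, P.subclass c d = true → C.typing v c → C.typing v d
  stack_ne : D.bot ∉ C.stack
  loc_ne : ∀ i, C.loc i ≠ some D.bot
  static_ne : ∀ c f, C.static c f ≠ some D.bot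
  field_ne : ∀ v f, C.field v f ≠ some D.bot

/-- Validity over the freely generated theory: truth in all type safe configurations under every
interpretation of the data types. -/
def Valid (P : Program) (φ : Assertion) : Prop :=
  ∀ (D : DataAlgebra) (C : Config D), C.TypeSafe P → φ.sem C

/-! ### Weakest preconditions and local validity -/

/-- A ghost update `⟨x₁, …, xₖ := e₁, …, eₖ⟩`. -/
abbrev GhostUpdate := List (GVar × Expr)

/-- The weakest precondition of a sequence of ghost updates. -/
def ghostWp (us : List GhostUpdate) (φ : Assertion) : Assertion :=
  us.foldr (fun u ψ => ψ.subst { ghost := fun x => (u.lookup x).getD (.ghost x) }) φ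

/-- The truth value of `a` as an integer. -/
def boolExpr (a : Assertion) : Expr := .cond a (.lit 1) (.lit 0)

/-- The weakest precondition of the instruction at position `L`, where `A` gives the assertions at all
positions, `H` is the handler array, `pre c m n` is the precondition of the method `c.m` and `post` is
the postcondition of the current method. -/
def wpInstr (P : Program) (pre : ℕ → ℕ → ℕ → Assertion) (post : Assertion) (H : List Handler)
    (A : ℕ → Assertion) (L : ℕ) : Instr → Assertion
  | .instanceof c => (A (L + 1)).subst { stack := replaceTop (boolExpr (.hasType (.stack 0) c)) }
  | .aload n => (A (L + 1)).subst { stack := pushStack (.loc n) }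
  | .astore n => (A (L + 1)).subst
      { stack := popStack 1, loc := fun i => if i = n then .stack 0 else .loc i }
  | .athrow => .select
      ((H.filter fun h => h.covers L).map fun h => (.hasType (.stack 0) h.cls, A h.target)) post
  | .dup => (A (L + 1)).subst { stack := pushStack (.stack 0) }
  | .getfield f => (A (L + 1)).subst { stack := replaceTop (.field (.stack 0) f) }
  | .getstatic c f => (A (L + 1)).subst { stack := pushStack (.static c f) }
  | .putstatic c f => (A (L + 1)).subst
      { stack := popStack 1,
        static := fun c' f' => if (c', f') = (c, f) then .stack 0 else .static c' f' }
  | .goto L' => A L'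
  | .iconst n => (A (L + 1)).subst { stack := pushStack (.lit n) }
  | .ldc v => (A (L + 1)).subst { stack := pushStack (.lit v) }
  | .ificmpeq L' => .ite (.eq (.stack 0) (.stack 1))
      ((A L').subst { stack := popStack 2 }) ((A (L + 1)).subst { stack := popStack 2 })
  | .ifeq L' => .ite (.eq (.stack 0) (.lit 0))
      ((A L').subst { stack := popStack 1 }) ((A (L + 1)).subst { stack := popStack 1 })
  | .invoke c m n => .conj ((P.defs c m n).map fun c' => pre c' m n)
  | .ret => post
  | .exit => .tt
  | .evalGuard g => (A (L + 1)).subst { stack := pushStack (boolExpr g) }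
  | .execUpdate u => (A (L + 1)).subst
      { static := fun c f =>
          if c = monitorClass then (u.lookup f).getD (.static c f) else .static c f }

/-- An extended method `(I, H, A, pre, post)`, with ghost updates embedded: `ghost L` is the sequence
of ghost updates that are performed immediately before the instruction at `L`. -/
structure ExtMethod where
  code : List Instr
  handlers : List Handler
  ghost : ℕ → List GhostUpdate
  A : List Assertion
  pre : Assertion
  post : Assertion

/-- `A_L`; a position outside the array cannot be reached. -/
def ExtMethod.at (X : ExtMethod) (L : ℕ) : Assertion := X.A.getD L .ff

/-- The verification conditions `pre ⇒ A₀` and `A_L ⇒ wp(L)` for all positions `L`. -/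
def ExtMethod.vcs (P : Program) (pre : ℕ → ℕ → ℕ → Assertion) (X : ExtMethod) : List Assertion :=
  .imp X.pre (X.at 0) :: X.code.zipIdx.map fun q =>
    .imp (X.at q.2)
      (ghostWp (X.ghost q.2) (wpInstr P pre X.post X.handlers X.at q.2 q.1))

/-- Local validity. -/
def ExtMethod.LocallyValid (P : Program) (pre : ℕ → ℕ → ℕ → Assertion) (X : ExtMethod) : Prop :=
  X.A.length = X.code.length ∧ ∀ φ ∈ X.vcs P pre, Valid P φ

/-! ### Contracts -/

/-- Contract expressions: constants, security state variables, arguments of the call (numbered from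
`0`), the returned value, object fields, and operators. -/
inductive CExpr where
  | lit (v : ℕ)
  | state (x : ℕ)
  | arg (j : ℕ)
  | result
  | field (e : CExpr) (f : ℕ)
  | op (o : ℕ) (e₁ e₂ : CExpr)

/-- Contract guards. -/
inductive CGuard where
  | tt
  | ff
  | eq (e₁ e₂ : CExpr)
  | rel (r : ℕ) (e₁ e₂ : CExpr)
  | and (g₁ g₂ : CGuard)
  | not (g : CGuard)
  | hasType (e : CExpr) (c : ℕ)

/-- A guarded command: a guard and a simultaneous assignment to security state variables. -/
structure Clause where
  guard : CGuard
  update : List (ℕ × CExpr)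

/-- The before, after and exceptional clauses for one method (each of the three may be absent). -/
structure MethodSpec where
  cls : ℕ
  name : ℕ
  arity : ℕ
  before : Option (List Clause)
  after : Option (List Clause)
  exceptional : Option (List Clause)

/-- A contract: its security state variables and its clauses. -/
structure Contract where
  state : List ℕ
  specs : List MethodSpec

/-- `e` uses only state variables in `S` and arguments below `n`, and the returned value only if
`r` holds. -/
def CExpr.WF (S : List ℕ) (n : ℕ) (r : Prop) : CExpr → Prop
  | .lit _ => True
  | .state x => x ∈ S
  | .arg j => j < n
  | .result => r
  | .field e _ => e.WF S n r
  | .op _ e₁ e₂ => e₁.WF S n r ∧ e₂.WF S n r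

def CGuard.WF (S : List ℕ) (n : ℕ) (r : Prop) : CGuard → Prop
  | .tt => True
  | .ff => True
  | .eq e₁ e₂ => e₁.WF S n r ∧ e₂.WF S n r
  | .rel _ e₁ e₂ => e₁.WF S n r ∧ e₂.WF S n r
  | .and g₁ g₂ => g₁.WF S n r ∧ g₂.WF S n r
  | .not g => g.WF S n r
  | .hasType e _ => e.WF S n r

def Clause.WF (S : List ℕ) (n : ℕ) (r : Prop) (cl : Clause) : Prop :=
  cl.guard.WF S n r ∧ ∀ p ∈ cl.update, p.1 ∈ S ∧ p.2.WF S n r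

/-- Clauses refer only to declared state variables, to existing arguments, and, in after clauses, to
the returned value. -/
def Contract.WF (K : Contract) : Prop :=
  ∀ s ∈ K.specs,
    (∀ l, s.before = some l → ∀ cl ∈ l, cl.WF K.state s.arity False) ∧
    (∀ l, s.after = some l → ∀ cl ∈ l, cl.WF K.state s.arity True) ∧
    (∀ l, s.exceptional = some l → ∀ cl ∈ l, cl.WF K.state s.arity False)

/-- The places where a monitor keeps the security state, the arguments and the returned value. -/
structure Places where
  state : ℕ → Expr
  arg : ℕ → Expr
  result : Expr

def CExpr.inst (ρ : Places) : CExpr → Expr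
  | .lit v => .lit v
  | .state x => ρ.state x
  | .arg j => ρ.arg j
  | .result => ρ.result
  | .field e f => .field (e.inst ρ) f
  | .op o e₁ e₂ => .op o (e₁.inst ρ) (e₂.inst ρ)

def CGuard.inst (ρ : Places) : CGuard → Assertion
  | .tt => .tt
  | .ff => .ff
  | .eq e₁ e₂ => .eq (e₁.inst ρ) (e₂.inst ρ)
  | .rel r e₁ e₂ => .rel r (e₁.inst ρ) (e₂.inst ρ)
  | .and g₁ g₂ => .and (g₁.inst ρ) (g₂.inst ρ)
  | .not g => .not (g.inst ρ)
  | .hasType e c => .hasType (e.inst ρ) c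

/-- The clauses of the contract for the method `m` of arity `n` in class `d`. -/
def Contract.spec (K : Contract) (d m n : ℕ) : Option MethodSpec :=
  K.specs.find? fun s => decide (s.cls = d ∧ s.name = m ∧ s.arity = n)

/-- The API classes defining or overriding `c.m`, bottom up. -/
def candidates (P : Program) (c m n : ℕ) : List ℕ :=
  P.api.filterMap fun q =>
    if q.2 = (m, n) ∧ (P.subclass q.1 c || P.subclass c q.1) = true then some q.1 else none

/-- A call of `c.m` is security relevant: the contract constrains one of the methods that may be
called. -/
def relevant (P : Program) (K : Contract) (c m n : ℕ) : Bool :=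
  (candidates P c m n).any fun d => (K.spec d m n).isSome

/-- For each candidate class its clauses for the event `ev` (`none`: unconstrained). -/
def eventClauses (P : Program) (K : Contract) (ev : MethodSpec → Option (List Clause))
    (c m n : ℕ) : List (ℕ × Option (List Clause)) :=
  (candidates P c m n).map fun d => (d, (K.spec d m n).bind ev)

/-! ### The ghost monitor -/

/-- The ghost monitor's places. -/
def ghostPlaces : Places where
  state x := .ghost (.ms x)
  arg j := .ghost (.arg j)
  result := .ghost .result

/-- The value of the state variable `x` after an event constrained by the clauses `l`: the first
clause whose guard holds determines it, and it is `⊥` if there is none. -/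
def ghostDelta (x : ℕ) (l : List Clause) : Expr :=
  l.foldr (fun cl r => .cond (cl.guard.inst ghostPlaces)
    (((cl.update.lookup x).getD (.state x)).inst ghostPlaces) r) .bot

/-- The update of the ghost monitor state for an event: dispatch on the class of the saved target. -/
def ghostStep (K : Contract) (l : List (ℕ × Option (List Clause))) : GhostUpdate :=
  K.state.map fun x => (.ms x, l.foldr (fun p r =>
    .cond (.hasType (.ghost .target) p.1)
      (match p.2 with
        | none => .ghost (.ms x)
        | some cls => ghostDelta x cls) r) (.ghost (.ms x)))

/-- Saving the target and the arguments of a call of arity `n`; the last argument is on top of the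
stack. -/
def ghostSave (n : ℕ) : GhostUpdate :=
  (.target, .stack n) :: (List.range n).map fun j => (.arg j, .stack (n - 1 - j))

def ghostBefore (P : Program) (K : Contract) (c m n : ℕ) : List GhostUpdate :=
  [ghostSave n, ghostStep K (eventClauses P K MethodSpec.before c m n)]

def ghostAfter (P : Program) (K : Contract) (c m n : ℕ) : List GhostUpdate :=
  [[(.result, .stack 0)], ghostStep K (eventClauses P K MethodSpec.after c m n)]

def ghostExceptional (P : Program) (K : Contract) (c m n : ℕ) : List GhostUpdate :=
  [ghostStep K (eventClauses P K MethodSpec.exceptional c m n)]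

/-- The first handler whose range contains `L`. -/
def firstHandler (H : List Handler) (L : ℕ) : Option Handler := H.find? fun h => h.covers L

/-- The ghost updates embedded before position `L`: for each security relevant call, at `L₀` say, the
before update is at `L₀`, the after update at `L₀ + 1`, and the exceptional update at the target of the
handler for `L₀`. -/
def ghostsAt (P : Program) (K : Contract) (code : List Instr) (H : List Handler) (L : ℕ) :
    List GhostUpdate :=
  code.zipIdx.flatMap fun q => match q.1 with
    | .invoke c m n =>
      if relevant P K c m n then
        (if q.2 + 1 = L then ghostAfter P K c m n else []) ++
        (if (firstHandler H q.2).map Handler.target = some L then ghostExceptional P K c m n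
          else []) ++
        (if q.2 = L then ghostBefore P K c m n else [])
      else []
    | _ => []

/-- Every security relevant call has an exception handler that catches any exception thrown by the call
and nothing else. -/
def Embeddable (P : Program) (K : Contract) (M : Method) : Prop :=
  ∀ L c m n, M.code[L]? = some (.invoke c m n) → relevant P K c m n = true →
    ∃ h, firstHandler M.handlers L = some h ∧ h.b = L ∧ h.e = L + 1 ∧ h.cls = throwable ∧
      (M.handlers.filter fun h' => decide (h'.target = h.target)).length = 1

/-! ### Adherence proofs -/

/-- The monitor invariant: embedded and ghost monitor state agree. -/
def monitorInvariant (K : Contract) : Assertion :=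
  .conj (K.state.map fun x => .eq (.static monitorClass x) (.ghost (.ms x)))

/-- A program, a contract, and a candidate proof: an assertion array for each method. -/
structure Bundle where
  prog : Program
  contract : Contract
  proof : List (List Assertion)

/-- The method `M` with the ghost monitor embedded, annotated with `A`, and with the monitor invariant
as pre- and postcondition. -/
def extend (P : Program) (K : Contract) (M : Method) (A : List Assertion) : ExtMethod where
  code := M.code
  handlers := M.handlers
  ghost := ghostsAt P K M.code M.handlers
  A := A
  pre := monitorInvariant K
  post := monitorInvariant K

/-- The verification conditions of a bundle. -/
def Bundle.vcs (B : Bundle) : List Assertion :=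
  (B.prog.methods.zip B.proof).flatMap fun q =>
    (extend B.prog B.contract q.1 q.2).vcs B.prog fun _ _ _ => monitorInvariant B.contract

/-- The proof in the bundle is an adherence proof for its program and contract. -/
def Bundle.IsAdherenceProof (B : Bundle) : Prop :=
  B.proof.length = B.prog.methods.length ∧
  ∀ q ∈ B.prog.methods.zip B.proof, Embeddable B.prog B.contract q.1 ∧
    (extend B.prog B.contract q.1 q.2).LocallyValid B.prog
      fun _ _ _ => monitorInvariant B.contract

/-! ### The inliner and the proof generator -/

/-- How the assertion at a position of inlined code is generated: it is a given assertion, or a given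
assertion taken back through the ghost updates at that position, or it is computed as the weakest
precondition. -/
inductive Mark where
  | cut (φ : Assertion)
  | beforeGhost (φ : Assertion)
  | computed

/-- A local variable above which the method uses no local variables. -/
def freshLocal (code : List Instr) : ℕ :=
  code.foldr (fun ι r => match ι with
    | .aload n => max (n + 1) r
    | .astore n => max (n + 1) r
    | _ => r) 0

/-- The inlined code keeps the target in local `v`, the returned value in local `v + 1` and the
arguments in locals `v + 2, v + 3, …`. -/
def realPlaces (v : ℕ) : Places where
  state x := .static monitorClass x
  arg j := .loc (v + 2 + j)
  result := .loc (v + 1)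

/-- Code at address `p` that tries the clauses in turn, continues at `done` after the update, and exits
if no guard holds. -/
def clauseCode (v done : ℕ) : ℕ → List Clause → List Instr
  | _, [] => [.iconst 1, .exit]
  | p, cl :: l =>
    [.evalGuard (cl.guard.inst (realPlaces v)), .ifeq (p + 4),
      .execUpdate (cl.update.map fun q => (q.1, q.2.inst (realPlaces v))), .goto done] ++
    clauseCode v done (p + 4) l

/-- Code at address `p` that traverses the candidate classes bottom up and enacts the clauses for the
first one of which the target is an instance. -/
def eventCode (v done : ℕ) : ℕ → List (ℕ × Option (List Clause)) → List Instr
  | _, [] => []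
  | p, (d, o) :: l =>
    let body := match o with
      | none => [.goto done]
      | some cls => clauseCode v done (p + 3) cls
    [.aload v, .instanceof d, .ifeq (p + 3 + body.length)] ++ body ++
    eventCode v done (p + 3 + body.length) l

/-- The event code at address `p`, continuing immediately behind it. -/
def eventBlock (v p : ℕ) (l : List (ℕ × Option (List Clause))) : List Instr :=
  eventCode v (p + (eventCode v 0 p l).length) p l

/-- The assertion before and after an inlined call: the monitor invariant, and the stored target and
arguments agree with those saved by the ghost monitor. -/
def callInvariant (K : Contract) (v n : ℕ) : Assertion :=
  .and (monitorInvariant K) (.conj (.eq (.loc v) (.ghost .target) ::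
    (List.range n).map fun j => .eq (.loc (v + 2 + j)) (.ghost (.arg j))))

/-- The first instruction is marked by `μ`, the others are computed. -/
def markHead (μ : Mark) : List Instr → List (Instr × Mark)
  | [] => []
  | ι :: l => (ι, μ) :: l.map fun κ => (κ, Mark.computed)

/-- Storing and reloading the target and arguments of a call of arity `n`. -/
def saveCode (v n : ℕ) : List Instr :=
  (List.range n).reverse.map (fun j => Instr.astore (v + 2 + j)) ++
  [.astore v, .aload v] ++
  (List.range n).map (fun j => Instr.aload (v + 2 + j))

/-- The inlined block for a security relevant call of `c.m`, at address `p`, with the address of the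
call instruction and that of the handler for it. -/
def callBlock (P : Program) (K : Contract) (v p c m n : ℕ) : List (Instr × Mark) × ℕ × ℕ :=
  let save := saveCode v n
  let before := eventBlock v (p + save.length) (eventClauses P K MethodSpec.before c m n)
  let call := p + save.length + before.length
  let exc := eventBlock v (call + 4) (eventClauses P K MethodSpec.exceptional c m n)
  let handlerEnd := call + 4 + exc.length + 1
  let after := eventBlock v handlerEnd (eventClauses P K MethodSpec.after c m n)
  (markHead (.cut (monitorInvariant K)) (save ++ before) ++
    [(.invoke c m n, .beforeGhost (callInvariant K v n))] ++
    markHead (.cut (callInvariant K v n)) [.astore (v + 1), .aload (v + 1), .goto handlerEnd] ++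
    markHead (.cut (callInvariant K v n)) exc ++
    [(.athrow, .cut (monitorInvariant K))] ++
    after.map fun ι => (ι, Mark.computed),
   call, call + 4)

/-- The instruction with its jump targets renamed. -/
def Instr.relabel (lab : ℕ → ℕ) : Instr → Instr
  | .goto L => .goto (lab L)
  | .ificmpeq L => .ificmpeq (lab L)
  | .ifeq L => .ifeq (lab L)
  | ι => ι

/-- The code at address `p` that replaces the instruction `ι`, and the handlers that are added
for it. -/
def inlineInstr (P : Program) (K : Contract) (v : ℕ) (lab : ℕ → ℕ) (p : ℕ) (ι : Instr) :
    List (Instr × Mark) × List Handler :=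
  match ι with
  | .invoke c m n =>
    if relevant P K c m n then
      let r := callBlock P K v p c m n
      (r.1, [⟨r.2.1, r.2.1 + 1, r.2.2, throwable⟩])
    else ([(ι, .cut (monitorInvariant K))], [])
  | _ => ([(ι.relabel lab, .cut (monitorInvariant K))], [])

/-- The new address of the instruction at `L`. -/
def newLabel (P : Program) (K : Contract) (code : List Instr) (L : ℕ) : ℕ :=
  ((code.take L).map fun ι => (inlineInstr P K (freshLocal code) id 0 ι).1.length).sum

/-- The inlined code, with marks. -/
def inlineCode (P : Program) (K : Contract) (code : List Instr) : List (Instr × Mark) :=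
  code.zipIdx.flatMap fun q => (inlineInstr P K (freshLocal code) (newLabel P K code)
    (newLabel P K code q.2) q.1).1

/-- The handlers of the inlined code: those added for the inlined calls, then the original ones. -/
def inlineHandlers (P : Program) (K : Contract) (code : List Instr) (H : List Handler) :
    List Handler :=
  (code.zipIdx.flatMap fun q => (inlineInstr P K (freshLocal code) (newLabel P K code)
    (newLabel P K code q.2) q.1).2) ++
  H.map fun h => ⟨newLabel P K code h.b, newLabel P K code h.e, newLabel P K code h.target, h.cls⟩

def inlineMethod (P : Program) (K : Contract) (M : Method) : Method where
  cls := M.cls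
  name := M.name
  arity := M.arity
  code := (inlineCode P K M.code).map Prod.fst
  handlers := inlineHandlers P K M.code M.handlers

/-- The program resulting from inlining `P` with the contract `K`. -/
def inlineProgram (P : Program) (K : Contract) : Program where
  supers := P.supers
  api := P.api
  methods := P.methods.map (inlineMethod P K)

/-- The assertions from position `L` on, computed backwards from the end of the code: at computed
positions control continues at later positions only. -/
def annotate (P : Program) (K : Contract) (H : List Handler) (ghost : ℕ → List GhostUpdate) :
    ℕ → List (Instr × Mark) → List Assertion
  | _, [] => []
  | L, (ι, μ) :: l =>
    let rest := annotate P K H ghost (L + 1) l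
    (match μ with
      | .cut φ => φ
      | .beforeGhost φ => ghostWp (ghost L) φ
      | .computed => ghostWp (ghost L)
          (wpInstr P (fun _ _ _ => monitorInvariant K) (monitorInvariant K) H
            (fun L' => (Assertion.ff :: rest).getD (L' - L) .ff) L ι)) :: rest

/-- The assertion array generated for the inlined version of `M`. -/
def generateMethod (P : Program) (K : Contract) (M : Method) : List Assertion :=
  let N := inlineMethod P K M
  annotate (inlineProgram P K) K N.handlers
    (ghostsAt (inlineProgram P K) K N.code N.handlers) 0 (inlineCode P K M.code)

/-- The inlined program with the generated adherence proof. -/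
def generate (P : Program) (K : Contract) : Bundle where
  prog := inlineProgram P K
  contract := K
  proof := P.methods.map (generateMethod P K)

/-- The positions to which an instruction at `L` may transfer control within the method, other than by
exceptions. -/
def Instr.succs (L : ℕ) : Instr → List ℕ
  | .goto L' => [L']
  | .ificmpeq L' => [L', L + 1]
  | .ifeq L' => [L', L + 1]
  | .athrow => []
  | .ret => []
  | .exit => []
  | _ => [L + 1]

/-- Instructions of target programs: no sections of monitor code, and no assignment to static fields
of the monitor class. -/
def Instr.isClient : Instr → Prop
  | .putstatic c _ => c ≠ monitorClass
  | .evalGuard _ => False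
  | .execUpdate _ => False
  | _ => True

/-- Target programs: methods have code, control stays inside the code, and the code contains client
instructions only. -/
def Program.WF (P : Program) : Prop :=
  ∀ M ∈ P.methods, M.code ≠ [] ∧
    (∀ (L : ℕ) (ι : Instr), M.code[L]? = some ι → ι.isClient ∧ ∀ L' ∈ ι.succs L, L' < M.code.length) ∧
    ∀ h ∈ M.handlers, h.target < M.code.length

/-! ### Rewriting of verification conditions -/

mutual
/-- Replaces all occurrences of the assertion `ψ` by `w`. -/
def Expr.replace (ψ w : Assertion) : Expr → Expr
  | .field e f => .field (e.replace ψ w) f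
  | .op o e₁ e₂ => .op o (e₁.replace ψ w) (e₂.replace ψ w)
  | .cond a e₁ e₂ => .cond (Assertion.replace ψ w a) (e₁.replace ψ w) (e₂.replace ψ w)
  | .pair e₁ e₂ => .pair (e₁.replace ψ w) (e₂.replace ψ w)
  | .lit v => .lit v
  | .static c f => .static c f
  | .stack i => .stack i
  | .loc i => .loc i
  | .ghost x => .ghost x
  | .bot => .bot
/-- Replaces all occurrences of the assertion `ψ` by `w`. -/
def Assertion.replace (ψ w : Assertion) : Assertion → Assertion
  | .tt => if Assertion.tt = ψ then w else .tt
  | .ff => if Assertion.ff = ψ then w else .ff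
  | .eq e₁ e₂ => if Assertion.eq e₁ e₂ = ψ then w else (.eq (e₁.replace ψ w) (e₂.replace ψ w))
  | .rel r e₁ e₂ =>
    if Assertion.rel r e₁ e₂ = ψ then w else (.rel r (e₁.replace ψ w) (e₂.replace ψ w))
  | .and a b =>
    if Assertion.and a b = ψ then w
    else (.and (Assertion.replace ψ w a) (Assertion.replace ψ w b))
  | .not a => if Assertion.not a = ψ then w else (.not (Assertion.replace ψ w a))
  | .hasType e c => if Assertion.hasType e c = ψ then w else (.hasType (e.replace ψ w) c)
end

/-- Variables: stack positions, local variables, static fields and ghost variables. -/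
def Expr.IsVar : Expr → Prop
  | .stack _ => True
  | .loc _ => True
  | .static _ _ => True
  | .ghost _ => True
  | _ => False

mutual
/-- The logical variables of an expression. -/
def Expr.tmps : Expr → List ℕ
  | .field e _ => e.tmps
  | .op _ e₁ e₂ => e₁.tmps ++ e₂.tmps
  | .cond a e₁ e₂ => a.tmps ++ e₁.tmps ++ e₂.tmps
  | .pair e₁ e₂ => e₁.tmps ++ e₂.tmps
  | .ghost (.tmp n) => [n]
  | _ => []
/-- The logical variables of an assertion. -/
def Assertion.tmps : Assertion → List ℕ
  | .eq e₁ e₂ => e₁.tmps ++ e₂.tmps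
  | .rel _ e₁ e₂ => e₁.tmps ++ e₂.tmps
  | .and a b => a.tmps ++ b.tmps
  | .not a => a.tmps
  | .hasType e _ => e.tmps
  | _ => []
end

/-- Rewrite rules for subassertions. -/
inductive RuleA : Assertion → Assertion → Prop where
  | refl (e : Expr) : RuleA (.eq e e) .tt
  | merge (ψ φ : Assertion) : RuleA (.and (.imp ψ φ) (.imp (.not ψ) φ)) φ
  | assume (ψ φ : Assertion) : RuleA (.imp ψ φ) (.imp ψ (Assertion.replace ψ .tt φ))
  | assumeNot (ψ φ : Assertion) : RuleA (.imp (.not ψ) φ) (.imp (.not ψ) (Assertion.replace ψ .ff φ))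
  | curry (a b φ : Assertion) : RuleA (.imp (.and a b) φ) (.imp a (.imp b φ))
  | test (a : Assertion) : RuleA (.eq (boolExpr a) (.lit 0)) (.not a)
  | notNot (a : Assertion) : RuleA (.not (.not a)) a
  | notTt : RuleA (.not .tt) .ff
  | notFf : RuleA (.not .ff) .tt
  | ttAnd (a : Assertion) : RuleA (.and .tt a) a
  | andTt (a : Assertion) : RuleA (.and a .tt) a
  | ffAnd (a : Assertion) : RuleA (.and .ff a) .ff
  | andFf (a : Assertion) : RuleA (.and a .ff) .ff

/-- Rewrite rules for subexpressions. -/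
inductive RuleE : Expr → Expr → Prop where
  | condTt (e₁ e₂ : Expr) : RuleE (.cond .tt e₁ e₂) e₁
  | condFf (e₁ e₂ : Expr) : RuleE (.cond .ff e₁ e₂) e₂

mutual
/-- One application of a rule somewhere inside an expression. -/
inductive StepE : Expr → Expr → Prop where
  | rule {e e'} : RuleE e e' → StepE e e'
  | field {e e'} (f) : StepE e e' → StepE (.field e f) (.field e' f)
  | op₁ {e e'} (o d) : StepE e e' → StepE (.op o e d) (.op o e' d)
  | op₂ {e e'} (o d) : StepE e e' → StepE (.op o d e) (.op o d e')
  | cond₀ {a a'} (d₁ d₂) : StepA a a' → StepE (.cond a d₁ d₂) (.cond a' d₁ d₂)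
  | cond₁ {e e'} (a d) : StepE e e' → StepE (.cond a e d) (.cond a e' d)
  | cond₂ {e e'} (a d) : StepE e e' → StepE (.cond a d e) (.cond a d e')
  | pair₁ {e e'} (d) : StepE e e' → StepE (.pair e d) (.pair e' d)
  | pair₂ {e e'} (d) : StepE e e' → StepE (.pair d e) (.pair d e')
/-- One application of a rule somewhere inside an assertion. -/
inductive StepA : Assertion → Assertion → Prop where
  | rule {a a'} : RuleA a a' → StepA a a'
  | eq₁ {e e'} (d) : StepE e e' → StepA (.eq e d) (.eq e' d)
  | eq₂ {e e'} (d) : StepE e e' → StepA (.eq d e) (.eq d e')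
  | rel₁ {e e'} (r d) : StepE e e' → StepA (.rel r e d) (.rel r e' d)
  | rel₂ {e e'} (r d) : StepE e e' → StepA (.rel r d e) (.rel r d e')
  | and₁ {a a'} (b) : StepA a a' → StepA (.and a b) (.and a' b)
  | and₂ {a a'} (b) : StepA a a' → StepA (.and b a) (.and b a')
  | not {a a'} : StepA a a' → StepA (.not a) (.not a')
  | hasType {e e'} (c) : StepE e e' → StepA (.hasType e c) (.hasType e' c)
end

/-- One rewrite step on a verification condition: a rule somewhere inside it, or, at the top,
`x = y ⇒ φ ⟶ φ[z/x][z/y]` for variables `x`, `y` and a fresh variable `z`. -/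
inductive Rewrite : Assertion → Assertion → Prop where
  | inside {φ φ' : Assertion} : StepA φ φ' → Rewrite φ φ'
  | unify (x y : Expr) (k : ℕ) (φ : Assertion) : x.IsVar → y.IsVar →
      k ∉ (Assertion.imp (.eq x y) φ).tmps →
      Rewrite (.imp (.eq x y) φ)
        ((φ.subst (.single x (.ghost (.tmp k)))).subst (.single y (.ghost (.tmp k))))

/-- Rewriting in exactly `n` steps. -/
inductive RewritesIn : ℕ → Assertion → Assertion → Prop where
  | zero (φ : Assertion) : RewritesIn 0 φ φ
  | succ {n : ℕ} {φ φ' ψ : Assertion} : Rewrite φ φ' → RewritesIn n φ' ψ → RewritesIn (n + 1) φ ψ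

/-! ### A machine model

Algorithms are programs of a small language over binary trees whose leaves carry natural numbers.
Recursion is structural recursion over trees and lists. Numbers have their binary length as size and every
elementary operation is charged the sizes of its input and of its output, so that a Turing machine can
run a program in time polynomial in its cost and in the size of its input. -/

inductive Tree where
  | atom (n : ℕ)
  | node (l r : Tree)
deriving DecidableEq

def Tree.size : Tree → ℕ
  | .atom n => n.size + 1
  | .node l r => l.size + r.size + 1

inductive Code where
  | id
  | const (t : Tree)
  | fst
  | snd
  | succ
  | pred
  | isAtom
  | eq
  | lt
  | comp (f g : Code)
  | pair (f g : Code)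
  | ite (c f g : Code)
  | fold (b s : Code)
  | foldList (b s : Code)

def Tree.ofBool (b : Bool) : Tree := .atom b.toNat

def Tree.fst : Tree → Tree
  | .node l _ => l
  | .atom _ => .atom 0

def Tree.snd : Tree → Tree
  | .node _ r => r
  | .atom _ => .atom 0

def Tree.succ : Tree → Tree
  | .atom n => .atom (n + 1)
  | .node _ _ => .atom 0

def Tree.pred : Tree → Tree
  | .atom n => .atom (n - 1)
  | .node _ _ => .atom 0

def Tree.isAtom : Tree → Tree
  | .atom _ => .atom 1
  | .node _ _ => .atom 0

def Tree.eqTest : Tree → Tree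
  | .node l r => .ofBool (decide (l = r))
  | .atom _ => .atom 0

def Tree.ltTest : Tree → Tree
  | .node (.atom m) (.atom n) => .ofBool (decide (m < n))
  | _ => .atom 0

/-- An elementary operation: its result and its cost. -/
def elementary (f : Tree → Tree) (x : Tree) : Tree × ℕ := (f x, x.size + (f x).size)

/-- Structural recursion over a tree. -/
def Tree.recurse {α : Type} (b : ℕ → α) (s : Tree → Tree → α → α → α) : Tree → α
  | .atom n => b n
  | .node l r => s l r (l.recurse b s) (r.recurse b s)

/-- Structural recursion over a tree read as a list (along its right spine). -/
def Tree.recurseList {α : Type} (b : ℕ → α) (s : Tree → Tree → α → α) : Tree → α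
  | .atom n => b n
  | .node l r => s l r (r.recurseList b s)

/-- The result of a program on an input, and the cost of computing it. In `ite c f g` the branch `g` is
taken if `c` yields the atom `0`. The program `fold b s` expects a pair of a parameter `e` and a tree,
over which it recurses: it runs `b` on `(e, leaf)` at the leaves and `s` on
`(e, ((l, r), (result for l, result for r)))` at the inner nodes; `foldList b s` recurses along the
right spine only and runs `s` on `(e, ((l, r), result for r))`. -/
def Code.run : Code → Tree → Tree × ℕ
  | .id, x => elementary (fun y => y) x
  | .const t, x => elementary (fun _ => t) x
  | .fst, x => elementary Tree.fst x
  | .snd, x => elementary Tree.snd x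
  | .succ, x => elementary Tree.succ x
  | .pred, x => elementary Tree.pred x
  | .isAtom, x => elementary Tree.isAtom x
  | .eq, x => elementary Tree.eqTest x
  | .lt, x => elementary Tree.ltTest x
  | .comp f g, x => ((g.run (f.run x).1).1, (f.run x).2 + (g.run (f.run x).1).2)
  | .pair f g, x =>
    let t := Tree.node (f.run x).1 (g.run x).1
    (t, (f.run x).2 + (g.run x).2 + t.size)
  | .ite c f g, x =>
    if (c.run x).1 = .atom 0 then ((g.run x).1, (c.run x).2 + (g.run x).2)
    else ((f.run x).1, (c.run x).2 + (f.run x).2)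
  | .fold _ _, .atom n => elementary (fun _ => .atom 0) (.atom n)
  | .fold b s, .node e t =>
    t.recurse (fun n => b.run (.node e (.atom n))) fun l r vl vr =>
      let q := s.run (.node e (.node (.node l r) (.node vl.1 vr.1)))
      (q.1, vl.2 + vr.2 + q.2)
  | .foldList _ _, .atom n => elementary (fun _ => .atom 0) (.atom n)
  | .foldList b s, .node e t =>
    t.recurseList (fun n => b.run (.node e (.atom n))) fun l r vr =>
      let q := s.run (.node e (.node (.node l r) vr.1))
      (q.1, vr.2 + q.2)

/-- The program accepts the input: its result is the atom `1`. -/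
def Code.Accepts (p : Code) (x : Tree) : Prop := (p.run x).1 = .atom 1

/-! ### Encoding of bundles as trees

Constructors are encoded by tags, and arities in unary, as lists of parameters. -/

def encList : List Tree → Tree
  | [] => .atom 0
  | t :: l => .node t (encList l)

def encTag (k : ℕ) (l : List Tree) : Tree := .node (.atom k) (encList l)

def encUnary (n : ℕ) : Tree := encList (List.replicate n (.atom 0))

def GVar.enc : GVar → Tree
  | .ms i => encTag 0 [.atom i]
  | .target => encTag 1 []
  | .arg j => encTag 2 [.atom j]
  | .result => encTag 3 []
  | .tmp n => encTag 4 [.atom n]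

mutual
def Expr.enc : Expr → Tree
  | .lit v => encTag 0 [.atom v]
  | .field e f => encTag 1 [e.enc, .atom f]
  | .static c f => encTag 2 [.atom c, .atom f]
  | .stack i => encTag 3 [.atom i]
  | .loc i => encTag 4 [.atom i]
  | .ghost x => encTag 5 [x.enc]
  | .op o e₁ e₂ => encTag 6 [.atom o, e₁.enc, e₂.enc]
  | .cond a e₁ e₂ => encTag 7 [a.enc, e₁.enc, e₂.enc]
  | .pair e₁ e₂ => encTag 8 [e₁.enc, e₂.enc]
  | .bot => encTag 9 []
def Assertion.enc : Assertion → Tree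
  | .tt => encTag 10 []
  | .ff => encTag 11 []
  | .eq e₁ e₂ => encTag 12 [e₁.enc, e₂.enc]
  | .rel r e₁ e₂ => encTag 13 [.atom r, e₁.enc, e₂.enc]
  | .and a b => encTag 14 [a.enc, b.enc]
  | .not a => encTag 15 [a.enc]
  | .hasType e c => encTag 16 [e.enc, .atom c]
end

def Instr.enc : Instr → Tree
  | .instanceof c => encTag 0 [.atom c]
  | .aload n => encTag 1 [.atom n]
  | .astore n => encTag 2 [.atom n]
  | .athrow => encTag 3 []
  | .dup => encTag 4 []
  | .getfield f => encTag 5 [.atom f]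
  | .getstatic c f => encTag 6 [.atom c, .atom f]
  | .putstatic c f => encTag 7 [.atom c, .atom f]
  | .goto L => encTag 8 [.atom L]
  | .iconst n => encTag 9 [.atom n]
  | .ldc v => encTag 10 [.atom v]
  | .ificmpeq L => encTag 11 [.atom L]
  | .ifeq L => encTag 12 [.atom L]
  | .invoke c m n => encTag 13 [.atom c, .atom m, encUnary n]
  | .ret => encTag 14 []
  | .exit => encTag 15 []
  | .evalGuard g => encTag 16 [g.enc]
  | .execUpdate u => encTag 17 (u.map fun q => .node (.atom q.1) q.2.enc)

def Handler.enc (h : Handler) : Tree :=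
  encList [.atom h.b, .atom h.e, .atom h.target, .atom h.cls]

def Method.enc (M : Method) : Tree :=
  encList [.atom M.cls, .atom M.name, encUnary M.arity, encList (M.code.map Instr.enc),
    encList (M.handlers.map Handler.enc)]

def Program.enc (P : Program) : Tree :=
  encList [encList (P.supers.map fun q => .node (.atom q.1) (.atom q.2)),
    encList (P.api.map fun q => encList [.atom q.1, .atom q.2.1, encUnary q.2.2]),
    encList (P.methods.map Method.enc)]

def CExpr.enc : CExpr → Tree
  | .lit v => encTag 0 [.atom v]
  | .state x => encTag 1 [.atom x]
  | .arg j => encTag 2 [.atom j]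
  | .result => encTag 3 []
  | .field e f => encTag 4 [e.enc, .atom f]
  | .op o e₁ e₂ => encTag 5 [.atom o, e₁.enc, e₂.enc]

def CGuard.enc : CGuard → Tree
  | .tt => encTag 0 []
  | .ff => encTag 1 []
  | .eq e₁ e₂ => encTag 2 [e₁.enc, e₂.enc]
  | .rel r e₁ e₂ => encTag 3 [.atom r, e₁.enc, e₂.enc]
  | .and g₁ g₂ => encTag 4 [g₁.enc, g₂.enc]
  | .not g => encTag 5 [g.enc]
  | .hasType e c => encTag 6 [e.enc, .atom c]

def Clause.enc (cl : Clause) : Tree :=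
  .node cl.guard.enc (encList (cl.update.map fun q => .node (.atom q.1) q.2.enc))

def encClauses : Option (List Clause) → Tree
  | none => .atom 0
  | some l => .node (.atom 1) (encList (l.map Clause.enc))

def MethodSpec.enc (s : MethodSpec) : Tree :=
  encList [.atom s.cls, .atom s.name, encUnary s.arity, encClauses s.before, encClauses s.after,
    encClauses s.exceptional]

def Contract.enc (K : Contract) : Tree :=
  .node (encList (K.state.map Tree.atom)) (encList (K.specs.map MethodSpec.enc))

def Bundle.enc (B : Bundle) : Tree :=
  encList [B.prog.enc, B.contract.enc,
    encList (B.proof.map fun A => encList (A.map Assertion.enc))]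

end IRM

-- The recognizer `Bundle.check` searches for no proofs. It compares annotations and weakest
-- preconditions syntactically with the few shapes that inlining produces. Outside the inlined
-- blocks, at the call itself and at computed positions the conditions are trivial: `a ⇒ a` or `a ⇒
-- tt`, up to merging of equal branches, currying and repeated conjuncts. Each inlined call leaves
-- three others: at the head of its block, behind the call and at the head of the handler. There the
-- premise is a conjunction of equations between variables, and the conclusion can be written down
-- from the contract and the call alone (`expectedFormula`); the checker recomputes it and tests
-- equality.
--
-- The inlined code and the ghost update for an event follow the same decision tree: class tests on
-- the target, then guards (`eventTree`). The weakest precondition of the code is this tree read as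
-- a branching formula (`DTree.formula`) whose leaves equate the new embedded state with the new
-- ghost state; the latter is the same tree read as a conditional expression (`DTree.chain`).
-- Unification with the premise makes the tests of the two readings literally equal (`unify_reach`).
-- Then the root test is decided: in each branch it is replaced by `tt` or `ff`, the conditional
-- expression collapses to that of the subtree, and induction applies; at the leaves both sides
-- coincide. Tests contain no conditional expressions, so the replacement cannot damage the
-- branching skeleton, apart from the degenerate tests, which are evaluated directly. The work at a
-- node is linear in the weight of the tree, which gives a quadratic number of steps
-- (`DTree.formula_reach_tt`, `expectedFormula_reach`).
--
-- Soundness (`Bundle.check_sound`) needs no separate semantic argument for programs: every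
-- condition of an accepted input rewrites to `tt`, and rewriting reflects validity
-- (`RewritesIn.valid`).
--
-- Completeness (`check_generate`) is a computation of weakest preconditions of inlined code. Jumps
-- in computed code go forward, so the backward pass that generates annotations sees the final
-- assertions. Event code yields the event formula (`eventCode_wp`), storing and reloading leaves
-- the operand stack as it was (`saveCode_stack`), and a well-formed contract mentions only places
-- that correspond in the two monitors (`eventFormula_eq_expected`).
--
-- For the running time, `PolyT` is closed under composition, case distinction and those recursions
-- over lists and terms whose results stay polynomially bounded. The checker is assembled from such
-- operations (`PolyT.check`).

namespace IRM

/-! ### Polynomial-time functions -/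

/-- Data types encoded as trees. -/
class TreeEnc (α : Type) where
  enc : α → Tree

/-- The size of the encoding. -/
def sz {α : Type} [TreeEnc α] (x : α) : ℕ := (TreeEnc.enc x).size

/-- Coefficients are natural numbers. Monotonicity is what allows a cost bound at an intermediate
result to be replaced by one at the input. -/
theorem polynomial_eval_mono (p : Polynomial ℕ) {m n : ℕ} (h : m ≤ n) : p.eval m ≤ p.eval n := by
  rw [Polynomial.eval_eq_sum_range, Polynomial.eval_eq_sum_range]
  exact Finset.sum_le_sum fun i _ => Nat.mul_le_mul_left _ (Nat.pow_le_pow_left h i)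

/-- Every elementary operation and every pairing is charged for its output, and the other constructs
return the output of a part that they have paid for. A time bound is therefore also a bound on the
size of the result. -/
theorem Code.size_le_cost (c : Code) : ∀ x, (c.run x).1.size ≤ (c.run x).2 := by
  induction c with
  | comp f g hf hg => intro x; simp only [Code.run]; exact (hg _).trans (Nat.le_add_left _ _)
  | pair f g hf hg => intro x; simp only [Code.run]; exact Nat.le_add_left _ _
  | ite c f g hc hf hg =>
    intro x; simp only [Code.run]; split
    · exact (hg _).trans (Nat.le_add_left _ _)
    · exact (hf _).trans (Nat.le_add_left _ _)
  | fold b s hb hs =>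
    intro x
    cases x with
    | atom n => simp [Code.run, elementary]
    | node e t =>
      simp only [Code.run]
      cases t with
      | atom n => exact hb _
      | node l r => exact (hs _).trans (Nat.le_add_left _ _)
  | foldList b s hb hs =>
    intro x
    cases x with
    | atom n => simp [Code.run, elementary]
    | node e t =>
      simp only [Code.run]
      cases t with
      | atom n => exact hb _
      | node l r => exact (hs _).trans (Nat.le_add_left _ _)
  | _ => intro x; simp [Code.run, elementary]

/-- Functions computed by a program in polynomial time. -/
@[fun_prop] def PolyT {α β : Type} [TreeEnc α] [TreeEnc β] (f : α → β) : Prop :=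
  ∃ (c : Code) (p : Polynomial ℕ), ∀ x, (c.run (TreeEnc.enc x)).1 = TreeEnc.enc (f x) ∧
    (c.run (TreeEnc.enc x)).2 ≤ p.eval (sz x)

-- Encodings of the standard data types and the sizes of encoded values.

instance : TreeEnc Tree := ⟨fun t => t⟩
instance : TreeEnc ℕ := ⟨Tree.atom⟩
instance : TreeEnc Bool := ⟨Tree.ofBool⟩
instance : TreeEnc Unit := ⟨fun _ => .atom 0⟩
instance {α β : Type} [TreeEnc α] [TreeEnc β] : TreeEnc (α × β) :=
  ⟨fun p => .node (TreeEnc.enc p.1) (TreeEnc.enc p.2)⟩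
instance {α : Type} [TreeEnc α] : TreeEnc (List α) := ⟨fun l => encList (l.map TreeEnc.enc)⟩
instance {α : Type} [TreeEnc α] : TreeEnc (Option α) :=
  ⟨fun o => match o with
    | none => .atom 0
    | some a => .node (.atom 1) (TreeEnc.enc a)⟩

/-- Equality test. -/
def teq {α : Type} [DecidableEq α] (a b : α) : Bool := decide (a = b)

@[simp] theorem teq_iff {α : Type} [DecidableEq α] (a b : α) : teq a b = true ↔ a = b := by simp [teq]

section
variable {α β γ δ : Type} [TreeEnc α] [TreeEnc β] [TreeEnc γ] [TreeEnc δ]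

theorem sz_pair (a : α) (b : β) : sz (a, b) = sz a + sz b + 1 := rfl
theorem sz_nil : sz ([] : List α) = 1 := rfl
theorem sz_cons (a : α) (l : List α) : sz (a :: l) = sz a + sz l + 1 := rfl
theorem sz_none : sz (none : Option α) = 1 := rfl
theorem sz_some (a : α) : sz (some a) = sz a + 3 := by
  change (Tree.atom 1).size + sz a + 1 = _
  simp [Tree.size]; omega
theorem sz_bool_le (b : Bool) : sz b ≤ 2 := by cases b <;> simp [sz, TreeEnc.enc, Tree.ofBool, Tree.size]
theorem one_le_sz (a : α) : 1 ≤ sz a := by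
  unfold sz; cases TreeEnc.enc a <;> simp [Tree.size]

theorem length_le_sz (l : List α) : l.length ≤ sz l := by
  induction l with
  | nil => simp
  | cons a l ih => rw [sz_cons, List.length_cons]; omega

theorem sz_le_of_mem {a : α} {l : List α} (h : a ∈ l) : sz a ≤ sz l := by
  induction l with
  | nil => simp at h
  | cons b l ih =>
    rw [sz_cons]
    rcases List.mem_cons.1 h with rfl | h
    · omega
    · have := ih h; omega

protected theorem PolyT.sz_le {f : α → β} (hf : PolyT f) : ∃ p : Polynomial ℕ, ∀ x, sz (f x) ≤ p.eval (sz x) := by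
  obtain ⟨c, p, h⟩ := hf
  refine ⟨p, fun x => ?_⟩
  rw [sz, ← (h x).1]
  exact (c.size_le_cost _).trans (h x).2

/-- The operation `F` has to agree with `f` only on encodings. The bound on the output is needed
because the output is part of the cost. -/
protected theorem PolyT.of_elementary {f : α → β} (c : Code) (F : Tree → Tree)
    (hc : ∀ x, c.run x = elementary F x) (hF : ∀ x, F (TreeEnc.enc x) = TreeEnc.enc (f x))
    (p : Polynomial ℕ) (hp : ∀ x, sz (f x) ≤ p.eval (sz x)) : PolyT f := by
  refine ⟨c, Polynomial.X + p, fun x => ?_⟩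
  rw [hc, elementary]
  refine ⟨hF x, ?_⟩
  simp only [Polynomial.eval_add, Polynomial.eval_X, hF]
  exact Nat.add_le_add_left (hp x) _

@[fun_prop] protected theorem PolyT.id : PolyT (fun x : α => x) :=
  .of_elementary .id (fun y => y) (fun _ => rfl) (fun _ => rfl) Polynomial.X fun x => by simp

@[fun_prop] protected theorem PolyT.const (b : β) : PolyT (fun _ : α => b) :=
  .of_elementary (.const (TreeEnc.enc b)) (fun _ => TreeEnc.enc b) (fun _ => rfl) (fun _ => rfl)
    (Polynomial.C (sz b)) fun x => by simp

@[fun_prop] protected theorem PolyT.comp {g : β → γ} {f : α → β} (hg : PolyT g) (hf : PolyT f) :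
    PolyT (fun x => g (f x)) := by
  obtain ⟨c, p, h⟩ := hf
  obtain ⟨d, q, k⟩ := hg
  refine ⟨.comp c d, p + q.comp p, fun x => ?_⟩
  simp only [Code.run, (h x).1, Polynomial.eval_add, Polynomial.eval_comp]
  refine ⟨(k _).1, Nat.add_le_add (h x).2 ((k _).2.trans (polynomial_eval_mono _ ?_))⟩
  -- The intermediate result is no larger than the time spent on it; this keeps the bound for the
  -- second program polynomial in the input.
  rw [sz, ← (h x).1]
  exact (c.size_le_cost _).trans (h x).2

@[fun_prop] protected theorem PolyT.prodMk {f : α → β} {g : α → γ} (hf : PolyT f) (hg : PolyT g) :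
    PolyT (fun x => (f x, g x)) := by
  obtain ⟨c, p, h⟩ := hf
  obtain ⟨d, q, k⟩ := hg
  refine ⟨.pair c d, 2 * (p + q) + 1, fun x => ?_⟩
  have h1 := c.size_le_cost (TreeEnc.enc x)
  have h2 := d.size_le_cost (TreeEnc.enc x)
  have h3 := (h x).2
  have h4 := (k x).2
  simp only [Code.run, Tree.size, Polynomial.eval_add, Polynomial.eval_mul, Polynomial.eval_ofNat,
    Polynomial.eval_one]
  refine ⟨?_, by omega⟩
  rw [(h x).1, (k x).1]; rfl

/-- Programs see encodings only, so an operation on trees that commutes with the encodings serves as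
a program for `f`. Projections and changes of representation come for free this way. -/
protected theorem PolyT.ofTreeCode {f : α → β} {F : Tree → Tree} (hF : PolyT F)
    (h : ∀ x, TreeEnc.enc (f x) = F (TreeEnc.enc x)) : PolyT f := by
  obtain ⟨c, p, k⟩ := hF
  refine ⟨c, p, fun x => ?_⟩
  rw [h]
  exact k (TreeEnc.enc x)

protected theorem PolyT.toTree : PolyT (fun x : α => (TreeEnc.enc x : Tree)) :=
  .ofTreeCode (F := fun t => t) PolyT.id fun _ => rfl

/-- Composition with a change of encoding. -/
protected theorem PolyT.ofTree {f : α → β} {F : α → Tree} (hF : PolyT F)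
    (h : ∀ x, TreeEnc.enc (f x) = F x) : PolyT f := by
  obtain ⟨c, p, k⟩ := hF
  refine ⟨c, p, fun x => ?_⟩
  rw [h]
  exact k x

theorem Tree.size_fst_le (t : Tree) : t.fst.size ≤ t.size := by
  cases t <;> simp [Tree.fst, Tree.size]; omega
theorem Tree.size_snd_le (t : Tree) : t.snd.size ≤ t.size := by
  cases t <;> simp [Tree.snd, Tree.size]; omega

@[fun_prop] protected theorem PolyT.treeFst : PolyT Tree.fst :=
  .of_elementary .fst Tree.fst (fun _ => rfl) (fun _ => rfl) Polynomial.X fun x => by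
    simpa using show sz x.fst ≤ sz x from Tree.size_fst_le x
@[fun_prop] protected theorem PolyT.treeSnd : PolyT Tree.snd :=
  .of_elementary .snd Tree.snd (fun _ => rfl) (fun _ => rfl) Polynomial.X fun x => by
    simpa using show sz x.snd ≤ sz x from Tree.size_snd_le x

@[fun_prop] protected theorem PolyT.fst : PolyT (Prod.fst : α × β → α) :=
  .ofTreeCode PolyT.treeFst fun _ => rfl
@[fun_prop] protected theorem PolyT.snd : PolyT (Prod.snd : α × β → β) :=
  .ofTreeCode PolyT.treeSnd fun _ => rfl
@[fun_prop] protected theorem PolyT.treeNode {f g : α → Tree} (hf : PolyT f) (hg : PolyT g) :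
    PolyT (fun x => Tree.node (f x) (g x)) :=
  .ofTree (PolyT.toTree.comp (hf.prodMk hg)) fun _ => rfl

-- Arithmetic on binary numbers, tests and case distinction.

theorem nat_size_succ_le (n : ℕ) : (n + 1).size ≤ n.size + 1 := by
  rw [Nat.size_le]
  have := Nat.lt_size_self n
  have h2 : 1 ≤ 2 ^ n.size := Nat.one_le_two_pow
  rw [pow_succ]; omega

theorem sz_nat (n : ℕ) : sz n = n.size + 1 := rfl

theorem sz_nat_le_of_le {m n : ℕ} (h : m ≤ n) : sz m ≤ sz n := by
  rw [sz_nat, sz_nat]; exact Nat.succ_le_succ (Nat.size_le_size h)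

theorem sz_nat_le (n : ℕ) : sz n ≤ n + 1 := by
  rw [sz_nat]
  have : n.size ≤ n := Nat.size_le.2 Nat.lt_two_pow_self
  omega

protected theorem PolyT.natSucc : PolyT (fun n : ℕ => n + 1) :=
  .of_elementary .succ Tree.succ (fun _ => rfl) (fun _ => rfl) (Polynomial.X + 1) fun x => by
    simp only [Polynomial.eval_add, Polynomial.eval_X, Polynomial.eval_one, sz_nat]
    have := nat_size_succ_le x; omega
protected theorem PolyT.natPred : PolyT (fun n : ℕ => n - 1) :=
  .of_elementary .pred Tree.pred (fun _ => rfl) (fun _ => rfl) Polynomial.X fun x => by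
    simpa using sz_nat_le_of_le (Nat.sub_le x 1)
@[fun_prop] protected theorem PolyT.add_one {f : α → ℕ} (hf : PolyT f) : PolyT (fun x => f x + 1) :=
  PolyT.natSucc.comp hf
@[fun_prop] protected theorem PolyT.sub_one {f : α → ℕ} (hf : PolyT f) : PolyT (fun x => f x - 1) :=
  PolyT.natPred.comp hf
@[fun_prop] protected theorem PolyT.add_two {f : α → ℕ} (hf : PolyT f) : PolyT (fun x => f x + 2) :=
  hf.add_one.add_one

/-- Whether a tree is a leaf. -/
def Tree.leafTest : Tree → Bool
  | .atom _ => true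
  | .node _ _ => false

@[fun_prop] protected theorem PolyT.leafTest : PolyT Tree.leafTest :=
  .of_elementary .isAtom Tree.isAtom (fun _ => rfl) (fun t => by cases t <;> rfl)
    (Polynomial.C 2) fun x => by simpa using sz_bool_le _

/-- Types with an injective encoding. -/
class TreeEncInj (α : Type) [TreeEnc α] : Prop where
  inj : Function.Injective (TreeEnc.enc : α → Tree)

-- The machine compares encodings, so injectivity of the encoding is what makes the test decide
-- equality of values.
@[fun_prop] protected theorem PolyT.teq [DecidableEq β] [TreeEncInj β] {f g : α → β} (hf : PolyT f) (hg : PolyT g) :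
    PolyT (fun x => teq (f x) (g x)) := by
  have h : PolyT (fun p : β × β => IRM.teq p.1 p.2) :=
    .of_elementary .eq Tree.eqTest (fun _ => rfl) (fun p => by
        change Tree.ofBool (decide (TreeEnc.enc p.1 = TreeEnc.enc p.2)) = Tree.ofBool (decide (p.1 = p.2))
        congr 2
        exact propext TreeEncInj.inj.eq_iff)
      (Polynomial.C 2) fun x => by simpa using sz_bool_le _
  exact h.comp (hf.prodMk hg)

@[fun_prop] protected theorem PolyT.decide_lt {f g : α → ℕ} (hf : PolyT f) (hg : PolyT g) :
    PolyT (fun x => decide (f x < g x)) := by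
  have h : PolyT (fun p : ℕ × ℕ => decide (p.1 < p.2)) :=
    .of_elementary .lt Tree.ltTest (fun _ => rfl) (fun p => rfl)
      (Polynomial.C 2) fun x => by simpa using sz_bool_le _
  exact h.comp (hf.prodMk hg)

@[fun_prop] protected theorem PolyT.cond {c : α → Bool} {f g : α → β} (hc : PolyT c) (hf : PolyT f) (hg : PolyT g) :
    PolyT (fun x => bif c x then f x else g x) := by
  obtain ⟨c', p, h⟩ := hc
  obtain ⟨f', q, k⟩ := hf
  obtain ⟨g', r, m⟩ := hg
  refine ⟨.ite c' f' g', p + q + r, fun x => ?_⟩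
  have h1 := h x
  have h2 := k x
  have h3 := m x
  simp only [Code.run, Polynomial.eval_add]
  rw [h1.1]
  cases c x with
  | true =>
    rw [if_neg (by simp [TreeEnc.enc, Tree.ofBool])]
    exact ⟨h2.1, by dsimp only; omega⟩
  | false =>
    rw [if_pos (by simp [TreeEnc.enc, Tree.ofBool])]
    exact ⟨h3.1, by dsimp only; omega⟩

@[fun_prop] protected theorem PolyT.and {f g : α → Bool} (hf : PolyT f) (hg : PolyT g) :
    PolyT (fun x => f x && g x) := by
  have : (fun x => f x && g x) = fun x => bif f x then g x else false := by
    funext x; cases f x <;> rfl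
  rw [this]; fun_prop
@[fun_prop] protected theorem PolyT.or {f g : α → Bool} (hf : PolyT f) (hg : PolyT g) :
    PolyT (fun x => f x || g x) := by
  have : (fun x => f x || g x) = fun x => bif f x then true else g x := by
    funext x; cases f x <;> rfl
  rw [this]; fun_prop
@[fun_prop] protected theorem PolyT.not {f : α → Bool} (hf : PolyT f) : PolyT (fun x => !f x) := by
  have : (fun x => !f x) = fun x => bif f x then false else true := by
    funext x; cases f x <;> rfl
  rw [this]; fun_prop

@[fun_prop] protected theorem PolyT.some {f : α → β} (hf : PolyT f) : PolyT (fun x => some (f x)) :=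
  .ofTree (F := fun x => Tree.node (.atom 1) (TreeEnc.enc (f x)))
    (.treeNode (.const _) (PolyT.toTree.comp hf)) fun _ => rfl

-- `none` is encoded as a leaf and `some` as a node, so a leaf test selects the branch; in the
-- second branch the content is the right subtree.
@[fun_prop] protected theorem PolyT.optionElim {o : α → Option β} {f : α → γ} {g : α → β → γ} (ho : PolyT o)
    (hf : PolyT f) (hg : PolyT (fun p : α × β => g p.1 p.2)) :
    PolyT (fun x => (o x).elim (f x) (g x)) := by
  obtain ⟨d, q, k⟩ := hf
  obtain ⟨e, r, m⟩ := hg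
  have hc : PolyT (fun p : α × Option β => (TreeEnc.enc p.2 : Tree).leafTest) :=
    PolyT.leafTest.comp (PolyT.toTree.comp PolyT.snd)
  have hfst : PolyT (fun p : α × Option β => p.1) := .fst
  have harg : PolyT (fun p : α × Option β => Tree.node (TreeEnc.enc p.1) (TreeEnc.enc p.2 : Tree).snd) :=
    .treeNode (PolyT.toTree.comp .fst) (PolyT.treeSnd.comp (PolyT.toTree.comp PolyT.snd))
  obtain ⟨c1, p1, h1⟩ := hc
  obtain ⟨c2, p2, h2⟩ := hfst
  obtain ⟨c3, p3, h3⟩ := harg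
  have key : PolyT (fun p : α × Option β => p.2.elim (f p.1) (g p.1)) := by
    refine ⟨.ite c1 (.comp c2 d) (.comp c3 e), p1 + p2 + q + p3 + r.comp p3, fun x => ?_⟩
    obtain ⟨x, o⟩ := x
    have a1 := h1 (x, o)
    have a2 := h2 (x, o)
    have a3 := h3 (x, o)
    simp only [Code.run, Polynomial.eval_add, Polynomial.eval_comp]
    rw [a1.1, a2.1, a3.1]
    cases o with
    | none =>
      rw [if_neg (by simp [TreeEnc.enc, Tree.ofBool, Tree.leafTest])]
      have a4 := k x
      refine ⟨a4.1, ?_⟩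
      have : q.eval (sz x) ≤ q.eval (sz (x, (none : Option β))) :=
        polynomial_eval_mono _ (by rw [sz_pair]; omega)
      dsimp only at *; omega
    | some b =>
      rw [if_pos (by simp [TreeEnc.enc, Tree.ofBool, Tree.leafTest])]
      have a4 := m (x, b)
      refine ⟨a4.1, ?_⟩
      -- The program for `g` runs on the pair rebuilt by `c3`, whose size is bounded by the cost of
      -- `c3`.
      have h5 : r.eval (sz (x, b)) ≤ r.eval (p3.eval (sz (x, Option.some b))) := by
        refine polynomial_eval_mono _ (le_trans ?_ a3.2)
        have := c3.size_le_cost (TreeEnc.enc (x, Option.some b))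
        rw [a3.1] at this
        exact this
      have a5 : (e.run (TreeEnc.enc (Tree.node (TreeEnc.enc x) (TreeEnc.enc (Option.some b) : Tree).snd))).2
        ≤ r.eval (sz (x, b)) := a4.2
      dsimp only at *; omega
  exact key.comp (PolyT.id.prodMk ho)

/-! #### Lists -/

@[fun_prop] protected theorem PolyT.cons {f : α → β} {g : α → List β} (hf : PolyT f) (hg : PolyT g) :
    PolyT (fun x => f x :: g x) :=
  .ofTree (PolyT.treeNode (PolyT.toTree.comp hf) (PolyT.toTree.comp hg)) fun _ => rfl

@[fun_prop] protected theorem PolyT.tail {f : α → List β} (hf : PolyT f) : PolyT (fun x => (f x).tail) :=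
  .ofTree (PolyT.treeSnd.comp (PolyT.toTree.comp hf)) fun x => by cases f x <;> rfl

@[fun_prop] protected theorem PolyT.isEmpty {f : α → List β} (hf : PolyT f) : PolyT (fun x => (f x).isEmpty) :=
  .ofTree (PolyT.toTree.comp (PolyT.leafTest.comp (PolyT.toTree.comp hf))) fun x => by
    cases f x <;> rfl

@[fun_prop] protected theorem PolyT.headD {f : α → List β} {g : α → β} (hf : PolyT f) (hg : PolyT g) :
    PolyT (fun x => (f x).headD (g x)) :=
  .ofTree (F := fun x => bif (TreeEnc.enc (f x) : Tree).leafTest then TreeEnc.enc (g x)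
      else (TreeEnc.enc (f x) : Tree).fst)
    (.cond (PolyT.leafTest.comp (PolyT.toTree.comp hf)) (PolyT.toTree.comp hg)
      (PolyT.treeFst.comp (PolyT.toTree.comp hf))) fun x => by cases f x <;> rfl

/-- Primitive recursion over lists. -/
def paraList {α β : Type} (b : β) (s : α → List α → β → β) : List α → β
  | [] => b
  | a :: l => s a l (paraList b s l)

/-- Iterating a polynomial-time step may produce results of exponential size, hence the assumed
bound `q` on the values at all lists. Given it, each step costs at most a fixed polynomial in the
input, and there is one step per list entry. -/
protected theorem PolyT.paraList_of_bound {b : γ → β} {s : γ → α → List α → β → β} {l : γ → List α}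
    (hb : PolyT b) (hs : PolyT (fun p : γ × α × List α × β => s p.1 p.2.1 p.2.2.1 p.2.2.2))
    (hl : PolyT l) (q : Polynomial ℕ)
    (hq : ∀ x (t : List α), sz (paraList (b x) (s x) t) ≤ q.eval (sz x + sz t)) :
    PolyT (fun x => paraList (b x) (s x) (l x)) := by
  have hb' : PolyT (fun p : γ × ℕ => b p.1) := hb.comp .fst
  have hs' : PolyT (fun p : γ × ((α × List α) × β) => s p.1 p.2.1.1 p.2.1.2 p.2.2) :=
    hs.comp (g := fun p : γ × α × List α × β => s p.1 p.2.1 p.2.2.1 p.2.2.2)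
      (f := fun p : γ × ((α × List α) × β) => (p.1, p.2.1.1, p.2.1.2, p.2.2)) (by fun_prop)
  obtain ⟨c, p, h⟩ := hb'
  obtain ⟨d, r, k⟩ := hs'
  have key : PolyT (fun p : γ × List α => paraList (b p.1) (s p.1) p.2) := by
    refine ⟨.foldList c d, (Polynomial.X + 1) *
      (p.comp (Polynomial.X + 2) + r.comp (Polynomial.X + q + 4)), ?_⟩
    rintro ⟨x, t⟩
    set N := sz (x, t) with hN
    set R := p.eval (N + 2) + r.eval (N + q.eval N + 4) with hR
    -- The recursion descends through the tails, so the claim is made for all lists within the fixed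
    -- size `N`. The summands in `R` leave room for the leaf and the pair nodes added when a program
    -- is called.
    have main : ∀ u : List α, sz x + sz u ≤ N →
        ((Code.foldList c d).run (TreeEnc.enc (x, u))).1 = TreeEnc.enc (paraList (b x) (s x) u) ∧
        ((Code.foldList c d).run (TreeEnc.enc (x, u))).2 ≤ (u.length + 1) * R := by
      intro u
      induction u with
      | nil =>
        intro hu
        have h1 := h (x, 0)
        refine ⟨h1.1, ?_⟩
        have : p.eval (sz (x, (0:ℕ))) ≤ p.eval (N + 2) := by
          refine polynomial_eval_mono _ ?_
          have : sz (0:ℕ) = 1 := by simp [sz_nat]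
          rw [sz_pair, this]; omega
        have h3 : ((Code.foldList c d).run (TreeEnc.enc (x, ([] : List α)))).2 ≤ p.eval (sz (x, (0:ℕ))) :=
          h1.2
        simp only [List.length_nil]; omega
      | cons a u ih =>
        intro hu
        rw [sz_cons] at hu
        obtain ⟨i1, i2⟩ := ih (by omega)
        have k1 := k (x, (a, u), paraList (b x) (s x) u)
        have e1 : (Code.foldList c d).run (TreeEnc.enc (x, a :: u)) =
            ((d.run (.node (TreeEnc.enc x) (.node (.node (TreeEnc.enc a) (TreeEnc.enc u))
              ((Code.foldList c d).run (TreeEnc.enc (x, u))).1))).1,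
             ((Code.foldList c d).run (TreeEnc.enc (x, u))).2 +
             (d.run (.node (TreeEnc.enc x) (.node (.node (TreeEnc.enc a) (TreeEnc.enc u))
              ((Code.foldList c d).run (TreeEnc.enc (x, u))).1))).2) := rfl
        rw [e1, i1]
        refine ⟨k1.1, ?_⟩
        have h5 : r.eval (sz (x, (a, u), paraList (b x) (s x) u)) ≤ r.eval (N + q.eval N + 4) := by
          refine polynomial_eval_mono _ ?_
          have h6 := hq x u
          have h7 : q.eval (sz x + sz u) ≤ q.eval N := polynomial_eval_mono _ (by omega)
          simp only [sz_pair]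
          omega
        have h8 : (d.run (.node (TreeEnc.enc x) (.node (.node (TreeEnc.enc a) (TreeEnc.enc u))
              (TreeEnc.enc (paraList (b x) (s x) u))))).2 ≤ r.eval (sz (x, (a, u), paraList (b x) (s x) u)) :=
          k1.2
        simp only [List.length_cons]
        have : (u.length + 1 + 1) * R = (u.length + 1) * R + R := by ring
        omega
    obtain ⟨m1, m2⟩ := main t (by rw [hN, sz_pair]; omega)
    refine ⟨m1, m2.trans ?_⟩
    simp only [Polynomial.eval_mul, Polynomial.eval_add, Polynomial.eval_comp, Polynomial.eval_X,
      Polynomial.eval_one, Polynomial.eval_ofNat]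
    refine Nat.mul_le_mul_right _ ?_
    have := length_le_sz t
    rw [hN, sz_pair]; omega
  exact key.comp (PolyT.id.prodMk hl)

/-- Recursion over lists with steps that add a bounded amount to the result. -/
protected theorem PolyT.paraList {b : γ → β} {s : γ → α → List α → β → β} {l : γ → List α}
    (hb : PolyT b) (hs : PolyT (fun p : γ × α × List α × β => s p.1 p.2.1 p.2.2.1 p.2.2.2))
    (hl : PolyT l)
    (hq : ∃ q : Polynomial ℕ, ∀ x a t v, sz (s x a t v) ≤ sz v + q.eval (sz x + sz a + sz t)) :
    PolyT (fun x => paraList (b x) (s x) (l x)) := by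
  obtain ⟨q, hq⟩ := hq
  obtain ⟨p, hp⟩ := hb.sz_le
  refine .paraList_of_bound hb hs hl (p + Polynomial.X * q) fun x t => ?_
  -- Each step adds at most `q.eval N`, so growth is linear in the number of entries.
  have key : ∀ N, ∀ u : List α, sz x + sz u ≤ N →
      sz (IRM.paraList (b x) (s x) u) ≤ p.eval (sz x) + u.length * q.eval N := by
    intro N u
    induction u with
    | nil => intro _; simpa [IRM.paraList] using hp x
    | cons a u ih =>
      intro hu
      rw [sz_cons] at hu
      have h1 := ih (by omega)
      have h2 := hq x a u (IRM.paraList (b x) (s x) u)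
      have h3 : q.eval (sz x + sz a + sz u) ≤ q.eval N := polynomial_eval_mono _ (by omega)
      have h4 : (u.length + 1) * q.eval N = u.length * q.eval N + q.eval N := by ring
      simp only [IRM.paraList, List.length_cons]
      omega
  refine (key _ t le_rfl).trans ?_
  simp only [Polynomial.eval_add, Polynomial.eval_mul, Polynomial.eval_X]
  refine Nat.add_le_add (polynomial_eval_mono _ (by omega)) (Nat.mul_le_mul_right _ ?_)
  have := length_le_sz t
  omega

end
section
variable {α β γ δ : Type} [TreeEnc α] [TreeEnc β] [TreeEnc γ] [TreeEnc δ]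

theorem sz_append (l m : List α) : sz (l ++ m) + 1 = sz l + sz m := by
  induction l with
  | nil => rw [List.nil_append, sz_nil]; omega
  | cons a l ih => rw [List.cons_append, sz_cons, sz_cons]; omega

/-- Recursion over lists: the bound may be given by the size of an auxiliary polynomial-time function. -/
protected theorem PolyT.paraList_of_le {b : γ → β} {s : γ → α → List α → β → β} {l : γ → List α}
    (hb : PolyT b) (hs : PolyT (fun p : γ × α × List α × β => s p.1 p.2.1 p.2.2.1 p.2.2.2))
    (hl : PolyT l) {f : γ → α → δ} (hf : PolyT (fun p : γ × α => f p.1 p.2))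
    (hq : ∀ x a t v, sz (s x a t v) ≤ sz v + sz (f x a) + 4) :
    PolyT (fun x => IRM.paraList (b x) (s x) (l x)) := by
  obtain ⟨p, hp⟩ := hf.sz_le
  refine .paraList hb hs hl ⟨p.comp (Polynomial.X + 1) + 4, fun x a t v => ?_⟩
  have h1 := hq x a t v
  have h2 := hp (x, a)
  have h3 : p.eval (sz (x, a)) ≤ p.eval (sz x + sz a + sz t + 1) :=
    polynomial_eval_mono _ (by rw [sz_pair]; omega)
  simp only [Polynomial.eval_add, Polynomial.eval_comp, Polynomial.eval_X, Polynomial.eval_one,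
    Polynomial.eval_ofNat]
  dsimp only at h2
  omega

@[fun_prop] protected theorem PolyT.length {l : γ → List α} (hl : PolyT l) : PolyT (fun x => (l x).length) := by
  have h : PolyT (fun x => IRM.paraList 0 (fun _ _ v => v + 1) (l x)) :=
    .paraList_of_le (b := fun _ => 0) (s := fun _ _ _ v => v + 1) (by fun_prop) (by fun_prop) hl
      (f := fun _ _ => 0) (by fun_prop) fun x a t v => by
        have := nat_size_succ_le v
        rw [sz_nat, sz_nat]; omega
  convert h using 2 with x
  induction l x with
  | nil => rfl
  | cons a l ih => rw [List.length_cons, ih]; rfl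

@[fun_prop] protected theorem PolyT.append {l m : γ → List α} (hl : PolyT l) (hm : PolyT m) :
    PolyT (fun x => l x ++ m x) := by
  have h : PolyT (fun x => IRM.paraList (m x) (fun a _ v => a :: v) (l x)) :=
    .paraList_of_le (s := fun _ a _ v => a :: v) hm (by fun_prop) hl
      (f := fun _ a => a) (by fun_prop) fun x a t v => by rw [sz_cons]; omega
  convert h using 2 with x
  induction l x with
  | nil => rfl
  | cons a l ih => rw [List.cons_append, ih]; rfl

@[fun_prop] protected theorem PolyT.flatMap {l : γ → List α} {f : γ → α → List β} (hl : PolyT l)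
    (hf : PolyT (fun p : γ × α => f p.1 p.2)) : PolyT (fun x => (l x).flatMap (f x)) := by
  have h : PolyT (fun x => IRM.paraList [] (fun a _ v => f x a ++ v) (l x)) :=
    .paraList_of_le (b := fun _ => []) (s := fun x a _ v => f x a ++ v) (by fun_prop)
      (.append (hf.comp (f := fun p : γ × α × List α × List β => (p.1, p.2.1)) (by fun_prop))
        (by fun_prop)) hl hf fun x a t v => by
          have := sz_append (f x a) v
          omega
  convert h using 2 with x
  induction l x with
  | nil => rfl
  | cons a l ih => rw [List.flatMap_cons, ih]; rfl

@[fun_prop] protected theorem PolyT.filterMap {l : γ → List α} {f : γ → α → Option β} (hl : PolyT l)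
    (hf : PolyT (fun p : γ × α => f p.1 p.2)) : PolyT (fun x => (l x).filterMap (f x)) := by
  have h : PolyT (fun x => (l x).flatMap fun a => (f x a).elim [] fun b => [b]) :=
    .flatMap hl (f := fun x a => (f x a).elim [] fun b => [b])
      (.optionElim hf (by fun_prop) (by fun_prop))
  convert h using 2 with x
  induction l x with
  | nil => rfl
  | cons a l ih => rw [List.flatMap_cons, List.filterMap_cons, ih]; cases f x a <;> rfl

@[fun_prop] protected theorem PolyT.map {l : γ → List α} {f : γ → α → β} (hl : PolyT l)
    (hf : PolyT (fun p : γ × α => f p.1 p.2)) : PolyT (fun x => (l x).map (f x)) := by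
  have h : PolyT (fun x => (l x).filterMap fun a => some (f x a)) := by fun_prop
  convert h using 2 with x
  exact (List.filterMap_eq_map).symm ▸ rfl

@[fun_prop] protected theorem PolyT.all {l : γ → List α} {f : γ → α → Bool} (hl : PolyT l)
    (hf : PolyT (fun p : γ × α => f p.1 p.2)) : PolyT (fun x => (l x).all (f x)) := by
  have h : PolyT (fun x => IRM.paraList true (fun a _ v => f x a && v) (l x)) :=
    .paraList_of_le (b := fun _ => true) (s := fun x a _ v => f x a && v) (by fun_prop)
      (.and (hf.comp (f := fun p : γ × α × List α × Bool => (p.1, p.2.1)) (by fun_prop))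
        (by fun_prop)) hl hf fun x a t v => by
          have := sz_bool_le (f x a && v)
          omega
  convert h using 2 with x
  induction l x with
  | nil => rfl
  | cons a l ih => rw [List.all_cons, ih]; rfl

@[fun_prop] protected theorem PolyT.any {l : γ → List α} {f : γ → α → Bool} (hl : PolyT l)
    (hf : PolyT (fun p : γ × α => f p.1 p.2)) : PolyT (fun x => (l x).any (f x)) := by
  have h : PolyT (fun x => !((l x).all fun a => !f x a)) := by fun_prop
  convert h using 2 with x
  simp [List.all_eq_not_any_not]

@[fun_prop] protected theorem PolyT.find? {l : γ → List α} {f : γ → α → Bool} (hl : PolyT l)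
    (hf : PolyT (fun p : γ × α => f p.1 p.2)) : PolyT (fun x => (l x).find? (f x)) := by
  have h : PolyT (fun x => IRM.paraList none (fun a _ v => bif f x a then some a else v) (l x)) :=
    .paraList_of_le (b := fun _ => none) (s := fun x a _ v => bif f x a then some a else v)
      (by fun_prop)
      (.cond (hf.comp (f := fun p : γ × α × List α × Option α => (p.1, p.2.1)) (by fun_prop))
        (by fun_prop) (by fun_prop)) hl (f := fun _ a => a) (by fun_prop) fun x a t v => by
          cases f x a
          · simp only [cond_false]; omega
          · simp only [cond_true, sz_some]; omega
  convert h using 2 with x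
  induction l x with
  | nil => rfl
  | cons a l ih => rw [List.find?_cons, IRM.paraList, ← ih]; cases f x a <;> rfl

@[fun_prop] protected theorem PolyT.filter {l : γ → List α} {f : γ → α → Bool} (hl : PolyT l)
    (hf : PolyT (fun p : γ × α => f p.1 p.2)) : PolyT (fun x => (l x).filter (f x)) := by
  have h : PolyT (fun x => (l x).filterMap fun a => bif f x a then some a else none) := by fun_prop
  convert h using 2 with x
  induction l x with
  | nil => rfl
  | cons a l ih =>
    rw [List.filter_cons, List.filterMap_cons, ih]; cases f x a <;> rfl

@[fun_prop] protected theorem PolyT.optionMap {o : α → Option β} {g : α → β → γ} (ho : PolyT o)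
    (hg : PolyT (fun p : α × β => g p.1 p.2)) : PolyT (fun x => (o x).map (g x)) := by
  have h : PolyT (fun x => (o x).elim none fun b => some (g x b)) := by fun_prop
  convert h using 2 with x
  cases o x <;> rfl

@[fun_prop] protected theorem PolyT.optionBind {o : α → Option β} {g : α → β → Option γ} (ho : PolyT o)
    (hg : PolyT (fun p : α × β => g p.1 p.2)) : PolyT (fun x => (o x).bind (g x)) := by
  have h : PolyT (fun x => (o x).elim none fun b => g x b) := by fun_prop
  convert h using 2 with x
  cases o x <;> rfl

@[fun_prop] protected theorem PolyT.optionGetD {o : α → Option β} {g : α → β} (ho : PolyT o)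
    (hg : PolyT g) : PolyT (fun x => (o x).getD (g x)) := by
  have h : PolyT (fun x => (o x).elim (g x) fun b => b) := by fun_prop
  convert h using 2 with x
  cases o x <;> rfl

@[fun_prop] protected theorem PolyT.optionIsSome {o : α → Option β} (ho : PolyT o) :
    PolyT (fun x => (o x).isSome) := by
  have h : PolyT (fun x => (o x).elim false fun b => true) := by fun_prop
  convert h using 2 with x
  cases o x <;> rfl

@[fun_prop] protected theorem PolyT.lookup [DecidableEq α] [TreeEncInj α] {l : γ → List (α × β)} {k : γ → α} (hl : PolyT l)
    (hk : PolyT k) : PolyT (fun x => (l x).lookup (k x)) := by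
  have h : PolyT (fun x => ((l x).find? fun p => IRM.teq (k x) p.1).map fun p => p.2) := by fun_prop
  convert h using 2 with x
  induction l x with
  | nil => rfl
  | cons a l ih =>
    obtain ⟨a, b⟩ := a
    rw [List.lookup_cons, List.find?_cons, ih, IRM.teq, beq_eq_decide]
    cases decide (k x = a) <;> rfl

@[fun_prop] protected theorem PolyT.reverse {l : γ → List α} (hl : PolyT l) : PolyT (fun x => (l x).reverse) := by
  have h : PolyT (fun x => IRM.paraList [] (fun a _ v => v ++ [a]) (l x)) :=
    .paraList_of_le (b := fun _ => []) (s := fun _ a _ v => v ++ [a]) (by fun_prop) (by fun_prop) hl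
      (f := fun _ a => a) (by fun_prop) fun x a t v => by
        have := sz_append v [a]
        rw [sz_cons, sz_nil] at this; omega
  convert h using 2 with x
  induction l x with
  | nil => rfl
  | cons a l ih => rw [List.reverse_cons, ih]; rfl

-- Recursion over a list works from its end, whereas indices count from the front; so the list is
-- reversed and a counter is carried along. A step adds an entry holding the counter, an amount that
-- depends on the previous value, and therefore an explicit bound on all values is given.
@[fun_prop] protected theorem PolyT.zipIdx {l : γ → List α} (hl : PolyT l) : PolyT (fun x => (l x).zipIdx) := by
  have h : PolyT (fun x => (IRM.paraList ((0 : ℕ), ([] : List (α × ℕ)))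
      (fun a _ v => (v.1 + 1, v.2 ++ [(a, v.1)])) (l x).reverse).2) := by
    refine PolyT.snd.comp (.paraList_of_bound (b := fun _ => ((0 : ℕ), ([] : List (α × ℕ))))
      (s := fun _ a _ v => (v.1 + 1, v.2 ++ [(a, v.1)])) (by fun_prop) (by fun_prop) (by fun_prop)
      (Polynomial.X * (2 * Polynomial.X + 4) + Polynomial.X + 10) fun x t => ?_)
    -- The counter equals the number of entries processed, so each index occupies at most that
    -- number plus one, and the total is quadratic.
    have key : ∀ u : List α, (IRM.paraList ((0 : ℕ), ([] : List (α × ℕ)))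
        (fun a _ v => (v.1 + 1, v.2 ++ [(a, v.1)])) u).1 = u.length ∧
        sz (IRM.paraList ((0 : ℕ), ([] : List (α × ℕ)))
        (fun a _ v => (v.1 + 1, v.2 ++ [(a, v.1)])) u).2 ≤ u.length * (sz u + u.length + 4) + 1 := by
      intro u
      induction u with
      | nil => exact ⟨rfl, by simp [IRM.paraList, sz_nil]⟩
      | cons a u ih =>
        obtain ⟨i1, i2⟩ := ih
        refine ⟨by simp only [IRM.paraList, i1, List.length_cons], ?_⟩
        simp only [IRM.paraList, i1, List.length_cons]
        generalize (IRM.paraList ((0 : ℕ), ([] : List (α × ℕ)))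
          (fun a _ v => (v.1 + 1, v.2 ++ [(a, v.1)])) u).2 = w at i2
        have h1 := sz_append w [(a, u.length)]
        rw [sz_cons, sz_nil, sz_pair] at h1
        have h2 := sz_nat_le u.length
        rw [sz_cons]
        have h3 : u.length * (sz u + u.length + 4) ≤ u.length * (sz a + sz u + 1 + (u.length + 1) + 4) :=
          Nat.mul_le_mul_left _ (by omega)
        have h4 : (u.length + 1) * (sz a + sz u + 1 + (u.length + 1) + 4) =
          u.length * (sz a + sz u + 1 + (u.length + 1) + 4) + (sz a + sz u + 1 + (u.length + 1) + 4) := by ring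
        omega
    obtain ⟨k1, k2⟩ := key t
    have k3 := length_le_sz t
    have k4 := sz_nat_le t.length
    set v := IRM.paraList ((0 : ℕ), ([] : List (α × ℕ))) (fun a _ v => (v.1 + 1, v.2 ++ [(a, v.1)])) t
    have k5 : sz v = sz v.1 + sz v.2 + 1 := rfl
    rw [k5, k1]
    simp only [Polynomial.eval_add, Polynomial.eval_mul, Polynomial.eval_X, Polynomial.eval_ofNat]
    have k6 : t.length * (sz t + t.length + 4) ≤ (sz x + sz t) * (2 * (sz x + sz t) + 4) :=
      Nat.mul_le_mul (by omega) (by omega)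
    omega
  convert h using 2 with x
  have key : ∀ u : List α, (IRM.paraList ((0 : ℕ), ([] : List (α × ℕ)))
        (fun a _ v => (v.1 + 1, v.2 ++ [(a, v.1)])) u) = (u.length, u.reverse.zipIdx) := by
    intro u
    induction u with
    | nil => rfl
    | cons a u ih => simp [IRM.paraList, ih, List.zipIdx_append]
  rw [key, List.reverse_reverse]

/-- Random access becomes a search among indexed entries, for which closure is already known. -/
theorem lookup_zipIdx {α : Type} (l : List α) (i : ℕ) :
    (l.zipIdx.map fun p => (p.2, p.1)).lookup i = l[i]? := by
  have key : ∀ (l : List α) (k : ℕ), ((l.zipIdx k).map fun p => (p.2, p.1)).lookup (k + i) = l[i]? := by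
    intro l
    induction l generalizing i with
    | nil => intro k; simp
    | cons a l ih =>
      intro k
      rw [List.zipIdx_cons, List.map_cons, List.lookup_cons]
      cases i with
      | zero => simp
      | succ i =>
        have h := ih i (k + 1)
        rw [show k + (i + 1) = k + 1 + i by omega, h]
        have : (k + 1 + i == k) = false := by simp; omega
        rw [this]; simp
  simpa using key l 0

instance : TreeEncInj ℕ := ⟨fun _ _ h => Tree.atom.inj h⟩
instance : TreeEncInj Tree := ⟨fun _ _ h => h⟩

@[fun_prop] protected theorem PolyT.getElem? {l : γ → List α} {i : γ → ℕ} (hl : PolyT l) (hi : PolyT i) :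
    PolyT (fun x => (l x)[i x]?) := by
  have h : PolyT (fun x => ((l x).zipIdx.map fun p => (p.2, p.1)).lookup (i x)) := by fun_prop
  convert h using 2 with x
  exact (lookup_zipIdx _ _).symm

@[fun_prop] protected theorem PolyT.getD {l : γ → List α} {i : γ → ℕ} {d : γ → α} (hl : PolyT l) (hi : PolyT i)
    (hd : PolyT d) : PolyT (fun x => (l x).getD (i x) (d x)) := by
  have h : PolyT (fun x => ((l x)[i x]?).getD (d x)) := by fun_prop
  convert h using 2 with x
  exact List.getD_eq_getElem?_getD

@[fun_prop] protected theorem PolyT.zip {l : γ → List α} {m : γ → List β} (hl : PolyT l) (hm : PolyT m) :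
    PolyT (fun x => (l x).zip (m x)) := by
  have h : PolyT (fun x => (l x).zipIdx.filterMap fun p => ((m x)[p.2]?).map fun b => (p.1, b)) := by
    fun_prop
  convert h using 2 with x
  -- For the induction, the remaining part `m` of the second list is described as the part of the
  -- fixed list `m'` from position `k` on.
  have key : ∀ (l : List α) (m : List β) (k : ℕ) (m' : List β), (∀ i, m[i]? = m'[k + i]?) →
      l.zip m = (l.zipIdx k).filterMap fun p => (m'[p.2]?).map fun b => (p.1, b) := by
    intro l
    induction l with
    | nil => intro m k m' h; simp
    | cons a l ih =>
      intro m k m' h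
      rw [List.zipIdx_cons, List.filterMap_cons]
      have h0 := h 0
      cases m with
      | nil =>
        have : m'[k]? = none := by simpa using h0.symm
        simp only [this, Option.map_none]
        rw [← ih [] (k + 1) m' fun i => by have := h (i + 1); rw [show k + 1 + i = k + (i + 1) by omega]; simpa using this]
        simp
      | cons b m =>
        have : m'[k]? = some b := by simpa using h0.symm
        simp only [this, Option.map_some]
        rw [← ih m (k + 1) m' fun i => by have := h (i + 1); rw [show k + 1 + i = k + (i + 1) by omega]; simpa using this]
        simp
  exact key _ _ 0 _ fun i => by simp

/-- Numbers in unary. -/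
structure Unary where
  val : ℕ

instance : TreeEnc Unary := ⟨fun n => encUnary n.val⟩

protected theorem PolyT.unaryList : PolyT (fun n : Unary => List.replicate n.val (0 : ℕ)) :=
  .ofTree PolyT.toTree fun n => by
    change encList _ = encList _
    rw [List.map_replicate]; rfl

@[fun_prop] protected theorem PolyT.unaryVal {n : γ → Unary} (hn : PolyT n) : PolyT (fun x => (n x).val) := by
  have h := PolyT.length (PolyT.unaryList.comp hn)
  simpa using h

-- The bound is in unary because the result has as many entries as its value, which is exponential
-- in the binary length. For this reason arities are encoded in unary.
@[fun_prop] protected theorem PolyT.range {n : γ → Unary} (hn : PolyT n) : PolyT (fun x => List.range (n x).val) := by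
  have h : PolyT (fun x => (List.replicate (n x).val (0 : ℕ)).zipIdx.map fun p => p.2) := by
    have := PolyT.unaryList.comp hn
    fun_prop
  convert h using 2 with x
  rw [List.zipIdx_map_snd, List.length_replicate, List.range_eq_range']
end

section
variable {γ : Type} [TreeEnc γ]

/-! #### Recursion over terms -/

mutual
/-- Recursion over encoded terms: the value at a node with tag `k` and parameter list `r` is computed from
`k`, `r` and the list of the values at the parameters. -/
def Tree.termRec (h : Tree → Tree → Tree → Tree) : Tree → Tree
  | .atom n => .atom n
  | .node l r => h l r (r.termRecList h)
def Tree.termRecList (h : Tree → Tree → Tree → Tree) : Tree → Tree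
  | .atom n => .atom n
  | .node l r => .node (l.termRec h) (r.termRecList h)
end

/-- Growth by a constant factor `m` is preserved: parameter values add up as the parameters do, and
the hypothesis on `h` is exactly the inductive step at a term node. -/
theorem Tree.sz_termRec_le {h : Tree → Tree → Tree → Tree} {m : ℕ} (hm1 : 1 ≤ m)
    (hm : ∀ l r v : Tree, sz v ≤ m * sz r → sz (h l r v) ≤ m * (sz l + sz r + 1)) (u : Tree) :
    sz (u.termRec h) ≤ m * sz u ∧ sz (u.termRecList h) ≤ m * sz u := by
  induction u with
  | atom n =>
    have : sz (Tree.atom n) ≤ m * sz (Tree.atom n) := Nat.le_mul_of_pos_left _ hm1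
    exact ⟨by simpa [Tree.termRec] using this, by simpa [Tree.termRecList] using this⟩
  | node l r ihl ihr =>
    have e : sz (Tree.node l r) = sz l + sz r + 1 := rfl
    rw [e]
    refine ⟨by rw [Tree.termRec]; exact hm l r _ ihr.2, ?_⟩
    have e2 : sz (Tree.node (l.termRec h) (r.termRecList h)) =
      sz (l.termRec h) + sz (r.termRecList h) + 1 := rfl
    rw [Tree.termRecList, e2]
    have := ihl.1
    have := ihr.2
    have e3 : m * (sz l + sz r + 1) = m * sz l + m * sz r + m := by ring
    omega

/-- An encoded node may be read as a term or as the remainder of a parameter list, and the fold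
cannot tell which. So it computes both readings at every node and the first is selected at the end.
The growth factor may depend polynomially on the parameter. -/
protected theorem PolyT.termRec {h : γ → Tree → Tree → Tree → Tree} {t : γ → Tree}
    (hh : PolyT (fun p : γ × Tree × Tree × Tree => h p.1 p.2.1 p.2.2.1 p.2.2.2)) (ht : PolyT t)
    (m : Polynomial ℕ) (hm1 : ∀ x : γ, 1 ≤ m.eval (sz x))
    (hm : ∀ (x : γ) (l r v : Tree), sz v ≤ m.eval (sz x) * sz r →
      sz (h x l r v) ≤ m.eval (sz x) * (sz l + sz r + 1)) :
    PolyT (fun x => (t x).termRec (h x)) := by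
  have hb : PolyT (fun p : γ × Tree => Tree.node p.2 p.2) := .treeNode .snd .snd
  have hs : PolyT (fun p : γ × ((Tree × Tree) × ((Tree × Tree) × (Tree × Tree))) =>
      Tree.node (h p.1 p.2.1.1 p.2.1.2 p.2.2.2.2) (.node p.2.2.1.1 p.2.2.2.2)) := by
    refine .treeNode (hh.comp (f := fun p : γ × ((Tree × Tree) × ((Tree × Tree) × (Tree × Tree))) =>
      (p.1, p.2.1.1, p.2.1.2, p.2.2.2.2)) (by fun_prop)) (by fun_prop)
  obtain ⟨c, p, hc⟩ := hb
  obtain ⟨d, q, hd⟩ := hs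
  have bound : ∀ x (u : Tree), sz (u.termRec (h x)) ≤ m.eval (sz x) * sz u ∧
      sz (u.termRecList (h x)) ≤ m.eval (sz x) * sz u := fun x u => Tree.sz_termRec_le (hm1 x) (hm x) u
  have key : PolyT (fun p : γ × Tree => Tree.node (p.2.termRec (h p.1)) (p.2.termRecList (h p.1))) := by
    refine ⟨.fold c d, Polynomial.X * (p + q.comp (4 * (m * Polynomial.X) + 2 * Polynomial.X + 10)), ?_⟩
    rintro ⟨x, t⟩
    set N := sz (x, t) with hN
    set R := p.eval N + q.eval (4 * (m.eval N * N) + 2 * N + 10) with hR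
    have main : ∀ u : Tree, sz x + sz u + 1 ≤ N →
        ((Code.fold c d).run (.node (TreeEnc.enc x) u)).1 =
          .node (u.termRec (h x)) (u.termRecList (h x)) ∧
        ((Code.fold c d).run (.node (TreeEnc.enc x) u)).2 ≤ sz u * R := by
      intro u
      induction u with
      | atom n =>
        intro hu
        have h1 := hc (x, Tree.atom n)
        refine ⟨h1.1, ?_⟩
        have h2 : p.eval (sz (x, Tree.atom n)) ≤ p.eval N :=
          polynomial_eval_mono _ (by rw [sz_pair]; omega)
        have h3 : ((Code.fold c d).run (.node (TreeEnc.enc x) (.atom n))).2 ≤ p.eval (sz (x, Tree.atom n)) :=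
          h1.2
        have h4 : R ≤ sz (Tree.atom n) * R := Nat.le_mul_of_pos_left _ (one_le_sz _)
        omega
      | node l r ihl ihr =>
        intro hu
        have e : sz (Tree.node l r) = sz l + sz r + 1 := rfl
        rw [e] at hu ⊢
        obtain ⟨i1, i2⟩ := ihl (by omega)
        obtain ⟨j1, j2⟩ := ihr (by omega)
        have k1 := hd (x, (l, r), (l.termRec (h x), l.termRecList (h x)), (r.termRec (h x), r.termRecList (h x)))
        have e1 : (Code.fold c d).run (.node (TreeEnc.enc x) (.node l r)) =
            ((d.run (.node (TreeEnc.enc x) (.node (.node l r)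
              (.node ((Code.fold c d).run (.node (TreeEnc.enc x) l)).1
                ((Code.fold c d).run (.node (TreeEnc.enc x) r)).1)))).1,
             ((Code.fold c d).run (.node (TreeEnc.enc x) l)).2 +
             ((Code.fold c d).run (.node (TreeEnc.enc x) r)).2 +
             (d.run (.node (TreeEnc.enc x) (.node (.node l r)
              (.node ((Code.fold c d).run (.node (TreeEnc.enc x) l)).1
                ((Code.fold c d).run (.node (TreeEnc.enc x) r)).1)))).2) := rfl
        rw [e1, i1, j1]
        refine ⟨by rw [Tree.termRec, Tree.termRecList]; exact k1.1, ?_⟩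
        have b1 := bound x l
        have b2 := bound x r
        have b3 : m.eval (sz x) ≤ m.eval N := polynomial_eval_mono _ (by omega)
        have b4 : m.eval (sz x) * sz l + m.eval (sz x) * sz r ≤ m.eval N * N := by
          rw [← Nat.mul_add]; exact Nat.mul_le_mul b3 (by omega)
        have h5 := k1.2
        have h6 : q.eval (sz (x, (l, r), (l.termRec (h x), l.termRecList (h x)),
            (r.termRec (h x), r.termRecList (h x)))) ≤ q.eval (4 * (m.eval N * N) + 2 * N + 10) := by
          refine polynomial_eval_mono _ ?_
          simp only [sz_pair]; omega
        have h7 : (d.run (.node (TreeEnc.enc x) (.node (.node l r)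
          (.node (.node (l.termRec (h x)) (l.termRecList (h x)))
            (.node (r.termRec (h x)) (r.termRecList (h x))))))).2 ≤ q.eval (4 * (m.eval N * N) + 2 * N + 10) :=
          h5.trans h6
        have h8 : (sz l + sz r + 1) * R = sz l * R + sz r * R + R := by ring
        rw [h8]
        dsimp only
        omega
    obtain ⟨m1, m2⟩ := main t (by rw [hN, sz_pair])
    refine ⟨m1, m2.trans ?_⟩
    simp only [Polynomial.eval_mul, Polynomial.eval_add, Polynomial.eval_comp, Polynomial.eval_X,
      Polynomial.eval_ofNat]
    refine Nat.mul_le_mul_right _ ?_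
    rw [hN, sz_pair]; omega
  exact PolyT.treeFst.comp (key.comp (PolyT.id.prodMk ht))
end

/-! ### Soundness of rewriting -/

section
variable {D : DataAlgebra} (C : Config D)

theorem Assertion.sem_imp (a b : Assertion) : (Assertion.imp a b).sem C ↔ (a.sem C → b.sem C) := by
  simp [Assertion.imp, Assertion.sem]

mutual
-- The replaced and the replacing assertion have the same truth value in this particular
-- configuration. That is enough, since meaning is compositional, also in the conditions of
-- conditional expressions.
theorem Expr.sem_replace {ψ w : Assertion} (h : w.sem C ↔ ψ.sem C) :
    ∀ e : Expr, (e.replace ψ w).sem C = e.sem C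
  | .lit _ => rfl
  | .field e f => by simp only [Expr.replace, Expr.sem, Expr.sem_replace h e]
  | .static _ _ => rfl
  | .stack _ => rfl
  | .loc _ => rfl
  | .ghost _ => rfl
  | .op o e₁ e₂ => by simp only [Expr.replace, Expr.sem, Expr.sem_replace h e₁, Expr.sem_replace h e₂]
  | .cond a e₁ e₂ => by
    simp only [Expr.replace, Expr.sem, Expr.sem_replace h e₁, Expr.sem_replace h e₂]
    rw [propext (Assertion.sem_replace h a)]
  | .pair e₁ e₂ => by simp only [Expr.replace, Expr.sem, Expr.sem_replace h e₁, Expr.sem_replace h e₂]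
  | .bot => rfl
theorem Assertion.sem_replace {ψ w : Assertion} (h : w.sem C ↔ ψ.sem C) :
    ∀ a : Assertion, (Assertion.replace ψ w a).sem C ↔ a.sem C
  | .tt => by
    rw [Assertion.replace]; split
    · next e => rw [h, ← e]
    · rfl
  | .ff => by
    rw [Assertion.replace]; split
    · next e => rw [h, ← e]
    · rfl
  | .eq e₁ e₂ => by
    rw [Assertion.replace]; split
    · next e => rw [h, ← e]
    · simp only [Assertion.sem, Expr.sem_replace h e₁, Expr.sem_replace h e₂]
  | .rel r e₁ e₂ => by
    rw [Assertion.replace]; split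
    · next e => rw [h, ← e]
    · simp only [Assertion.sem, Expr.sem_replace h e₁, Expr.sem_replace h e₂]
  | .and a b => by
    rw [Assertion.replace]; split
    · next e => rw [h, ← e]
    · simp only [Assertion.sem, Assertion.sem_replace h a, Assertion.sem_replace h b]
  | .not a => by
    rw [Assertion.replace]; split
    · next e => rw [h, ← e]
    · simp only [Assertion.sem, Assertion.sem_replace h a]
  | .hasType e c => by
    rw [Assertion.replace]; split
    · next e => rw [h, ← e]
    · simp only [Assertion.sem, Expr.sem_replace h e]
end

/-- The rules preserve truth in every single configuration, not merely validity. For `assume` and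
`assumeNot` the premise fixes the truth value of the replaced assertion. -/
theorem RuleA.sem_iff {a b : Assertion} (h : RuleA a b) : a.sem C ↔ b.sem C := by
  cases h with
  | refl e => simp [Assertion.sem]
  | merge ψ φ => simp only [Assertion.sem, Assertion.sem_imp]; tauto
  | assume ψ φ =>
    rw [Assertion.sem_imp, Assertion.sem_imp]
    exact forall_congr' fun hψ => (Assertion.sem_replace C (by simp [Assertion.sem, hψ]) φ).symm
  | assumeNot ψ φ =>
    rw [Assertion.sem_imp, Assertion.sem_imp]
    refine forall_congr' fun hψ => (Assertion.sem_replace C ?_ φ).symm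
    simp only [Assertion.sem] at hψ ⊢
    tauto
  | curry a b φ => simp only [Assertion.sem, Assertion.sem_imp]; tauto
  | test a =>
    simp only [Assertion.sem, boolExpr, Expr.sem]
    by_cases ha : a.sem C
    · simp only [ha, if_true, Option.some.injEq, not_true, iff_false]
      -- Distinctness of the constants `1` and `0` enters here.
      exact fun e => absurd (D.lit_injective e) (by decide)
    · simp [ha]
  | _ => simp [Assertion.sem]

mutual
theorem StepE.sem_eq : ∀ {a b : Expr}, StepE a b → a.sem C = b.sem C
  | _, _, .rule (.condTt _ _) => by simp [Expr.sem, Assertion.sem]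
  | _, _, .rule (.condFf _ _) => by simp [Expr.sem, Assertion.sem]
  | _, _, .field f h => by simp only [Expr.sem, StepE.sem_eq h]
  | _, _, .op₁ o d h => by simp only [Expr.sem, StepE.sem_eq h]
  | _, _, .op₂ o d h => by simp only [Expr.sem, StepE.sem_eq h]
  | _, _, .cond₀ d₁ d₂ h => by simp only [Expr.sem]; rw [propext (StepA.sem_iff h)]
  | _, _, .cond₁ a d h => by simp only [Expr.sem, StepE.sem_eq h]
  | _, _, .cond₂ a d h => by simp only [Expr.sem, StepE.sem_eq h]
  | _, _, .pair₁ d h => by simp only [Expr.sem, StepE.sem_eq h]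
  | _, _, .pair₂ d h => by simp only [Expr.sem, StepE.sem_eq h]
theorem StepA.sem_iff : ∀ {a b : Assertion}, StepA a b → (a.sem C ↔ b.sem C)
  | _, _, .rule h => h.sem_iff C
  | _, _, .eq₁ d h => by simp only [Assertion.sem, StepE.sem_eq h]
  | _, _, .eq₂ d h => by simp only [Assertion.sem, StepE.sem_eq h]
  | _, _, .rel₁ r d h => by simp only [Assertion.sem, StepE.sem_eq h]
  | _, _, .rel₂ r d h => by simp only [Assertion.sem, StepE.sem_eq h]
  | _, _, .and₁ b h => by simp only [Assertion.sem, StepA.sem_iff h]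
  | _, _, .and₂ b h => by simp only [Assertion.sem, StepA.sem_iff h]
  | _, _, .not h => by simp only [Assertion.sem, StepA.sem_iff h]
  | _, _, .hasType c h => by simp only [Assertion.sem, StepE.sem_eq h]
end

/-- The configuration with the logical variable `k` set to `o`. -/
def Config.setTmp (k : ℕ) (o : Option D.Val) : Config D :=
  { C with ghost := fun y => if y = .tmp k then o else C.ghost y }

theorem Subst.single_var {v x z : Expr} (hv : v.IsVar) :
    v.subst (.single x z) = if v = x then z else v := by
  cases v <;> first | exact False.elim hv | rfl

/-- The fresh variable is given the common value of `x` and `y`. A variable equal to one of them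
then keeps its value after replacement, and any other is unaffected because `k` does not occur in
it. -/
theorem Expr.sem_unify_var {x y v : Expr} {k : ℕ} (h : x.sem C = y.sem C) (hv : v.IsVar)
    (hk : k ∉ v.tmps) :
    ((v.subst (.single x (.ghost (.tmp k)))).subst (.single y (.ghost (.tmp k)))).sem
      (C.setTmp k (x.sem C)) = v.sem C := by
  have hz : ((Expr.ghost (.tmp k)).subst (.single y (.ghost (.tmp k)))).sem
      (C.setTmp k (x.sem C)) = x.sem C := by
    rw [Subst.single_var (v := .ghost (.tmp k)) trivial, ite_self]
    simp [Expr.sem, Config.setTmp]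
  rw [Subst.single_var hv]
  split
  · next e => rw [hz, e]
  · rw [Subst.single_var hv]
    split
    · next e => rw [e, ← h]; simp [Expr.sem, Config.setTmp]
    · cases v with
      | ghost u =>
        have : u ≠ .tmp k := by rintro rfl; simp [Expr.tmps] at hk
        simp [Expr.sem, Config.setTmp, this]
      | stack i => rfl
      | loc i => rfl
      | static c f => rfl
      | _ => exact False.elim hv

mutual
theorem Expr.sem_unify {x y : Expr} {k : ℕ} (h : x.sem C = y.sem C) : ∀ e : Expr, k ∉ e.tmps →
    ((e.subst (.single x (.ghost (.tmp k)))).subst (.single y (.ghost (.tmp k)))).sem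
      (C.setTmp k (x.sem C)) = e.sem C
  | .lit _, _ => rfl
  | .field e f, hk => by
    simp only [Expr.subst, Expr.sem, Expr.sem_unify h e (by simpa [Expr.tmps] using hk)]; rfl
  | .static c f, hk => Expr.sem_unify_var C h (v := .static c f) trivial hk
  | .stack i, hk => Expr.sem_unify_var C h (v := .stack i) trivial hk
  | .loc i, hk => Expr.sem_unify_var C h (v := .loc i) trivial hk
  | .ghost g, hk => Expr.sem_unify_var C h (v := .ghost g) trivial hk
  | .op o e₁ e₂, hk => by
    simp only [Expr.tmps, List.mem_append, not_or] at hk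
    simp only [Expr.subst, Expr.sem, Expr.sem_unify h e₁ hk.1, Expr.sem_unify h e₂ hk.2]
  | .cond a e₁ e₂, hk => by
    simp only [Expr.tmps, List.mem_append, not_or] at hk
    simp only [Expr.subst, Expr.sem, Expr.sem_unify h e₁ hk.1.2, Expr.sem_unify h e₂ hk.2]
    rw [propext (Assertion.sem_unify h a hk.1.1)]
  | .pair e₁ e₂, hk => by
    simp only [Expr.tmps, List.mem_append, not_or] at hk
    simp only [Expr.subst, Expr.sem, Expr.sem_unify h e₁ hk.1, Expr.sem_unify h e₂ hk.2]
  | .bot, _ => rfl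
theorem Assertion.sem_unify {x y : Expr} {k : ℕ} (h : x.sem C = y.sem C) :
    ∀ a : Assertion, k ∉ a.tmps →
    (((a.subst (.single x (.ghost (.tmp k)))).subst (.single y (.ghost (.tmp k)))).sem
      (C.setTmp k (x.sem C)) ↔ a.sem C)
  | .tt, _ => Iff.rfl
  | .ff, _ => Iff.rfl
  | .eq e₁ e₂, hk => by
    simp only [Assertion.tmps, List.mem_append, not_or] at hk
    simp only [Assertion.subst, Assertion.sem, Expr.sem_unify h e₁ hk.1, Expr.sem_unify h e₂ hk.2]
  | .rel r e₁ e₂, hk => by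
    simp only [Assertion.tmps, List.mem_append, not_or] at hk
    simp only [Assertion.subst, Assertion.sem, Expr.sem_unify h e₁ hk.1, Expr.sem_unify h e₂ hk.2]
  | .and a b, hk => by
    simp only [Assertion.tmps, List.mem_append, not_or] at hk
    simp only [Assertion.subst, Assertion.sem, Assertion.sem_unify h a hk.1,
      Assertion.sem_unify h b hk.2]
  | .not a, hk => by
    simp only [Assertion.tmps] at hk
    simp only [Assertion.subst, Assertion.sem, Assertion.sem_unify h a hk]
  | .hasType e c, hk => by
    simp only [Assertion.tmps] at hk
    simp only [Assertion.subst, Assertion.sem, Expr.sem_unify h e hk]; rfl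
end
end

/-- Steps inside a formula preserve truth pointwise. Unification does not: it transfers validity, by
evaluating the new formula in a configuration with a different value of the fresh variable. -/
theorem Rewrite.valid {P : Program} {φ φ' : Assertion} (h : Rewrite φ φ') (hv : Valid P φ') :
    Valid P φ := by
  intro D C hC
  cases h with
  | inside h => exact (h.sem_iff C).2 (hv D C hC)
  | unify x y k φ hx hy hk =>
    rw [Assertion.sem_imp]
    intro h
    have hk' : k ∉ φ.tmps := by
      simp only [Assertion.imp, Assertion.tmps, List.mem_append, not_or] at hk
      exact hk.2
    refine (Assertion.sem_unify C h φ hk').1 (hv D _ ?_)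
    -- Type safety does not constrain ghost variables, so any value of the logical variable is
    -- allowed.
    exact ⟨hC.typing_mono, hC.stack_ne, hC.loc_ne, hC.static_ne, hC.field_ne⟩

theorem RewritesIn.valid {P : Program} {n : ℕ} {φ : Assertion} (h : RewritesIn n φ .tt) :
    Valid P φ := by
  generalize e : Assertion.tt = ψ at h
  induction h with
  | zero φ => subst e; exact fun _ _ _ => trivial
  | succ h _ ih => exact h.valid (ih e)

/-! ### Bounded reachability -/

/-- `b` can be reached from `a` in at most `n` steps. -/
inductive Reach {α : Type} (R : α → α → Prop) : ℕ → α → α → Prop where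
  | refl (n : ℕ) (a : α) : Reach R n a a
  | step {n : ℕ} {a b c : α} : R a b → Reach R n b c → Reach R (n + 1) a c

namespace Reach
variable {α β : Type} {R : α → α → Prop} {R' : β → β → Prop} {m n : ℕ} {a b c : α}

theorem mono (h : Reach R m a b) : ∀ {n : ℕ}, m ≤ n → Reach R n a b := by
  induction h with
  | refl n a => intro n _; exact .refl _ _
  | step h _ ih =>
    intro n hn
    obtain ⟨k, rfl⟩ : ∃ k, n = k + 1 := ⟨n - 1, by omega⟩
    exact .step h (ih (by omega))

theorem trans (h : Reach R m a b) (h' : Reach R n b c) : Reach R (m + n) a c := by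
  induction h with
  | refl k a => exact h'.mono (by omega)
  | step h _ ih => exact (Reach.step h (ih h')).mono (by omega)

theorem single (h : R a b) : Reach R 1 a b := .step h (.refl 0 b)

theorem lift (f : α → β) (hf : ∀ {a b}, R a b → R' (f a) (f b)) (h : Reach R n a b) :
    Reach R' n (f a) (f b) := by
  induction h with
  | refl n a => exact .refl _ _
  | step h _ ih => exact .step (hf h) ih

end Reach

theorem Reach.rewritesIn {n : ℕ} {a b : Assertion} (h : Reach Rewrite n a b) :
    ∃ m ≤ n, RewritesIn m a b := by
  induction h with
  | refl n a => exact ⟨0, Nat.zero_le _, .zero _⟩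
  | step h _ ih =>
    obtain ⟨m, hm, h'⟩ := ih
    exact ⟨m + 1, by omega, .succ h h'⟩

abbrev ReachA := Reach StepA

section
variable {n : ℕ} {a b c : Assertion}

theorem Reach.rewrite (h : ReachA n a b) : Reach Rewrite n a b := h.lift (fun x => x) .inside

theorem Reach.andLeft (c : Assertion) (h : ReachA n a b) : ReachA n (.and a c) (.and b c) :=
  h.lift (R' := StepA) (fun x => Assertion.and x c) fun h => .and₁ c h
theorem Reach.andRight (c : Assertion) (h : ReachA n a b) : ReachA n (.and c a) (.and c b) :=
  h.lift (R' := StepA) (fun x => Assertion.and c x) fun h => .and₂ c h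
theorem Reach.impLeft (c : Assertion) (h : ReachA n a b) : ReachA n (.imp a c) (.imp b c) :=
  h.lift (R' := StepA) (fun x => Assertion.imp x c) fun h => .not (.and₁ _ h)
theorem Reach.impRight (c : Assertion) (h : ReachA n a b) : ReachA n (.imp c a) (.imp c b) :=
  h.lift (R' := StepA) (fun x => Assertion.imp c x) fun h => .not (.and₂ _ (.not h))
theorem Reach.not (h : ReachA n a b) : ReachA n (.not a) (.not b) := h.lift (R' := StepA) Assertion.not .not

theorem Reach.rule (h : RuleA a b) : ReachA 1 a b := .single (.rule h)

/-- Implication abbreviates `¬(a ∧ ¬b)`, and there is no rule for it at truth values; these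
evaluations are carried out on the expanded form, which explains the step counts. -/
theorem reach_imp_tt (a : Assertion) : ReachA 3 (.imp a .tt) .tt :=
  ((Reach.single (.not (.and₂ _ (.rule .notTt)))).trans (.single (.not (.rule (.andFf a))))).trans
    (.rule .notFf)
theorem reach_tt_imp (a : Assertion) : ReachA 2 (.imp .tt a) a :=
  (Reach.single (.not (.rule (.ttAnd _)))).trans (.rule (.notNot a))
theorem reach_ff_imp (a : Assertion) : ReachA 2 (.imp .ff a) .tt :=
  (Reach.single (.not (.rule (.ffAnd _)))).trans (.rule .notFf)

theorem replace_self (ψ w : Assertion) : Assertion.replace ψ w ψ = w := by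
  cases ψ <;> simp [Assertion.replace]

/-- The premise is assumed in the conclusion, where its one occurrence is the whole formula. -/
theorem reach_imp_self (a : Assertion) : ReachA 4 (.imp a a) .tt := by
  have h : ReachA 1 (.imp a a) (.imp a .tt) := by
    have := Reach.rule (.assume a a)
    rwa [replace_self] at this
  exact h.trans (reach_imp_tt a)

end

section
variable {ι : Type}

theorem Reach.conj (f g : ι → Assertion) {k : ℕ} (l : List ι) (h : ∀ x ∈ l, ReachA k (f x) (g x)) :
    ReachA (l.length * k) (.conj (l.map f)) (.conj (l.map g)) := by
  induction l with
  | nil => exact .refl _ _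
  | cons a l ih =>
    have ha := h a (by simp)
    cases l with
    | nil => simpa [Assertion.conj] using ha
    | cons b l =>
      have ih := ih fun x hx => h x (by simp [hx])
      simp only [List.map_cons, Assertion.conj] at ih ⊢
      refine ((ha.andLeft _).trans (ih.andRight _)).mono ?_
      simp only [List.length_cons]
      exact le_of_eq (by ring)

theorem reach_conj_tt (l : List ι) : ReachA l.length (.conj (l.map fun _ => .tt)) .tt := by
  induction l with
  | nil => exact .refl _ _
  | cons a l ih =>
    cases l with
    | nil => exact .refl _ _
    | cons b l =>
      simp only [List.map_cons, Assertion.conj] at ih ⊢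
      exact (Reach.rule (.ttAnd _)).trans ih |>.mono (by simp only [List.length_cons]; omega)

theorem reach_conj_refl (f : ι → Expr) (l : List ι) :
    ReachA (2 * l.length) (.conj (l.map fun x => .eq (f x) (f x))) .tt :=
  ((Reach.conj _ (fun _ => .tt) l fun x _ => .rule (.refl (f x))).trans (reach_conj_tt l)).mono
    (by omega)
end

/-! ### Formulas without conditional expressions -/

/-- Expressions without conditionals. -/
def Expr.Plain : Expr → Prop
  | .cond _ _ _ => False
  | .field e _ => e.Plain
  | .op _ e₁ e₂ => e₁.Plain ∧ e₂.Plain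
  | .pair e₁ e₂ => e₁.Plain ∧ e₂.Plain
  | _ => True

/-- Assertions without conditional expressions. -/
def Assertion.Plain : Assertion → Prop
  | .tt => True
  | .ff => True
  | .eq e₁ e₂ => e₁.Plain ∧ e₂.Plain
  | .rel _ e₁ e₂ => e₁.Plain ∧ e₂.Plain
  | .and a b => a.Plain ∧ b.Plain
  | .not a => a.Plain
  | .hasType e _ => e.Plain

/-- Assertions occur inside expressions only as conditions of conditionals, so there is nothing to
replace. -/
theorem Expr.Plain.replace_eq (ψ w : Assertion) {e : Expr} (h : e.Plain) : e.replace ψ w = e := by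
  induction e using Expr.rec (motive_2 := fun _ => True) with
  | field e f ih => simp only [Expr.replace, ih h]
  | op o e₁ e₂ ih₁ ih₂ => simp only [Expr.replace, ih₁ h.1, ih₂ h.2]
  | pair e₁ e₂ ih₁ ih₂ => simp only [Expr.replace, ih₁ h.1, ih₂ h.2]
  | cond a e₁ e₂ => exact h.elim
  | _ => trivial

theorem Assertion.Plain.replace {ψ w a : Assertion} (h : a.Plain) (hw : w.Plain) :
    (Assertion.replace ψ w a).Plain := by
  induction a using Assertion.rec (motive_1 := fun _ => True) with
  | tt => rw [Assertion.replace]; split <;> trivial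
  | ff => rw [Assertion.replace]; split <;> trivial
  | eq e₁ e₂ =>
    rw [Assertion.replace, h.1.replace_eq, h.2.replace_eq]; split
    exacts [hw, h]
  | rel r e₁ e₂ =>
    rw [Assertion.replace, h.1.replace_eq, h.2.replace_eq]; split
    exacts [hw, h]
  | and a b iha ihb =>
    rw [Assertion.replace]; split
    exacts [hw, ⟨iha h.1, ihb h.2⟩]
  | not a iha =>
    rw [Assertion.replace]; split
    exacts [hw, iha h]
  | hasType e c =>
    rw [Assertion.replace, Expr.Plain.replace_eq _ _ (e := e) h]; split
    exacts [hw, h]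
  | _ => trivial

section
variable {ψ : Assertion}

/-- A plain `ψ` cannot equal a formula that contains a conditional expression, so the replacement
passes through the top connective. -/
theorem replace_and (hψ : ψ.Plain) (w : Assertion) {a b : Assertion} (h : ¬ (a.Plain ∧ b.Plain)) :
    Assertion.replace ψ w (.and a b) = .and (Assertion.replace ψ w a) (Assertion.replace ψ w b) := by
  rw [Assertion.replace, if_neg]
  rintro rfl
  exact h hψ
theorem replace_not (hψ : ψ.Plain) (w : Assertion) {a : Assertion} (h : ¬ a.Plain) :
    Assertion.replace ψ w (.not a) = .not (Assertion.replace ψ w a) := by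
  rw [Assertion.replace, if_neg]
  rintro rfl
  exact h hψ
theorem replace_eq (hψ : ψ.Plain) (w : Assertion) {a b : Expr} (h : ¬ (a.Plain ∧ b.Plain)) :
    Assertion.replace ψ w (.eq a b) = .eq (a.replace ψ w) (b.replace ψ w) := by
  rw [Assertion.replace, if_neg]
  rintro rfl
  exact h hψ
end

/-! ### Decision trees -/

/-- Decision trees over assertions, with leaves labelled by updates. -/
inductive DTree (ρ : Type) where
  | leaf (r : ρ)
  | exit
  | test (g : Assertion) (no yes : DTree ρ)

theorem Expr.one_le_size (e : Expr) : 1 ≤ e.size := by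
  cases e <;> simp [Expr.size]

section
variable (a b c : Assertion)

/-- The rule `test` is applied to both copies of the condition. The first branch then belongs to the
negated test, in accordance with a jump on zero. -/
theorem reach_ite_test : ReachA 2 (.ite (.eq (boolExpr a) (.lit 0)) b c) (.ite (.not a) b c) :=
  (((Reach.rule (.test a)).impLeft b).andLeft _).trans
    ((((Reach.rule (.test a)).not).impLeft c).andRight _)

theorem reach_ite_cond {a a' : Assertion} {k : ℕ} (h : ReachA k a a') (b c : Assertion) :
    ReachA (k + k) (.ite a b c) (.ite a' b c) :=
  ((h.impLeft b).andLeft _).trans ((h.not.impLeft c).andRight _)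

theorem reach_ite_tt_cond : ReachA 6 (.ite .tt b c) b :=
  ((((reach_tt_imp b).andLeft _).trans ((((Reach.rule .notTt).impLeft c).trans
    (reach_ff_imp c)).andRight _)).trans (.rule (.andTt b))).mono (by omega)

theorem reach_ite_ff : ReachA 6 (.ite .ff b c) c :=
  ((((reach_ff_imp b).andLeft _).trans ((((Reach.rule .notFf).impLeft c).trans
    (reach_tt_imp c)).andRight _)).trans (.rule (.ttAnd c))).mono (by omega)
end

namespace DTree
variable {ρ : Type}

/-- The formula that branches on the tests of the tree, with `F r` at the leaves. -/
def formula (F : ρ → Assertion) : DTree ρ → Assertion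
  | leaf r => F r
  | exit => .tt
  | test g n y => .ite (.eq (boolExpr g) (.lit 0)) (n.formula F) (y.formula F)

/-- The conditional expression that branches on the tests of the tree. -/
def chain (V : ρ → Expr) : DTree ρ → Expr
  | leaf r => V r
  | exit => .bot
  | test g n y => .cond g (y.chain V) (n.chain V)

def mapTests (f : Assertion → Assertion) : DTree ρ → DTree ρ
  | leaf r => leaf r
  | exit => exit
  | test g n y => test (f g) (n.mapTests f) (y.mapTests f)

def PlainTests : DTree ρ → Prop
  | leaf _ => True
  | exit => True
  | test g n y => g.Plain ∧ n.PlainTests ∧ y.PlainTests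

/-- A measure for the number of rewrite steps. -/
def weight (s : ℕ) : DTree ρ → ℕ
  | leaf _ => 2 * s + 1
  | exit => 1
  | test _ n y => 12 + n.weight s + y.weight s

theorem weight_mapTests (s : ℕ) (f : Assertion → Assertion) (D : DTree ρ) :
    (D.mapTests f).weight s = D.weight s := by
  induction D <;> simp_all [mapTests, weight]

theorem PlainTests.mapTests {f : Assertion → Assertion} (hf : ∀ a : Assertion, a.Plain → (f a).Plain)
    {D : DTree ρ} (h : D.PlainTests) : (D.mapTests f).PlainTests := by
  induction D with
  | leaf r => trivial
  | exit => trivial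
  | test g n y ihn ihy => exact ⟨hf _ h.1, ihn h.2.1, ihy h.2.2⟩

/-- The leaf assertion: the components of the update agree with the expressions `cs`. -/
def leafEqs (S : List ℕ) (V : ℕ → ρ → Expr) (cs : ℕ → Expr) (r : ρ) : Assertion :=
  .conj (S.map fun x => .eq (V x r) (cs x))

theorem formula_reach {F G : ρ → Assertion} {s : ℕ} (h : ∀ r, ReachA (2 * s) (F r) (G r))
    (D : DTree ρ) :
    ReachA (D.weight s) (D.formula F) (D.formula G) := by
  induction D with
  | leaf r => exact (h r).mono (by simp [weight])
  | exit => exact .refl _ _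
  | test g n y ihn ihy =>
    exact (((ihn.impRight _).andLeft _).trans ((ihy.impRight _).andRight _)).mono
      (by simp only [weight]; omega)

theorem chain_replace {V : ρ → Expr} (hV : ∀ r, (V r).Plain) (ψ w : Assertion) (D : DTree ρ) :
    (D.chain V).replace ψ w = (D.mapTests (Assertion.replace ψ w)).chain V := by
  induction D with
  | leaf r => exact (hV r).replace_eq _ _
  | exit => rfl
  | test g n y ihn ihy => simp only [chain, mapTests, Expr.replace, ihn, ihy]

/-- Every equation has a conditional expression on its right-hand side and so differs from `ψ`; `ψ ≠
tt` takes care of the empty conjunction. Only the right-hand sides change, the left-hand sides being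
plain. -/
theorem leafEqs_replace {S : List ℕ} {V : ℕ → ρ → Expr} (hV : ∀ x r, (V x r).Plain) {cs : ℕ → Expr}
    (hcs : ∀ x, ¬ (cs x).Plain) {ψ : Assertion} (hψ : ψ.Plain) (hne : ψ ≠ .tt) (w : Assertion) (r : ρ) :
    Assertion.replace ψ w (leafEqs S V cs r) = leafEqs S V (fun x => (cs x).replace ψ w) r := by
  unfold leafEqs
  induction S with
  | nil => simp only [List.map_nil, Assertion.conj, Assertion.replace, if_neg hne.symm]
  | cons x S ih =>
    have hx : Assertion.replace ψ w (.eq (V x r) (cs x)) = .eq (V x r) ((cs x).replace ψ w) := by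
      rw [replace_eq hψ w fun h => hcs x h.2, (hV x r).replace_eq]
    cases S with
    | nil => exact hx
    | cons y S =>
      simp only [List.map_cons, Assertion.conj] at ih ⊢
      rw [replace_and hψ w fun h => hcs x (And.left h : Assertion.Plain (.eq _ _)).2, hx, ih]

theorem leafEqs_plain {S : List ℕ} {V : ℕ → ρ → Expr} {cs : ℕ → Expr}
    (hcs : ∀ x, ¬ (cs x).Plain) {r : ρ} (h : (leafEqs S V cs r).Plain) : leafEqs S V cs r = .tt := by
  unfold leafEqs at *
  cases S with
  | nil => rfl
  | cons x S =>
    cases S with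
    | nil => exact absurd (And.right h) (hcs x)
    | cons y S => exact absurd (And.left h : Assertion.Plain (.eq _ _)).2 (hcs x)

/-- A test contributes a conditional expression, so a plain formula comes from a tree without tests.
-/
theorem formula_plain {F : ρ → Assertion} (hF : ∀ r, (F r).Plain → F r = .tt) {D : DTree ρ}
    (h : (D.formula F).Plain) : D.formula F = .tt := by
  cases D with
  | leaf r => exact hF r h
  | exit => rfl
  | test g n y =>
    have h1 : (Assertion.imp (.eq (boolExpr g) (.lit 0)) (n.formula F)).Plain := And.left h
    have h2 : (Assertion.eq (boolExpr g) (.lit 0)).Plain := And.left h1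
    exact (And.left h2 : Expr.Plain (boolExpr g)).elim

/-- Only the tests and the leaves change. The two exclusions are necessary because `tt` is the
formula of `exit` and `¬tt` appears in the expansion of an implication with conclusion `tt`. -/
theorem formula_replace {F : ρ → Assertion} (hF : ∀ r, (F r).Plain → F r = .tt) {ψ : Assertion}
    (hψ : ψ.Plain) (hne : ψ ≠ .tt) (hne' : ψ ≠ .not .tt) (w : Assertion) (D : DTree ρ) :
    Assertion.replace ψ w (D.formula F) =
      (D.mapTests (Assertion.replace ψ w)).formula fun r => Assertion.replace ψ w (F r) := by
  induction D with
  | leaf r => rfl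
  | exit => simp only [formula, mapTests, Assertion.replace, if_neg hne.symm]
  | test g n y ihn ihy =>
    have hb : ¬ (Assertion.eq (boolExpr g) (.lit 0)).Plain := fun h =>
      (And.left h : Expr.Plain (boolExpr g)).elim
    have e : Assertion.replace ψ w (.eq (boolExpr g) (.lit 0)) =
        .eq (boolExpr (Assertion.replace ψ w g)) (.lit 0) := by
      rw [replace_eq hψ w fun h => (And.left h : Expr.Plain (boolExpr g)).elim]; rfl
    have key : ∀ (a : Assertion) (D : DTree ρ), ¬ a.Plain →
        Assertion.replace ψ w (.imp a (D.formula F)) =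
        .imp (Assertion.replace ψ w a) (Assertion.replace ψ w (D.formula F)) := by
      intro a D ha
      have h1 : ¬ (Assertion.and a (.not (D.formula F))).Plain := fun h => ha (And.left h)
      -- The negated conclusion is the one part of the implication's skeleton that may be plain, and
      -- then it is `¬tt`.
      have h2 : Assertion.not (D.formula F) ≠ ψ := by
        intro h
        rw [formula_plain hF (D := D) (by rw [← h] at hψ; exact hψ)] at h
        exact hne' h.symm
      rw [Assertion.imp, replace_not hψ w h1, replace_and hψ w fun h => ha h.1,
        Assertion.replace.eq_6, if_neg h2]
      rfl
    simp only [formula, mapTests, Assertion.ite]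
    have h3 : ¬ ((Assertion.imp (.eq (boolExpr g) (.lit 0)) (n.formula F)).Plain ∧
        (Assertion.imp (.not (.eq (boolExpr g) (.lit 0))) (y.formula F)).Plain) := fun h =>
      hb (And.left (show (Assertion.and (.eq (boolExpr g) (.lit 0)) (.not (n.formula F))).Plain from h.1))
    rw [replace_and hψ w h3, key _ n hb, key (.not (.eq (boolExpr g) (.lit 0))) y fun h => hb h, replace_not hψ w hb, e, ihn, ihy]

theorem leafEqs_reach {S : List ℕ} {V : ℕ → ρ → Expr} {cs cs' : ℕ → Expr} {k : ℕ}
    (h : ∀ x, Reach StepE k (cs x) (cs' x)) (r : ρ) :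
    ReachA (S.length * k) (leafEqs S V cs r) (leafEqs S V cs' r) :=
  Reach.conj _ _ S fun x _ => (h x).lift (R' := StepA) (fun e => .eq (V x r) e) (.eq₂ _)

/-- A formula whose leaves compare the updates with the conditional expressions of its own tree is
rewritten to `tt`. -/
theorem formula_reach_tt (S : List ℕ) {V : ℕ → ρ → Expr} (hV : ∀ x r, (V x r).Plain) :
    ∀ (k : ℕ) (D : DTree ρ), D.weight S.length ≤ k → D.PlainTests →
      ReachA ((D.weight S.length) ^ 2) (D.formula (leafEqs S V fun x => D.chain (V x))) .tt := by
  -- Induction is on the weight: assuming a test changes the tests below it, so the new subtree is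
  -- not a structural part of the old tree, but its weight is unchanged.
  intro k
  induction k with
  | zero => intro D hD; cases D <;> simp [weight] at hD
  | succ k ih =>
    intro D hD hp
    cases D with
    | leaf r =>
      exact (reach_conj_refl _ S).mono (by simp only [weight]; nlinarith)
    | exit => exact .refl _ _
    | test g n y =>
      obtain ⟨hg, hn, hy⟩ := hp
      simp only [weight] at hD
      set s := S.length with hs
      -- Once the root test is decided, the conditional expressions in the leaves reduce in at most
      -- two steps each to those of the subtree, and the induction hypothesis takes over. The weight
      -- pays for the reductions in all leaves.
      have branch : ∀ (D : DTree ρ) (cs : ℕ → Expr), D.PlainTests → D.weight s ≤ k →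
          (∀ x, Reach StepE 2 (cs x) (D.chain (V x))) →
          ReachA (D.weight s + (D.weight s) ^ 2) (D.formula (leafEqs S V cs)) .tt := by
        intro D cs hp hD h
        refine (formula_reach (s := s) (fun r => ?_) D).trans (ih D hD hp)
        exact (leafEqs_reach h r).mono (by rw [hs]; omega)
      have htest : ReachA 2 ((test g n y).formula (leafEqs S V fun x => (test g n y).chain (V x)))
          (.ite (.not g) (n.formula (leafEqs S V fun x => (test g n y).chain (V x)))
            (y.formula (leafEqs S V fun x => (test g n y).chain (V x)))) := reach_ite_test _ _ _
      -- The square of the total weight covers both subtrees, the reductions in their leaves and a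
      -- constant amount of work at the root.
      have bound : ∀ N Y : ℕ, 12 + N + N ^ 2 + Y + Y ^ 2 ≤ (12 + N + Y) ^ 2 := by
        intro N Y; nlinarith [Nat.zero_le (N * Y)]
      have hbound := bound (n.weight s) (y.weight s)
      have hfalse : ∀ x, Reach StepE 1 (.cond .ff (y.chain (V x)) (n.chain (V x))) (n.chain (V x)) :=
        fun x => .single (.rule (.condFf _ _))
      have htrue : ∀ x, Reach StepE 1 (.cond .tt (y.chain (V x)) (n.chain (V x))) (y.chain (V x)) :=
        fun x => .single (.rule (.condTt _ _))
      simp only [weight]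
      -- Replacing `tt` or `¬tt` could also hit the skeleton of the formula. These tests, and `ff`,
      -- are evaluated instead, which discards one branch at once.
      by_cases h1 : g = .tt
      · subst h1
        have h := branch y (fun x => (test .tt n y).chain (V x)) hy (by omega)
          fun x => (htrue x).mono (by omega)
        exact (((htest.trans (reach_ite_cond (.rule .notTt) _ _)).trans
          (reach_ite_ff _ _)).trans h).mono (by omega)
      by_cases h2 : g = .ff
      · subst h2
        have h := branch n (fun x => (test .ff n y).chain (V x)) hn (by omega)
          fun x => (hfalse x).mono (by omega)
        exact (((htest.trans (reach_ite_cond (.rule .notFf) _ _)).trans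
          (reach_ite_tt_cond _ _)).trans h).mono (by omega)
      by_cases h3 : g = .not .tt
      · subst h3
        have h := branch n (fun x => (test (.not .tt) n y).chain (V x)) hn (by omega)
          fun x => (Reach.single (StepE.cond₀ _ _ (.rule .notTt))).trans (hfalse x)
        exact (((htest.trans (reach_ite_cond (.rule (.notNot _)) _ _)).trans
          (reach_ite_tt_cond _ _)).trans h).mono (by omega)
      have hcs : ∀ x, ¬ ((test g n y).chain (V x)).Plain := fun x h => h
      -- One application of `assume` or `assumeNot` acts on the tests of the branch and, in all
      -- leaves, on the conditional expressions of the whole tree, whose root condition becomes the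
      -- truth value `w`.
      have hrep : ∀ (D : DTree ρ) (w : Assertion),
          Assertion.replace g w (D.formula (leafEqs S V fun x => (test g n y).chain (V x))) =
          (D.mapTests (Assertion.replace g w)).formula (leafEqs S V fun x =>
            .cond w ((y.mapTests (Assertion.replace g w)).chain (V x))
              ((n.mapTests (Assertion.replace g w)).chain (V x))) := by
        intro D w
        rw [formula_replace (fun r => leafEqs_plain hcs) hg h1 h3]
        congr 1
        funext r
        rw [leafEqs_replace hV hcs hg h1]
        congr 1
        funext x
        rw [chain_replace (hV x)]
        simp only [mapTests, chain, replace_self]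
      have hl := branch (n.mapTests (Assertion.replace g .ff)) (fun x =>
            .cond .ff ((y.mapTests (Assertion.replace g .ff)).chain (V x))
              ((n.mapTests (Assertion.replace g .ff)).chain (V x)))
          (hn.mapTests fun a ha => ha.replace (w := .ff) trivial) (by rw [weight_mapTests]; omega)
          fun x => (Reach.single (StepE.rule (.condFf _ _))).mono (by omega)
      have hr := branch (y.mapTests (Assertion.replace g .tt)) (fun x =>
            .cond .tt ((y.mapTests (Assertion.replace g .tt)).chain (V x))
              ((n.mapTests (Assertion.replace g .tt)).chain (V x)))
          (hy.mapTests fun a ha => ha.replace (w := .tt) trivial) (by rw [weight_mapTests]; omega)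
          fun x => (Reach.single (StepE.rule (.condTt _ _))).mono (by omega)
      rw [← hrep, weight_mapTests] at hl hr
      have hl' := ((Reach.rule (.assumeNot g (n.formula (leafEqs S V fun x =>
        (test g n y).chain (V x))))).trans (hl.impRight _)).trans (reach_imp_tt _)
      have hr' := ((Reach.rule (.assume g (y.formula (leafEqs S V fun x =>
        (test g n y).chain (V x))))).trans (hr.impRight _)).trans (reach_imp_tt _)
      exact (((htest.trans (hl'.andLeft _)).trans ((((Reach.rule (.notNot g)).impLeft _).trans
        hr').andRight _)).trans (.rule (.andTt .tt))).mono (by omega)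

/-- A test appears twice in its branching formula, with more than twelve symbols of its own, and a
leaf has at least two symbols per equation. The bound on steps thus becomes one in the number of
symbols. -/
theorem weight_le_size (S : List ℕ) (V : ℕ → ρ → Expr) (cs : ℕ → Expr) (D : DTree ρ) :
    D.weight S.length ≤ (D.formula (leafEqs S V cs)).size := by
  induction D with
  | leaf r =>
    simp only [weight, formula, leafEqs]
    induction S with
    | nil => simp [Assertion.conj, Assertion.size]
    | cons x S ih =>
      have h1 := Expr.one_le_size (V x r)
      have h2 := Expr.one_le_size (cs x)
      cases S with
      | nil => simp only [List.map_cons, List.map_nil, Assertion.conj, Assertion.size, List.length_cons,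
          List.length_nil]; omega
      | cons y S =>
        simp only [List.map_cons, Assertion.conj, Assertion.size, List.length_cons] at ih ⊢
        omega
  | exit => simp [weight, formula, Assertion.size]
  | test g n y ihn ihy =>
    simp only [weight, formula, Assertion.ite, Assertion.imp, boolExpr, Assertion.size, Expr.size]
    omega

end DTree

/-! ### Composition of substitutions, unification -/

theorem Assertion.conj_subst (σ : Subst) (l : List Assertion) :
    (Assertion.conj l).subst σ = .conj (l.map (Assertion.subst σ)) := by
  induction l with
  | nil => rfl
  | cons a l ih =>
    cases l with
    | nil => rfl
    | cons b l => simp only [Assertion.conj, List.map_cons, Assertion.subst, ih]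

/-- `σ` followed by `τ`. -/
def Subst.comp (σ τ : Subst) : Subst where
  stack i := (σ.stack i).subst τ
  loc i := (σ.loc i).subst τ
  static c f := (σ.static c f).subst τ
  ghost x := (σ.ghost x).subst τ

mutual
theorem Expr.subst_subst (σ τ : Subst) : ∀ e : Expr, (e.subst σ).subst τ = e.subst (σ.comp τ)
  | .lit _ => rfl
  | .field e f => by simp only [Expr.subst, Expr.subst_subst σ τ e]
  | .static _ _ => rfl
  | .stack _ => rfl
  | .loc _ => rfl
  | .ghost _ => rfl
  | .op o e₁ e₂ => by simp only [Expr.subst, Expr.subst_subst σ τ e₁, Expr.subst_subst σ τ e₂]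
  | .cond a e₁ e₂ => by
    simp only [Expr.subst, Expr.subst_subst σ τ e₁, Expr.subst_subst σ τ e₂, Assertion.subst_subst σ τ a]
  | .pair e₁ e₂ => by simp only [Expr.subst, Expr.subst_subst σ τ e₁, Expr.subst_subst σ τ e₂]
  | .bot => rfl
theorem Assertion.subst_subst (σ τ : Subst) :
    ∀ a : Assertion, (a.subst σ).subst τ = a.subst (σ.comp τ)
  | .tt => rfl
  | .ff => rfl
  | .eq e₁ e₂ => by simp only [Assertion.subst, Expr.subst_subst σ τ e₁, Expr.subst_subst σ τ e₂]
  | .rel r e₁ e₂ => by simp only [Assertion.subst, Expr.subst_subst σ τ e₁, Expr.subst_subst σ τ e₂]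
  | .and a b => by simp only [Assertion.subst, Assertion.subst_subst σ τ a, Assertion.subst_subst σ τ b]
  | .not a => by simp only [Assertion.subst, Assertion.subst_subst σ τ a]
  | .hasType e c => by simp only [Assertion.subst, Expr.subst_subst σ τ e]
end

mutual
theorem Expr.subst_id : ∀ e : Expr, e.subst {} = e
  | .lit _ => rfl
  | .field e f => by simp only [Expr.subst, Expr.subst_id e]
  | .static _ _ => rfl
  | .stack _ => rfl
  | .loc _ => rfl
  | .ghost _ => rfl
  | .op o e₁ e₂ => by simp only [Expr.subst, Expr.subst_id e₁, Expr.subst_id e₂]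
  | .cond a e₁ e₂ => by
    simp only [Expr.subst, Expr.subst_id e₁, Expr.subst_id e₂, Assertion.subst_id a]
  | .pair e₁ e₂ => by simp only [Expr.subst, Expr.subst_id e₁, Expr.subst_id e₂]
  | .bot => rfl
theorem Assertion.subst_id : ∀ a : Assertion, a.subst {} = a
  | .tt => rfl
  | .ff => rfl
  | .eq e₁ e₂ => by simp only [Assertion.subst, Expr.subst_id e₁, Expr.subst_id e₂]
  | .rel r e₁ e₂ => by simp only [Assertion.subst, Expr.subst_id e₁, Expr.subst_id e₂]
  | .and a b => by simp only [Assertion.subst, Assertion.subst_id a, Assertion.subst_id b]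
  | .not a => by simp only [Assertion.subst, Assertion.subst_id a]
  | .hasType e c => by simp only [Assertion.subst, Expr.subst_id e]
end

/-- Substitutions that map variables to variables. -/
def Subst.Renaming (σ : Subst) : Prop := ∀ e : Expr, e.IsVar → (e.subst σ).IsVar

theorem Subst.Renaming.comp {σ τ : Subst} (hσ : σ.Renaming) (hτ : τ.Renaming) : (σ.comp τ).Renaming := by
  intro e he
  rw [← Expr.subst_subst]
  exact hτ _ (hσ _ he)

theorem Subst.single_renaming (x : Expr) {z : Expr} (hz : z.IsVar) : (Subst.single x z).Renaming := by
  intro e he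
  rw [Subst.single_var he]
  split
  exacts [hz, he]

/-- Rewriting with a conjunction of equations between variables. -/
theorem unify_reach : ∀ (k : ℕ) (l : List (Expr × Expr)) (φ : Assertion), l.length = k →
    (∀ p ∈ l, p.1.IsVar ∧ p.2.IsVar) →
    ∃ τ : Subst, τ.Renaming ∧ (∀ p ∈ l, p.1.subst τ = p.2.subst τ) ∧
      Reach Rewrite (2 * k + 2) (.imp (.conj (l.map fun p => .eq p.1 p.2)) φ) (φ.subst τ) := by
  intro k
  induction k with
  | zero =>
    intro l φ hk hl
    rw [List.length_eq_zero_iff] at hk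
    subst hk
    refine ⟨{}, fun e he => by rwa [Expr.subst_id], by simp, ?_⟩
    rw [Assertion.subst_id]
    exact (reach_tt_imp φ).rewrite
  | succ k ih =>
    intro l φ hk hl
    obtain ⟨⟨x, y⟩, l, rfl⟩ := List.exists_cons_of_length_eq_add_one hk
    have hxy := hl (x, y) (by simp)
    dsimp only at hxy
    have hu : ∀ ψ : Assertion, ∃ z : Expr, z.IsVar ∧
        Rewrite (.imp (.eq x y) ψ) ((ψ.subst (.single x z)).subst (.single y z)) := by
      intro ψ
      -- A logical variable outside the finitely many that occur.
      obtain ⟨n, hn⟩ := Infinite.exists_notMem_finset (Assertion.imp (.eq x y) ψ).tmps.toFinset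
      exact ⟨.ghost (.tmp n), trivial, .unify x y n ψ hxy.1 hxy.2 (by simpa using hn)⟩
    -- After the two replacements both sides of the equation are `z`. The second replacement leaves
    -- `z` alone, even if `z` is `y`.
    have hs : ∀ z : Expr, z.IsVar → x.subst ((Subst.single x z).comp (.single y z)) =
        y.subst ((Subst.single x z).comp (.single y z)) := by
      intro z hz
      have hzz : z.subst (.single y z) = z := by rw [Subst.single_var hz, ite_self]
      rw [← Expr.subst_subst, ← Expr.subst_subst, Subst.single_var hxy.1, Subst.single_var hxy.2, if_pos rfl,
        hzz]
      split
      · rw [hzz]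
      · rw [Subst.single_var hxy.2, if_pos rfl]
    cases l with
    | nil =>
      obtain ⟨z, hz, h⟩ := hu φ
      refine ⟨(Subst.single x z).comp (.single y z),
        (Subst.single_renaming x hz).comp (Subst.single_renaming y hz), ?_, ?_⟩
      · simpa using hs z hz
      · rw [← Assertion.subst_subst]
        exact (Reach.single h).mono (by omega)
    | cons p l =>
      obtain ⟨z, hz, h⟩ := hu (.imp (.conj ((p :: l).map fun p => .eq p.1 p.2)) φ)
      set σ := (Subst.single x z).comp (.single y z) with hσ
      have hσr : σ.Renaming := (Subst.single_renaming x hz).comp (Subst.single_renaming y hz)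
      -- The remaining equations are affected by `σ` as well, which is why the induction is on their
      -- number. A renaming keeps them equations between variables.
      obtain ⟨τ, hτ, hτl, hr⟩ := ih ((p :: l).map fun p => (p.1.subst σ, p.2.subst σ)) (φ.subst σ)
        (by simpa using hk) (by
          intro q hq
          obtain ⟨q, hq', rfl⟩ := List.mem_map.1 hq
          exact ⟨hσr _ (hl q (List.mem_cons_of_mem _ hq')).1, hσr _ (hl q (List.mem_cons_of_mem _ hq')).2⟩)
      refine ⟨σ.comp τ, hσr.comp hτ, ?_, ?_⟩
      · intro q hq
        rw [← Expr.subst_subst σ τ q.1, ← Expr.subst_subst σ τ q.2]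
        rcases List.mem_cons.1 hq with rfl | hq
        · exact congrArg (Expr.subst τ) (hs z hz)
        · exact hτl (q.1.subst σ, q.2.subst σ) (List.mem_map.2 ⟨q, hq, rfl⟩)
      · rw [← Assertion.subst_subst]
        have e : ((Assertion.imp (.conj ((p :: l).map fun p => .eq p.1 p.2)) φ).subst (.single x z)).subst
            (.single y z) = .imp (.conj (((p :: l).map fun p => (p.1.subst σ, p.2.subst σ)).map
              fun p => .eq p.1 p.2)) (φ.subst σ) := by
          rw [Assertion.subst_subst]
          simp only [Assertion.imp, Assertion.subst, Assertion.conj_subst, List.map_map]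
          rfl
        rw [e] at h
        -- Currying isolates the first equation and unification consumes it: two steps per equation.
        exact ((Reach.single (.inside (.rule (.curry _ _ _)))).trans
          ((Reach.single h).trans hr)).mono (by omega)

/-! ### Substitutions as data -/

/-- Finite descriptions of substitutions: an association list for variables, and a mode for the
renumbering of the other stack positions. -/
abbrev SubstData := List (Expr × Expr) × ℕ

/-- The renumbering of stack positions: unchanged, one or two pops, or a push. -/
def shiftIndex (mode i : ℕ) : ℕ :=
  bif teq mode 0 then i else bif teq mode 1 then i + 1 else bif teq mode 2 then i + 2 else i - 1

/-- Listed variables take precedence over renumbering. For pushes position `0` is always listed, so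
the truncated predecessor of `0` is never used. -/
def SubstData.toSubst (d : SubstData) : Subst where
  stack i := (d.1.lookup (.stack i)).getD (.stack (shiftIndex d.2 i))
  loc i := (d.1.lookup (.loc i)).getD (.loc i)
  static c f := (d.1.lookup (.static c f)).getD (.static c f)
  ghost x := (d.1.lookup (.ghost x)).getD (.ghost x)

theorem mem_of_lookup {α β : Type} [DecidableEq α] {k : α} {b : β} {l : List (α × β)}
    (h : l.lookup k = some b) : (k, b) ∈ l := by
  induction l with
  | nil => simp at h
  | cons p l ih =>
    rw [List.lookup_cons] at h
    by_cases e : k = p.1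
    · simp [e] at h; simp [← h, e]
    · have : (k == p.1) = false := by simpa using e
      rw [this] at h
      exact List.mem_cons_of_mem _ (ih h)

theorem lookup_map {α β α' β' : Type} [DecidableEq α] [DecidableEq α'] {f : α → α'}
    (hf : Function.Injective f) (g : β → β') (k : α) (l : List (α × β)) :
    (l.map fun p => (f p.1, g p.2)).lookup (f k) = (l.lookup k).map g := by
  induction l with
  | nil => rfl
  | cons p l ih =>
    rw [List.map_cons, List.lookup_cons, List.lookup_cons, ih]
    by_cases e : k = p.1
    · simp [e]
    · have h1 : (k == p.1) = false := by simpa using e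
      have h2 : (f k == f p.1) = false := by simpa using hf.ne e
      simp only [h1, h2]

theorem lookup_eq_none {α β : Type} [DecidableEq α] {k : α} {l : List (α × β)}
    (h : ∀ p ∈ l, p.1 ≠ k) : l.lookup k = none := by
  cases e : l.lookup k with
  | none => rfl
  | some b => exact absurd rfl (h _ (mem_of_lookup e))

theorem lookup_append {α β : Type} [DecidableEq α] (k : α) (l m : List (α × β)) :
    (l ++ m).lookup k = (l.lookup k).or (m.lookup k) := by
  induction l with
  | nil => simp
  | cons p l ih =>
    rw [List.cons_append, List.lookup_cons, List.lookup_cons, ih]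
    cases k == p.1 <;> simp

/-- The substitution of a ghost update. -/
def ghostData (u : GhostUpdate) : SubstData := (u.map fun p => (.ghost p.1, p.2), 0)

theorem ghostData_toSubst (u : GhostUpdate) :
    (ghostData u).toSubst = { ghost := fun x => (u.lookup x).getD (.ghost x) } := by
  have h : ∀ e : Expr, (∀ x, e ≠ .ghost x) → (ghostData u).1.lookup e = none := fun e he =>
    lookup_eq_none fun p hp => by
      obtain ⟨q, _, rfl⟩ := List.mem_map.1 hp
      exact (he _).symm
  unfold SubstData.toSubst
  simp only [Subst.mk.injEq]
  refine ⟨?_, ?_, ?_, ?_⟩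
  · funext i; rw [h _ (by simp)]; rfl
  · funext i; rw [h _ (by simp)]; rfl
  · funext c f; rw [h _ (by simp)]; rfl
  · funext x
    have := lookup_map (f := Expr.ghost) (fun _ _ h => Expr.ghost.inj h) (fun e : Expr => e) x u
    rw [ghostData, this, Option.map_id']

/-- The weakest precondition of at most two ghost updates. -/
def ghostWpPair (us : List GhostUpdate) (φ : Assertion) : Assertion :=
  (φ.subst (ghostData (us.tail.headD [])).toSubst).subst (ghostData (us.headD [])).toSubst

theorem ghostData_nil_toSubst : (ghostData []).toSubst = {} := by
  rw [ghostData_toSubst]; rfl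

/-- A single substitution can multiply the size of an assertion by the size of the update.
Restricting the number of updates at a position to two, which the checker verifies, keeps the
computation polynomial. -/
theorem ghostWpPair_eq {us : List GhostUpdate} (h : us.tail.tail.isEmpty = true) (φ : Assertion) :
    ghostWpPair us φ = ghostWp us φ := by
  unfold ghostWpPair ghostWp
  match us, h with
  | [], _ =>
    simp only [List.tail_nil, List.headD_nil, ghostData_nil_toSubst, Assertion.subst_id]; rfl
  | [u], _ =>
    simp only [List.tail_cons, List.headD_nil, List.headD_cons, ghostData_nil_toSubst,
      Assertion.subst_id]
    rw [ghostData_toSubst]; rfl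
  | [u, v], _ =>
    simp only [List.tail_cons, List.headD_cons, ghostData_toSubst, List.foldr]

/-- The substitutions of the instructions whose only successor is the next position. -/
def Instr.data : Instr → Option SubstData
  | .instanceof c => some ([(.stack 0, boolExpr (.hasType (.stack 0) c))], 0)
  | .aload n => some ([(.stack 0, .loc n)], 3)
  | .astore n => some ([(.loc n, .stack 0)], 1)
  | .dup => some ([(.stack 0, .stack 0)], 3)
  | .getfield f => some ([(.stack 0, .field (.stack 0) f)], 0)
  | .getstatic c f => some ([(.stack 0, .static c f)], 3)
  | .putstatic c f => some ([(.static c f, .stack 0)], 1)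
  | .iconst n => some ([(.stack 0, .lit n)], 3)
  | .ldc v => some ([(.stack 0, .lit v)], 3)
  | .evalGuard g => some ([(.stack 0, boolExpr g)], 3)
  | .execUpdate u => some (u.map fun p => (.static monitorClass p.1, p.2), 0)
  | _ => none

theorem toSubst_push (e : Expr) :
    SubstData.toSubst ([(.stack 0, e)], 3) = { stack := pushStack e } := by
  unfold SubstData.toSubst
  simp only [Subst.mk.injEq]
  refine ⟨?_, ?_, ?_, ?_⟩
  · funext i
    cases i with
    | zero => simp [pushStack]
    | succ i =>
      have : (Expr.stack (i + 1) == Expr.stack 0) = false := by simp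
      simp [List.lookup_cons, this, pushStack, shiftIndex, teq]
  · funext i; rfl
  · funext c f; rfl
  · funext x; rfl

theorem toSubst_replaceTop (e : Expr) :
    SubstData.toSubst ([(.stack 0, e)], 0) = { stack := replaceTop e } := by
  unfold SubstData.toSubst
  simp only [Subst.mk.injEq]
  refine ⟨?_, ?_, ?_, ?_⟩
  · funext i
    cases i with
    | zero => simp [replaceTop]
    | succ i =>
      have : (Expr.stack (i + 1) == Expr.stack 0) = false := by simp
      simp [List.lookup_cons, this, replaceTop, shiftIndex, teq]
  · funext i; rfl
  · funext c f; rfl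
  · funext x; rfl

theorem toSubst_astore (n : ℕ) : SubstData.toSubst ([(.loc n, .stack 0)], 1) =
    { stack := popStack 1, loc := fun i => if i = n then .stack 0 else .loc i } := by
  unfold SubstData.toSubst
  simp only [Subst.mk.injEq]
  refine ⟨?_, ?_, ?_, ?_⟩
  · funext i; rfl
  · funext i
    by_cases h : i = n
    · simp [h]
    · have : (Expr.loc i == Expr.loc n) = false := by simpa using h
      simp [List.lookup_cons, this, h]
  · funext c f; rfl
  · funext x; rfl

theorem toSubst_putstatic (c f : ℕ) : SubstData.toSubst ([(.static c f, .stack 0)], 1) =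
    { stack := popStack 1,
      static := fun c' f' => if (c', f') = (c, f) then .stack 0 else .static c' f' } := by
  unfold SubstData.toSubst
  simp only [Subst.mk.injEq]
  refine ⟨?_, ?_, ?_, ?_⟩
  · funext i; rfl
  · funext i; rfl
  · funext c' f'
    by_cases h : (c', f') = (c, f)
    · cases h; simp
    · have h' : ¬ (c' = c ∧ f' = f) := by simpa using h
      have : (Expr.static c' f' == Expr.static c f) = false := by simpa using h'
      simp [List.lookup_cons, this, h']
  · funext x; rfl

theorem toSubst_exec (u : List (ℕ × Expr)) :
    SubstData.toSubst (u.map fun p => (.static monitorClass p.1, p.2), 0) =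
      { static := fun c f =>
          if c = monitorClass then (u.lookup f).getD (.static c f) else .static c f } := by
  have h : ∀ e : Expr, (∀ f, e ≠ .static monitorClass f) →
      (u.map fun p => (Expr.static monitorClass p.1, p.2)).lookup e = none := fun e he =>
    lookup_eq_none fun p hp => by
      obtain ⟨q, _, rfl⟩ := List.mem_map.1 hp
      exact (he _).symm
  unfold SubstData.toSubst
  simp only [Subst.mk.injEq]
  refine ⟨?_, ?_, ?_, ?_⟩
  · funext i; rw [h _ (by simp)]; rfl
  · funext i; rw [h _ (by simp)]; rfl
  · funext c f
    split
    · next hc =>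
      subst hc
      have := lookup_map (f := Expr.static monitorClass) (fun _ _ h => (Expr.static.inj h).2)
        (fun e : Expr => e) f u
      rw [this, Option.map_id']
    · next hc => rw [h _ (by simpa using fun h => absurd h hc)]; rfl
  · funext x; rw [h _ (by simp)]; rfl

theorem toSubst_pop (k : ℕ) (hk : k = 1 ∨ k = 2) : SubstData.toSubst ([], k) = { stack := popStack k } := by
  rcases hk with rfl | rfl <;> rfl

/-- All straight-line instructions are treated uniformly through a finite description of their
substitution. -/
theorem wpInstr_data {ι : Instr} {d : SubstData} (h : ι.data = some d) (P : Program)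
    (pre : ℕ → ℕ → ℕ → Assertion) (post : Assertion) (H : List Handler) (A : ℕ → Assertion) (L : ℕ) :
    wpInstr P pre post H A L ι = (A (L + 1)).subst d.toSubst := by
  cases ι <;> simp only [Instr.data, reduceCtorEq, Option.some.injEq] at h <;> subst h <;>
    simp only [wpInstr, toSubst_push, toSubst_replaceTop, toSubst_astore, toSubst_putstatic,
      toSubst_exec]

/-! ### The expected verification conditions of inlined blocks -/

/-- The formula that tries the clauses in turn. -/
def clauseFormula (G : CGuard → Assertion) (F : List (ℕ × CExpr) → Assertion) :
    List Clause → Assertion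
  | [] => .tt
  | cl :: l => .ite (.eq (boolExpr (G cl.guard)) (.lit 0)) (clauseFormula G F l) (F cl.update)

/-- The formula that dispatches on the class of the target and tries the clauses for that class. -/
def eventFormula (t : Expr) (G : CGuard → Assertion) (F : List (ℕ × CExpr) → Assertion) :
    List (ℕ × Option (List Clause)) → Assertion
  | [] => F []
  | p :: l => .ite (.eq (boolExpr (.hasType t p.1)) (.lit 0)) (eventFormula t G F l)
    (p.2.elim (F []) (clauseFormula G F))

/-- The common skeleton of inlined code and ghost update. The tree ends in `exit` if no guard holds,
where the code calls System.exit and the ghost state becomes `⊥`. -/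
def clauseTree (G : CGuard → Assertion) : List Clause → DTree (List (ℕ × CExpr))
  | [] => .exit
  | cl :: l => .test (G cl.guard) (clauseTree G l) (.leaf cl.update)

def eventTree (t : Expr) (G : CGuard → Assertion) :
    List (ℕ × Option (List Clause)) → DTree (List (ℕ × CExpr))
  | [] => .leaf []
  | p :: l => .test (.hasType t p.1) (eventTree t G l) (p.2.elim (.leaf []) (clauseTree G))

theorem clauseTree_formula (G : CGuard → Assertion) (F : List (ℕ × CExpr) → Assertion)
    (l : List Clause) : (clauseTree G l).formula F = clauseFormula G F l := by
  induction l with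
  | nil => rfl
  | cons cl l ih => simp only [clauseTree, DTree.formula, clauseFormula, ih]

theorem eventTree_formula (t : Expr) (G : CGuard → Assertion) (F : List (ℕ × CExpr) → Assertion)
    (l : List (ℕ × Option (List Clause))) : (eventTree t G l).formula F = eventFormula t G F l := by
  induction l with
  | nil => rfl
  | cons p l ih =>
    obtain ⟨d, o⟩ := p
    cases o <;> simp only [eventTree, DTree.formula, eventFormula, ih, Option.elim, clauseTree_formula]

theorem clauseFormula_subst (G : CGuard → Assertion) (F : List (ℕ × CExpr) → Assertion) (σ : Subst)
    (l : List Clause) : (clauseFormula G F l).subst σ =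
      clauseFormula (fun g => (G g).subst σ) (fun u => (F u).subst σ) l := by
  induction l with
  | nil => rfl
  | cons cl l ih =>
    simp only [clauseFormula, Assertion.ite, Assertion.imp, Assertion.subst, boolExpr, Expr.subst, ih]

theorem eventFormula_subst (t : Expr) (G : CGuard → Assertion) (F : List (ℕ × CExpr) → Assertion)
    (σ : Subst) (l : List (ℕ × Option (List Clause))) : (eventFormula t G F l).subst σ =
      eventFormula (t.subst σ) (fun g => (G g).subst σ) (fun u => (F u).subst σ) l := by
  induction l with
  | nil => rfl
  | cons p l ih =>
    obtain ⟨d, o⟩ := p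
    cases o <;> simp only [eventFormula, Assertion.ite, Assertion.imp, Assertion.subst, boolExpr,
      Expr.subst, ih, Option.elim, clauseFormula_subst]

/-- The value of `x` after the update `u`, in terms of the ghost monitor's places. -/
def updValue (u : List (ℕ × CExpr)) (x : ℕ) : Expr := ((u.lookup x).getD (.state x)).inst ghostPlaces

/-- The value of `x` after the ghost update for an event. -/
def stepValue (K : Contract) (l : List (ℕ × Option (List Clause))) (x : ℕ) : Expr :=
  ((ghostStep K l).lookup (.ms x)).getD (.ghost (.ms x))

/-- The leaf of the expected formula: the monitor states agree after the update `u`. -/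
def leafFormula (K : Contract) (l : List (ℕ × Option (List Clause))) (θ η : SubstData)
    (u : List (ℕ × CExpr)) : Assertion :=
  .conj (K.state.map fun x => .eq ((updValue u x).subst θ.toSubst) ((stepValue K l x).subst η.toSubst))

/-- The weakest precondition of the inlined code for an event, where `θ` gives the places of the
inlined monitor and `η` those of the ghost monitor. -/
def expectedFormula (K : Contract) (l : List (ℕ × Option (List Clause))) (θ η : SubstData)
    (extra : Option Assertion) : Assertion :=
  eventFormula ((Expr.ghost .target).subst θ.toSubst) (fun g => (g.inst ghostPlaces).subst θ.toSubst)
    (fun u => extra.elim (leafFormula K l θ η u) (.and (leafFormula K l θ η u))) l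

/-- This and the next lists send the places of the ghost monitor to those of the inlined one: state
to static fields, saved target and arguments to stack positions before the call and to locals after
it. -/
def stateData (K : Contract) : List (Expr × Expr) :=
  K.state.map fun x => (.ghost (.ms x), .static monitorClass x)

/-- Argument `j` lies at stack position `n - 1 - j`. Zipping with the reversed range produces these
pairs without a subtraction of two variable numbers, which is convenient for the running time. -/
def argPairs (n : ℕ) : List (ℕ × ℕ) := (List.range n).zip (List.range n).reverse

def stackData (n : ℕ) : List (Expr × Expr) :=
  (.ghost .target, .stack n) :: (argPairs n).map fun p => (.ghost (.arg p.1), .stack p.2)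

def localData (v n : ℕ) : List (Expr × Expr) :=
  (.ghost .target, .loc v) ::
    ((List.range n).zip (List.range' (v + 2) n)).map fun p => (.ghost (.arg p.1), .loc p.2)

/-- What remains of the agreement of stored and saved arguments at the beginning of the block. -/
def trivialEqs (n : ℕ) : Assertion :=
  .conj ((n :: (argPairs n).map Prod.snd).map fun i => .eq (.stack i) (.stack i))

/-- The tests for the verification conditions at the beginning of the block for a call, and behind the
call. -/
def callTest (P : Program) (K : Contract) (a w : Assertion) (k c m n : ℕ) : Bool :=
  (teq a (monitorInvariant K) &&
    teq w (expectedFormula K (eventClauses P K MethodSpec.before c m n)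
      (stateData K ++ stackData n, 0) (stackData n, 0) (some (trivialEqs n)))) ||
  -- The handler begins with `aload v`, so here `k` is the local that holds the target.
  (teq a (callInvariant K k n) &&
    teq w (expectedFormula K (eventClauses P K MethodSpec.exceptional c m n)
      (stateData K ++ localData k n, 0) ([], 0) none)) ||
  -- Behind the call stands `astore (v + 1)`, so `k - 1` is the local that holds the target.
  (teq a (callInvariant K (k - 1) n) &&
    teq w (expectedFormula K (eventClauses P K MethodSpec.after c m n)
      ((.ghost .result, .stack 0) :: (stateData K ++ localData (k - 1) n), 0)
      ([(.ghost .result, .stack 0)], 0) none))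

/-- The test does not locate the block to which a position belongs: a match with any call of the
method is enough for the condition to be rewritten to `tt`. -/
def blockTest (P : Program) (K : Contract) (code : List Instr) (a w : Assertion) (k : ℕ) : Bool :=
  code.any fun ι => match ι with
    | .invoke c m n => callTest P K a w k c m n
    | _ => false

def dataTest (P : Program) (K : Contract) (code : List Instr) (us : List GhostUpdate) (a a' : Assertion)
    (d : SubstData) (k : ℕ) : Bool :=
  teq a (ghostWpPair us (a'.subst d.toSubst)) ||
    blockTest P K code a (ghostWpPair us (a'.subst d.toSubst)) k

/-- The first alternative is for computed annotations, the second for conditional jumps of the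
client, where both branches carry the same assertion and case merging applies. -/
def branchTest (us : List GhostUpdate) (a a₁ a₂ : Assertion) (c : Assertion) (k : ℕ) : Bool :=
  teq a (.ite c (ghostWpPair us (a₁.subst (SubstData.toSubst ([], k))))
      (ghostWpPair us (a₂.subst (SubstData.toSubst ([], k))))) ||
    (teq a (ghostWpPair us (a₁.subst (SubstData.toSubst ([], k)))) &&
      teq a (ghostWpPair us (a₂.subst (SubstData.toSubst ([], k)))))

/-- The first conjunct. -/
def Assertion.left : Assertion → Assertion
  | .and a _ => a
  | a => a

/-- The test for the verification condition of the instruction `ι` at `L`, where `us` are the ghost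
updates before it. -/
def instrTest (P : Program) (K : Contract) (M : Method) (A : List Assertion) (us : List GhostUpdate)
    (L : ℕ) : Instr → Bool
  | .goto L' => teq (A.getD L .ff) (ghostWpPair us (A.getD L' .ff))
  | .ret => teq (A.getD L .ff) (ghostWpPair us (monitorInvariant K))
  | .exit => true
  | .ifeq L' => branchTest us (A.getD L .ff) (A.getD L' .ff) (A.getD (L + 1) .ff)
      (.eq (.stack 0) (.lit 0)) 1
  | .ificmpeq L' => branchTest us (A.getD L .ff) (A.getD L' .ff) (A.getD (L + 1) .ff)
      (.eq (.stack 0) (.stack 1)) 2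
  | .athrow => us.isEmpty && teq (A.getD L .ff) (monitorInvariant K) &&
      M.handlers.all fun h => !h.covers L || teq (A.getD h.target .ff) (monitorInvariant K)
  -- The second alternative is for inlined calls, annotated with a conjunction taken back through
  -- the ghost updates. Its first conjunct is the monitor invariant taken back.
  | .invoke _ _ _ => teq (A.getD L .ff) (ghostWpPair us (monitorInvariant K)) ||
      teq (A.getD L .ff).left (ghostWpPair us (monitorInvariant K))
  | .aload n => dataTest P K M.code us (A.getD L .ff) (A.getD (L + 1) .ff) ([(.stack 0, .loc n)], 3) n
  | .astore n => dataTest P K M.code us (A.getD L .ff) (A.getD (L + 1) .ff) ([(.loc n, .stack 0)], 1) n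
  | .instanceof c => dataTest P K M.code us (A.getD L .ff) (A.getD (L + 1) .ff)
      ([(.stack 0, boolExpr (.hasType (.stack 0) c))], 0) 0
  | .dup => dataTest P K M.code us (A.getD L .ff) (A.getD (L + 1) .ff) ([(.stack 0, .stack 0)], 3) 0
  | .getfield f => dataTest P K M.code us (A.getD L .ff) (A.getD (L + 1) .ff)
      ([(.stack 0, .field (.stack 0) f)], 0) 0
  | .getstatic c f => dataTest P K M.code us (A.getD L .ff) (A.getD (L + 1) .ff)
      ([(.stack 0, .static c f)], 3) 0
  | .putstatic c f => dataTest P K M.code us (A.getD L .ff) (A.getD (L + 1) .ff)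
      ([(.static c f, .stack 0)], 1) 0
  | .iconst n => dataTest P K M.code us (A.getD L .ff) (A.getD (L + 1) .ff) ([(.stack 0, .lit n)], 3) 0
  | .ldc v => dataTest P K M.code us (A.getD L .ff) (A.getD (L + 1) .ff) ([(.stack 0, .lit v)], 3) 0
  | .evalGuard g => dataTest P K M.code us (A.getD L .ff) (A.getD (L + 1) .ff)
      ([(.stack 0, boolExpr g)], 3) 0
  | .execUpdate u => dataTest P K M.code us (A.getD L .ff) (A.getD (L + 1) .ff)
      (u.map fun p => (.static monitorClass p.1, p.2), 0) 0

def embedTest (P : Program) (K : Contract) (M : Method) : Bool :=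
  M.code.zipIdx.all fun q => match q.1 with
    | .invoke c m n => !relevant P K c m n || (firstHandler M.handlers q.2).elim false fun h =>
        teq h.b q.2 && teq h.e (q.2 + 1) && teq h.cls throwable &&
          teq (M.handlers.filter fun h' => teq h'.target h.target).length 1
    | _ => true

def methodTest (P : Program) (K : Contract) (M : Method) (A : List Assertion) : Bool :=
  embedTest P K M && teq A.length M.code.length && teq (A.getD 0 .ff) (monitorInvariant K) &&
    M.code.zipIdx.all fun q => (ghostsAt P K M.code M.handlers q.2).tail.tail.isEmpty &&
      instrTest P K M A (ghostsAt P K M.code M.handlers q.2) q.2 q.1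

/-- The checker. -/
def Bundle.check (B : Bundle) : Bool :=
  teq B.proof.length B.prog.methods.length &&
    (B.prog.methods.zip B.proof).all fun q => methodTest B.prog B.contract q.1 q.2

/-! ### Rewriting of the expected formulas -/

/-- Instantiated with the ghost monitor's places, a contract expression contains no variables other
than ghost variables. -/
theorem CExpr.inst_subst_congr {σ τ : Subst} (h : ∀ x, σ.ghost x = τ.ghost x) (e : CExpr) :
    (e.inst ghostPlaces).subst σ = (e.inst ghostPlaces).subst τ := by
  induction e <;> simp_all [CExpr.inst, Expr.subst, ghostPlaces]

theorem CGuard.inst_subst_congr {σ τ : Subst} (h : ∀ x, σ.ghost x = τ.ghost x) (g : CGuard) :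
    (g.inst ghostPlaces).subst σ = (g.inst ghostPlaces).subst τ := by
  induction g <;> simp_all [CGuard.inst, Assertion.subst, CExpr.inst_subst_congr h]

theorem Expr.IsVar.plain {e : Expr} (h : e.IsVar) : e.Plain := by
  cases e <;> first | exact False.elim h | trivial

/-- The contract language has no conditional expressions. This is the source of the plainness
required of tests and leaves of decision trees. -/
theorem CExpr.inst_subst_plain {σ : Subst} (h : ∀ x, (σ.ghost x).IsVar) (e : CExpr) :
    ((e.inst ghostPlaces).subst σ).Plain := by
  induction e <;> simp_all [CExpr.inst, Expr.subst, ghostPlaces, Expr.Plain, Expr.IsVar.plain]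

theorem CGuard.inst_subst_plain {σ : Subst} (h : ∀ x, (σ.ghost x).IsVar) (g : CGuard) :
    ((g.inst ghostPlaces).subst σ).Plain := by
  induction g <;>
    simp_all [CGuard.inst, Assertion.subst, Assertion.Plain, CExpr.inst_subst_plain h]

theorem clauseTree_plain {G : CGuard → Assertion} (hG : ∀ g, (G g).Plain) (l : List Clause) :
    (clauseTree G l).PlainTests := by
  induction l with
  | nil => trivial
  | cons cl l ih => exact ⟨hG _, ih, trivial⟩

theorem eventTree_plain {t : Expr} (ht : t.Plain) {G : CGuard → Assertion} (hG : ∀ g, (G g).Plain)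
    (l : List (ℕ × Option (List Clause))) : (eventTree t G l).PlainTests := by
  induction l with
  | nil => trivial
  | cons p l ih =>
    obtain ⟨d, o⟩ := p
    refine ⟨ht, ih, ?_⟩
    cases o
    exacts [trivial, clauseTree_plain hG _]

/-- The ghost update is the clause tree read as a conditional expression, whose leaves are the
values after the respective update. -/
theorem ghostDelta_subst (σ : Subst) (x : ℕ) (l : List Clause) : (ghostDelta x l).subst σ =
    (clauseTree (fun g => (g.inst ghostPlaces).subst σ) l).chain fun u => (updValue u x).subst σ := by
  induction l with
  | nil => rfl
  | cons cl l ih =>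
    have e : ghostDelta x (cl :: l) = .cond (cl.guard.inst ghostPlaces) (updValue cl.update x)
      (ghostDelta x l) := rfl
    rw [e, Expr.subst, ih]; rfl

/-- The value of `x` after the ghost update for an event with clauses `l`. -/
def eventValue (x : ℕ) : List (ℕ × Option (List Clause)) → Expr
  | [] => .ghost (.ms x)
  | p :: l => .cond (.hasType (.ghost .target) p.1) (p.2.elim (.ghost (.ms x)) (ghostDelta x))
      (eventValue x l)

theorem ghostStep_eq (K : Contract) (l : List (ℕ × Option (List Clause))) :
    ghostStep K l = K.state.map fun x => (.ms x, eventValue x l) := by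
  unfold ghostStep
  refine List.map_congr_left fun x _ => ?_
  congr 1
  induction l with
  | nil => rfl
  | cons p l ih =>
    obtain ⟨d, o⟩ := p
    rw [List.foldr_cons, ih]
    cases o <;> rfl

/-- If a state variable is declared twice, its entries in the update agree, so it does not matter
which one is found. -/
theorem stepValue_eq {K : Contract} {x : ℕ} (hx : x ∈ K.state) (l : List (ℕ × Option (List Clause))) :
    stepValue K l x = eventValue x l := by
  rw [stepValue, ghostStep_eq]
  generalize K.state = S at hx
  induction S with
  | nil => simp at hx
  | cons y S ih =>
    rw [List.map_cons, List.lookup_cons]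
    by_cases h : x = y
    · subst h; simp
    · have : (GVar.ms x == GVar.ms y) = false := by simpa using h
      rw [this]
      exact ih ((List.mem_cons.1 hx).resolve_left h)

/-- Together with `eventTree_formula` this exhibits the two monitors as two readings of one tree. -/
theorem stepValue_subst {K : Contract} {x : ℕ} (hx : x ∈ K.state) (σ : Subst)
    (l : List (ℕ × Option (List Clause))) : (stepValue K l x).subst σ =
    (eventTree ((Expr.ghost .target).subst σ) (fun g => (g.inst ghostPlaces).subst σ) l).chain
      fun u => (updValue u x).subst σ := by
  rw [stepValue_eq hx]
  induction l with
  | nil => rfl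
  | cons p l ih =>
    obtain ⟨d, o⟩ := p
    have e : (eventValue x ((d, o) :: l)).subst σ = .cond (.hasType ((Expr.ghost .target).subst σ) d)
      ((o.elim (Expr.ghost (.ms x)) (ghostDelta x)).subst σ) ((eventValue x l).subst σ) := rfl
    rw [e, ih]
    cases o
    · rfl
    · simp only [Option.elim, ghostDelta_subst]; rfl

-- Sizes of formulas, and step bounds in terms of them.

theorem conj_size {ι : Type} (f : ι → Expr × Expr) (l : List ι) :
    2 * l.length + 1 ≤ (Assertion.conj (l.map fun x => .eq (f x).1 (f x).2)).size := by
  induction l with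
  | nil => simp [Assertion.conj, Assertion.size]
  | cons x l ih =>
    have h1 := Expr.one_le_size (f x).1
    have h2 := Expr.one_le_size (f x).2
    cases l with
    | nil => simp only [List.map_cons, List.map_nil, Assertion.conj, Assertion.size, List.length_cons,
        List.length_nil]; omega
    | cons y l =>
      simp only [List.map_cons, Assertion.conj, Assertion.size, List.length_cons] at ih ⊢
      omega

theorem Expr.IsVar.size_eq {e : Expr} (h : e.IsVar) : e.size = 1 := by
  cases e <;> first | exact False.elim h | rfl

mutual
-- A renaming exchanges symbols one for one, so bounds stated after unification hold for the
-- original formula.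
theorem Expr.size_subst {σ : Subst} (h : σ.Renaming) : ∀ e : Expr, (e.subst σ).size = e.size
  | .lit _ => rfl
  | .field e f => by simp only [Expr.subst, Expr.size, Expr.size_subst h e]
  | .static c f => Expr.IsVar.size_eq (h (.static c f) trivial)
  | .stack i => Expr.IsVar.size_eq (h (.stack i) trivial)
  | .loc i => Expr.IsVar.size_eq (h (.loc i) trivial)
  | .ghost x => Expr.IsVar.size_eq (h (.ghost x) trivial)
  | .op o e₁ e₂ => by simp only [Expr.subst, Expr.size, Expr.size_subst h e₁, Expr.size_subst h e₂]
  | .cond a e₁ e₂ => by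
    simp only [Expr.subst, Expr.size, Expr.size_subst h e₁, Expr.size_subst h e₂, Assertion.size_subst h a]
  | .pair e₁ e₂ => by simp only [Expr.subst, Expr.size, Expr.size_subst h e₁, Expr.size_subst h e₂]
  | .bot => rfl
theorem Assertion.size_subst {σ : Subst} (h : σ.Renaming) : ∀ a : Assertion, (a.subst σ).size = a.size
  | .tt => rfl
  | .ff => rfl
  | .eq e₁ e₂ => by simp only [Assertion.subst, Assertion.size, Expr.size_subst h e₁, Expr.size_subst h e₂]
  | .rel r e₁ e₂ => by
    simp only [Assertion.subst, Assertion.size, Expr.size_subst h e₁, Expr.size_subst h e₂]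
  | .and a b => by
    simp only [Assertion.subst, Assertion.size, Assertion.size_subst h a, Assertion.size_subst h b]
  | .not a => by simp only [Assertion.subst, Assertion.size, Assertion.size_subst h a]
  | .hasType e c => by simp only [Assertion.subst, Assertion.size, Expr.size_subst h e]
end

theorem DTree.weight_le_of_leaf {ρ : Type} {s : ℕ} {F : ρ → Assertion}
    (h : ∀ r, 2 * s + 1 ≤ (F r).size) (D : DTree ρ) : D.weight s ≤ (D.formula F).size := by
  induction D with
  | leaf r => exact h r
  | exit => simp [weight, formula, Assertion.size]
  | test g n y ihn ihy =>
    simp only [weight, formula, Assertion.ite, Assertion.imp, boolExpr, Assertion.size, Expr.size]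
    omega

theorem DTree.chain_congr {ρ : Type} {V V' : ρ → Expr} (h : ∀ r, V r = V' r) (D : DTree ρ) :
    D.chain V = D.chain V' := by rw [funext h]

/-- After unification of the places of the two monitors, the expected formula is rewritten to `tt`. -/
theorem expectedFormula_reach (K : Contract) (l : List (ℕ × Option (List Clause))) (θ η : SubstData)
    (xs : Option (List Expr)) {τ : Subst} (hτ : τ.Renaming) (hθ : ∀ y, (θ.toSubst.ghost y).IsVar)
    (h : ∀ y, (θ.toSubst.ghost y).subst τ = (η.toSubst.ghost y).subst τ) :
    ∀ E, E = expectedFormula K l θ η (xs.map fun xs => .conj (xs.map fun e => .eq e e)) →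
      ReachA (2 * E.size + E.size ^ 2) (E.subst τ) .tt := by
  intro E hE
  -- `σ` leads to the places of the inlined monitor and `σ'` to those of the ghost monitor, both
  -- followed by the unifier. By assumption they agree on ghost variables.
  set σ := θ.toSubst.comp τ with hσ
  set σ' := η.toSubst.comp τ with hσ'
  have hg : ∀ y, σ.ghost y = σ'.ghost y := h
  have hv : ∀ y, (σ.ghost y).IsVar := fun y => hτ _ (hθ y)
  set D := eventTree ((Expr.ghost .target).subst σ) (fun g => (g.inst ghostPlaces).subst σ) l with hD
  set V : ℕ → List (ℕ × CExpr) → Expr := fun x u => (updValue u x).subst σ with hV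
  have hup : ∀ x u, V x u = (updValue u x).subst σ' := fun x u => CExpr.inst_subst_congr hg _
  have hD' : D = eventTree ((Expr.ghost .target).subst σ') (fun g => (g.inst ghostPlaces).subst σ') l := by
    rw [hD]
    have e1 : (Expr.ghost .target).subst σ = (Expr.ghost .target).subst σ' := hg _
    have e2 : (fun g : CGuard => (g.inst ghostPlaces).subst σ) =
      fun g => (g.inst ghostPlaces).subst σ' := funext fun g => CGuard.inst_subst_congr hg g
    rw [e1, e2]
  -- After unification each leaf compares its update with the conditional expression of the very
  -- tree `D` in which it sits.
  have hleaf : ∀ u, (leafFormula K l θ η u).subst τ =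
      DTree.leafEqs K.state V (fun x => D.chain (V x)) u := by
    intro u
    rw [leafFormula, Assertion.conj_subst, DTree.leafEqs, List.map_map]
    congr 1
    refine List.map_congr_left fun x hx => ?_
    simp only [Function.comp, Assertion.subst, Expr.subst_subst]
    rw [← hσ, ← hσ', stepValue_subst hx, ← hD', DTree.chain_congr (hup x)]
  have hplain : ∀ x u, (V x u).Plain := fun x u => CExpr.inst_subst_plain hv _
  have hDp : D.PlainTests := eventTree_plain (hv .target).plain (fun g => CGuard.inst_subst_plain hv g) l
  have main := DTree.formula_reach_tt K.state hplain _ D le_rfl hDp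
  have hform : E.subst τ = D.formula fun u =>
      ((xs.map fun xs => .conj (xs.map fun e => .eq e e)).elim (leafFormula K l θ η u)
        (.and (leafFormula K l θ η u))).subst τ := by
    rw [hE, expectedFormula, eventFormula_subst, ← eventTree_formula]
    simp only [Assertion.subst_subst, Expr.subst_subst]
    rfl
  have hsz := Assertion.size_subst hτ E
  cases xs with
  | none =>
    simp only [Option.map_none, Option.elim, hleaf] at hform
    rw [hform] at hsz ⊢
    have hw := DTree.weight_le_size K.state V (fun x => D.chain (V x)) D
    rw [← hsz]
    refine main.mono (le_trans (Nat.pow_le_pow_left hw 2) (Nat.le_add_left _ _))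
  | some xs =>
    simp only [Option.map_some, Option.elim, Assertion.subst, Assertion.conj_subst, List.map_map,
      hleaf] at hform
    rw [hform] at hsz ⊢
    -- At the head of a block the leaves also contain trivial equations. They are removed from every
    -- leaf first, at a cost proportional to their number.
    set F : List (ℕ × CExpr) → Assertion := fun u =>
      .and (DTree.leafEqs K.state V (fun x => D.chain (V x)) u)
        (.conj (xs.map (Assertion.subst τ ∘ fun e => .eq e e))) with hF
    have hstep : ∀ u, ReachA (2 * (xs.length + 1)) (F u)
        (DTree.leafEqs K.state V (fun x => D.chain (V x)) u) := fun u =>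
      (((reach_conj_refl (fun e : Expr => e.subst τ) xs).andRight _).trans (.rule (.andTt _))).mono
        (by omega)
    have h1 := DTree.formula_reach hstep D
    have hsize : ∀ u, 2 * (xs.length + 1) + 1 ≤ (F u).size := by
      intro u
      have a1 := conj_size (fun e : Expr => (e.subst τ, e.subst τ)) xs
      have a2 : 1 ≤ (DTree.leafEqs K.state V (fun x => D.chain (V x)) u).size := by
        have := conj_size (fun x => (V x u, D.chain (V x))) K.state
        rw [DTree.leafEqs]; dsimp only at this; omega
      have a3 : (F u).size = (DTree.leafEqs K.state V (fun x => D.chain (V x)) u).size +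
        (Assertion.conj (xs.map fun e => .eq (e.subst τ) (e.subst τ))).size + 1 := rfl
      rw [a3]; dsimp only at a1; omega
    have hw1 := DTree.weight_le_of_leaf hsize D
    have hw2 : D.weight K.state.length ≤ (D.formula F).size := by
      refine DTree.weight_le_of_leaf (fun u => ?_) D
      have := conj_size (fun x => (V x u, D.chain (V x))) K.state
      have a3 : (F u).size = (DTree.leafEqs K.state V (fun x => D.chain (V x)) u).size +
        (Assertion.conj (xs.map fun e => .eq (e.subst τ) (e.subst τ))).size + 1 := rfl
      rw [a3, DTree.leafEqs]; dsimp only at this; omega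
    rw [← hsz]
    have := Nat.pow_le_pow_left hw2 2
    exact (h1.trans main).mono (by omega)

/-- The premise behind a call is a conjunction of two conjunctions. One currying step separates
them, and the second is unified after the renaming produced by the first. -/
theorem Reach.unify_and {l m : List (Expr × Expr)} {φ : Assertion}
    (hl : ∀ p ∈ l, p.1.IsVar ∧ p.2.IsVar) (hm : ∀ p ∈ m, p.1.IsVar ∧ p.2.IsVar) :
    ∃ τ : Subst, τ.Renaming ∧ (∀ p ∈ l, p.1.subst τ = p.2.subst τ) ∧
      (∀ p ∈ m, p.1.subst τ = p.2.subst τ) ∧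
      Reach Rewrite (2 * l.length + 2 * m.length + 5) (.imp (.and (.conj (l.map fun p => .eq p.1 p.2))
        (.conj (m.map fun p => .eq p.1 p.2))) φ) (φ.subst τ) := by
  obtain ⟨σ, hσ, hσl, h1⟩ := unify_reach _ l (.imp (.conj (m.map fun p => .eq p.1 p.2)) φ) rfl hl
  have e : (Assertion.imp (.conj (m.map fun p => .eq p.1 p.2)) φ).subst σ =
      .imp (.conj ((m.map fun p => (p.1.subst σ, p.2.subst σ)).map fun p => .eq p.1 p.2)) (φ.subst σ) := by
    simp only [Assertion.imp, Assertion.subst, Assertion.conj_subst, List.map_map]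
    rfl
  obtain ⟨τ, hτ, hτm, h2⟩ := unify_reach _ (m.map fun p => (p.1.subst σ, p.2.subst σ)) (φ.subst σ) rfl (by
    intro q hq
    obtain ⟨q, hq', rfl⟩ := List.mem_map.1 hq
    exact ⟨hσ _ (hm q hq').1, hσ _ (hm q hq').2⟩)
  refine ⟨σ.comp τ, hσ.comp hτ, ?_, ?_, ?_⟩
  · intro p hp
    rw [← Expr.subst_subst σ τ p.1, ← Expr.subst_subst σ τ p.2, hσl p hp]
  · intro p hp
    rw [← Expr.subst_subst σ τ p.1, ← Expr.subst_subst σ τ p.2]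
    exact hτm (p.1.subst σ, p.2.subst σ) (List.mem_map.2 ⟨p, hp, rfl⟩)
  · rw [← Assertion.subst_subst]
    rw [e] at h1
    rw [List.length_map] at h2
    exact ((Reach.single (Rewrite.inside (.rule (.curry _ _ _)))).trans (h1.trans h2)).mono (by omega)

/-- A bound for the number of rewrite steps. -/
def stepBound (n : ℕ) : ℕ := n ^ 2 + 10 * n + 10

theorem toSubst_ghost_isVar {d : SubstData} (h : ∀ p ∈ d.1, p.2.IsVar) (y : GVar) :
    (d.toSubst.ghost y).IsVar := by
  change ((d.1.lookup (.ghost y)).getD (.ghost y)).IsVar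
  cases e : d.1.lookup (.ghost y) with
  | none => trivial
  | some b => exact h _ (mem_of_lookup e)

theorem stateData_isVar (K : Contract) : ∀ p ∈ stateData K, p.1.IsVar ∧ p.2.IsVar := by
  intro p hp
  obtain ⟨x, _, rfl⟩ := List.mem_map.1 hp
  exact ⟨trivial, trivial⟩
theorem stackData_isVar (n : ℕ) : ∀ p ∈ stackData n, p.1.IsVar ∧ p.2.IsVar := by
  intro p hp
  rcases List.mem_cons.1 hp with rfl | hp
  · exact ⟨trivial, trivial⟩
  · obtain ⟨x, _, rfl⟩ := List.mem_map.1 hp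
    exact ⟨trivial, trivial⟩
theorem localData_isVar (v n : ℕ) : ∀ p ∈ localData v n, p.1.IsVar ∧ p.2.IsVar := by
  intro p hp
  rcases List.mem_cons.1 hp with rfl | hp
  · exact ⟨trivial, trivial⟩
  · obtain ⟨x, _, rfl⟩ := List.mem_map.1 hp
    exact ⟨trivial, trivial⟩

theorem monitorInvariant_eq (K : Contract) :
    monitorInvariant K = .conj (((stateData K).map Prod.swap).map fun p => .eq p.1 p.2) := by
  simp only [monitorInvariant, stateData, List.map_map]; rfl

theorem zip_range_range' (v n : ℕ) : (List.range n).zip (List.range' v n) =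
    (List.range n).map fun j => (j, v + j) := by
  apply List.ext_getElem
  · simp
  · intro i h1 h2; simp

theorem localData_eq (v n : ℕ) : localData v n =
    (.ghost .target, .loc v) :: (List.range n).map fun j => (.ghost (.arg j), .loc (v + 2 + j)) := by
  rw [localData, zip_range_range', List.map_map]; rfl

theorem callInvariant_eq (K : Contract) (v n : ℕ) : callInvariant K v n =
    .and (.conj (((stateData K).map Prod.swap).map fun p => .eq p.1 p.2))
      (.conj (((localData v n).map Prod.swap).map fun p => .eq p.1 p.2)) := by
  rw [callInvariant, monitorInvariant_eq, localData_eq]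
  simp only [List.map_cons, List.map_map]; rfl

theorem swap_isVar {l : List (Expr × Expr)} (h : ∀ p ∈ l, p.1.IsVar ∧ p.2.IsVar) :
    ∀ p ∈ l.map Prod.swap, p.1.IsVar ∧ p.2.IsVar := by
  intro p hp
  obtain ⟨q, hq, rfl⟩ := List.mem_map.1 hp
  exact (h q hq).symm

theorem imp_size (a b : Assertion) : (Assertion.imp a b).size = a.size + b.size + 3 := by
  simp only [Assertion.imp, Assertion.size]; omega

/-- In all three cases the premise is unified first. What has to be checked is that the unifier
identifies the place of each ghost variable in the inlined monitor with its value in the ghost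
monitor. -/
theorem callTest_reach {P : Program} {K : Contract} {a w : Assertion} {k c m n : ℕ}
    (h : callTest P K a w k c m n = true) :
    Reach Rewrite (stepBound (Assertion.imp a w).size) (.imp a w) .tt := by
  simp only [callTest, Bool.or_eq_true, Bool.and_eq_true, teq_iff] at h
  -- Unification is linear in the premise and the rest quadratic in the conclusion; both fit into
  -- `stepBound`.
  have hfin : ∀ {k : ℕ} {τ : Subst}, Reach Rewrite k (.imp a w) (w.subst τ) → k ≤ a.size + 5 →
      ReachA (2 * w.size + w.size ^ 2) (w.subst τ) .tt →
      Reach Rewrite (stepBound (Assertion.imp a w).size) (.imp a w) .tt := by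
    intro k τ h1 hk h2
    refine (h1.trans h2.rewrite).mono ?_
    rw [imp_size, stepBound]
    nlinarith [Nat.zero_le (a.size * w.size), Nat.zero_le (a.size ^ 2)]
  have hS := stateData_isVar K
  rcases h with (⟨ha, hw⟩ | ⟨ha, hw⟩) | ⟨ha, hw⟩
  · rw [monitorInvariant_eq] at ha
    have hlen := conj_size (fun p : Expr × Expr => p) ((stateData K).map Prod.swap)
    rw [← ha] at hlen
    obtain ⟨τ, hτ, hl, h1⟩ := unify_reach _ ((stateData K).map Prod.swap) w rfl (swap_isVar hS)
    rw [← ha] at h1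
    refine hfin h1 (by omega) (expectedFormula_reach K (eventClauses P K MethodSpec.before c m n)
      (stateData K ++ stackData n, 0) (stackData n, 0)
      (some ((n :: (argPairs n).map Prod.snd).map Expr.stack)) hτ (fun y => toSubst_ghost_isVar ?_ y)
      (fun y => ?_) w ?_)
    · intro p hp
      rcases List.mem_append.1 hp with hp | hp
      exacts [(hS p hp).2, (stackData_isVar n p hp).2]
    -- The two substitutions differ only on state variables, whose places the monitor invariant
    -- equates. Saving the call does not touch these.
    · change (((stateData K ++ stackData n).lookup (.ghost y)).getD _).subst τ =
        (((stackData n).lookup (.ghost y)).getD _).subst τ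
      rw [lookup_append]
      cases e : (stateData K).lookup (.ghost y) with
      | none => rfl
      | some b =>
        have hb := mem_of_lookup e
        have hb' := hl _ (List.mem_map.2 ⟨_, hb, rfl⟩)
        obtain ⟨x, _, hx⟩ := List.mem_map.1 hb
        have hy : y = .ms x := by simpa using (congrArg Prod.fst hx).symm
        have : (stackData n).lookup (.ghost y) = none := lookup_eq_none fun p hp => by
          rw [hy]
          rcases List.mem_cons.1 hp with rfl | hp
          · simp
          · obtain ⟨x, _, rfl⟩ := List.mem_map.1 hp
            simp
        rw [this]
        exact hb'
    · rw [hw]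
      simp only [Option.map_some, trivialEqs, List.map_map]; rfl
  all_goals
    rw [callInvariant_eq] at ha
  · have hlen1 := conj_size (fun p : Expr × Expr => p) ((stateData K).map Prod.swap)
    have hlen2 := conj_size (fun p : Expr × Expr => p) ((localData k n).map Prod.swap)
    have hsz := congrArg Assertion.size ha
    rw [Assertion.size] at hsz
    obtain ⟨τ, hτ, hl, hm, h1⟩ := Reach.unify_and (φ := w) (swap_isVar hS)
      (swap_isVar (localData_isVar k n))
    rw [← ha] at h1
    refine hfin h1 (by omega) (expectedFormula_reach K (eventClauses P K MethodSpec.exceptional c m n)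
      (stateData K ++ localData k n, 0) ([], 0) none hτ
      (fun y => toSubst_ghost_isVar ?_ y) (fun y => ?_) w ?_)
    · intro p hp
      rcases List.mem_append.1 hp with hp | hp
      exacts [(hS p hp).2, (localData_isVar k n p hp).2]
    -- On the ghost side nothing is substituted, so every listed pair has to be an equation of the
    -- call invariant, and is one.
    · change (((stateData K ++ localData k n).lookup (.ghost y)).getD _).subst τ = (Expr.ghost y).subst τ
      cases e : (stateData K ++ localData k n).lookup (.ghost y) with
      | none => rfl
      | some b =>
        rcases List.mem_append.1 (mem_of_lookup e) with hb | hb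
        exacts [hl _ (List.mem_map.2 ⟨_, hb, rfl⟩), hm _ (List.mem_map.2 ⟨_, hb, rfl⟩)]
    · rw [hw]; rfl
  · have hlen1 := conj_size (fun p : Expr × Expr => p) ((stateData K).map Prod.swap)
    have hlen2 := conj_size (fun p : Expr × Expr => p) ((localData (k - 1) n).map Prod.swap)
    have hsz := congrArg Assertion.size ha
    rw [Assertion.size] at hsz
    obtain ⟨τ, hτ, hl, hm, h1⟩ := Reach.unify_and (φ := w) (swap_isVar hS)
      (swap_isVar (localData_isVar (k - 1) n))
    rw [← ha] at h1
    refine hfin h1 (by omega) (expectedFormula_reach K (eventClauses P K MethodSpec.after c m n)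
      ((.ghost .result, .stack 0) :: (stateData K ++ localData (k - 1) n), 0)
      ([(.ghost .result, .stack 0)], 0) none hτ
      (fun y => toSubst_ghost_isVar ?_ y) (fun y => ?_) w ?_)
    · intro p hp
      rcases List.mem_cons.1 hp with rfl | hp
      · trivial
      rcases List.mem_append.1 hp with hp | hp
      exacts [(hS p hp).2, (localData_isVar (k - 1) n p hp).2]
    · change ((((Expr.ghost .result, Expr.stack 0) :: (stateData K ++ localData (k - 1) n)).lookup
        (.ghost y)).getD _).subst τ =
        (([(Expr.ghost .result, Expr.stack 0)].lookup (.ghost y)).getD _).subst τ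
      rw [List.lookup_cons, List.lookup_cons]
      -- The returned value is the top of the stack on both sides, even before unification.
      cases Expr.ghost y == Expr.ghost .result with
      | true => rfl
      | false =>
        cases e : (stateData K ++ localData (k - 1) n).lookup (.ghost y) with
        | none => rfl
        | some b =>
          rcases List.mem_append.1 (mem_of_lookup e) with hb | hb
          exacts [hl _ (List.mem_map.2 ⟨_, hb, rfl⟩), hm _ (List.mem_map.2 ⟨_, hb, rfl⟩)]
    · rw [hw]; rfl

/-! ### Soundness of the checker -/

theorem length_le_conj_size {ι : Type} (f : ι → Assertion) (l : List ι) :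
    l.length ≤ (Assertion.conj (l.map f)).size := by
  induction l with
  | nil => exact Nat.zero_le _
  | cons x l ih =>
    cases l with
    | nil => simp only [List.map_cons, List.map_nil, Assertion.conj, List.length_cons, List.length_nil]
             have : ∀ a : Assertion, 1 ≤ a.size := by intro a; cases a <;> simp [Assertion.size]
             exact this _
    | cons y l =>
      simp only [List.map_cons, Assertion.conj, Assertion.size, List.length_cons] at ih ⊢
      omega

theorem conj_subst_replicate (σ : Subst) {ι : Type} (l : List ι) (a : Assertion) :
    (Assertion.conj (l.map fun _ => a)).subst σ = .conj (l.map fun _ => a.subst σ) := by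
  rw [Assertion.conj_subst, List.map_map]; rfl

/-- A conjunction with conjunct `b` is larger than `b`, so the replacement strikes exactly the
conjuncts. -/
theorem conj_const_replace {ι : Type} (b w : Assertion) (l : List ι) (hl : l ≠ []) :
    Assertion.replace b w (.conj (l.map fun _ => b)) = .conj (l.map fun _ => w) := by
  induction l with
  | nil => exact absurd rfl hl
  | cons x l ih =>
    cases l with
    | nil => exact replace_self b w
    | cons y l =>
      have e := ih (by simp)
      simp only [List.map_cons, Assertion.conj] at e ⊢
      have hne : ∀ c : Assertion, Assertion.and b c ≠ b := by
        intro c h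
        have := congrArg Assertion.size h
        simp only [Assertion.size] at this; omega
      rw [Assertion.replace, if_neg (hne _), replace_self, e]

theorem size_le_conj_const {ι : Type} (b : Assertion) (l : List ι) (hl : l ≠ []) :
    b.size ≤ (Assertion.conj (l.map fun _ => b)).size := by
  match l, hl with
  | [x], _ => exact le_rfl
  | x :: y :: l, _ => simp only [List.map_cons, Assertion.conj, Assertion.size]; omega

/-- No node of the implication's skeleton above `d` is small enough to equal `b`. -/
theorem replace_imp_of_size_le {b : Assertion} (w : Assertion) {c d : Assertion} (h : b.size ≤ d.size) :
    Assertion.replace b w (.imp c d) = .imp (Assertion.replace b w c) (Assertion.replace b w d) := by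
  have h1 : ∀ e : Assertion, b.size < e.size → e ≠ b := fun e he h => by subst h; omega
  rw [Assertion.imp, Assertion.replace, if_neg (h1 _ (by simp only [Assertion.size]; omega)),
    Assertion.replace, if_neg (h1 _ (by simp only [Assertion.size]; omega)),
    Assertion.replace, if_neg (h1 _ (by simp only [Assertion.size]; omega))]
  rfl

/-- A single assumption step turns all copies of the premise into `tt`. -/
theorem reach_imp_conj_const {ι : Type} (b : Assertion) (l : List ι) :
    ReachA (l.length + 4) (.imp b (.conj (l.map fun _ => b))) .tt := by
  by_cases hl : l = []
  · subst hl; exact (reach_imp_tt b).mono (by simp)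
  · have h1 : ReachA 1 (.imp b (.conj (l.map fun _ => b))) (.imp b (.conj (l.map fun _ => .tt))) := by
      rw [← conj_const_replace b .tt l hl]
      exact .rule (.assume _ _)
    exact ((h1.trans ((reach_conj_tt l).impRight b)).trans (reach_imp_tt b)).mono (by omega)

/-- With equal branches, the cases merge from the innermost one outwards. -/
theorem reach_select {ι : Type} (g : ι → Assertion) (b : Assertion) (l : List ι) :
    ReachA l.length (.select (l.map fun i => (g i, b)) b) b := by
  induction l with
  | nil => exact .refl 0 b
  | cons i l ih =>
    have : Assertion.select ((i :: l).map fun i => (g i, b)) b =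
      .and (.imp (g i) b) (.imp (.not (g i)) (.select (l.map fun i => (g i, b)) b)) := rfl
    rw [this]
    exact ((ih.impRight _).andRight _).trans (.rule (.merge _ _))

theorem length_le_select_size {ι : Type} (g : ι → Assertion) (b : Assertion) (l : List ι) :
    l.length ≤ (Assertion.select (l.map fun i => (g i, b)) b).size := by
  induction l with
  | nil => exact Nat.zero_le _
  | cons i l ih =>
    have : Assertion.select ((i :: l).map fun i => (g i, b)) b =
      .and (.imp (g i) b) (.imp (.not (g i)) (.select (l.map fun i => (g i, b)) b)) := rfl
    rw [this]
    simp only [Assertion.size, imp_size, List.length_cons]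
    omega

theorem reach_mono_bound {n : ℕ} {φ : Assertion} (h : ReachA n φ .tt) (hn : n ≤ φ.size + 10) :
    Reach Rewrite (stepBound φ.size) φ .tt :=
  h.rewrite.mono (by rw [stepBound]; nlinarith [Nat.zero_le (φ.size ^ 2)])

theorem reach_imp_of_eq {a w : Assertion} (h : a = w) :
    Reach Rewrite (stepBound (Assertion.imp a w).size) (.imp a w) .tt := by
  subst h; exact reach_mono_bound (reach_imp_self a) (by omega)

theorem blockTest_reach {P : Program} {K : Contract} {code : List Instr} {a w : Assertion} {k : ℕ}
    (h : blockTest P K code a w k = true) :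
    Reach Rewrite (stepBound (Assertion.imp a w).size) (.imp a w) .tt := by
  rw [blockTest, List.any_eq_true] at h
  obtain ⟨ι, _, h⟩ := h
  cases ι with
  | invoke c m n => exact callTest_reach h
  | _ => simp at h

theorem dataTest_reach {P : Program} {K : Contract} {code : List Instr} {us : List GhostUpdate}
    {a a' : Assertion} {d : SubstData} {k : ℕ} (hus : us.tail.tail.isEmpty = true)
    (h : dataTest P K code us a a' d k = true) :
    Reach Rewrite (stepBound (Assertion.imp a (ghostWp us (a'.subst d.toSubst))).size)
      (.imp a (ghostWp us (a'.subst d.toSubst))) .tt := by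
  rw [dataTest, Bool.or_eq_true, teq_iff, ghostWpPair_eq hus] at h
  rcases h with h | h
  exacts [reach_imp_of_eq h, blockTest_reach h]

theorem ghostWp_tt (us : List GhostUpdate) : ghostWp us .tt = .tt := by
  induction us with
  | nil => rfl
  | cons u us ih => rw [ghostWp, List.foldr_cons]; rw [ghostWp] at ih; rw [ih]; rfl

theorem ghostWp_ite (us : List GhostUpdate) {c : Assertion} (hc : ghostWp us c = c) (a b : Assertion) :
    ghostWp us (.ite c a b) = .ite c (ghostWp us a) (ghostWp us b) := by
  have : ghostWp us (.ite c a b) = .ite (ghostWp us c) (ghostWp us a) (ghostWp us b) := by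
    clear hc
    induction us with
    | nil => rfl
    | cons u us ih => simp only [ghostWp, List.foldr_cons] at ih ⊢; rw [ih]; rfl
  rw [this, hc]

/-- Ghost updates do not assign to stack positions, so the conditions of jumps are unaffected. -/
theorem ghostWp_stackTest (us : List GhostUpdate) (i : ℕ) (e : Expr) (he : e = .lit 0 ∨ e = .stack 1) :
    ghostWp us (.eq (.stack i) e) = .eq (.stack i) e := by
  induction us with
  | nil => rfl
  | cons u us ih => simp only [ghostWp, List.foldr_cons] at ih ⊢; rw [ih]; rcases he with rfl | rfl <;> rfl

theorem ghostWp_conj_const {ι : Type} (us : List GhostUpdate) (a : Assertion) (l : List ι) :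
    ghostWp us (.conj (l.map fun _ => a)) = .conj (l.map fun _ => ghostWp us a) := by
  induction us with
  | nil => rfl
  | cons u us ih => simp only [ghostWp, List.foldr_cons] at ih ⊢; rw [ih, conj_subst_replicate]

/-- If both branches equal the premise, one merging step leaves `a ⇒ a`. -/
theorem branchTest_reach {us : List GhostUpdate} {a a₁ a₂ e : Assertion} {k : ℕ}
    (hk : k = 1 ∨ k = 2) (he : ghostWp us e = e)
    (hus : us.tail.tail.isEmpty = true) (h : branchTest us a a₁ a₂ e k = true) :
    Reach Rewrite (stepBound (Assertion.imp a (ghostWp us (.ite e (a₁.subst { stack := popStack k })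
      (a₂.subst { stack := popStack k })))).size)
      (.imp a (ghostWp us (.ite e (a₁.subst { stack := popStack k })
      (a₂.subst { stack := popStack k })))) .tt := by
  simp only [branchTest, Bool.or_eq_true, Bool.and_eq_true, teq_iff, ghostWpPair_eq hus, toSubst_pop k hk] at h
  rw [ghostWp_ite us he]
  rcases h with h | ⟨h1, h2⟩
  · exact reach_imp_of_eq h
  · rw [← h1, ← h2]
    have : ReachA 1 (.imp a (.ite e a a)) (.imp a a) := (Reach.rule (.merge e a)).impRight a
    exact reach_mono_bound (this.trans (reach_imp_self a)) (by omega)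

/-- All methods that may be called have the same precondition, so the conclusion repeats one
assertion. If it is only the first conjunct of the premise, currying brings it to the front. -/
theorem invokeTest_reach {ι : Type} {us : List GhostUpdate} {a b : Assertion} (l : List ι)
    (h : a = ghostWp us b ∨ a.left = ghostWp us b) :
    Reach Rewrite (stepBound (Assertion.imp a (ghostWp us (.conj (l.map fun _ => b)))).size)
      (.imp a (ghostWp us (.conj (l.map fun _ => b)))) .tt := by
  rw [ghostWp_conj_const]
  have h1 := length_le_conj_size (fun _ : ι => ghostWp us b) l
  have key : ∀ n, ReachA n (.imp a (.conj (l.map fun _ => ghostWp us b))) .tt → n ≤ l.length + 10 →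
      Reach Rewrite (stepBound (Assertion.imp a (.conj (l.map fun _ => ghostWp us b))).size)
      (.imp a (.conj (l.map fun _ => ghostWp us b))) .tt := fun n hn hb =>
    reach_mono_bound hn (by rw [imp_size]; omega)
  have direct : a = ghostWp us b →
      Reach Rewrite (stepBound (Assertion.imp a (.conj (l.map fun _ => ghostWp us b))).size)
      (.imp a (.conj (l.map fun _ => ghostWp us b))) .tt := by
    intro h
    refine key (l.length + 4) ?_ (by omega)
    rw [h]; exact reach_imp_conj_const _ l
  rcases h with h | h
  · exact direct h
  · cases a with
    | and a c =>
      have e : a = ghostWp us b := h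
      refine key (1 + (1 + (l.length + 3)) + 3) ?_ (by omega)
      have s1 : ReachA 1 (.imp (.and a c) (.conj (l.map fun _ => ghostWp us b)))
          (.imp a (.imp c (.conj (l.map fun _ => ghostWp us b)))) := .rule (.curry _ _ _)
      by_cases hl : l = []
      · subst hl
        exact (reach_imp_tt _).mono (by omega)
      · rw [e] at s1 ⊢
        have hsz := size_le_conj_const (ghostWp us b) l hl
        -- The assumption step also replaces inside the second conjunct `c`. This is harmless
        -- because the conclusion becomes trivial.
        have s2 : ReachA 1 (.imp (ghostWp us b) (.imp c (.conj (l.map fun _ => ghostWp us b))))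
            (.imp (ghostWp us b) (.imp (Assertion.replace (ghostWp us b) .tt c)
              (.conj (l.map fun _ => .tt)))) := by
          rw [← conj_const_replace (ghostWp us b) .tt l hl, ← replace_imp_of_size_le _ hsz]
          exact .rule (.assume _ _)
        have s3 := ((reach_conj_tt l).impRight (Assertion.replace (ghostWp us b) .tt c)).trans
          (reach_imp_tt _)
        exact ((s1.trans (s2.trans (s3.impRight _))).trans (reach_imp_tt _))
    | _ => exact direct h

theorem instrTest_reach {P : Program} {K : Contract} {M : Method} {A : List Assertion}
    {us : List GhostUpdate} {L : ℕ} {ι : Instr} (hus : us.tail.tail.isEmpty = true)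
    (h : instrTest P K M A us L ι = true) : ∀ φ, φ = Assertion.imp (A.getD L .ff)
      (ghostWp us (wpInstr P (fun _ _ _ => monitorInvariant K) (monitorInvariant K) M.handlers
        (fun L => A.getD L .ff) L ι)) → Reach Rewrite (stepBound φ.size) φ .tt := by
  rintro φ rfl
  cases ι with
  | goto L' =>
    simp only [instrTest, teq_iff, ghostWpPair_eq hus] at h
    exact reach_imp_of_eq h
  | ret =>
    simp only [instrTest, teq_iff, ghostWpPair_eq hus] at h
    exact reach_imp_of_eq h
  | exit =>
    rw [wpInstr, ghostWp_tt]
    exact reach_mono_bound (reach_imp_tt _) (by omega)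
  | ifeq L' => exact branchTest_reach (.inl rfl) (ghostWp_stackTest _ _ _ (.inl rfl)) hus h
  | ificmpeq L' => exact branchTest_reach (.inr rfl) (ghostWp_stackTest _ _ _ (.inr rfl)) hus h
  | athrow =>
    simp only [instrTest, Bool.and_eq_true, teq_iff, List.isEmpty_iff, List.all_eq_true] at h
    obtain ⟨⟨rfl, h1⟩, h2⟩ := h
    have e : wpInstr P (fun _ _ _ => monitorInvariant K) (monitorInvariant K) M.handlers
        (fun L => A.getD L .ff) L .athrow = .select ((M.handlers.filter fun h => h.covers L).map
          fun h => (.hasType (.stack 0) h.cls, monitorInvariant K)) (monitorInvariant K) := by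
      rw [wpInstr]
      congr 1
      refine List.map_congr_left fun x hx => ?_
      rw [List.mem_filter] at hx
      have := h2 x hx.1
      simp only [hx.2, Bool.not_true, Bool.false_or, teq_iff] at this
      rw [this]
    rw [e, h1]
    have e' : ∀ a, ghostWp [] a = a := fun _ => rfl
    rw [e']
    have l1 := length_le_select_size (fun h : Handler => .hasType (.stack 0) h.cls) (monitorInvariant K)
      (M.handlers.filter fun h => h.covers L)
    exact reach_mono_bound (((reach_select _ _ _).impRight _).trans (reach_imp_self _))
      (by rw [imp_size]; omega)
  | invoke c m n =>
    simp only [instrTest, Bool.or_eq_true, teq_iff, ghostWpPair_eq hus] at h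
    exact invokeTest_reach _ h
  | _ =>
    rw [wpInstr_data (by rfl)]
    exact dataTest_reach hus h

theorem embedTest_sound {P : Program} {K : Contract} {M : Method} (h : embedTest P K M = true) :
    Embeddable P K M := by
  intro L c m n hL hr
  rw [embedTest, List.all_eq_true] at h
  have := h (.invoke c m n, L) (List.mem_zipIdx_iff_getElem?.2 hL)
  simp only [hr, Bool.not_true, Bool.false_or] at this
  cases e : firstHandler M.handlers L with
  | none => rw [e] at this; simp at this
  | some x =>
    rw [e] at this
    simp only [Option.elim, Bool.and_eq_true, teq_iff] at this
    exact ⟨x, rfl, this.1.1.1, this.1.1.2, this.1.2, this.2⟩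

/-- The accepted conditions rewrite to `tt`, and their validity is a consequence of this rewriting.
-/
theorem Bundle.check_sound {B : Bundle} (h : B.check = true) : B.IsAdherenceProof ∧
    ∀ φ ∈ B.vcs, Reach Rewrite (stepBound φ.size) φ .tt := by
  simp only [Bundle.check, Bool.and_eq_true, teq_iff, List.all_eq_true] at h
  obtain ⟨h0, h1⟩ := h
  have key : ∀ q ∈ B.prog.methods.zip B.proof, ∀ φ ∈
      (extend B.prog B.contract q.1 q.2).vcs B.prog fun _ _ _ => monitorInvariant B.contract,
      Reach Rewrite (stepBound φ.size) φ .tt := by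
    intro q hq φ hφ
    have hm := h1 q hq
    simp only [methodTest, Bool.and_eq_true, teq_iff, List.all_eq_true] at hm
    obtain ⟨⟨⟨_, _⟩, m3⟩, m4⟩ := hm
    rcases List.mem_cons.1 hφ with rfl | hφ
    · exact reach_imp_of_eq m3.symm
    · obtain ⟨r, hr, rfl⟩ := List.mem_map.1 hφ
      obtain ⟨m5, m6⟩ := m4 r hr
      exact instrTest_reach m5 m6 _ rfl
  refine ⟨⟨h0, fun q hq => ?_⟩, ?_⟩
  · have hm := h1 q hq
    simp only [methodTest, Bool.and_eq_true, teq_iff, List.all_eq_true] at hm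
    refine ⟨embedTest_sound hm.1.1.1, hm.1.1.2, fun φ hφ => ?_⟩
    obtain ⟨n, _, hn⟩ := (key q hq φ hφ).rewritesIn
    exact hn.valid
  · intro φ hφ
    obtain ⟨q, hq, hφ⟩ := List.mem_flatMap.1 hφ
    exact key q hq φ hφ

/-! ### Segments of lists -/

/-- The list `s` occurs in `C` at position `p`. -/
def Seg {α : Type} (C : List α) (p : ℕ) (s : List α) : Prop :=
  ∃ a b, C = a ++ s ++ b ∧ a.length = p

namespace Seg
variable {α β : Type} {C s t : List α} {p : ℕ} {x : α}

theorem left (h : Seg C p (s ++ t)) : Seg C p s := by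
  obtain ⟨a, b, rfl, h⟩ := h
  exact ⟨a, t ++ b, by simp, h⟩

theorem right (h : Seg C p (s ++ t)) : Seg C (p + s.length) t := by
  obtain ⟨a, b, rfl, h⟩ := h
  exact ⟨a ++ s, b, by simp, by simp [h]⟩

theorem get (h : Seg C p s) {k : ℕ} (hk : s[k]? = some x) : C[p + k]? = some x := by
  obtain ⟨a, b, rfl, rfl⟩ := h
  have := (List.getElem?_eq_some_iff.1 hk).1
  rw [List.append_assoc, List.getElem?_append_right (Nat.le_add_right _ _), Nat.add_sub_cancel_left,
    List.getElem?_append_left this, hk]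

theorem head (h : Seg C p (x :: s)) : C[p]? = some x := h.get (k := 0) rfl

theorem tail (h : Seg C p (x :: s)) : Seg C (p + 1) s := right (s := [x]) h

theorem map (f : α → β) (h : Seg C p s) : Seg (C.map f) p (s.map f) := by
  obtain ⟨a, b, rfl, h⟩ := h
  exact ⟨a.map f, b.map f, by simp, by simp [h]⟩

end Seg

/-- Ghost updates and handlers are collected over all instructions; typically exactly one of them
contributes to a given position. -/
theorem flatMap_zipIdx_single {α β : Type} {l : List α} {f : α × ℕ → List β} {i : ℕ} {x : α}
    (hx : l[i]? = some x) (h : ∀ j y, l[j]? = some y → j ≠ i → f (y, j) = []) :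
    l.zipIdx.flatMap f = f (x, i) := by
  have key : ∀ (l : List α) (k : ℕ), (∀ j y, l[j]? = some y → j + k ≠ i → f (y, j + k) = []) →
      (∀ j, j + k = i → l[j]? = some x) → k ≤ i → (l.zipIdx k).flatMap f = f (x, i) := by
    intro l
    induction l with
    | nil =>
      intro k _ h2 hk
      have := h2 (i - k) (by omega)
      simp at this
    | cons y l ih =>
      intro k h1 h2 hk
      rw [List.zipIdx_cons, List.flatMap_cons]
      by_cases hki : k = i
      · subst hki
        have : y = x := by simpa using h2 0 (by omega)
        subst this
        have : (l.zipIdx (k + 1)).flatMap f = [] := by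
          rw [List.flatMap_eq_nil_iff]
          rintro ⟨z, j⟩ hz
          rw [List.mem_zipIdx_iff_le_and_getElem?_sub] at hz
          have := h1 (j - k) z (by
            have e : j - k = (j - (k + 1)) + 1 := by omega
            rw [e, List.getElem?_cons_succ]; exact hz.2) (by omega)
          rwa [show j - k + k = j by omega] at this
        rw [this, List.append_nil]
      · have e := h1 0 y rfl (by omega)
        rw [Nat.zero_add] at e
        rw [e, List.nil_append]
        refine ih (k + 1) (fun j z hz hj => ?_) (fun j hj => ?_) (by omega)
        · have := h1 (j + 1) z (by simpa using hz) (by omega)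
          rwa [show j + 1 + k = j + (k + 1) by omega] at this
        · have := h2 (j + 1) (by omega)
          simpa using this
  exact key l 0 (fun j y hy hj => h j y hy hj) (fun j hj => by
    have : j = i := by omega
    rw [this, hx]) (Nat.zero_le _)

theorem flatMap_zipIdx_nil {α β : Type} {l : List α} {f : α × ℕ → List β}
    (h : ∀ j y, l[j]? = some y → f (y, j) = []) : l.zipIdx.flatMap f = [] := by
  rw [List.flatMap_eq_nil_iff]
  rintro ⟨z, j⟩ hz
  exact h j z (List.mem_zipIdx_iff_getElem?.1 hz)

/-- The length of a block does not depend on its position, so its address is the sum of the lengths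
before it. -/
theorem seg_flatMap_zipIdx {α β : Type} {l : List α} {f : α × ℕ → List β} {len : α → ℕ}
    (hlen : ∀ a i, (f (a, i)).length = len a) {i : ℕ} {x : α} (hx : l[i]? = some x) :
    Seg (l.zipIdx.flatMap f) ((l.take i).map len).sum (f (x, i)) := by
  obtain ⟨hi, rfl⟩ := List.getElem?_eq_some_iff.1 hx
  have e : l.zipIdx.flatMap f = (l.take i).zipIdx.flatMap f ++ f (l[i], i) ++
      ((l.drop (i + 1)).zipIdx (i + 1)).flatMap f := by
    conv_lhs => rw [← List.take_append_drop i l, List.drop_eq_getElem_cons hi]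
    rw [List.zipIdx_append, List.zipIdx_cons, List.flatMap_append, List.flatMap_cons,
      List.length_take, Nat.min_eq_left hi.le]
    simp
  refine ⟨_, _, e, ?_⟩
  have : ∀ (m : List α) k, ((m.zipIdx k).flatMap f).length = (m.map len).sum := by
    intro m
    induction m with
    | nil => intro k; rfl
    | cons a m ih => intro k; simp [List.zipIdx_cons, hlen, ih]
  exact this _ 0

theorem exists_of_flatMap_zipIdx {α β : Type} {l : List α} {f : α × ℕ → List β} {len : α → ℕ}
    (hlen : ∀ a i, (f (a, i)).length = len a) {L : ℕ} {y : β} (hy : (l.zipIdx.flatMap f)[L]? = some y) :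
    ∃ i x k, l[i]? = some x ∧ L = ((l.take i).map len).sum + k ∧ (f (x, i))[k]? = some y := by
  have key : ∀ (m : List α) (j L : ℕ), ((m.zipIdx j).flatMap f)[L]? = some y →
      ∃ i x k, m[i]? = some x ∧ L = ((m.take i).map len).sum + k ∧ (f (x, i + j))[k]? = some y := by
    intro m
    induction m with
    | nil => intro j L h; simp at h
    | cons a m ih =>
      intro j L h
      rw [List.zipIdx_cons, List.flatMap_cons] at h
      by_cases hL : L < (f (a, j)).length
      · rw [List.getElem?_append_left hL] at h
        exact ⟨0, a, L, rfl, by simp, by simpa using h⟩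
      · rw [List.getElem?_append_right (by omega)] at h
        obtain ⟨i, x, k, h1, h2, h3⟩ := ih _ _ h
        refine ⟨i + 1, x, k, by simpa using h1, ?_, ?_⟩
        · simp only [List.take_succ_cons, List.map_cons, List.sum_cons]
          have := hlen a j
          omega
        · rwa [show i + 1 + j = i + (j + 1) by omega]
  simpa using key l 0 L hy

/-! ### The generated assertions -/

theorem annotate_length (P : Program) (K : Contract) (H : List Handler) (g : ℕ → List GhostUpdate)
    (l : List (Instr × Mark)) : ∀ L, (annotate P K H g L l).length = l.length := by
  induction l with
  | nil => intro L; rfl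
  | cons x l ih => intro L; simp [annotate, ih]

/-- The assertion generated for the instruction `ι` at `L` with mark `μ`, given the assertions at later
positions. -/
def markValue (P : Program) (K : Contract) (H : List Handler) (g : ℕ → List GhostUpdate)
    (W : ℕ → Assertion) (L : ℕ) (ι : Instr) : Mark → Assertion
  | .cut φ => φ
  | .beforeGhost φ => ghostWp (g L) φ
  | .computed => ghostWp (g L)
      (wpInstr P (fun _ _ _ => monitorInvariant K) (monitorInvariant K) H W L ι)

/-- The assertion is computed from the part of the array that follows it. The leading `ff` stands
for the position itself, so that offset `1` is the next position. -/
theorem annotate_getElem? (P : Program) (K : Contract) (H : List Handler) (g : ℕ → List GhostUpdate)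
    {ι : Instr} {μ : Mark} (l : List (Instr × Mark)) : ∀ (L k : ℕ), l[k]? = some (ι, μ) →
    (annotate P K H g L l)[k]? = some (markValue P K H g (fun L' =>
      (Assertion.ff :: (annotate P K H g L l).drop (k + 1)).getD (L' - (L + k)) .ff) (L + k) ι μ) := by
  induction l with
  | nil => intro L k h; simp at h
  | cons x l ih =>
    intro L k h
    cases k with
    | zero =>
      have : x = (ι, μ) := by simpa using h
      subst this
      cases μ <;> rfl
    | succ k =>
      obtain ⟨κ, ν⟩ := x
      have := ih (L + 1) k (by simpa using h)
      have e : ∃ a, annotate P K H g L ((κ, ν) :: l) = a :: annotate P K H g (L + 1) l := ⟨_, rfl⟩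
      obtain ⟨a, e⟩ := e
      rw [e, List.getElem?_cons_succ, this, show L + 1 + k = L + (k + 1) by omega]
      rfl

/-- Instructions whose successors within the method are at later positions. -/
def Instr.Forward (L : ℕ) : Instr → Prop
  | .goto L' => L < L'
  | .ifeq L' => L < L'
  | .exit => True
  | ι => ι.data.isSome

/-- A forward instruction consults the annotation only at later positions, which the backward pass
has already fixed. -/
theorem wpInstr_congr {P : Program} {pre : ℕ → ℕ → ℕ → Assertion} {post : Assertion} {H : List Handler}
    {W W' : ℕ → Assertion} {L : ℕ} {ι : Instr} (hι : ι.Forward L) (h : ∀ L', L < L' → W L' = W' L') :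
    wpInstr P pre post H W L ι = wpInstr P pre post H W' L ι := by
  have h1 := h (L + 1) (Nat.lt_succ_self L)
  cases ι with
  | goto L' => exact h L' hι
  | ifeq L' => simp only [wpInstr, h1, h L' hι]
  | athrow => simp [Instr.Forward, Instr.data] at hι
  | ificmpeq => simp [Instr.Forward, Instr.data] at hι
  | _ => simp only [wpInstr, h1]

/-! ### The structure of inlined code -/

theorem clauseCode_length (v done : ℕ) (l : List Clause) : ∀ p,
    (clauseCode v done p l).length = 4 * l.length + 2 := by
  induction l with
  | nil => intro p; rfl
  | cons cl l ih => intro p; simp [clauseCode, ih]; ring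

/-- Addresses occur only as jump targets. Hence the length is known before the addresses are, which
resolves the circularity between code layout and jump targets. -/
theorem eventCode_length_eq (v done done' : ℕ) (l : List (ℕ × Option (List Clause))) : ∀ p p',
    (eventCode v done p l).length = (eventCode v done' p' l).length := by
  induction l with
  | nil => intro p p'; rfl
  | cons q l ih =>
    obtain ⟨d, o⟩ := q
    intro p p'
    cases o <;> simp only [eventCode, List.length_append, List.length_cons, List.length_nil,
      clauseCode_length] <;> rw [ih _ _]

theorem eventBlock_length_eq (v p p' : ℕ) (l : List (ℕ × Option (List Clause))) :
    (eventBlock v p l).length = (eventBlock v p' l).length := eventCode_length_eq _ _ _ _ _ _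

theorem markHead_length (μ : Mark) (l : List Instr) : (markHead μ l).length = l.length := by
  cases l <;> simp [markHead]

theorem map_computed_fst (l : List Instr) : (l.map fun κ => (κ, Mark.computed)).map Prod.fst = l := by
  induction l with
  | nil => rfl
  | cons x l ih => rw [List.map_cons, List.map_cons, ih]

theorem markHead_fst (μ : Mark) (l : List Instr) : (markHead μ l).map Prod.fst = l := by
  cases l with
  | nil => rfl
  | cons x l => rw [markHead, List.map_cons, map_computed_fst]

theorem markHead_getElem? (μ : Mark) {l : List Instr} {k : ℕ} {ι : Instr} (h : l[k]? = some ι) :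
    (markHead μ l)[k]? = some (ι, if k = 0 then μ else .computed) := by
  cases l with
  | nil => simp at h
  | cons x l =>
    cases k with
    | zero => simpa [markHead] using h
    | succ k => simp only [List.getElem?_cons_succ] at h; simp [markHead, h]

theorem saveCode_ne_nil (v n : ℕ) : saveCode v n ≠ [] := by simp [saveCode]

/-- This justifies computing new labels with a dummy labelling and a dummy address. -/
theorem inlineInstr_length (P : Program) (K : Contract) (v : ℕ) (lab : ℕ → ℕ) (p : ℕ) (ι : Instr) :
    (inlineInstr P K v lab p ι).1.length = (inlineInstr P K v id 0 ι).1.length := by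
  cases ι with
  | invoke c m n =>
    simp only [inlineInstr]
    split
    · simp only [callBlock, List.length_append, markHead_length, List.length_map, List.length_cons,
        List.length_nil]
      rw [eventBlock_length_eq v _ (0 + (saveCode v n).length),
        eventBlock_length_eq v _ 0 (eventClauses P K MethodSpec.exceptional c m n),
        eventBlock_length_eq v _ 0 (eventClauses P K MethodSpec.after c m n)]
      rw [eventBlock_length_eq v (_ + 4) 0 (eventClauses P K MethodSpec.exceptional c m n),
        eventBlock_length_eq v (_ + 1) 0 (eventClauses P K MethodSpec.after c m n)]
    · rfl
  | _ => rfl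

section
variable {P : Program} {K : Contract} {code : List Instr}

theorem inlineCode_seg {i : ℕ} {ι : Instr} (h : code[i]? = some ι) :
    Seg (inlineCode P K code) (newLabel P K code i)
      (inlineInstr P K (freshLocal code) (newLabel P K code) (newLabel P K code i) ι).1 :=
  seg_flatMap_zipIdx (f := fun q => (inlineInstr P K (freshLocal code) (newLabel P K code)
    (newLabel P K code q.2) q.1).1) (fun _ _ => inlineInstr_length _ _ _ _ _ _) h

theorem exists_of_inlineCode {L : ℕ} {y : Instr × Mark} (h : (inlineCode P K code)[L]? = some y) :
    ∃ i ι k, code[i]? = some ι ∧ L = newLabel P K code i + k ∧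
      (inlineInstr P K (freshLocal code) (newLabel P K code) (newLabel P K code i) ι).1[k]? = some y :=
  exists_of_flatMap_zipIdx (f := fun q => (inlineInstr P K (freshLocal code) (newLabel P K code)
    (newLabel P K code q.2) q.1).1) (fun _ _ => inlineInstr_length _ _ _ _ _ _) h

theorem newLabel_succ (lab : ℕ → ℕ) (p : ℕ) {i : ℕ} {ι : Instr} (h : code[i]? = some ι) :
    newLabel P K code (i + 1) =
      newLabel P K code i + (inlineInstr P K (freshLocal code) lab p ι).1.length := by
  rw [newLabel, List.take_add_one, h, newLabel, inlineInstr_length]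
  simp

theorem newLabel_mono {i j : ℕ} (h : i ≤ j) : newLabel P K code i ≤ newLabel P K code j := by
  obtain ⟨k, rfl⟩ := Nat.exists_eq_add_of_le h
  rw [newLabel, newLabel, List.take_add, List.map_append, List.sum_append]
  exact Nat.le_add_right _ _

/-- The inlined block at the call `c.m` at position `p`. -/
structure IsBlock (P : Program) (K : Contract) (code : List Instr) (v p q c m n : ℕ) : Prop where
  rel : relevant P K c m n = true
  before : Seg (inlineCode P K code) p (markHead (.cut (monitorInvariant K)) (saveCode v n ++
    eventBlock v (p + (saveCode v n).length) (eventClauses P K MethodSpec.before c m n)))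
  pos : q = p + (saveCode v n).length +
    (eventBlock v (p + (saveCode v n).length) (eventClauses P K MethodSpec.before c m n)).length
  call : Seg (inlineCode P K code) q [(.invoke c m n, .beforeGhost (callInvariant K v n)),
    (.astore (v + 1), .cut (callInvariant K v n)), (.aload (v + 1), .computed),
    (.goto (q + 4 + (eventBlock v (q + 4) (eventClauses P K MethodSpec.exceptional c m n)).length + 1),
      .computed)]
  exc : Seg (inlineCode P K code) (q + 4) (markHead (.cut (callInvariant K v n))
    (eventBlock v (q + 4) (eventClauses P K MethodSpec.exceptional c m n)))
  rethrow : (inlineCode P K code)[q + 4 +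
    (eventBlock v (q + 4) (eventClauses P K MethodSpec.exceptional c m n)).length]? =
    some (.athrow, .cut (monitorInvariant K))
  after : Seg (inlineCode P K code)
    (q + 4 + (eventBlock v (q + 4) (eventClauses P K MethodSpec.exceptional c m n)).length + 1)
    ((eventBlock v (q + 4 + (eventBlock v (q + 4)
      (eventClauses P K MethodSpec.exceptional c m n)).length + 1)
      (eventClauses P K MethodSpec.after c m n)).map fun ι => (ι, Mark.computed))

theorem callBlock_isBlock {v p c m n : ℕ} (hr : relevant P K c m n = true)
    (h : Seg (inlineCode P K code) p (callBlock P K v p c m n).1) :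
    IsBlock P K code v p (callBlock P K v p c m n).2.1 c m n := by
  simp only [callBlock] at h
  set S := saveCode v n with hS
  set B := eventBlock v (p + S.length) (eventClauses P K MethodSpec.before c m n) with hB
  set q := p + S.length + B.length with hq
  set E := eventBlock v (q + 4) (eventClauses P K MethodSpec.exceptional c m n) with hE
  set F := eventBlock v (q + 4 + E.length + 1) (eventClauses P K MethodSpec.after c m n) with hF
  have h1 := h.left.left.left.left
  have h2 := h.left.left.left
  have h3 := h.left.left.right
  have h4 := h.left.right
  have h5 := h.right
  simp only [List.length_append, markHead_length, List.length_cons, List.length_nil] at h2 h3 h4 h5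
  refine ⟨hr, h1.left, rfl, ?_, ?_, ?_, ?_⟩
  · change Seg _ q _
    have h6 := h2
    rw [List.append_assoc] at h6
    have h7 := h6.right
    simp only [List.length_append, markHead_length] at h7
    rw [← Nat.add_assoc] at h7
    exact h7
  · rwa [show p + (S.length + B.length + (0 + 1) + (0 + 1 + 1 + 1)) = q + 4 by omega] at h3
  · have := h4.head
    rwa [show p + (S.length + B.length + (0 + 1) + (0 + 1 + 1 + 1) + E.length) = q + 4 + E.length by
      omega] at this
  · rwa [show p + (S.length + B.length + (0 + 1) + (0 + 1 + 1 + 1) + E.length + (0 + 1)) =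
      q + 4 + E.length + 1 by omega] at h5

theorem callBlock_length (P : Program) (K : Contract) (v p c m n : ℕ) :
    p + (callBlock P K v p c m n).1.length = (callBlock P K v p c m n).2.1 + 4 +
      (eventBlock v ((callBlock P K v p c m n).2.1 + 4)
        (eventClauses P K MethodSpec.exceptional c m n)).length + 1 +
      (eventBlock v ((callBlock P K v p c m n).2.1 + 4 +
        (eventBlock v ((callBlock P K v p c m n).2.1 + 4)
        (eventClauses P K MethodSpec.exceptional c m n)).length + 1)
        (eventClauses P K MethodSpec.after c m n)).length := by
  simp only [callBlock, List.length_append, markHead_length, List.length_cons, List.length_nil,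
    List.length_map]
  omega

/-- Every instruction of the inlined code is either the translation of an instruction that is not
changed, or part of the block for a security relevant call. -/
theorem inlineCode_cases {L : ℕ} {y : Instr × Mark} (h : (inlineCode P K code)[L]? = some y) :
    ∃ i ι, code[i]? = some ι ∧
      ((L = newLabel P K code i ∧ newLabel P K code (i + 1) = L + 1 ∧
        y = (ι.relabel (newLabel P K code), .cut (monitorInvariant K)) ∧
        ∀ c m n, ι = .invoke c m n → relevant P K c m n = false) ∨
      ∃ c m n k, ι = .invoke c m n ∧ relevant P K c m n = true ∧ L = newLabel P K code i + k ∧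
        Seg (inlineCode P K code) (newLabel P K code i)
          (callBlock P K (freshLocal code) (newLabel P K code i) c m n).1 ∧
        newLabel P K code (i + 1) = newLabel P K code i +
          (callBlock P K (freshLocal code) (newLabel P K code i) c m n).1.length ∧
        (callBlock P K (freshLocal code) (newLabel P K code i) c m n).1[k]? = some y) := by
  obtain ⟨i, ι, k, h1, h2, h3⟩ := exists_of_inlineCode h
  refine ⟨i, ι, h1, ?_⟩
  have h4 := inlineCode_seg (P := P) (K := K) h1
  have h5 := newLabel_succ (P := P) (K := K) (newLabel P K code) (newLabel P K code i) h1
  by_cases hr : ∃ c m n, ι = .invoke c m n ∧ relevant P K c m n = true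
  · obtain ⟨c, m, n, rfl, hr⟩ := hr
    have e : inlineInstr P K (freshLocal code) (newLabel P K code) (newLabel P K code i) (.invoke c m n)
      = ((callBlock P K (freshLocal code) (newLabel P K code i) c m n).1,
        [⟨(callBlock P K (freshLocal code) (newLabel P K code i) c m n).2.1,
          (callBlock P K (freshLocal code) (newLabel P K code i) c m n).2.1 + 1,
          (callBlock P K (freshLocal code) (newLabel P K code i) c m n).2.2, throwable⟩]) := by
      simp only [inlineInstr, hr, if_true]
    rw [e] at h3 h4 h5
    exact .inr ⟨c, m, n, k, rfl, hr, h2, h4, h5, h3⟩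
  · have hr' : ∀ c m n, ι = .invoke c m n → relevant P K c m n = false := fun c m n e => by
      by_contra hh
      exact hr ⟨c, m, n, e, by simpa using hh⟩
    have e : inlineInstr P K (freshLocal code) (newLabel P K code) (newLabel P K code i) ι
      = ([(ι.relabel (newLabel P K code), .cut (monitorInvariant K))], []) := by
      cases ι with
      | invoke c m n => simp only [inlineInstr, hr' c m n rfl]; rfl
      | _ => rfl
    rw [e] at h3 h5
    refine .inl ?_
    cases k with
    | zero => exact ⟨h2, by rw [h5, h2]; rfl, by simpa using h3.symm, hr'⟩
    | succ k => simp at h3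

/-- An unchanged instruction carries the invariant, and so does the head of a block, which exists
because at least the target is stored. All jump and handler targets of the client thus carry the
invariant. -/
theorem newLabel_cut {i : ℕ} (h : i < code.length) :
    ∃ ι, (inlineCode P K code)[newLabel P K code i]? = some (ι, .cut (monitorInvariant K)) := by
  have hx := List.getElem?_eq_getElem h
  have h4 := inlineCode_seg (P := P) (K := K) hx
  obtain ⟨ι, e⟩ : ∃ ι, (inlineInstr P K (freshLocal code) (newLabel P K code) (newLabel P K code i)
      code[i]).1[0]? = some (ι, .cut (monitorInvariant K)) := by
    cases code[i] with
    | invoke c m n =>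
      simp only [inlineInstr]
      split
      · simp only [callBlock]
        obtain ⟨ι, l, hl⟩ := List.exists_cons_of_ne_nil (saveCode_ne_nil (freshLocal code) n)
        refine ⟨ι, ?_⟩
        rw [hl]; rfl
      · exact ⟨_, rfl⟩
    | _ => exact ⟨_, rfl⟩
  exact ⟨ι, h4.get e⟩

end

/-! ### Ghost updates and handlers of inlined code -/

/-- A failed guard leads to the next clause and a performed update to `done`, which lies behind the
code. -/
theorem clauseCode_forward (v done : ℕ) (l : List Clause) : ∀ p, p + (clauseCode v done p l).length ≤ done →
    ∀ (k : ℕ) (ι : Instr), (clauseCode v done p l)[k]? = some ι → ι.Forward (p + k) := by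
  induction l with
  | nil =>
    intro p _ k ι h
    match k, h with
    | 0, h => cases h; trivial
    | 1, h => cases h; trivial
    | k + 2, h => simp [clauseCode] at h
  | cons cl l ih =>
    intro p hp k ι h
    simp only [clauseCode_length, List.length_cons] at hp
    match k, h with
    | 0, h => cases h; rfl
    | 1, h => cases h; change p + 1 < p + 4; omega
    | 2, h => cases h; rfl
    | 3, h => cases h; change p + 3 < done; omega
    | k + 4, h =>
      rw [show p + (k + 4) = p + 4 + k by omega]
      refine ih (p + 4) (by rw [clauseCode_length]; omega) k ι ?_
      simpa [clauseCode] using h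

/-- The code that enacts the clauses for one class. -/
def bodyCode (v done p : ℕ) (o : Option (List Clause)) : List Instr :=
  o.elim [.goto done] (clauseCode v done p)

theorem eventCode_cons (v done p d : ℕ) (o : Option (List Clause)) (l : List (ℕ × Option (List Clause))) :
    eventCode v done p ((d, o) :: l) =
      [.aload v, .instanceof d, .ifeq (p + 3 + (bodyCode v done (p + 3) o).length)] ++
        bodyCode v done (p + 3) o ++ eventCode v done (p + 3 + (bodyCode v done (p + 3) o).length) l := by
  cases o <;> rfl

theorem eventCode_forward (v done : ℕ) (l : List (ℕ × Option (List Clause))) : ∀ p,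
    p + (eventCode v done p l).length ≤ done →
    ∀ (k : ℕ) (ι : Instr), (eventCode v done p l)[k]? = some ι → ι.Forward (p + k) := by
  induction l with
  | nil => intro p _ k ι h; simp [eventCode] at h
  | cons q l ih =>
    obtain ⟨d, o⟩ := q
    intro p hp k ι h
    rw [eventCode_cons] at h hp
    set body := bodyCode v done (p + 3) o with hbody
    simp only [List.length_append, List.length_cons, List.length_nil] at hp
    rcases Nat.lt_or_ge k 3 with hk | hk
    · have h' : ([.aload v, .instanceof d, .ifeq (p + 3 + body.length)] : List Instr)[k]? = some ι := by
        rwa [List.append_assoc, List.getElem?_append_left (by simpa using hk)] at h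
      match k, h' with
      | 0, h => cases h; rfl
      | 1, h => cases h; rfl
      | 2, h => cases h; change p + 2 < p + 3 + body.length; omega
    · obtain ⟨k, rfl⟩ := Nat.exists_eq_add_of_le hk
      rw [List.append_assoc, List.getElem?_append_right (by simp)] at h
      simp only [List.length_cons, List.length_nil] at h
      rw [show 3 + k - (0 + 1 + 1 + 1) = k by omega] at h
      rcases Nat.lt_or_ge k body.length with hk | hk
      · rw [List.getElem?_append_left hk] at h
        rw [← Nat.add_assoc]
        cases o with
        | none =>
          match k, h with
          | 0, h => cases h; change p + 3 + 0 < done; omega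
          | k + 1, h => simp [hbody, bodyCode] at h
        | some cls => exact clauseCode_forward v done cls (p + 3) (by
            change p + 3 + body.length ≤ done; omega) k ι h
      · rw [List.getElem?_append_right hk] at h
        have := ih (p + 3 + body.length) (by omega) _ ι h
        rwa [show p + 3 + body.length + (k - body.length) = p + (3 + k) by omega] at this

theorem eventBlock_forward {v p : ℕ} {l : List (ℕ × Option (List Clause))} {k : ℕ} {ι : Instr}
    (h : (eventBlock v p l)[k]? = some ι) : ι.Forward (p + k) :=
  eventCode_forward v _ l p (by rw [eventCode_length_eq v _ 0 l p p]) k ι h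

theorem saveCode_data {v n k : ℕ} {ι : Instr} (h : (saveCode v n)[k]? = some ι) : ι.data.isSome := by
  have := List.mem_of_getElem? h
  simp only [saveCode, List.mem_append, List.mem_map, List.mem_cons, List.not_mem_nil, or_false] at this
  rcases this with (⟨_, _, rfl⟩ | rfl | rfl) | ⟨_, _, rfl⟩ <;> rfl

theorem Instr.forward_of_data {ι : Instr} (h : ι.data.isSome) (L : ℕ) : ι.Forward L := by
  cases ι <;> first | exact h | simp [Instr.data] at h

theorem eventBlock_ne_nil (v p : ℕ) {l : List (ℕ × Option (List Clause))} (h : l ≠ []) :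
    eventBlock v p l ≠ [] := by
  obtain ⟨⟨d, o⟩, l, rfl⟩ := List.exists_cons_of_ne_nil h
  simp [eventBlock, eventCode]

/-- Relevance provides a candidate class. So the code for an event is not empty, even if the
contract has no clauses for that event, and it has a first instruction that can carry a mark. -/
theorem eventClauses_ne_nil {P : Program} {K : Contract} {c m n : ℕ} (h : relevant P K c m n = true)
    (ev : MethodSpec → Option (List Clause)) : eventClauses P K ev c m n ≠ [] := by
  intro e
  rw [eventClauses, List.map_eq_nil_iff] at e
  simp [relevant, e] at h

/-- The two marks are distinguishable by size, so the marks reveal which positions are next to an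
inlined call. -/
theorem callInvariant_ne (K : Contract) (v n : ℕ) : callInvariant K v n ≠ monitorInvariant K := by
  intro h
  have := congrArg Assertion.size h
  simp only [callInvariant, Assertion.size] at this
  omega

section
variable {P : Program} {K : Contract} {code : List Instr} {v p q c m n : ℕ}

/-- The length of the code for exceptions. -/
abbrev excLength (P : Program) (K : Contract) (v q c m n : ℕ) : ℕ :=
  (eventBlock v (q + 4) (eventClauses P K MethodSpec.exceptional c m n)).length

/-- The position of the code behind the handler. -/
abbrev afterPos (P : Program) (K : Contract) (v q c m n : ℕ) : ℕ := q + 4 + excLength P K v q c m n + 1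

/-- The parts of a block: code before the call, the call and the three instructions behind it,
handler code, rethrow, and code after a normal return. Every later case distinction on positions
goes through this one. -/
theorem IsBlock.position_cases (B : IsBlock P K code v p q c m n) {L : ℕ} (h1 : p ≤ L)
    (h2 : L < afterPos P K v q c m n +
      (eventBlock v (afterPos P K v q c m n) (eventClauses P K MethodSpec.after c m n)).length) :
    (∃ ι, (inlineCode P K code)[L]? = some (ι, if L = p then .cut (monitorInvariant K) else .computed) ∧
      ι.Forward L ∧ (L = p → ι.data.isSome) ∧ L < q) ∨ L = q ∨ L = q + 1 ∨ L = q + 2 ∨ L = q + 3 ∨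
    (∃ ι, (inlineCode P K code)[L]? =
      some (ι, if L = q + 4 then .cut (callInvariant K v n) else .computed) ∧ ι.Forward L) ∨
    (inlineCode P K code)[L]? = some (.athrow, .cut (monitorInvariant K)) ∨
    (∃ ι, (inlineCode P K code)[L]? = some (ι, .computed) ∧ ι.Forward L) := by
  have hpos := B.pos
  rcases Nat.lt_or_ge L q with hq | hq
  · refine .inl ?_
    obtain ⟨k, rfl⟩ := Nat.exists_eq_add_of_le h1
    have hk : k < (saveCode v n ++ eventBlock v (p + (saveCode v n).length)
      (eventClauses P K MethodSpec.before c m n)).length := by rw [List.length_append]; omega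
    obtain ⟨ι, hι⟩ : ∃ ι, (saveCode v n ++ eventBlock v (p + (saveCode v n).length)
      (eventClauses P K MethodSpec.before c m n))[k]? = some ι := ⟨_, List.getElem?_eq_getElem hk⟩
    refine ⟨ι, ?_, ?_, ?_, hq⟩
    · rw [B.before.get (markHead_getElem? _ hι)]
      simp
    · rcases Nat.lt_or_ge k (saveCode v n).length with h | h
      · rw [List.getElem?_append_left h] at hι
        exact Instr.forward_of_data (saveCode_data hι) _
      · rw [List.getElem?_append_right h] at hι
        have := eventBlock_forward hι
        rwa [show p + (saveCode v n).length + (k - (saveCode v n).length) = p + k by omega] at this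
    · intro hp
      have h : k < (saveCode v n).length := by
        have := List.length_pos_of_ne_nil (saveCode_ne_nil v n); omega
      rw [List.getElem?_append_left h] at hι
      exact saveCode_data hι
  refine .inr ?_
  by_cases e0 : L = q
  · exact .inl e0
  by_cases e1 : L = q + 1
  · exact .inr (.inl e1)
  by_cases e2 : L = q + 2
  · exact .inr (.inr (.inl e2))
  by_cases e3 : L = q + 3
  · exact .inr (.inr (.inr (.inl e3)))
  refine .inr (.inr (.inr (.inr ?_)))
  rcases Nat.lt_or_ge L (q + 4 + excLength P K v q c m n) with h3 | h3
  · refine .inl ?_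
    obtain ⟨k, rfl⟩ := Nat.exists_eq_add_of_le (show q + 4 ≤ L by omega)
    have hk : k < excLength P K v q c m n := by omega
    have hι := List.getElem?_eq_getElem hk
    refine ⟨_, ?_, eventBlock_forward hι⟩
    rw [B.exc.get (markHead_getElem? _ hι)]
    simp
  refine .inr ?_
  by_cases e4 : L = q + 4 + excLength P K v q c m n
  · refine .inl ?_
    rw [e4]; exact B.rethrow
  · refine .inr ?_
    obtain ⟨k, rfl⟩ := Nat.exists_eq_add_of_le (show afterPos P K v q c m n ≤ L by
      simp only [afterPos]; omega)
    have hk : k < (eventBlock v (afterPos P K v q c m n) (eventClauses P K MethodSpec.after c m n)).length := by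
      omega
    have hι := List.getElem?_eq_getElem hk
    refine ⟨_, ?_, eventBlock_forward hι⟩
    exact B.after.get (by rw [List.getElem?_map, hι]; rfl)

theorem IsBlock.call_eq (B : IsBlock P K code v p q c m n) :
    (inlineCode P K code)[q]? = some (.invoke c m n, .beforeGhost (callInvariant K v n)) := B.call.head
theorem IsBlock.call_add_one (B : IsBlock P K code v p q c m n) :
    (inlineCode P K code)[q + 1]? = some (.astore (v + 1), .cut (callInvariant K v n)) := B.call.tail.head
theorem IsBlock.call_add_two (B : IsBlock P K code v p q c m n) :
    (inlineCode P K code)[q + 2]? = some (.aload (v + 1), .computed) := B.call.tail.tail.head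
theorem IsBlock.call_add_three (B : IsBlock P K code v p q c m n) :
    (inlineCode P K code)[q + 3]? = some (.goto (afterPos P K v q c m n), .computed) :=
  B.call.tail.tail.tail.head
theorem IsBlock.call_add_four (B : IsBlock P K code v p q c m n) :
    (inlineCode P K code)[q + 4]? = some (.aload v, .cut (callInvariant K v n)) := by
  obtain ⟨⟨d, o⟩, l, e⟩ := List.exists_cons_of_ne_nil (eventClauses_ne_nil B.rel MethodSpec.exceptional)
  have := B.exc
  rw [e] at this
  exact this.head

theorem not_forward_invoke (L : ℕ) : ¬ (Instr.invoke c m n).Forward L := by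
  simp [Instr.Forward, Instr.data]

/-- Security relevant calls of inlined code are those in the inlined blocks. -/
theorem exists_isBlock {μ : Mark} (h : (inlineCode P K code)[q]? = some (.invoke c m n, μ))
    (hr : relevant P K c m n = true) :
    ∃ i, code[i]? = some (.invoke c m n) ∧
      q = (callBlock P K (freshLocal code) (newLabel P K code i) c m n).2.1 ∧
      newLabel P K code i ≤ q ∧ q < newLabel P K code (i + 1) ∧
      IsBlock P K code (freshLocal code) (newLabel P K code i) q c m n := by
  obtain ⟨i, ι, hi, ⟨_, _, h3, h4⟩ | ⟨c', m', n', k, rfl, hr', hL, hseg, hlab, hk⟩⟩ := inlineCode_cases h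
  · have h5 : ι.relabel (newLabel P K code) = .invoke c m n := (congrArg Prod.fst h3).symm
    have h6 : ι = .invoke c m n := by cases ι <;> simp_all [Instr.relabel]
    rw [h4 _ _ _ h6] at hr
    cases hr
  · have B := callBlock_isBlock hr' hseg
    have hlen := callBlock_length P K (freshLocal code) (newLabel P K code i) c' m' n'
    have hklt := (List.getElem?_eq_some_iff.1 hk).1
    have hp : newLabel P K code i ≤ (callBlock P K (freshLocal code) (newLabel P K code i) c' m' n').2.1 := by
      rw [B.pos]; omega
    set q' := (callBlock P K (freshLocal code) (newLabel P K code i) c' m' n').2.1 with hq'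
    -- Event code and saving code consist of forward instructions, which excludes calls, and the
    -- remaining positions are explicit.
    have key : q = q' := by
      rcases B.position_cases (L := q) (by omega) (by
        simp only [afterPos, excLength]; omega) with ⟨ι, h1, h2, _⟩ | rfl | rfl | rfl | rfl | ⟨ι, h1, h2⟩ | h1 |
        ⟨ι, h1, h2⟩
      · rw [h] at h1
        have : ι = .invoke c m n := by cases h1; rfl
        subst this
        exact absurd h2 (not_forward_invoke _)
      · rfl
      · rw [B.call_add_one] at h; cases h
      · rw [B.call_add_two] at h; cases h
      · rw [B.call_add_three] at h; cases h
      · rw [h] at h1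
        have : ι = .invoke c m n := by cases h1; rfl
        subst this
        exact absurd h2 (not_forward_invoke _)
      · rw [h1] at h; cases h
      · rw [h] at h1
        have : ι = .invoke c m n := by cases h1; rfl
        subst this
        exact absurd h2 (not_forward_invoke _)
    have e := B.call_eq
    rw [← key, h] at e
    obtain ⟨rfl, rfl, rfl⟩ : c = c' ∧ m = m' ∧ n = n' := by
      injection e with e; injection e with e _; injection e with a b c; exact ⟨a, b, c⟩
    rw [← key] at B
    exact ⟨i, hi, key, key ▸ hp, by omega, B⟩

/-- The handlers added for inlined calls. -/
abbrev addedHandlers (P : Program) (K : Contract) (code : List Instr) : List Handler :=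
  code.zipIdx.flatMap fun q => (inlineInstr P K (freshLocal code) (newLabel P K code)
    (newLabel P K code q.2) q.1).2

theorem handlers_inlineInstr (v : ℕ) (lab : ℕ → ℕ) (p : ℕ) (ι : Instr) {h : Handler}
    (hh : h ∈ (inlineInstr P K v lab p ι).2) : ∃ c m n, ι = .invoke c m n ∧
      relevant P K c m n = true ∧ (inlineInstr P K v lab p ι).1 = (callBlock P K v p c m n).1 ∧
      h = ⟨(callBlock P K v p c m n).2.1, (callBlock P K v p c m n).2.1 + 1,
        (callBlock P K v p c m n).2.1 + 4, throwable⟩ := by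
  cases ι with
  | invoke c m n =>
    by_cases hr : relevant P K c m n = true
    · refine ⟨c, m, n, rfl, hr, ?_⟩
      simp only [inlineInstr, hr, if_true, List.mem_singleton] at hh ⊢
      exact ⟨trivial, hh⟩
    · simp [inlineInstr, hr] at hh
  | _ => simp [inlineInstr] at hh

theorem mem_addedHandlers {h : Handler} (hh : h ∈ addedHandlers P K code) :
    ∃ q p c m n, h = ⟨q, q + 1, q + 4, throwable⟩ ∧ IsBlock P K code (freshLocal code) p q c m n := by
  obtain ⟨⟨ι, i⟩, h1, h2⟩ := List.mem_flatMap.1 hh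
  have h3 := List.mem_zipIdx_iff_getElem?.1 h1
  obtain ⟨c, m, n, _, hr, e, rfl⟩ := handlers_inlineInstr _ _ _ _ h2
  have h4 := inlineCode_seg (P := P) (K := K) h3
  rw [e] at h4
  exact ⟨_, _, c, m, n, rfl, callBlock_isBlock hr h4⟩

/-- Added handlers precede the original ones and each covers a single position, its own call. -/
theorem firstHandler_inline {μ : Mark} (h : (inlineCode P K code)[q]? = some (.invoke c m n, μ))
    (hr : relevant P K c m n = true) (H : List Handler) :
    firstHandler (inlineHandlers P K code H) q = some ⟨q, q + 1, q + 4, throwable⟩ := by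
  obtain ⟨i, hi, hq, _, _, _⟩ := exists_isBlock h hr
  have hmem : (⟨q, q + 1, q + 4, throwable⟩ : Handler) ∈ addedHandlers P K code := by
    refine List.mem_flatMap.2 ⟨(.invoke c m n, i), List.mem_zipIdx_iff_getElem?.2 hi, ?_⟩
    simp only [inlineInstr, hr, if_true, List.mem_singleton]
    rw [hq]; rfl
  rw [firstHandler, inlineHandlers, List.find?_append]
  cases e : (addedHandlers P K code).find? fun h => h.covers q with
  | none =>
    have := List.find?_eq_none.1 e _ hmem
    simp [Handler.covers] at this
  | some x =>
    have h1 := List.find?_some e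
    obtain ⟨q', p', c', m', n', rfl, _⟩ := mem_addedHandlers (List.mem_of_find?_eq_some e)
    simp only [Handler.covers, Bool.and_eq_true, decide_eq_true_eq] at h1
    have : q' = q := by omega
    subst this
    rfl

/-- What needs proof is that no other handler shares the target, the first instruction of the
handler code. -/
theorem embedTest_inline (M : Method) (hM : ∀ h ∈ M.handlers, h.target < M.code.length) :
    embedTest (inlineProgram P K) K (inlineMethod P K M) = true := by
  rw [embedTest, List.all_eq_true]
  rintro ⟨ι, q⟩ hq
  rw [List.mem_zipIdx_iff_getElem?] at hq
  cases ι with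
  | invoke c m n =>
    by_cases hr : relevant P K c m n = true
    · change (inlineCode P K M.code |>.map Prod.fst)[q]? = _ at hq
      rw [List.getElem?_map, Option.map_eq_some_iff] at hq
      obtain ⟨⟨ι, μ⟩, h1, rfl : ι = _⟩ := hq
      have h2 := firstHandler_inline h1 hr M.handlers
      obtain ⟨i, hi, hqi, hl, hu, B⟩ := exists_isBlock h1 hr
      change (!relevant (inlineProgram P K) K c m n ||
        (firstHandler (inlineHandlers P K M.code M.handlers) q).elim _ _) = true
      rw [h2]
      simp only [Option.elim, teq_iff, Bool.or_eq_true, Bool.and_eq_true]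
      refine .inr ⟨⟨⟨trivial, trivial⟩, trivial⟩, ?_⟩
      change (List.filter _ (addedHandlers P K M.code ++ _)).length = 1
      rw [List.filter_append]
      -- Targets of original handlers are marked with the monitor invariant, this one with the call
      -- invariant.
      have h3 : List.filter (fun h : Handler => teq h.target (q + 4)) (M.handlers.map fun h =>
          ⟨newLabel P K M.code h.b, newLabel P K M.code h.e, newLabel P K M.code h.target, h.cls⟩) = [] := by
        rw [List.filter_eq_nil_iff]
        intro h hh
        obtain ⟨h', hh', rfl⟩ := List.mem_map.1 hh
        intro e
        rw [teq_iff] at e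
        obtain ⟨ι, hι⟩ := newLabel_cut (P := P) (K := K) (hM _ hh')
        dsimp only at e
        rw [e, B.call_add_four] at hι
        injection hι with hι
        injection hι with _ hι
        injection hι with hι
        exact callInvariant_ne _ _ _ hι
      rw [h3, List.append_nil, addedHandlers, List.filter_flatMap,
        flatMap_zipIdx_single (f := fun a => List.filter (fun h : Handler => teq h.target (q + 4))
          (inlineInstr P K (freshLocal M.code) (newLabel P K M.code) (newLabel P K M.code a.2) a.1).2) hi]
      · simp only [inlineInstr, hr, if_true]
        rw [List.filter_singleton]
        rw [show teq _ (q + 4) = true from (teq_iff _ _).2 (by rw [hqi]; rfl)]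
        rfl
      -- Handlers added for other calls have their targets in other blocks, whose address ranges are
      -- disjoint from this one.
      · intro j y hj hne
        rw [List.filter_eq_nil_iff]
        intro h hh
        obtain ⟨c', m', n', rfl, hr', e, rfl⟩ := handlers_inlineInstr _ _ _ _ hh
        have h4 := inlineCode_seg (P := P) (K := K) hj
        rw [e] at h4
        have B' := callBlock_isBlock hr' h4
        have hs := newLabel_succ (P := P) (K := K) (newLabel P K M.code) (newLabel P K M.code j) hj
        dsimp only at e
        rw [e] at hs
        have hlen := callBlock_length P K (freshLocal M.code) (newLabel P K M.code j) c' m' n'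
        have hpos := B'.pos
        intro e'
        rw [teq_iff] at e'
        dsimp only at e'
        rcases Nat.lt_or_gt_of_ne hne with h | h
        · have := newLabel_mono (P := P) (K := K) (code := M.code) (show j + 1 ≤ i from h); omega
        · have := newLabel_mono (P := P) (K := K) (code := M.code) (show i + 1 ≤ j from h); omega
    · have : relevant (inlineProgram P K) K c m n = false := by
        change relevant P K c m n = false
        simpa using hr
      simp only [this]; rfl
  | _ => rfl

end

section
variable {P : Program} {K : Contract} {code : List Instr} {v p q c m n : ℕ}

/-- The ghost updates embedded in inlined code. -/
abbrev inlineGhosts (P : Program) (K : Contract) (code : List Instr) (H : List Handler) (L : ℕ) :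
    List GhostUpdate :=
  ghostsAt (inlineProgram P K) K ((inlineCode P K code).map Prod.fst) (inlineHandlers P K code H) L

/-- The ghost updates at `L` for the instruction `q.1` at `q.2`. -/
def ghostsFor (P : Program) (K : Contract) (H : List Handler) (L : ℕ) (q : Instr × ℕ) :
    List GhostUpdate :=
  match q.1 with
  | .invoke c m n =>
    if relevant P K c m n then
      (if q.2 + 1 = L then ghostAfter P K c m n else []) ++
      (if (firstHandler H q.2).map Handler.target = some L then ghostExceptional P K c m n else []) ++
      (if q.2 = L then ghostBefore P K c m n else [])
    else []
  | _ => []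

theorem inlineGhosts_eq (H : List Handler) (L : ℕ) : inlineGhosts P K code H L =
    ((inlineCode P K code).map Prod.fst).zipIdx.flatMap
      (ghostsFor P K (inlineHandlers P K code H) L) := rfl

theorem ghostsFor_relevant {H : List Handler} {L : ℕ} {μ : Mark} (hr : relevant P K c m n = true)
    (h : (inlineCode P K code)[q]? = some (.invoke c m n, μ)) :
    ghostsFor P K (inlineHandlers P K code H) L (.invoke c m n, q) =
      (if q + 1 = L then ghostAfter P K c m n else []) ++
      (if q + 4 = L then ghostExceptional P K c m n else []) ++
      (if q = L then ghostBefore P K c m n else []) := by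
  simp only [ghostsFor, hr, if_true, firstHandler_inline h hr H, Option.map_some, Option.some.injEq]

theorem ghostsFor_eq_nil {H : List Handler} {L : ℕ} {ι : Instr}
    (hq : ((inlineCode P K code).map Prod.fst)[q]? = some ι)
    (h : ∀ p v c m n, IsBlock P K code v p q c m n → L ≠ q ∧ L ≠ q + 1 ∧ L ≠ q + 4) :
    ghostsFor P K (inlineHandlers P K code H) L (ι, q) = [] := by
  cases ι with
  | invoke c m n =>
    by_cases hr : relevant P K c m n = true
    · rw [List.getElem?_map, Option.map_eq_some_iff] at hq
      obtain ⟨⟨ι, μ⟩, h1, rfl : ι = _⟩ := hq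
      obtain ⟨i, _, _, _, _, B⟩ := exists_isBlock h1 hr
      obtain ⟨a, b, d⟩ := h _ _ _ _ _ B
      rw [ghostsFor_relevant hr h1, if_neg (Ne.symm a), if_neg (Ne.symm b), if_neg (Ne.symm d)]
      rfl
    · simp only [ghostsFor, hr]; rfl
  | _ => rfl

/-- Ghost updates occur only at a call, behind it and at its handler, and those three positions
carry different marks. -/
theorem inlineGhosts_eq_nil {L : ℕ} {ι : Instr} {μ : Mark} (h : (inlineCode P K code)[L]? = some (ι, μ))
    (hμ : μ = .cut (monitorInvariant K) ∨ μ = .computed) (H : List Handler) :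
    inlineGhosts P K code H L = [] := by
  rw [inlineGhosts_eq]
  refine flatMap_zipIdx_nil fun q κ hq => ghostsFor_eq_nil hq fun p v c m n B => ⟨?_, ?_, ?_⟩
  · rintro rfl
    rw [B.call_eq] at h; cases h; simp at hμ
  · rintro rfl
    rw [B.call_add_one] at h; cases h; simp [callInvariant_ne] at hμ
  · rintro rfl
    rw [B.call_add_four] at h; cases h; simp [callInvariant_ne] at hμ

theorem IsBlock.fst_getElem? (B : IsBlock P K code v p q c m n) :
    ((inlineCode P K code).map Prod.fst)[q]? = some (.invoke c m n) := by
  rw [List.getElem?_map, B.call_eq]; rfl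

/-- An update contributed by another call would make this position the successor or handler head of
that call, where the instruction is a different one. -/
theorem IsBlock.ghosts_call (B : IsBlock P K code v p q c m n) (H : List Handler) :
    inlineGhosts P K code H q = ghostBefore P K c m n := by
  rw [inlineGhosts_eq, flatMap_zipIdx_single B.fst_getElem?, ghostsFor_relevant B.rel B.call_eq,
    if_neg (by omega), if_neg (by omega), if_pos rfl]
  · rfl
  · intro j y hj hne
    refine ghostsFor_eq_nil hj fun p' v' c' m' n' B' => ⟨Ne.symm hne, ?_, ?_⟩
    · rintro rfl
      have := B.call_eq; rw [B'.call_add_one] at this; cases this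
    · rintro rfl
      have := B.call_eq; rw [B'.call_add_four] at this; cases this

theorem IsBlock.ghosts_after (B : IsBlock P K code v p q c m n) (H : List Handler) :
    inlineGhosts P K code H (q + 1) = ghostAfter P K c m n := by
  rw [inlineGhosts_eq, flatMap_zipIdx_single B.fst_getElem?, ghostsFor_relevant B.rel B.call_eq,
    if_pos rfl, if_neg (by omega), if_neg (by omega)]
  · simp
  · intro j y hj hne
    refine ghostsFor_eq_nil hj fun p' v' c' m' n' B' => ⟨?_, by omega, ?_⟩
    · rintro rfl
      have := B.call_add_one; rw [B'.call_eq] at this; cases this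
    · intro e
      have := B.call_add_one; rw [e, B'.call_add_four] at this; cases this

theorem IsBlock.ghosts_exceptional (B : IsBlock P K code v p q c m n) (H : List Handler) :
    inlineGhosts P K code H (q + 4) = ghostExceptional P K c m n := by
  rw [inlineGhosts_eq, flatMap_zipIdx_single B.fst_getElem?, ghostsFor_relevant B.rel B.call_eq,
    if_neg (by omega), if_pos rfl, if_neg (by omega)]
  · simp
  · intro j y hj hne
    refine ghostsFor_eq_nil hj fun p' v' c' m' n' B' => ⟨?_, ?_, by omega⟩
    · rintro rfl
      have := B.call_add_four; rw [B'.call_eq] at this; cases this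
    · intro e
      have := B.call_add_four; rw [e, B'.call_add_one] at this; cases this

/-- The generated assertion at position `L`. -/
def genAt (P : Program) (K : Contract) (M : Method) (L : ℕ) : Assertion :=
  (generateMethod P K M).getD L .ff

variable {M : Method} {L : ℕ} {ι : Instr}

theorem generateMethod_length : (generateMethod P K M).length = (inlineMethod P K M).code.length := by
  change (annotate _ _ _ _ _ _).length = ((inlineCode P K M.code).map Prod.fst).length
  rw [annotate_length, List.length_map]

theorem genAt_eq {μ : Mark} (h : (inlineCode P K M.code)[L]? = some (ι, μ)) :
    genAt P K M L = markValue (inlineProgram P K) K (inlineHandlers P K M.code M.handlers)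
      (inlineGhosts P K M.code M.handlers) (fun L' =>
      (Assertion.ff :: (generateMethod P K M).drop (L + 1)).getD (L' - L) .ff) L ι μ := by
  have := annotate_getElem? (inlineProgram P K) K (inlineHandlers P K M.code M.handlers)
    (inlineGhosts P K M.code M.handlers) (inlineCode P K M.code) 0 L h
  rw [Nat.zero_add] at this
  rw [genAt, List.getD_eq_getElem?_getD]
  exact congrArg (fun o => o.getD .ff) this

theorem genAt_cut {φ : Assertion} (h : (inlineCode P K M.code)[L]? = some (ι, .cut φ)) :
    genAt P K M L = φ := by rw [genAt_eq h]; rfl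

theorem genAt_beforeGhost {φ : Assertion} (h : (inlineCode P K M.code)[L]? = some (ι, .beforeGhost φ)) :
    genAt P K M L = ghostWp (inlineGhosts P K M.code M.handlers L) φ := by rw [genAt_eq h]; rfl

/-- The weakest precondition of `ι` at `L`, without ghost updates. -/
abbrev genWp (P : Program) (K : Contract) (M : Method) (L : ℕ) (ι : Instr) : Assertion :=
  wpInstr (inlineProgram P K) (fun _ _ _ => monitorInvariant K) (monitorInvariant K)
    (inlineHandlers P K M.code M.handlers) (genAt P K M) L ι

/-- There are no ghost updates at computed positions, and a forward instruction sees only assertions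
that agree with the final array. -/
theorem genAt_computed (h : (inlineCode P K M.code)[L]? = some (ι, .computed)) (hι : ι.Forward L) :
    genAt P K M L = genWp P K M L ι := by
  rw [genAt_eq h]
  have hg := inlineGhosts_eq_nil h (.inr rfl) M.handlers
  have e : ∀ a, ghostWp [] a = a := fun _ => rfl
  simp only [markValue, hg, e]
  refine wpInstr_congr hι fun L' hL' => ?_
  obtain ⟨k, rfl⟩ := Nat.exists_eq_add_of_lt hL'
  rw [show L + k + 1 - L = k + 1 by omega, genAt, List.getD_eq_getElem?_getD,
    List.getD_eq_getElem?_getD, List.getElem?_cons_succ, List.getElem?_drop,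
    show L + 1 + k = L + k + 1 by omega]

theorem genAt_newLabel {i : ℕ} (h : i < M.code.length) :
    genAt P K M (newLabel P K M.code i) = monitorInvariant K := by
  obtain ⟨ι, hι⟩ := newLabel_cut (P := P) (K := K) h
  exact genAt_cut hι

/-! ### Weakest preconditions of inlined code -/

theorem subst_pop_push (e : Expr) (a : Assertion) :
    (a.subst { stack := popStack 1 }).subst { stack := pushStack e } = a := by
  rw [Assertion.subst_subst]
  exact Assertion.subst_id a

theorem subst_pop_replaceTop (e : Expr) (a : Assertion) :
    (a.subst { stack := popStack 1 }).subst { stack := replaceTop e } = a.subst { stack := popStack 1 } := by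
  rw [Assertion.subst_subst]
  rfl

/-- Substitution for the execution of the update `u`, whose expressions are in terms of `realPlaces`. -/
def execSubst (v : ℕ) (u : List (ℕ × CExpr)) : Subst where
  static c f := if c = monitorClass then
    ((u.map fun q => (q.1, q.2.inst (realPlaces v))).lookup f).getD (.static c f) else .static c f

theorem execSubst_nil (v : ℕ) : execSubst v [] = {} := by
  simp [execSubst]

variable {W : ℕ → Assertion} {wp : ℕ → Instr → Assertion} {Q : Program}
  {pre : ℕ → ℕ → ℕ → Assertion} {post : Assertion} {H : List Handler} {I : List Instr} {done : ℕ}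

/-- The pushed truth value is consumed by the jump that follows, so only the tests remain, with the
assertion at `done` taken back through the chosen update. -/
theorem clauseCode_wp (l : List Clause) : ∀ p, Seg I p (clauseCode v done p l) →
    (∀ L ι, p ≤ L → L < p + (clauseCode v done p l).length → I[L]? = some ι →
      W L = wpInstr Q pre post H W L ι) →
    W p = clauseFormula (fun g => g.inst (realPlaces v)) (fun u => (W done).subst (execSubst v u)) l := by
  induction l with
  | nil =>
    intro p hs hW
    have h0 := hW p _ le_rfl (by simp [clauseCode]) hs.head
    have h1 := hW (p + 1) _ (by omega) (by simp [clauseCode]) hs.tail.head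
    rw [h0, wpInstr, h1]; rfl
  | cons cl l ih =>
    intro p hs hW
    simp only [clauseCode_length, List.length_cons] at hW
    have s0 : Seg I p (_ :: _) := hs
    have s1 : Seg I (p + 1) (_ :: _) := s0.tail
    have s2 : Seg I (p + 2) (_ :: _) := s1.tail
    have s3 : Seg I (p + 3) (_ :: _) := s2.tail
    have h0 := hW p _ le_rfl (by omega) s0.head
    have h1 := hW (p + 1) _ (by omega) (by omega) s1.head
    have h2 := hW (p + 2) _ (by omega) (by omega) s2.head
    have h3 := hW (p + 3) _ (by omega) (by omega) s3.head
    have h4 := ih (p + 4) s3.tail (fun L ι a b c => hW L ι (by omega) (by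
      rw [clauseCode_length] at b; omega) c)
    rw [h0, wpInstr, h1, wpInstr, show p + 1 + 1 = p + 2 by omega, h2, wpInstr,
      show p + 2 + 1 = p + 3 by omega, h3, wpInstr, h4]
    simp only [clauseFormula, Assertion.ite, Assertion.imp, Assertion.subst, Expr.subst, subst_pop_push]
    rfl

/-- The annotation at the first position is not assumed to be computed, since it may be a mark; the
claim concerns the weakest precondition there. -/
theorem eventCode_wp (l : List (ℕ × Option (List Clause))) : ∀ p, Seg I p (eventCode v done p l) →
    done = p + (eventCode v done p l).length → ∀ κ, (eventCode v done p l).head? = some κ →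
    (∀ L ι, p < L → L < p + (eventCode v done p l).length → I[L]? = some ι →
      W L = wpInstr Q pre post H W L ι) →
    wpInstr Q pre post H W p κ = eventFormula (.loc v) (fun g => g.inst (realPlaces v))
      (fun u => (W done).subst (execSubst v u)) l := by
  induction l with
  | nil => intro p _ _ κ hκ; simp [eventCode] at hκ
  | cons r l ih =>
    obtain ⟨d, o⟩ := r
    intro p hs hd κ hκ hW
    rw [eventCode_cons] at hs hd hκ hW
    set b := bodyCode v done (p + 3) o with hb
    have hlen : (([.aload v, .instanceof d, .ifeq (p + 3 + b.length)] : List Instr) ++ b ++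
      eventCode v done (p + 3 + b.length) l).length = 3 + b.length +
        (eventCode v done (p + 3 + b.length) l).length := by
      simp only [List.length_append, List.length_cons, List.length_nil]
    rw [hlen] at hd hW
    have s0 := hs.left.left
    have sb : Seg I (p + 3) b := hs.left.right
    have se := hs.right
    rw [List.length_append] at se
    have se : Seg I (p + 3 + b.length) (eventCode v done (p + 3 + b.length) l) := by
      rw [← Nat.add_assoc] at se; exact se
    have h1 := hW (p + 1) _ (by omega) (by omega) s0.tail.head
    have h2 := hW (p + 2) _ (by omega) (by omega) s0.tail.tail.head
    have hκ' : κ = .aload v := by simpa using hκ.symm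
    have hb1 : W (p + 3) = o.elim ((W done).subst (execSubst v []))
        (clauseFormula (fun g => g.inst (realPlaces v)) (fun u => (W done).subst (execSubst v u))) := by
      cases o with
      | none =>
        have h3 := hW (p + 3) _ (by omega) (by simp [hb, bodyCode]; omega) sb.head
        rw [h3, wpInstr, Option.elim, execSubst_nil, Assertion.subst_id]
      | some cls =>
        exact clauseCode_wp cls (p + 3) sb fun L ι a b' c => hW L ι (by omega) (by
          change L < p + 3 + b.length at b'; omega) c
    -- If no candidate class is left, control falls through to `done` with no update.
    have hl1 : W (p + 3 + b.length) = eventFormula (.loc v) (fun g => g.inst (realPlaces v))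
      (fun u => (W done).subst (execSubst v u)) l := by
      cases hh : (eventCode v done (p + 3 + b.length) l).head? with
      | none =>
        rw [List.head?_eq_none_iff] at hh
        rw [hh] at hd
        cases l with
        | cons r l =>
          obtain ⟨d', o'⟩ := r
          rw [eventCode_cons] at hh
          simp at hh
        | nil =>
          rw [show p + 3 + b.length = done by rw [hd, List.length_nil]; omega, eventFormula, execSubst_nil, Assertion.subst_id]
      | some κ' =>
        have hlt : 0 < (eventCode v done (p + 3 + b.length) l).length :=
          List.length_pos_of_ne_nil fun e => by rw [e] at hh; simp at hh
        have hhead : I[p + 3 + b.length]? = some κ' := by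
          have := se.get (k := 0) (x := κ') (by rw [← List.head?_eq_getElem?]; exact hh)
          exact this
        rw [hW _ _ (by omega) (by omega) hhead]
        exact ih _ se (by omega) κ' hh fun L ι a b' c => hW L ι (by omega) (by omega) c
    rw [hκ', wpInstr, h1, wpInstr, show p + 1 + 1 = p + 2 by omega, h2, wpInstr,
      show p + 2 + 1 = p + 3 by omega, hb1, hl1]
    simp only [eventFormula, Assertion.ite, Assertion.imp, Assertion.subst, Expr.subst,
      subst_pop_replaceTop, subst_pop_push]
    rfl

end

/-! ### Storing and reloading -/

/-- The substitution for a sequence of instructions. -/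
def seqSubst : List Instr → Subst
  | [] => {}
  | ι :: l => (seqSubst l).comp (ι.data.getD ([], 0)).toSubst

theorem subst_seqSubst_cons (e : Expr) (ι : Instr) (l : List Instr) :
    e.subst (seqSubst (ι :: l)) = (e.subst (seqSubst l)).subst (ι.data.getD ([], 0)).toSubst := by
  rw [Expr.subst_subst]; rfl

theorem subst_seqSubst_append (e : Expr) (s t : List Instr) :
    e.subst (seqSubst (s ++ t)) = (e.subst (seqSubst t)).subst (seqSubst s) := by
  induction s generalizing e with
  | nil => rw [seqSubst, Expr.subst_id]; rfl
  | cons ι s ih => rw [List.cons_append, subst_seqSubst_cons, ih, subst_seqSubst_cons]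

/-- As for event code, the first position may be marked and only its weakest precondition is
computed. -/
theorem seqSubst_wp {W : ℕ → Assertion} {Q : Program} {pre : ℕ → ℕ → ℕ → Assertion} {post : Assertion}
    {H : List Handler} {I : List Instr} (s : List Instr) : ∀ p, Seg I p s →
    (∀ ι ∈ s, ι.data.isSome = true) → ∀ κ, s.head? = some κ →
    (∀ L ι, p < L → L < p + s.length → I[L]? = some ι → W L = wpInstr Q pre post H W L ι) →
    wpInstr Q pre post H W p κ = (W (p + s.length)).subst (seqSubst s) := by
  induction s with
  | nil => intro p _ _ κ h; simp at h
  | cons ι s ih =>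
    intro p hs hd κ hκ hW
    obtain rfl : ι = κ := by simpa using hκ
    obtain ⟨d, hd1⟩ := Option.isSome_iff_exists.1 (hd ι List.mem_cons_self)
    rw [wpInstr_data hd1, seqSubst, hd1, Option.getD_some, ← Assertion.subst_subst]
    congr 1
    cases s with
    | nil => rw [seqSubst, Assertion.subst_id]; rfl
    | cons κ s =>
      rw [hW (p + 1) κ (by omega) (by simp) hs.tail.head]
      rw [ih (p + 1) hs.tail (fun ι h => hd ι (List.mem_cons_of_mem _ h)) κ rfl fun L ι a b c =>
        hW L ι (by omega) (by simp only [List.length_cons] at b ⊢; omega) c]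
      congr 2
      simp only [List.length_cons]; omega

theorem data_aload (n : ℕ) : ((Instr.aload n).data.getD ([], 0)).toSubst = { stack := pushStack (.loc n) } :=
  toSubst_push _
theorem data_astore (n : ℕ) : ((Instr.astore n).data.getD ([], 0)).toSubst =
    { stack := popStack 1, loc := fun i => if i = n then .stack 0 else .loc i } := toSubst_astore _

/-- Variables that are not changed by storing and loading. -/
def Expr.IsGlobal : Expr → Prop
  | .static _ _ => True
  | .ghost _ => True
  | _ => False

theorem subst_seqSubst_global {s : List Instr} (hs : ∀ ι ∈ s, (∃ n, ι = .aload n) ∨ ∃ n, ι = .astore n)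
    {e : Expr} (he : e.IsGlobal) : e.subst (seqSubst s) = e := by
  induction s with
  | nil => exact Expr.subst_id e
  | cons ι s ih =>
    rw [subst_seqSubst_cons, ih fun ι h => hs ι (List.mem_cons_of_mem _ h)]
    rcases hs ι List.mem_cons_self with ⟨n, rfl⟩ | ⟨n, rfl⟩
    · rw [data_aload]; cases e <;> first | rfl | exact he.elim
    · rw [data_astore]; cases e <;> first | rfl | exact he.elim

theorem loads_loc (f : ℕ → ℕ) (s : List ℕ) (i : ℕ) :
    (Expr.loc i).subst (seqSubst (s.map fun j => .aload (f j))) = .loc i := by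
  induction s with
  | nil => rfl
  | cons j s ih => rw [List.map_cons, subst_seqSubst_cons, ih, data_aload]; rfl

/-- The value loaded last is on top, hence the reversed index. -/
theorem loads_stack (w n : ℕ) : ∀ i,
    (Expr.stack i).subst (seqSubst ((List.range n).map fun j => .aload (w + j))) =
      if i < n then .loc (w + (n - 1 - i)) else .stack (i - n) := by
  induction n with
  | zero => intro i; rfl
  | succ n ih =>
    intro i
    rw [List.range_succ, List.map_append, subst_seqSubst_append, List.map_singleton,
      subst_seqSubst_cons, seqSubst, Expr.subst_id, data_aload]
    cases i with
    | zero =>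
      change (Expr.loc (w + n)).subst _ = _
      rw [loads_loc, if_pos (by omega)]; simp
    | succ i =>
      change (Expr.stack i).subst _ = _
      rw [ih]
      by_cases h : i < n
      · rw [if_pos h, if_pos (by omega), show n + 1 - 1 - (i + 1) = n - 1 - i by omega]
      · rw [if_neg h, if_neg (by omega), show i + 1 - (n + 1) = i - n by omega]

theorem stores_stack (w n : ℕ) (i : ℕ) :
    (Expr.stack i).subst (seqSubst ((List.range n).reverse.map fun j => .astore (w + j))) =
      .stack (i + n) := by
  induction n with
  | zero => rfl
  | succ n ih =>
    rw [List.range_succ, List.reverse_append, List.reverse_singleton, List.singleton_append,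
      List.map_cons, subst_seqSubst_cons, ih, data_astore]
    rfl

theorem stores_loc (w n : ℕ) (i : ℕ) :
    (Expr.loc i).subst (seqSubst ((List.range n).reverse.map fun j => .astore (w + j))) =
      if w ≤ i ∧ i < w + n then .stack (n - 1 - (i - w)) else .loc i := by
  induction n with
  | zero => rw [if_neg (by omega)]; rfl
  | succ n ih =>
    rw [List.range_succ, List.reverse_append, List.reverse_singleton, List.singleton_append,
      List.map_cons, subst_seqSubst_cons, ih, data_astore]
    by_cases h : w ≤ i ∧ i < w + n
    · rw [if_pos h, if_pos (by omega)]
      change Expr.stack (n - 1 - (i - w) + 1) = _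
      congr 1; omega
    · rw [if_neg h]
      change (if i = w + n then Expr.stack 0 else Expr.loc i) = _
      by_cases h' : i = w + n
      · rw [if_pos h', if_pos (by omega)]; congr 1; omega
      · rw [if_neg h', if_neg (by omega)]

theorem saveCode_subst (v n : ℕ) (e : Expr) : e.subst (seqSubst (saveCode v n)) =
    (((e.subst (seqSubst ((List.range n).map fun j => .aload (v + 2 + j)))).subst
      { stack := pushStack (.loc v) }).subst
      { stack := popStack 1, loc := fun i => if i = v then .stack 0 else .loc i }).subst
      (seqSubst ((List.range n).reverse.map fun j => .astore (v + 2 + j))) := by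
  rw [saveCode, subst_seqSubst_append, subst_seqSubst_append, subst_seqSubst_cons, subst_seqSubst_cons,
    data_aload, data_astore, seqSubst, Expr.subst_id]

/-- Arguments are stored from the last to the first and reloaded in the opposite order, so the
operand stack is restored. The same computation shows where the locals come from. -/
theorem saveCode_stack (v n i : ℕ) : (Expr.stack i).subst (seqSubst (saveCode v n)) = .stack i := by
  rw [saveCode_subst, loads_stack]
  by_cases h : i < n
  · rw [if_pos h]
    change ((if v + 2 + (n - 1 - i) = v then Expr.stack 0 else Expr.loc (v + 2 + (n - 1 - i)))).subst _ = _
    rw [if_neg (by omega), stores_loc, if_pos (by omega)]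
    congr 1; omega
  · rw [if_neg h]
    obtain ⟨k, rfl⟩ := Nat.exists_eq_add_of_le (Nat.not_lt.1 h)
    rw [Nat.add_sub_cancel_left]
    cases k with
    | zero =>
      change (if v = v then Expr.stack 0 else Expr.loc v).subst _ = _
      rw [if_pos rfl, stores_stack]; congr 1; omega
    | succ k =>
      change (Expr.stack (k + 1)).subst _ = _
      rw [stores_stack]; congr 1; omega

theorem saveCode_loc (v n : ℕ) : (Expr.loc v).subst (seqSubst (saveCode v n)) = .stack n := by
  rw [saveCode_subst, loads_loc]
  change (if v = v then Expr.stack 0 else Expr.loc v).subst _ = _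
  rw [if_pos rfl, stores_stack]; congr 1; omega

theorem saveCode_arg (v n : ℕ) {j : ℕ} (hj : j < n) :
    (Expr.loc (v + 2 + j)).subst (seqSubst (saveCode v n)) = .stack (n - 1 - j) := by
  rw [saveCode_subst, loads_loc]
  change (if v + 2 + j = v then Expr.stack 0 else Expr.loc (v + 2 + j)).subst _ = _
  rw [if_neg (by omega), stores_loc, if_pos (by omega)]
  congr 1; omega

theorem saveCode_global (v n : ℕ) {e : Expr} (he : e.IsGlobal) : e.subst (seqSubst (saveCode v n)) = e := by
  refine subst_seqSubst_global (fun ι hι => ?_) he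
  simp only [saveCode, List.mem_append, List.mem_map, List.mem_cons, List.not_mem_nil, or_false] at hι
  rcases hι with (⟨j, _, rfl⟩ | rfl | rfl) | ⟨j, _, rfl⟩
  exacts [.inr ⟨_, rfl⟩, .inr ⟨_, rfl⟩, .inl ⟨_, rfl⟩, .inl ⟨_, rfl⟩]

/-! ### The generated assertions have the expected form -/

theorem clauseFormula_congr {G G' : CGuard → Assertion} {F F' : List (ℕ × CExpr) → Assertion}
    {l : List Clause} (h : ∀ cl ∈ l, G cl.guard = G' cl.guard ∧ F cl.update = F' cl.update) :
    clauseFormula G F l = clauseFormula G' F' l := by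
  induction l with
  | nil => rfl
  | cons cl l ih =>
    have := h cl List.mem_cons_self
    rw [clauseFormula, clauseFormula, this.1, this.2, ih fun cl hc => h cl (List.mem_cons_of_mem _ hc)]

/-- Agreement is needed only for guards and updates that occur, so well-formedness of the clauses
can be used. -/
theorem eventFormula_congr {t t' : Expr} {G G' : CGuard → Assertion}
    {F F' : List (ℕ × CExpr) → Assertion} {l : List (ℕ × Option (List Clause))} (ht : t = t')
    (hF : F [] = F' []) (h : ∀ p ∈ l, ∀ cls, p.2 = some cls → ∀ cl ∈ cls,
      G cl.guard = G' cl.guard ∧ F cl.update = F' cl.update) :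
    eventFormula t G F l = eventFormula t' G' F' l := by
  subst ht
  induction l with
  | nil => exact hF
  | cons p l ih =>
    rw [eventFormula, eventFormula, ih fun p hp => h p (List.mem_cons_of_mem _ hp)]
    congr 1
    have := h p List.mem_cons_self
    cases e : p.2 with
    | none => exact hF
    | some cls => exact clauseFormula_congr (this cls e)

/-- The substitutions `σ` of the places of the inlined monitor and `θ` of those of the ghost monitor
agree on the state variables `S`, on the first `n` arguments, and on the result if `r`. -/
structure PlacesAgree (S : List ℕ) (n : ℕ) (r : Prop) (v : ℕ) (σ θ : Subst) : Prop where
  state : ∀ x ∈ S, (Expr.static monitorClass x).subst σ = (Expr.ghost (.ms x)).subst θ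
  arg : ∀ j < n, (Expr.loc (v + 2 + j)).subst σ = (Expr.ghost (.arg j)).subst θ
  result : r → (Expr.loc (v + 1)).subst σ = (Expr.ghost .result).subst θ

variable {S : List ℕ} {n : ℕ} {r : Prop} {v : ℕ} {σ θ : Subst}

theorem PlacesAgree.cexpr (h : PlacesAgree S n r v σ θ) {e : CExpr} (he : e.WF S n r) :
    (e.inst (realPlaces v)).subst σ = (e.inst ghostPlaces).subst θ := by
  induction e with
  | lit => rfl
  | state x => exact h.state x he
  | arg j => exact h.arg j he
  | result => exact h.result he
  | field e f ih => simp only [CExpr.inst, Expr.subst, ih he]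
  | op o a b iha ihb => simp only [CExpr.inst, Expr.subst, iha he.1, ihb he.2]

theorem PlacesAgree.cguard (h : PlacesAgree S n r v σ θ) {g : CGuard} (hg : g.WF S n r) :
    (g.inst (realPlaces v)).subst σ = (g.inst ghostPlaces).subst θ := by
  induction g with
  | tt => rfl
  | ff => rfl
  | eq a b => simp only [CGuard.inst, Assertion.subst, h.cexpr hg.1, h.cexpr hg.2]
  | rel _ a b => simp only [CGuard.inst, Assertion.subst, h.cexpr hg.1, h.cexpr hg.2]
  | and a b iha ihb => simp only [CGuard.inst, Assertion.subst, iha hg.1, ihb hg.2]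
  | not a ih => simp only [CGuard.inst, Assertion.subst, ih hg]
  | hasType e c => simp only [CGuard.inst, Assertion.subst, h.cexpr hg]

theorem execSubst_static (v x : ℕ) (u : List (ℕ × CExpr)) :
    (Expr.static monitorClass x).subst (execSubst v u) =
      ((u.lookup x).getD (.state x)).inst (realPlaces v) := by
  simp only [Expr.subst, execSubst, if_true]
  have := lookup_map (f := fun x : ℕ => x) (fun _ _ h => h) (fun e : CExpr => e.inst (realPlaces v)) x u
  rw [this]
  cases u.lookup x <;> rfl

theorem PlacesAgree.update (h : PlacesAgree S n r v σ θ) {u : List (ℕ × CExpr)}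
    (hu : ∀ p ∈ u, p.1 ∈ S ∧ p.2.WF S n r) {x : ℕ} (hx : x ∈ S) :
    ((Expr.static monitorClass x).subst (execSubst v u)).subst σ = (updValue u x).subst θ := by
  rw [execSubst_static, updValue]
  refine h.cexpr ?_
  cases e : u.lookup x with
  | none => exact hx
  | some d => exact (hu _ (mem_of_lookup e)).2

/-- The inlined monitor state agrees with `V`, and `X` holds. -/
def agreeWith (K : Contract) (V : ℕ → Expr) (X : Option Assertion) : Assertion :=
  X.elim (Assertion.conj (K.state.map fun x => .eq (.static monitorClass x) (V x)))
    (Assertion.and (Assertion.conj (K.state.map fun x => .eq (.static monitorClass x) (V x))))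

/-- Under `σ` and `θ` corresponding places of the two monitors denote the same expression, so the
code's formula, in terms of real places, becomes the expected one, in terms of ghost places. `V` is
the ghost side of the leaf equations and `X` what else holds behind the code. -/
theorem eventFormula_eq_expected {K : Contract} {l : List (ℕ × Option (List Clause))}
    {θ η : SubstData} {V : ℕ → Expr} (h : PlacesAgree K.state n r v σ θ.toSubst)
    (hl : ∀ p ∈ l, ∀ cls, p.2 = some cls → ∀ cl ∈ cls, cl.WF K.state n r)
    (ht : (Expr.loc v).subst σ = (Expr.ghost .target).subst θ.toSubst)
    (hV : ∀ x ∈ K.state, ∀ u, ((V x).subst (execSubst v u)).subst σ = (stepValue K l x).subst η.toSubst)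
    {X Y : Option Assertion} (hX : ∀ u, X.map (fun X => (X.subst (execSubst v u)).subst σ) = Y) :
    (eventFormula (.loc v) (fun g => g.inst (realPlaces v)) (fun u =>
      (agreeWith K V X).subst (execSubst v u)) l).subst σ = expectedFormula K l θ η Y := by
  have key : ∀ u : List (ℕ × CExpr), (∀ p ∈ u, p.1 ∈ K.state ∧ p.2.WF K.state n r) →
      ((agreeWith K V X).subst (execSubst v u)).subst σ = Y.elim (leafFormula K l θ η u) (.and (leafFormula K l θ η u)) := by
    intro u hu
    have e : ((Assertion.conj (K.state.map fun x => .eq (.static monitorClass x) (V x))).subst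
        (execSubst v u)).subst σ = leafFormula K l θ η u := by
      rw [Assertion.conj_subst, Assertion.conj_subst, List.map_map, List.map_map, leafFormula]
      congr 1
      refine List.map_congr_left fun x hx => ?_
      have e1 := h.update hu hx
      have e2 := hV x hx u
      change Assertion.eq _ _ = Assertion.eq _ _
      rw [← e1, ← e2]
    rw [← hX u]
    cases X with
    | none => exact e
    | some X =>
      change Assertion.and _ _ = Assertion.and _ _
      rw [← e]
  rw [eventFormula_subst, expectedFormula]
  exact eventFormula_congr ht (key [] (by simp)) fun p hp cls hc cl hcl =>
    ⟨h.cguard (hl p hp cls hc cl hcl).1, key _ (hl p hp cls hc cl hcl).2⟩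

theorem eventClauses_wf {P : Program} {K : Contract} {ev : MethodSpec → Option (List Clause)}
    {c m n : ℕ} {r : Prop}
    (h : ∀ s ∈ K.specs, ∀ l, ev s = some l → ∀ cl ∈ l, cl.WF K.state s.arity r) :
    ∀ p ∈ eventClauses P K ev c m n, ∀ cls, p.2 = some cls → ∀ cl ∈ cls, cl.WF K.state n r := by
  intro p hp cls hc cl hcl
  obtain ⟨d, _, rfl⟩ := List.mem_map.1 hp
  obtain ⟨s, hs, he⟩ := Option.bind_eq_some_iff.1 hc
  have h1 := List.find?_some hs
  have h2 : s.cls = d ∧ s.name = m ∧ s.arity = n := by simpa using h1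
  rw [← h2.2.2]
  exact h s (List.mem_of_find?_eq_some hs) cls he cl hcl

/-! ### Completeness of the checker -/

/-- The invariant mentions only static fields of the monitor class and the ghost state. -/
theorem monitorInvariant_subst (K : Contract) {σ : Subst}
    (h1 : ∀ x, σ.static monitorClass x = .static monitorClass x) (h2 : ∀ x, σ.ghost (.ms x) = .ghost (.ms x)) :
    (monitorInvariant K).subst σ = monitorInvariant K := by
  rw [monitorInvariant, Assertion.conj_subst, List.map_map]
  congr 1
  refine List.map_congr_left fun x _ => ?_
  simp only [Function.comp, Assertion.subst, Expr.subst, h1, h2]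

theorem instrTest_of_data {P : Program} {K : Contract} {M : Method} {A : List Assertion}
    {us : List GhostUpdate} {L : ℕ} {ι : Instr} {d : SubstData} (hd : ι.data = some d)
    (hus : us.tail.tail.isEmpty = true)
    (h : A.getD L .ff = ghostWp us ((A.getD (L + 1) .ff).subst d.toSubst)) :
    instrTest P K M A us L ι = true := by
  have key : ∀ k, dataTest P K M.code us (A.getD L .ff) (A.getD (L + 1) .ff) d k = true := fun k => by
    rw [dataTest, Bool.or_eq_true, teq_iff, ghostWpPair_eq hus]
    exact .inl h
  cases ι <;> simp only [Instr.data, reduceCtorEq, Option.some.injEq] at hd <;> subst hd <;> exact key _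

/-- A computed annotation is its weakest precondition literally, so the test succeeds by syntactic
equality. -/
theorem instrTest_forward {P : Program} {K : Contract} {M : Method} {A : List Assertion} {L : ℕ}
    {ι : Instr} (hι : ι.Forward L) (h : A.getD L .ff = wpInstr P (fun _ _ _ => monitorInvariant K)
      (monitorInvariant K) M.handlers (fun L => A.getD L .ff) L ι) : instrTest P K M A [] L ι = true := by
  have e : ∀ φ, ghostWpPair [] φ = φ := fun φ => ghostWpPair_eq rfl φ
  cases hd : ι.data with
  | some d =>
    rw [wpInstr_data hd] at h
    exact instrTest_of_data hd rfl h
  | none =>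
    cases ι with
    | goto L' =>
      rw [instrTest, teq_iff, e]; exact h
    | ifeq L' =>
      rw [instrTest, branchTest, Bool.or_eq_true, teq_iff, e, e, toSubst_pop 1 (.inl rfl)]
      exact .inl h
    | exit => rfl
    | _ => simp [Instr.Forward, Instr.data] at hι hd

variable {P : Program} {K : Contract} {M : Method} {L : ℕ} {ι : Instr}

/-- The verification condition at position `L` of the inlined method passes the test. -/
def Passes (P : Program) (K : Contract) (M : Method) (L : ℕ) (ι : Instr) : Prop :=
  (inlineGhosts P K M.code M.handlers L).tail.tail.isEmpty = true ∧
  instrTest (inlineProgram P K) K (inlineMethod P K M) (generateMethod P K M)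
    (inlineGhosts P K M.code M.handlers L) L ι = true

theorem passes_computed (h : (inlineCode P K M.code)[L]? = some (ι, .computed)) (hι : ι.Forward L) :
    Passes P K M L ι := by
  rw [Passes, inlineGhosts_eq_nil h (.inr rfl)]
  exact ⟨rfl, instrTest_forward hι (genAt_computed h hι)⟩

/-- An added handler covers one call and never an `athrow`; an original handler leads to a position
with the invariant. -/
theorem inlineHandlers_cases {h : Handler} (hh : h ∈ inlineHandlers P K M.code M.handlers)
    (hM : ∀ h ∈ M.handlers, h.target < M.code.length) :
    (∃ c m n μ, (inlineCode P K M.code)[h.b]? = some (.invoke c m n, μ) ∧ h.e = h.b + 1) ∨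
    genAt P K M h.target = monitorInvariant K := by
  rcases List.mem_append.1 hh with hh | hh
  · obtain ⟨q, p, c, m, n, rfl, B⟩ := mem_addedHandlers hh
    exact .inl ⟨c, m, n, _, B.call_eq, rfl⟩
  · obtain ⟨h', hh', rfl⟩ := List.mem_map.1 hh
    exact .inr (genAt_newLabel (hM _ hh'))

theorem passes_athrow (hM : ∀ h ∈ M.handlers, h.target < M.code.length)
    (h : (inlineCode P K M.code)[L]? = some (.athrow, .cut (monitorInvariant K))) :
    Passes P K M L .athrow := by
  rw [Passes, inlineGhosts_eq_nil h (.inl rfl)]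
  refine ⟨rfl, ?_⟩
  rw [instrTest, Bool.and_eq_true, Bool.and_eq_true, teq_iff, List.all_eq_true]
  refine ⟨⟨rfl, genAt_cut h⟩, fun x hx => ?_⟩
  rw [Bool.or_eq_true, teq_iff]
  rcases inlineHandlers_cases hx hM with ⟨c, m, n, μ, h1, h2⟩ | h1
  · left
    by_contra hc
    have hc : x.b ≤ L ∧ L < x.e := by simpa [Handler.covers] using hc
    have : x.b = L := by omega
    rw [this, h] at h1
    cases h1
  · exact .inr h1

/-- The invariant stands at the instruction and at all its successors, and client instructions do
not change the variables in it. -/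
theorem passes_client {i : ℕ} (hi : M.code[i]? = some ι) (hc : ι.isClient)
    (hs : ∀ L' ∈ ι.succs i, L' < M.code.length) (hM : ∀ h ∈ M.handlers, h.target < M.code.length)
    (hL1 : newLabel P K M.code (i + 1) = L + 1)
    (h : (inlineCode P K M.code)[L]? = some (ι.relabel (newLabel P K M.code), .cut (monitorInvariant K))) :
    Passes P K M L (ι.relabel (newLabel P K M.code)) := by
  by_cases ht : ι = .athrow
  · subst ht; exact passes_athrow hM h
  rw [Passes, inlineGhosts_eq_nil h (.inl rfl)]
  refine ⟨rfl, ?_⟩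
  have e : ∀ φ, ghostWpPair [] φ = φ := fun φ => ghostWpPair_eq rfl φ
  have h0 : (generateMethod P K M).getD L .ff = monitorInvariant K := genAt_cut h
  have h1 : i + 1 < M.code.length → (generateMethod P K M).getD (L + 1) .ff = monitorInvariant K :=
    fun hlt => by rw [← hL1]; exact genAt_newLabel hlt
  have hpop : ∀ k, (monitorInvariant K).subst (SubstData.toSubst ([], k)) = monitorInvariant K :=
    fun k => monitorInvariant_subst K (fun _ => rfl) fun _ => rfl
  have hj : ∀ L', L' < M.code.length →
      (generateMethod P K M).getD (newLabel P K M.code L') .ff = monitorInvariant K :=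
    fun L' hlt => genAt_newLabel hlt
  have hdata : ∀ d, ι.data = some d → ι.relabel (newLabel P K M.code) = ι → ι.succs i = [i + 1] →
      (∀ x, d.toSubst.static monitorClass x = .static monitorClass x) →
      (∀ x, d.toSubst.ghost (.ms x) = .ghost (.ms x)) →
      instrTest (inlineProgram P K) K (inlineMethod P K M) (generateMethod P K M) [] L
        (ι.relabel (newLabel P K M.code)) = true := by
    intro d hd hr hsucc d1 d2
    rw [hr]
    refine instrTest_of_data hd rfl ?_
    rw [h0, h1 (hs _ (by simp [hsucc])), monitorInvariant_subst K d1 d2]; rfl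
  cases ι with
  | athrow => exact absurd rfl ht
  | goto L' =>
    rw [Instr.relabel, instrTest, teq_iff, e, h0, hj L' (hs _ (by simp [Instr.succs]))]
  | ret =>
    rw [Instr.relabel, instrTest, teq_iff, e, h0]
    all_goals simp
  | exit => rfl
  | ifeq L' =>
    rw [Instr.relabel, instrTest, branchTest, Bool.or_eq_true, Bool.and_eq_true, teq_iff, teq_iff, e, e, h0,
      hj L' (hs _ (by simp [Instr.succs])), h1 (hs _ (by simp [Instr.succs])), hpop]
    exact .inr ⟨rfl, (teq_iff _ _).2 rfl⟩
  | ificmpeq L' =>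
    rw [Instr.relabel, instrTest, branchTest, Bool.or_eq_true, Bool.and_eq_true, teq_iff, teq_iff, e, e, h0,
      hj L' (hs _ (by simp [Instr.succs])), h1 (hs _ (by simp [Instr.succs])), hpop]
    exact .inr ⟨rfl, (teq_iff _ _).2 rfl⟩
  | invoke c m n =>
    rw [Instr.relabel, instrTest, Bool.or_eq_true, teq_iff, e, h0]
    · exact .inl rfl
    all_goals simp
  | evalGuard g => exact hc.elim
  | execUpdate u => exact hc.elim
  | putstatic c f =>
    refine hdata _ rfl rfl rfl (fun x => ?_) fun x => rfl
    rw [toSubst_putstatic]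
    have : c ≠ monitorClass := hc
    -- Target programs do not assign to fields of the monitor class.
    exact if_neg (by simp [this.symm])
  | _ => exact hdata _ rfl rfl rfl (fun _ => rfl) fun _ => rfl

-- The verification conditions of an inlined block.

variable {v p q c m n : ℕ}

theorem ghostStep_lookup (K : Contract) (l : List (ℕ × Option (List Clause))) {y : GVar}
    (hy : ∀ x, y ≠ .ms x) : (ghostStep K l).lookup y = none :=
  lookup_eq_none fun p hp => by
    obtain ⟨x, _, rfl⟩ := List.mem_map.1 hp
    exact (hy x).symm

theorem stateData_lookup {K : Contract} {x : ℕ} (hx : x ∈ K.state) :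
    (stateData K).lookup (.ghost (.ms x)) = some (.static monitorClass x) := by
  rw [stateData]
  generalize K.state = S at hx
  induction S with
  | nil => simp at hx
  | cons y S ih =>
    rw [List.map_cons, List.lookup_cons]
    by_cases h : x = y
    · subst h; simp
    · have : (Expr.ghost (GVar.ms x) == Expr.ghost (GVar.ms y)) = false := by simpa using h
      rw [this]
      exact ih ((List.mem_cons.1 hx).resolve_left h)

theorem stateData_lookup_none (K : Contract) {y : GVar} (hy : ∀ x, y ≠ .ms x) :
    (stateData K).lookup (.ghost y) = none :=
  lookup_eq_none fun p hp => by
    obtain ⟨x, _, rfl⟩ := List.mem_map.1 hp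
    simpa using (hy x).symm

theorem lookup_range_map (f : ℕ → Expr) {j n : ℕ} (hj : j < n) :
    ((List.range n).map fun j => (Expr.ghost (.arg j), f j)).lookup (.ghost (.arg j)) = some (f j) := by
  induction n with
  | zero => omega
  | succ n ih =>
    rw [List.range_succ, List.map_append, lookup_append]
    by_cases h : j < n
    · rw [ih h]; rfl
    · obtain rfl : j = n := by omega
      rw [lookup_eq_none]
      · simp
      · intro p hp
        obtain ⟨i, hi, rfl⟩ := List.mem_map.1 hp
        have := List.mem_range.1 hi
        simp; omega

theorem argPairs_eq (n : ℕ) : argPairs n = (List.range n).map fun j => (j, n - 1 - j) := by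
  rw [argPairs]
  apply List.ext_getElem
  · simp
  · intro i h1 h2; simp

theorem stackData_eq (n : ℕ) : stackData n = (ghostData (ghostSave n)).1 := by
  rw [stackData, argPairs_eq, ghostData, ghostSave, List.map_cons, List.map_map, List.map_map]; rfl

theorem stackData_toSubst (n : ℕ) : SubstData.toSubst (stackData n, 0) =
    { ghost := fun x => ((ghostSave n).lookup x).getD (.ghost x) } := by
  rw [← ghostData_toSubst, stackData_eq]; rfl

theorem stackData_ghost_target (n : ℕ) :
    (SubstData.toSubst (stackData n, 0)).ghost .target = .stack n := by
  change ((stackData n).lookup (Expr.ghost .target)).getD (.ghost .target) = Expr.stack n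
  rw [stackData, List.lookup_cons]; simp

theorem stackData_lookup_arg {j n : ℕ} (hj : j < n) :
    (stackData n).lookup (.ghost (.arg j)) = some (.stack (n - 1 - j)) := by
  have h1 : (Expr.ghost (GVar.arg j) == Expr.ghost GVar.target) = false := by simp
  rw [stackData, List.lookup_cons, h1, argPairs_eq, List.map_map]
  exact lookup_range_map (fun j => .stack (n - 1 - j)) hj

theorem localData_lookup_arg {j n : ℕ} (v : ℕ) (hj : j < n) :
    (localData v n).lookup (.ghost (.arg j)) = some (.loc (v + 2 + j)) := by
  have h1 : (Expr.ghost (GVar.arg j) == Expr.ghost GVar.target) = false := by simp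
  rw [localData_eq, List.lookup_cons, h1]
  exact lookup_range_map (fun j => .loc (v + 2 + j)) hj

/-- The values assigned by a ghost update contain no variables except ghost variables. -/
theorem stepValue_subst_congr {x : ℕ} (hx : x ∈ K.state) (l : List (ℕ × Option (List Clause)))
    {σ τ : Subst} (h : ∀ y, σ.ghost y = τ.ghost y) : (stepValue K l x).subst σ = (stepValue K l x).subst τ := by
  rw [stepValue_subst hx, stepValue_subst hx]
  have e1 : (Expr.ghost .target).subst σ = (Expr.ghost .target).subst τ := h _
  have e2 : (fun g : CGuard => (g.inst ghostPlaces).subst σ) = fun g => (g.inst ghostPlaces).subst τ :=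
    funext fun g => CGuard.inst_subst_congr h g
  rw [e1, e2]
  exact DTree.chain_congr (fun u => CExpr.inst_subst_congr h _) _

/-- What an instruction in the inlined block reveals about the locals used there. -/
def Instr.Key : Instr → ℕ → Prop
  | .aload x, k => k = x
  | .astore x, k => k = x
  | _, _ => True

/-- The call itself occurs in the inlined code, so the search through all calls finds it.
`Instr.Key` ties the number passed to the test to the local used by the instruction. -/
theorem instrTest_of_call {P : Program} {K : Contract} {M : Method} {A : List Assertion}
    {us : List GhostUpdate} {L : ℕ} {ι : Instr} (hin : Instr.invoke c m n ∈ M.code)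
    (hd : ι.data.isSome = true) (hus : us.tail.tail.isEmpty = true) {pre : ℕ → ℕ → ℕ → Assertion}
    {post : Assertion} {H : List Handler} {Q : Program}
    (h : ∀ k, ι.Key k → callTest P K (A.getD L .ff)
      (ghostWp us (wpInstr Q pre post H (fun L => A.getD L .ff) L ι)) k c m n = true) :
    instrTest P K M A us L ι = true := by
  obtain ⟨d, hd⟩ := Option.isSome_iff_exists.1 hd
  rw [wpInstr_data hd, ← ghostWpPair_eq hus] at h
  have key : ∀ k, ι.Key k → dataTest P K M.code us (A.getD L .ff) (A.getD (L + 1) .ff) d k = true :=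
    fun k hk => by
      rw [dataTest, Bool.or_eq_true, blockTest, List.any_eq_true]
      exact .inr ⟨_, hin, h k hk⟩
  cases ι <;> simp only [Instr.data, reduceCtorEq, Option.some.injEq] at hd <;> subst hd <;>
    first | exact key _ trivial | exact key _ rfl

theorem IsBlock.mem_code (B : IsBlock P K M.code v p q c m n) :
    Instr.invoke c m n ∈ (inlineMethod P K M).code := List.mem_of_getElem? B.fst_getElem?

/-- Within a marked segment only the head can fail to be computed. -/
theorem genAt_of_seg {μ : Mark} {l : List Instr} (hs : Seg (inlineCode P K M.code) p (markHead μ l))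
    (hf : ∀ (k : ℕ) (ι : Instr), l[k]? = some ι → ι.Forward (p + k)) {L : ℕ} {ι : Instr}
    (h1 : p < L ∨ p ≤ L ∧ μ = .computed) (h2 : L < p + l.length)
    (h : ((inlineCode P K M.code).map Prod.fst)[L]? = some ι) : genAt P K M L = genWp P K M L ι := by
  obtain ⟨k, rfl⟩ := Nat.exists_eq_add_of_le (show p ≤ L by omega)
  have hk := List.getElem?_eq_getElem (show k < l.length by omega)
  have hC := hs.get (markHead_getElem? μ hk)
  have hμ : (if k = 0 then μ else Mark.computed) = .computed := by
    by_cases hk0 : k = 0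
    · rw [if_pos hk0]
      rcases h1 with h1 | h1
      · omega
      · exact h1.2
    · rw [if_neg hk0]
  rw [hμ] at hC
  rw [List.getElem?_map, hC] at h
  obtain rfl : _ = ι := Option.some.inj h
  exact genAt_computed hC (hf k _ hk)

theorem seg_fst {μ : Mark} {l : List Instr} {code : List Instr}
    (hs : Seg (inlineCode P K code) p (markHead μ l)) : Seg ((inlineCode P K code).map Prod.fst) p l := by
  have := hs.map Prod.fst
  rwa [markHead_fst] at this

theorem eventBlock_wp {μ : Mark} {l : List (ℕ × Option (List Clause))} (hl : l ≠ [])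
    (hs : Seg (inlineCode P K M.code) p (markHead μ (eventBlock v p l))) :
    genWp P K M p (.aload v) = eventFormula (.loc v) (fun g => g.inst (realPlaces v))
      (fun u => (genAt P K M (p + (eventBlock v p l).length)).subst (execSubst v u)) l := by
  have hd : p + (eventCode v 0 p l).length = p + (eventBlock v p l).length := by
    congr 1; exact eventCode_length_eq _ _ _ _ _ _
  have key := eventCode_wp (W := genAt P K M) (Q := inlineProgram P K)
    (pre := fun _ _ _ => monitorInvariant K) (post := monitorInvariant K)
    (H := inlineHandlers P K M.code M.handlers) (v := v) (done := p + (eventCode v 0 p l).length) l p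
    (seg_fst hs) (by congr 1; exact eventCode_length_eq _ _ _ _ _ _) (.aload v) (by
      obtain ⟨⟨d, o⟩, l', rfl⟩ := List.exists_cons_of_ne_nil hl
      rw [eventCode_cons]; rfl)
    fun L ι a b h => genAt_of_seg hs (fun k ι h => eventBlock_forward h) (.inl a) b h
  rw [hd] at key
  exact key

/-- The handler code ends at the rethrow, which carries the invariant. Target and arguments are read
from the locals in which they were stored. -/
theorem IsBlock.passes_exceptional (B : IsBlock P K M.code v p q c m n) (hK : K.WF) :
    Passes P K M (q + 4) (.aload v) := by
  rw [Passes, B.ghosts_exceptional]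
  refine ⟨rfl, instrTest_of_call (H := inlineHandlers P K M.code M.handlers)
    (pre := fun _ _ _ => monitorInvariant K) (post := monitorInvariant K) (Q := inlineProgram P K)
    B.mem_code rfl rfl ?_⟩
  rintro k (rfl : k = v)
  simp only [callTest, Bool.or_eq_true, Bool.and_eq_true, teq_iff]
  refine .inl (.inr ⟨genAt_cut B.call_add_four, ?_⟩)
  have hw := eventBlock_wp (eventClauses_ne_nil B.rel MethodSpec.exceptional) B.exc
  rw [genAt_cut B.rethrow] at hw
  have hw' : wpInstr (inlineProgram P K) (fun _ _ _ => monitorInvariant K) (monitorInvariant K)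
    (inlineHandlers P K M.code M.handlers) (fun L => (generateMethod P K M).getD L .ff) (q + 4)
    (.aload k) = _ := hw
  rw [hw', ghostExceptional, ghostWp, List.foldr_cons, List.foldr_nil]
  refine eventFormula_eq_expected (K := K) (n := n) (r := False) (V := fun x => .ghost (.ms x)) (X := none)
    ⟨fun x hx => ?_, fun j hj => ?_, False.elim⟩
    (eventClauses_wf fun s hs => (hK s hs).2.2) ?_ (fun x hx u => ?_) fun _ => rfl
  · change Expr.static monitorClass x =
      ((stateData K ++ localData k n).lookup (Expr.ghost (.ms x))).getD (.ghost (.ms x))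
    rw [lookup_append, stateData_lookup hx]; rfl
  · change Expr.loc (k + 2 + j) =
      ((stateData K ++ localData k n).lookup (Expr.ghost (.arg j))).getD (.ghost (.arg j))
    rw [lookup_append, stateData_lookup_none K (by simp), localData_lookup_arg k hj]; rfl
  · change Expr.loc k =
      ((stateData K ++ localData k n).lookup (Expr.ghost .target)).getD (.ghost .target)
    rw [lookup_append, stateData_lookup_none K (by simp), localData, List.lookup_cons]; simp
  -- With no further ghost update, the ghost side of the expected formula is unsubstituted.
  · change stepValue K _ x = (stepValue K _ x).subst (ghostData []).toSubst
    rw [ghostData_nil_toSubst, Expr.subst_id]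

/-- Between the call and the event code the returned value is stored, reloaded and left on the
stack, and control jumps over the handler. The code ends at the next original instruction, where
`hend` gives the invariant. -/
theorem IsBlock.passes_after (B : IsBlock P K M.code v p q c m n) (hK : K.WF)
    (hend : genAt P K M (afterPos P K v q c m n + (eventBlock v (afterPos P K v q c m n)
      (eventClauses P K MethodSpec.after c m n)).length) = monitorInvariant K) :
    Passes P K M (q + 1) (.astore (v + 1)) := by
  rw [Passes, B.ghosts_after]
  refine ⟨rfl, instrTest_of_call (H := inlineHandlers P K M.code M.handlers)
    (pre := fun _ _ _ => monitorInvariant K) (post := monitorInvariant K) (Q := inlineProgram P K)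
    B.mem_code rfl rfl ?_⟩
  rintro k (rfl : k = v + 1)
  simp only [callTest, Bool.or_eq_true, Bool.and_eq_true, teq_iff]
  refine .inr ⟨genAt_cut B.call_add_one, ?_⟩
  have hne := eventClauses_ne_nil B.rel MethodSpec.after
  have hseg : Seg (inlineCode P K M.code) (afterPos P K v q c m n) (markHead .computed
      (eventBlock v (afterPos P K v q c m n) (eventClauses P K MethodSpec.after c m n))) := by
    have := B.after
    have e : ∀ l : List Instr, markHead .computed l = l.map fun ι => (ι, Mark.computed) := fun l => by
      cases l <;> rfl
    rw [e]; exact this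
  have hw := eventBlock_wp hne hseg
  rw [hend] at hw
  have h2 := genAt_computed B.call_add_two rfl
  have h3 := genAt_computed B.call_add_three (show q + 3 < afterPos P K v q c m n by
    simp only [afterPos]; omega)
  have h4 : genAt P K M (afterPos P K v q c m n) = genWp P K M (afterPos P K v q c m n) (.aload v) := by
    refine genAt_of_seg hseg (fun k ι h => eventBlock_forward h) (.inr ⟨le_rfl, rfl⟩) ?_ ?_
    · have := List.length_pos_of_ne_nil (eventBlock_ne_nil v (afterPos P K v q c m n) hne); omega
    · obtain ⟨⟨d, o⟩, l, e⟩ := List.exists_cons_of_ne_nil hne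
      have := seg_fst hseg
      rw [e] at this
      exact this.head
  have hw' : wpInstr (inlineProgram P K) (fun _ _ _ => monitorInvariant K) (monitorInvariant K)
    (inlineHandlers P K M.code M.handlers) (fun L => (generateMethod P K M).getD L .ff) (q + 1)
    (.astore (v + 1)) = (genAt P K M (q + 2)).subst
      { stack := popStack 1, loc := fun i => if i = v + 1 then .stack 0 else .loc i } := rfl
  rw [hw', h2, genWp, wpInstr, show q + 2 + 1 = q + 3 by omega, h3, genWp, wpInstr, h4, hw]
  rw [ghostAfter, ghostWp, List.foldr_cons, List.foldr_cons, List.foldr_nil]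
  -- Loading, storing and the two ghost updates are combined into one substitution, to be compared
  -- with the expected places.
  rw [Assertion.subst_subst, Assertion.subst_subst, Assertion.subst_subst]
  refine eventFormula_eq_expected (K := K) (n := n) (r := True) (V := fun x => .ghost (.ms x)) (X := none)
    ⟨fun x hx => ?_, fun j hj => ?_, fun _ => ?_⟩
    (eventClauses_wf fun s hs => (hK s hs).2.1) ?_ (fun x hx u => ?_) fun _ => rfl
  · change Expr.static monitorClass x = (((Expr.ghost .result, Expr.stack 0) ::
      (stateData K ++ localData v n)).lookup (Expr.ghost (.ms x))).getD (.ghost (.ms x))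
    have h : (Expr.ghost (.ms x) == Expr.ghost .result) = false := by simp
    rw [List.lookup_cons, h, lookup_append, stateData_lookup hx]; rfl
  · rw [← Expr.subst_subst, ← Expr.subst_subst, ← Expr.subst_subst]
    have e1 : ((Expr.loc (v + 2 + j)).subst { stack := pushStack (.loc (v + 1)) }).subst
      { stack := popStack 1, loc := fun i => if i = v + 1 then .stack 0 else .loc i } =
        .loc (v + 2 + j) := if_neg (by omega)
    rw [e1]
    change Expr.loc (v + 2 + j) = (((Expr.ghost .result, Expr.stack 0) ::
      (stateData K ++ localData v n)).lookup (Expr.ghost (.arg j))).getD (.ghost (.arg j))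
    have h : (Expr.ghost (.arg j) == Expr.ghost .result) = false := by simp
    rw [List.lookup_cons, h, lookup_append, stateData_lookup_none K (by simp),
      localData_lookup_arg v hj]; rfl
  · rw [← Expr.subst_subst, ← Expr.subst_subst, ← Expr.subst_subst]
    -- The local for the returned value, taken back through its store, is the top of the stack,
    -- which is also what the ghost monitor saves.
    have e1 : ((Expr.loc (v + 1)).subst { stack := pushStack (.loc (v + 1)) }).subst
      { stack := popStack 1, loc := fun i => if i = v + 1 then .stack 0 else .loc i } =
        .stack 0 := if_pos rfl
    rw [e1]
    change Expr.stack 0 = (((Expr.ghost .result, Expr.stack 0) ::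
      (stateData K ++ localData v n)).lookup (Expr.ghost .result)).getD (.ghost .result)
    rw [List.lookup_cons]; simp
  · rw [← Expr.subst_subst, ← Expr.subst_subst, ← Expr.subst_subst]
    have e1 : ((Expr.loc v).subst { stack := pushStack (.loc (v + 1)) }).subst
      { stack := popStack 1, loc := fun i => if i = v + 1 then .stack 0 else .loc i } =
        .loc v := if_neg (by omega)
    rw [e1]
    change Expr.loc v = (((Expr.ghost .result, Expr.stack 0) ::
      (stateData K ++ localData v n)).lookup (Expr.ghost .target)).getD (.ghost .target)
    have h : (Expr.ghost .target == Expr.ghost .result) = false := by simp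
    rw [List.lookup_cons, h, lookup_append, stateData_lookup_none K (by simp), localData,
      List.lookup_cons]; simp
  · have e : SubstData.toSubst ([(.ghost .result, .stack 0)], 0) =
      { ghost := fun x => (([(.result, .stack 0)] : GhostUpdate).lookup x).getD (.ghost x) } :=
        ghostData_toSubst [(.result, .stack 0)]
    rw [e]; rfl

theorem ghostSave_lookup (n : ℕ) (y : GVar) : (ghostSave n).lookup y = none ∨
    ∃ i, (ghostSave n).lookup y = some (.stack i) := by
  cases e : (ghostSave n).lookup y with
  | none => exact .inl rfl
  | some b =>
    refine .inr ?_
    rcases List.mem_cons.1 (mem_of_lookup e) with h | h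
    · cases h; exact ⟨n, rfl⟩
    · obtain ⟨j, _, h⟩ := List.mem_map.1 h
      cases h; exact ⟨_, rfl⟩

/-- Here both monitors act between the head of the block and the call: the inlined code on the way
to the call, the ghost updates at the call. So the call invariant is taken back first through the
ghost updates and then through event code and saving code. -/
theorem IsBlock.passes_before (B : IsBlock P K M.code v p q c m n) (hK : K.WF)
    (h : (inlineCode P K M.code)[p]? = some (ι, .cut (monitorInvariant K))) (hι : ι.data.isSome = true) :
    Passes P K M p ι := by
  rw [Passes, inlineGhosts_eq_nil h (.inl rfl)]
  refine ⟨rfl, instrTest_of_call (H := inlineHandlers P K M.code M.handlers)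
    (pre := fun _ _ _ => monitorInvariant K) (post := monitorInvariant K) (Q := inlineProgram P K)
    B.mem_code hι rfl ?_⟩
  intro k _
  simp only [callTest, Bool.or_eq_true, Bool.and_eq_true, teq_iff]
  refine .inl (.inl ⟨genAt_cut h, ?_⟩)
  have hne := eventClauses_ne_nil B.rel MethodSpec.before
  have hlen := List.length_pos_of_ne_nil (saveCode_ne_nil v n)
  have hfwd : ∀ (k : ℕ) (ι : Instr), (saveCode v n ++ eventBlock v (p + (saveCode v n).length)
      (eventClauses P K MethodSpec.before c m n))[k]? = some ι → ι.Forward (p + k) := by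
    intro k ι hk
    rcases Nat.lt_or_ge k (saveCode v n).length with h | h
    · rw [List.getElem?_append_left h] at hk
      exact Instr.forward_of_data (saveCode_data hk) _
    · rw [List.getElem?_append_right h] at hk
      have := eventBlock_forward hk
      rwa [show p + (saveCode v n).length + (k - (saveCode v n).length) = p + k by omega] at this
  have hsegs := seg_fst B.before
  have hW : ∀ L ι, p < L → L < q → ((inlineCode P K M.code).map Prod.fst)[L]? = some ι →
      genAt P K M L = genWp P K M L ι := fun L ι a b hL => genAt_of_seg B.before hfwd (.inl a)
    (by rw [List.length_append, ← Nat.add_assoc, ← B.pos]; exact b) hL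
  have hq := B.pos
  have hblk := List.length_pos_of_ne_nil (eventBlock_ne_nil v (p + (saveCode v n).length) hne)
  have hdone : p + (saveCode v n).length + (eventCode v 0 (p + (saveCode v n).length)
      (eventClauses P K MethodSpec.before c m n)).length = q := by
    rw [hq]; congr 1; exact eventCode_length_eq _ _ _ _ _ _
  have hw := eventCode_wp (W := genAt P K M) (Q := inlineProgram P K)
    (pre := fun _ _ _ => monitorInvariant K) (post := monitorInvariant K)
    (H := inlineHandlers P K M.code M.handlers) (v := v) _ _ hsegs.right
    (by congr 1; exact eventCode_length_eq _ _ _ _ _ _) (.aload v) (by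
      obtain ⟨⟨d, o⟩, l', e⟩ := List.exists_cons_of_ne_nil hne
      rw [e, eventCode_cons]; rfl)
    fun L ι a b hL => hW L ι (by omega) (by
      rw [hq]; exact b) hL
  rw [hdone] at hw
  have hX : genAt P K M (p + (saveCode v n).length) =
      genWp P K M (p + (saveCode v n).length) (.aload v) := by
    refine hW _ _ (by omega) (by omega) ?_
    have := hsegs.right
    obtain ⟨⟨d, o⟩, l', e⟩ := List.exists_cons_of_ne_nil hne
    rw [e] at this
    exact this.head
  have hhead : (saveCode v n).head? = some ι := by
    obtain ⟨κ, l, e⟩ := List.exists_cons_of_ne_nil (saveCode_ne_nil v n)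
    have h1 := hsegs
    rw [e] at h1 ⊢
    have h2 := h1.head
    rw [List.getElem?_map, h] at h2
    exact h2.symm
  have hseq := seqSubst_wp (W := genAt P K M) (Q := inlineProgram P K)
    (pre := fun _ _ _ => monitorInvariant K) (post := monitorInvariant K)
    (H := inlineHandlers P K M.code M.handlers) (saveCode v n) p hsegs.left (fun ι hι => by
      obtain ⟨k, hk⟩ := List.mem_iff_getElem?.1 hι
      exact saveCode_data hk) ι hhead fun L ι a b hL => hW L ι a (by omega) hL
  have e0 : ∀ a, ghostWp [] a = a := fun _ => rfl
  have hwp : wpInstr (inlineProgram P K) (fun _ _ _ => monitorInvariant K) (monitorInvariant K)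
    (inlineHandlers P K M.code M.handlers) (fun L => (generateMethod P K M).getD L .ff) p ι = _ := hseq
  rw [e0, hwp, hX, genWp, hw, genAt_beforeGhost B.call_eq, B.ghosts_call, ghostBefore, ghostWp,
    List.foldr_cons, List.foldr_cons, List.foldr_nil]
  set l := eventClauses P K MethodSpec.before c m n with hl
  -- The ghost monitor saves the call and then changes its state; going backwards, `step` is applied
  -- before `save`.
  set step : Subst := { ghost := fun x => ((ghostStep K l).lookup x).getD (.ghost x) } with hstep
  set save : Subst := { ghost := fun x => ((ghostSave n).lookup x).getD (.ghost x) } with hsave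
  have hsd : save = SubstData.toSubst (stackData n, 0) := (stackData_toSubst n).symm
  have htarget : ((Expr.ghost .target).subst step).subst save = .stack n := by
    have : (Expr.ghost .target).subst step = .ghost .target := by
      change ((ghostStep K l).lookup .target).getD (.ghost .target) = Expr.ghost .target
      rw [ghostStep_lookup K l (by simp)]; rfl
    rw [this, hsd]; exact stackData_ghost_target n
  have harg : ∀ j < n, ((Expr.ghost (.arg j)).subst step).subst save = .stack (n - 1 - j) := by
    intro j hj
    have : (Expr.ghost (.arg j)).subst step = .ghost (.arg j) := by
      change ((ghostStep K l).lookup (.arg j)).getD (.ghost (.arg j)) = Expr.ghost (.arg j)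
      rw [ghostStep_lookup K l (by simp)]; rfl
    rw [this, hsd]
    change ((stackData n).lookup (Expr.ghost (.arg j))).getD (.ghost (.arg j)) = Expr.stack _
    rw [stackData_lookup_arg hj]; rfl
  -- The state equations now compare the embedded state with the new ghost state, and the equations
  -- for saved values compare locals with stack positions.
  have hinv : ((callInvariant K v n).subst step).subst save = agreeWith K
      (fun x => (stepValue K l x).subst save) (some (.conj (.eq (.loc v) (.stack n) ::
        (List.range n).map fun j => .eq (.loc (v + 2 + j)) (.stack (n - 1 - j))))) := by
    simp only [callInvariant, monitorInvariant, Assertion.subst, Assertion.conj_subst, agreeWith,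
      Option.elim, List.map_map, List.map_cons, htarget]
    refine congrArg₂ Assertion.and rfl ?_
    congr 2
    refine List.map_congr_left fun j hj => ?_
    have := harg j (List.mem_range.1 hj)
    simp only [Function.comp, Assertion.subst, this]; rfl
  rw [hinv]
  refine eventFormula_eq_expected (K := K) (n := n) (r := False)
    ⟨fun x hx => ?_, fun j hj => ?_, False.elim⟩
    (eventClauses_wf fun s hs => (hK s hs).1) ?_ (fun x hx u => ?_) fun u => ?_
  · rw [saveCode_global v n (e := .static monitorClass x) trivial]
    change Expr.static monitorClass x =
      ((stateData K ++ stackData n).lookup (Expr.ghost (.ms x))).getD (.ghost (.ms x))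
    rw [lookup_append, stateData_lookup hx]; rfl
  · rw [saveCode_arg v n hj]
    change Expr.stack _ =
      ((stateData K ++ stackData n).lookup (Expr.ghost (.arg j))).getD (.ghost (.arg j))
    rw [lookup_append, stateData_lookup_none K (by simp), stackData_lookup_arg hj]; rfl
  · rw [saveCode_loc]
    change Expr.stack _ =
      ((stateData K ++ stackData n).lookup (Expr.ghost .target)).getD (.ghost .target)
    rw [lookup_append, stateData_lookup_none K (by simp), stackData, List.lookup_cons]; simp
  -- The new ghost state is expressed by old ghost variables and stack positions. The inlined update
  -- changes neither, and saving code restores the stack.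
  · rw [Expr.subst_subst, Expr.subst_subst, ← hsd]
    refine stepValue_subst_congr hx l fun y => ?_
    change (save.ghost y).subst ((execSubst v u).comp (seqSubst (saveCode v n))) = save.ghost y
    rw [← Expr.subst_subst, hsave]
    dsimp only
    rcases ghostSave_lookup n y with e | ⟨i, e⟩ <;> rw [e]
    · exact saveCode_global v n (e := .ghost y) trivial
    · exact saveCode_stack v n i
  -- Taken back through saving code, each local becomes the stack position with which it is
  -- compared; hence the trivial equations in the expected formula.
  · simp only [Option.map_some, Assertion.conj_subst, List.map_cons, List.map_map, Assertion.subst,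
      trivialEqs, argPairs_eq]
    have a1 : ((Expr.loc v).subst (execSubst v u)).subst (seqSubst (saveCode v n)) = .stack n :=
      saveCode_loc v n
    have a2 : ∀ i, ((Expr.stack i).subst (execSubst v u)).subst (seqSubst (saveCode v n)) = .stack i :=
      fun i => saveCode_stack v n i
    rw [a1, a2]
    congr 3
    refine List.map_congr_left fun j hj => ?_
    have a3 : ((Expr.loc (v + 2 + j)).subst (execSubst v u)).subst (seqSubst (saveCode v n)) =
      .stack (n - 1 - j) := saveCode_arg v n (List.mem_range.1 hj)
    simp only [Function.comp, Assertion.subst, a3, a2]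

/-- Taking an assertion back through ghost updates distributes over conjunction, so the first
conjunct of the annotation is the required precondition. -/
theorem IsBlock.passes_call (B : IsBlock P K M.code v p q c m n) : Passes P K M q (.invoke c m n) := by
  have h := genAt_beforeGhost B.call_eq
  rw [B.ghosts_call] at h
  rw [Passes, B.ghosts_call]
  refine ⟨rfl, ?_⟩
  rw [instrTest, Bool.or_eq_true, teq_iff, teq_iff, ghostWpPair_eq rfl]
  refine .inr ?_
  have h' : (generateMethod P K M).getD q .ff = _ := h
  rw [h']; rfl

/-- The checker accepts the proofs generated for inlined programs. -/
theorem methodTest_generate (hP : P.WF) (hK : K.WF) (hM : M ∈ P.methods) :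
    methodTest (inlineProgram P K) K (inlineMethod P K M) (generateMethod P K M) = true := by
  obtain ⟨hne, hcode, hH⟩ := hP M hM
  have hpass : ∀ L ι μ, (inlineCode P K M.code)[L]? = some (ι, μ) → Passes P K M L ι := by
    intro L ι μ h
    obtain ⟨i, ι', hi, ⟨h1, h2, h3, _⟩ | ⟨c, m, n, k, rfl, hr, hL, hseg, hlab, hk⟩⟩ := inlineCode_cases h
    · rw [h3] at h
      obtain rfl : ι = _ := congrArg Prod.fst h3
      exact passes_client hi (hcode i ι' hi).1 (hcode i ι' hi).2 hH h2 h
    · have B := callBlock_isBlock hr hseg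
      have hlen := callBlock_length P K (freshLocal M.code) (newLabel P K M.code i) c m n
      have hklt := (List.getElem?_eq_some_iff.1 hk).1
      set q := (callBlock P K (freshLocal M.code) (newLabel P K M.code i) c m n).2.1
      have hι : ∀ {κ ν}, (inlineCode P K M.code)[L]? = some (κ, ν) → κ = ι := fun h' => by
        rw [h] at h'; cases h'; rfl
      rcases B.position_cases (L := L) (by omega) (by simp only [afterPos, excLength]; omega) with
        ⟨κ, h1, h2, h3, _⟩ | rfl | rfl | rfl | rfl | ⟨κ, h1, h2⟩ | h1 | ⟨κ, h1, h2⟩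
      · obtain rfl := hι h1
        by_cases e : L = newLabel P K M.code i
        · rw [if_pos e] at h1
          rw [e] at h1 ⊢
          exact B.passes_before hK h1 (h3 e)
        · rw [if_neg e] at h1
          exact passes_computed h1 h2
      · obtain rfl := hι B.call_eq
        exact B.passes_call
      · obtain rfl := hι B.call_add_one
        refine B.passes_after hK ?_
        -- The block ends where the translation of the next original instruction begins.
        have : afterPos P K (freshLocal M.code) q c m n + (eventBlock (freshLocal M.code)
          (afterPos P K (freshLocal M.code) q c m n) (eventClauses P K MethodSpec.after c m n)).length
            = newLabel P K M.code (i + 1) := by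
          simp only [afterPos, excLength]; omega
        rw [this]
        -- Control may not fall off the end of a target program, so a call has a successor.
        exact genAt_newLabel ((hcode i _ hi).2 (i + 1) (by simp [Instr.succs]))
      · obtain rfl := hι B.call_add_two
        exact passes_computed B.call_add_two rfl
      · obtain rfl := hι B.call_add_three
        exact passes_computed B.call_add_three (show q + 3 < afterPos _ _ _ _ _ _ _ by
          simp only [afterPos]; omega)
      · obtain rfl := hι h1
        by_cases e : L = q + 4
        · subst e
          obtain rfl := hι B.call_add_four
          exact B.passes_exceptional hK
        · rw [if_neg e] at h1
          exact passes_computed h1 h2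
      · obtain rfl := hι h1
        exact passes_athrow hH h1
      · obtain rfl := hι h1
        exact passes_computed h1 h2
  rw [methodTest, Bool.and_eq_true, Bool.and_eq_true, Bool.and_eq_true, teq_iff, teq_iff, List.all_eq_true]
  refine ⟨⟨⟨embedTest_inline M hH, generateMethod_length⟩, ?_⟩, ?_⟩
  · exact genAt_newLabel (P := P) (K := K) (i := 0) (List.length_pos_of_ne_nil hne)
  · rintro ⟨ι, L⟩ hL
    rw [List.mem_zipIdx_iff_getElem?] at hL
    change ((inlineCode P K M.code).map Prod.fst)[L]? = _ at hL
    rw [List.getElem?_map, Option.map_eq_some_iff] at hL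
    obtain ⟨⟨κ, μ⟩, h1, rfl : κ = ι⟩ := hL
    have := hpass L κ μ h1
    rw [Bool.and_eq_true]
    exact this

theorem check_generate (hP : P.WF) (hK : K.WF) : (generate P K).check = true := by
  rw [Bundle.check, Bool.and_eq_true, teq_iff, List.all_eq_true]
  refine ⟨by simp [generate, inlineProgram], ?_⟩
  intro r hr
  change r ∈ (P.methods.map (inlineMethod P K)).zip (P.methods.map (generateMethod P K)) at hr
  rw [List.zip_map', List.mem_map] at hr
  obtain ⟨M, hM, rfl⟩ := hr
  exact methodTest_generate hP hK hM

/-! ### Encoded syntax -/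

instance : TreeEnc GVar := ⟨GVar.enc⟩
instance : TreeEnc Expr := ⟨Expr.enc⟩
instance : TreeEnc Assertion := ⟨Assertion.enc⟩
instance : TreeEnc Instr := ⟨Instr.enc⟩
instance : TreeEnc Handler := ⟨Handler.enc⟩
instance : TreeEnc Method := ⟨Method.enc⟩
instance : TreeEnc Program := ⟨Program.enc⟩
instance : TreeEnc CExpr := ⟨CExpr.enc⟩
instance : TreeEnc CGuard := ⟨CGuard.enc⟩
instance : TreeEnc Clause := ⟨Clause.enc⟩
instance : TreeEnc MethodSpec := ⟨MethodSpec.enc⟩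
instance : TreeEnc Contract := ⟨Contract.enc⟩
instance : TreeEnc Bundle := ⟨Bundle.enc⟩

theorem GVar.enc_injective : Function.Injective GVar.enc := by
  intro x y h
  cases x <;> cases y <;> simp_all [GVar.enc, encTag, encList]

mutual
theorem Expr.eq_of_enc : ∀ {d e : Expr}, d.enc = e.enc → d = e
  | .lit _, e, h => by cases e <;> simp_all [Expr.enc, encTag, encList]
  | .field d f, e, h => by
    cases e <;> simp_all [Expr.enc, encTag, encList]
    exact Expr.eq_of_enc h.1
  | .static _ _, e, h => by cases e <;> simp_all [Expr.enc, encTag, encList]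
  | .stack _, e, h => by cases e <;> simp_all [Expr.enc, encTag, encList]
  | .loc _, e, h => by cases e <;> simp_all [Expr.enc, encTag, encList]
  | .ghost _, e, h => by
    cases e <;> simp_all [Expr.enc, encTag, encList]
    exact GVar.enc_injective h
  | .op _ d₁ d₂, e, h => by
    cases e <;> simp_all [Expr.enc, encTag, encList]
    exact ⟨Expr.eq_of_enc h.2.1, Expr.eq_of_enc h.2.2⟩
  | .cond a d₁ d₂, e, h => by
    cases e <;> simp_all [Expr.enc, encTag, encList]
    exact ⟨Assertion.eq_of_enc h.1, Expr.eq_of_enc h.2.1, Expr.eq_of_enc h.2.2⟩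
  | .pair d₁ d₂, e, h => by
    cases e <;> simp_all [Expr.enc, encTag, encList]
    exact ⟨Expr.eq_of_enc h.1, Expr.eq_of_enc h.2⟩
  | .bot, e, h => by cases e <;> simp_all [Expr.enc, encTag, encList]
theorem Assertion.eq_of_enc : ∀ {a b : Assertion}, a.enc = b.enc → a = b
  | .tt, b, h => by cases b <;> simp_all [Assertion.enc, encTag, encList]
  | .ff, b, h => by cases b <;> simp_all [Assertion.enc, encTag, encList]
  | .eq d₁ d₂, b, h => by
    cases b <;> simp_all [Assertion.enc, encTag, encList]
    exact ⟨Expr.eq_of_enc h.1, Expr.eq_of_enc h.2⟩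
  | .rel _ d₁ d₂, b, h => by
    cases b <;> simp_all [Assertion.enc, encTag, encList]
    exact ⟨Expr.eq_of_enc h.2.1, Expr.eq_of_enc h.2.2⟩
  | .and a₁ a₂, b, h => by
    cases b <;> simp_all [Assertion.enc, encTag, encList]
    exact ⟨Assertion.eq_of_enc h.1, Assertion.eq_of_enc h.2⟩
  | .not a, b, h => by
    cases b <;> simp_all [Assertion.enc, encTag, encList]
    exact Assertion.eq_of_enc h
  | .hasType d _, b, h => by
    cases b <;> simp_all [Assertion.enc, encTag, encList]
    exact Expr.eq_of_enc h.1
end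

instance : TreeEncInj GVar := ⟨GVar.enc_injective⟩
instance : TreeEncInj Assertion := ⟨fun _ _ => Assertion.eq_of_enc⟩

section
variable {γ : Type} [TreeEnc γ]

/-! #### Constructors -/

/-! Nodes with a tag and up to three parameters. -/

theorem PolyT.encTag_one (k : ℕ) {f : γ → Tree} (hf : PolyT f) : PolyT (fun x => encTag k [f x]) :=
  .treeNode (.const _) (.treeNode hf (.const _))
theorem PolyT.encTag_two (k : ℕ) {f g : γ → Tree} (hf : PolyT f) (hg : PolyT g) :
    PolyT (fun x => encTag k [f x, g x]) :=
  .treeNode (.const _) (.treeNode hf (.treeNode hg (.const _)))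
theorem PolyT.encTag_three (k : ℕ) {f g h : γ → Tree} (hf : PolyT f) (hg : PolyT g) (hh : PolyT h) :
    PolyT (fun x => encTag k [f x, g x, h x]) :=
  .treeNode (.const _) (.treeNode hf (.treeNode hg (.treeNode hh (.const _))))

theorem PolyT.encoded {α : Type} [TreeEnc α] {f : γ → α} (hf : PolyT f) :
    PolyT (fun x => (TreeEnc.enc (f x) : Tree)) := PolyT.toTree.comp hf

@[fun_prop] protected theorem PolyT.gvarMs {f : γ → ℕ} (hf : PolyT f) : PolyT (fun x => GVar.ms (f x)) :=
  .ofTree (.encTag_one 0 hf.encoded) fun _ => rfl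
@[fun_prop] protected theorem PolyT.gvarArg {f : γ → ℕ} (hf : PolyT f) : PolyT (fun x => GVar.arg (f x)) :=
  .ofTree (.encTag_one 2 hf.encoded) fun _ => rfl
@[fun_prop] protected theorem PolyT.exprLit {f : γ → ℕ} (hf : PolyT f) : PolyT (fun x => Expr.lit (f x)) :=
  .ofTree (.encTag_one 0 hf.encoded) fun _ => rfl
@[fun_prop] protected theorem PolyT.exprField {f : γ → Expr} {g : γ → ℕ} (hf : PolyT f) (hg : PolyT g) :
    PolyT (fun x => Expr.field (f x) (g x)) :=
  .ofTree (.encTag_two 1 hf.encoded hg.encoded) fun _ => rfl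
@[fun_prop] protected theorem PolyT.exprStatic {f g : γ → ℕ} (hf : PolyT f) (hg : PolyT g) :
    PolyT (fun x => Expr.static (f x) (g x)) :=
  .ofTree (.encTag_two 2 hf.encoded hg.encoded) fun _ => rfl
@[fun_prop] protected theorem PolyT.exprStack {f : γ → ℕ} (hf : PolyT f) : PolyT (fun x => Expr.stack (f x)) :=
  .ofTree (.encTag_one 3 hf.encoded) fun _ => rfl
@[fun_prop] protected theorem PolyT.exprLoc {f : γ → ℕ} (hf : PolyT f) : PolyT (fun x => Expr.loc (f x)) :=
  .ofTree (.encTag_one 4 hf.encoded) fun _ => rfl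
@[fun_prop] protected theorem PolyT.exprGhost {f : γ → GVar} (hf : PolyT f) : PolyT (fun x => Expr.ghost (f x)) :=
  .ofTree (.encTag_one 5 hf.encoded) fun _ => rfl
@[fun_prop] protected theorem PolyT.exprCond {a : γ → Assertion} {f g : γ → Expr} (ha : PolyT a) (hf : PolyT f)
    (hg : PolyT g) : PolyT (fun x => Expr.cond (a x) (f x) (g x)) :=
  .ofTree (.encTag_three 7 ha.encoded hf.encoded hg.encoded) fun _ => rfl
@[fun_prop] protected theorem PolyT.assertionEq {f g : γ → Expr} (hf : PolyT f) (hg : PolyT g) :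
    PolyT (fun x => Assertion.eq (f x) (g x)) :=
  .ofTree (.encTag_two 12 hf.encoded hg.encoded) fun _ => rfl
@[fun_prop] protected theorem PolyT.assertionAnd {f g : γ → Assertion} (hf : PolyT f) (hg : PolyT g) :
    PolyT (fun x => Assertion.and (f x) (g x)) :=
  .ofTree (.encTag_two 14 hf.encoded hg.encoded) fun _ => rfl
@[fun_prop] protected theorem PolyT.assertionNot {f : γ → Assertion} (hf : PolyT f) :
    PolyT (fun x => Assertion.not (f x)) :=
  .ofTree (.encTag_one 15 hf.encoded) fun _ => rfl
@[fun_prop] protected theorem PolyT.assertionHasType {f : γ → Expr} {g : γ → ℕ} (hf : PolyT f) (hg : PolyT g) :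
    PolyT (fun x => Assertion.hasType (f x) (g x)) :=
  .ofTree (.encTag_two 16 hf.encoded hg.encoded) fun _ => rfl
@[fun_prop] protected theorem PolyT.boolExpr {f : γ → Assertion} (hf : PolyT f) :
    PolyT (fun x => boolExpr (f x)) := by unfold IRM.boolExpr; fun_prop
@[fun_prop] protected theorem PolyT.imp {f g : γ → Assertion} (hf : PolyT f) (hg : PolyT g) :
    PolyT (fun x => Assertion.imp (f x) (g x)) := by unfold Assertion.imp; fun_prop
@[fun_prop] protected theorem PolyT.ite {a f g : γ → Assertion} (ha : PolyT a) (hf : PolyT f) (hg : PolyT g) :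
    PolyT (fun x => Assertion.ite (a x) (f x) (g x)) := by unfold Assertion.ite; fun_prop

/-- The constant consists of five for the tag, one for the end of the parameter list and three inner
nodes. -/
theorem sz_and (a b : Assertion) : sz (Assertion.and a b) = sz a + sz b + 9 := by
  change (encTag 14 [a.enc, b.enc]).size = a.enc.size + b.enc.size + 9
  have : Nat.size 14 = 4 := by decide
  simp [encTag, encList, Tree.size, this]; omega

@[fun_prop] protected theorem PolyT.conj {l : γ → List Assertion} (hl : PolyT l) :
    PolyT (fun x => Assertion.conj (l x)) := by
  have h : PolyT (fun x => IRM.paraList Assertion.tt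
      (fun a t v => bif t.isEmpty then a else Assertion.and a v) (l x)) := by
    refine .paraList (b := fun _ => Assertion.tt)
      (s := fun _ a t v => bif t.isEmpty then a else Assertion.and a v) (.const _) (by fun_prop) hl
      ⟨Polynomial.X + 9, fun x a t v => ?_⟩
    simp only [Polynomial.eval_add, Polynomial.eval_X, Polynomial.eval_ofNat]
    cases t.isEmpty with
    | true => simp only [cond_true]; omega
    | false => simp only [cond_false, sz_and]; omega
  convert h using 2 with x
  induction l x with
  | nil => rfl
  | cons a l ih =>
    cases l with
    | nil => rfl
    | cons b l => rw [Assertion.conj, ih]; rfl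

/-! #### Components -/

/-- Record fields and similar accessors are paths in the encoded tree. -/
theorem PolyT.component {α β : Type} [TreeEnc α] [TreeEnc β] {g : α → β} (F : Tree → Tree) (hF : PolyT F)
    (h : ∀ a, TreeEnc.enc (g a) = F (TreeEnc.enc a)) {f : γ → α} (hf : PolyT f) : PolyT (fun x => g (f x)) :=
  PolyT.comp (.ofTreeCode hF h) hf

@[fun_prop] protected theorem PolyT.bundleProg {f : γ → Bundle} (hf : PolyT f) : PolyT (fun x => (f x).prog) :=
  .component (fun t => t.fst) (by fun_prop) (fun _ => rfl) hf
@[fun_prop] protected theorem PolyT.bundleContract {f : γ → Bundle} (hf : PolyT f) :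
    PolyT (fun x => (f x).contract) :=
  .component (fun t => t.snd.fst) (by fun_prop) (fun _ => rfl) hf
@[fun_prop] protected theorem PolyT.bundleProof {f : γ → Bundle} (hf : PolyT f) :
    PolyT (fun x => (f x).proof) :=
  .component (fun t => t.snd.snd.fst) (by fun_prop) (fun _ => rfl) hf
@[fun_prop] protected theorem PolyT.supers {f : γ → Program} (hf : PolyT f) : PolyT (fun x => (f x).supers) :=
  .component (fun t => t.fst) (by fun_prop) (fun _ => rfl) hf

/-- The API methods, with arities in unary. -/
def Program.unaryApi (P : Program) : List (ℕ × ℕ × Unary × Unit) :=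
  P.api.map fun q => (q.1, q.2.1, ⟨q.2.2⟩, ())

-- The unit in each entry matches the leaf that terminates the encoded list, so the nested tuples
-- have the same tree as the original encoding.
@[fun_prop] protected theorem PolyT.unaryApi {f : γ → Program} (hf : PolyT f) :
    PolyT (fun x => (f x).unaryApi) :=
  .component (fun t => t.snd.fst) (by fun_prop) (fun P => by
    change encList _ = encList _
    rw [Program.unaryApi, List.map_map]; rfl) hf
@[fun_prop] protected theorem PolyT.methods {f : γ → Program} (hf : PolyT f) : PolyT (fun x => (f x).methods) :=
  .component (fun t => t.snd.snd.fst) (by fun_prop) (fun _ => rfl) hf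
@[fun_prop] protected theorem PolyT.methodCode {f : γ → Method} (hf : PolyT f) : PolyT (fun x => (f x).code) :=
  .component (fun t => t.snd.snd.snd.fst) (by fun_prop) (fun _ => rfl) hf
@[fun_prop] protected theorem PolyT.methodHandlers {f : γ → Method} (hf : PolyT f) :
    PolyT (fun x => (f x).handlers) :=
  .component (fun t => t.snd.snd.snd.snd.fst) (by fun_prop) (fun _ => rfl) hf
@[fun_prop] protected theorem PolyT.handlerB {f : γ → Handler} (hf : PolyT f) : PolyT (fun x => (f x).b) :=
  .component (fun t => t.fst) (by fun_prop) (fun _ => rfl) hf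
@[fun_prop] protected theorem PolyT.handlerE {f : γ → Handler} (hf : PolyT f) : PolyT (fun x => (f x).e) :=
  .component (fun t => t.snd.fst) (by fun_prop) (fun _ => rfl) hf
@[fun_prop] protected theorem PolyT.handlerTarget {f : γ → Handler} (hf : PolyT f) :
    PolyT (fun x => (f x).target) :=
  .component (fun t => t.snd.snd.fst) (by fun_prop) (fun _ => rfl) hf
@[fun_prop] protected theorem PolyT.handlerCls {f : γ → Handler} (hf : PolyT f) : PolyT (fun x => (f x).cls) :=
  .component (fun t => t.snd.snd.snd.fst) (by fun_prop) (fun _ => rfl) hf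
@[fun_prop] protected theorem PolyT.state {f : γ → Contract} (hf : PolyT f) : PolyT (fun x => (f x).state) :=
  .component (fun t => t.fst) (by fun_prop) (fun _ => rfl) hf
@[fun_prop] protected theorem PolyT.specs {f : γ → Contract} (hf : PolyT f) : PolyT (fun x => (f x).specs) :=
  .component (fun t => t.snd) (by fun_prop) (fun _ => rfl) hf
@[fun_prop] protected theorem PolyT.specCls {f : γ → MethodSpec} (hf : PolyT f) : PolyT (fun x => (f x).cls) :=
  .component (fun t => t.fst) (by fun_prop) (fun _ => rfl) hf
@[fun_prop] protected theorem PolyT.specName {f : γ → MethodSpec} (hf : PolyT f) : PolyT (fun x => (f x).name) :=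
  .component (fun t => t.snd.fst) (by fun_prop) (fun _ => rfl) hf
@[fun_prop] protected theorem PolyT.specArity {f : γ → MethodSpec} (hf : PolyT f) :
    PolyT (fun x => (f x).arity) :=
  PolyT.unaryVal (n := fun x => ⟨(f x).arity⟩)
    (.component (g := fun s : MethodSpec => (⟨s.arity⟩ : Unary)) (fun t => t.snd.snd.fst) (by fun_prop)
      (fun _ => rfl) hf)

theorem enc_clauses (o : Option (List Clause)) : TreeEnc.enc o = encClauses o := by cases o <;> rfl

@[fun_prop] protected theorem PolyT.specBefore {f : γ → MethodSpec} (hf : PolyT f) :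
    PolyT (fun x => (f x).before) :=
  .component (fun t => t.snd.snd.snd.fst) (by fun_prop) (fun _ => enc_clauses _) hf
@[fun_prop] protected theorem PolyT.specAfter {f : γ → MethodSpec} (hf : PolyT f) :
    PolyT (fun x => (f x).after) :=
  .component (fun t => t.snd.snd.snd.snd.fst) (by fun_prop) (fun _ => enc_clauses _) hf
@[fun_prop] protected theorem PolyT.specExceptional {f : γ → MethodSpec} (hf : PolyT f) :
    PolyT (fun x => (f x).exceptional) :=
  .component (fun t => t.snd.snd.snd.snd.snd.fst) (by fun_prop) (fun _ => enc_clauses _) hf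
@[fun_prop] protected theorem PolyT.clauseGuard {f : γ → Clause} (hf : PolyT f) : PolyT (fun x => (f x).guard) :=
  .component (fun t => t.fst) (by fun_prop) (fun _ => rfl) hf
@[fun_prop] protected theorem PolyT.clauseUpdate {f : γ → Clause} (hf : PolyT f) :
    PolyT (fun x => (f x).update) :=
  .component (fun t => t.snd) (by fun_prop) (fun _ => rfl) hf

/-! #### Instructions -/

/-- The number at a leaf. -/
def Tree.value : Tree → ℕ
  | .atom n => n
  | .node _ _ => 0

@[fun_prop] protected theorem PolyT.treeValue {f : γ → Tree} (hf : PolyT f) : PolyT (fun x => (f x).value) :=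
  .ofTree (F := fun x => bif (f x).leafTest then f x else .atom 0) (by fun_prop) fun x => by
    cases f x <;> rfl

/-- Matching on instructions is replaced by tests of the tag and total accessors with default
values, since programs of the machine model see only trees. -/
def Instr.tag (ι : Instr) : ℕ := ι.enc.fst.value
def Instr.num (ι : Instr) : ℕ := ι.enc.snd.fst.value
def Instr.num' (ι : Instr) : ℕ := ι.enc.snd.snd.fst.value
def Instr.arity : Instr → Unary
  | .invoke _ _ n => ⟨n⟩
  | _ => ⟨0⟩
def Instr.guard : Instr → Assertion
  | .evalGuard g => g
  | _ => .ff
def Instr.update : Instr → List (ℕ × Expr)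
  | .execUpdate u => u
  | _ => []

@[fun_prop] protected theorem PolyT.instrTag {f : γ → Instr} (hf : PolyT f) : PolyT (fun x => (f x).tag) :=
  have h : PolyT (fun x => ((TreeEnc.enc (f x) : Tree).fst.value)) :=
    .treeValue (PolyT.treeFst.comp hf.encoded)
  h
@[fun_prop] protected theorem PolyT.instrNum {f : γ → Instr} (hf : PolyT f) : PolyT (fun x => (f x).num) :=
  have h : PolyT (fun x => ((TreeEnc.enc (f x) : Tree).snd.fst.value)) :=
    .treeValue (PolyT.treeFst.comp (PolyT.treeSnd.comp hf.encoded))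
  h
@[fun_prop] protected theorem PolyT.instrNum' {f : γ → Instr} (hf : PolyT f) : PolyT (fun x => (f x).num') :=
  have h : PolyT (fun x => ((TreeEnc.enc (f x) : Tree).snd.snd.fst.value)) :=
    .treeValue (PolyT.treeFst.comp (PolyT.treeSnd.comp (PolyT.treeSnd.comp hf.encoded)))
  h
@[fun_prop] protected theorem PolyT.instrArity {f : γ → Instr} (hf : PolyT f) : PolyT (fun x => (f x).arity) :=
  .component (fun t => bif IRM.teq t.fst (.atom 13) then t.snd.snd.snd.fst else .atom 0) (by fun_prop)
    (fun ι => by cases ι <;> rfl) hf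
@[fun_prop] protected theorem PolyT.instrGuard {f : γ → Instr} (hf : PolyT f) : PolyT (fun x => (f x).guard) :=
  .component (fun t => bif IRM.teq t.fst (.atom 16) then t.snd.fst else TreeEnc.enc Assertion.ff)
    (by fun_prop) (fun ι => by cases ι <;> rfl) hf
@[fun_prop] protected theorem PolyT.instrUpdate {f : γ → Instr} (hf : PolyT f) : PolyT (fun x => (f x).update) :=
  .component (fun t => bif IRM.teq t.fst (.atom 17) then t.snd else .atom 0)
    (by fun_prop) (fun ι => by cases ι <;> rfl) hf

/-- The case distinction in terms of tags is built from operations with known closure properties. -/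
theorem data_eq (ι : Instr) : ι.data =
    bif teq ι.tag 0 then some ([(.stack 0, boolExpr (.hasType (.stack 0) ι.num))], 0)
    else bif teq ι.tag 1 then some ([(.stack 0, .loc ι.num)], 3)
    else bif teq ι.tag 2 then some ([(.loc ι.num, .stack 0)], 1)
    else bif teq ι.tag 4 then some ([(.stack 0, .stack 0)], 3)
    else bif teq ι.tag 5 then some ([(.stack 0, .field (.stack 0) ι.num)], 0)
    else bif teq ι.tag 6 then some ([(.stack 0, .static ι.num ι.num')], 3)
    else bif teq ι.tag 7 then some ([(.static ι.num ι.num', .stack 0)], 1)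
    else bif teq ι.tag 9 then some ([(.stack 0, .lit ι.num)], 3)
    else bif teq ι.tag 10 then some ([(.stack 0, .lit ι.num)], 3)
    else bif teq ι.tag 16 then some ([(.stack 0, boolExpr ι.guard)], 3)
    else bif teq ι.tag 17 then some (ι.update.map fun p => (.static monitorClass p.1, p.2), 0)
    else none := by
  cases ι <;> rfl

@[fun_prop] protected theorem PolyT.instrData {f : γ → Instr} (hf : PolyT f) : PolyT (fun x => (f x).data) := by
  simp only [data_eq]
  fun_prop

end
section
variable {γ : Type} [TreeEnc γ]

/-! #### Substitution and instantiation -/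

@[fun_prop] protected theorem PolyT.shiftIndex {f g : γ → ℕ} (hf : PolyT f) (hg : PolyT g) :
    PolyT (fun x => shiftIndex (f x) (g x)) := by unfold IRM.shiftIndex; fun_prop

theorem sz_shiftIndex_le (mode i : ℕ) : sz (shiftIndex mode i) ≤ sz i + 2 := by
  have h1 := nat_size_succ_le i
  have h2 : Nat.size (i + 2) ≤ Nat.size (i + 1) + 1 := nat_size_succ_le (i + 1)
  have h3 : Nat.size (i - 1) ≤ Nat.size i := Nat.size_le_size (Nat.sub_le i 1)
  rw [shiftIndex, sz_nat, sz_nat]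
  cases teq mode 0 <;> cases teq mode 1 <;> cases teq mode 2 <;>
    simp only [cond_true, cond_false] <;> omega

/-- The step of substitution, as a recursion over encoded terms. -/
def SubstData.step (d : SubstData) (l r v : Tree) : Tree :=
  bif teq l (.atom 2) || teq l (.atom 3) || teq l (.atom 4) || teq l (.atom 5) then
    ((d.1.map fun p => ((TreeEnc.enc p.1 : Tree), (TreeEnc.enc p.2 : Tree))).lookup (.node l r)).getD
      (bif teq l (.atom 3) then .node l (.node (.atom (shiftIndex d.2 r.fst.value)) (.atom 0))
        else .node l r)
  else .node l v

theorem SubstData.lookup_enc (d : SubstData) (e : Expr) :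
    (d.1.map fun p => ((TreeEnc.enc p.1 : Tree), (TreeEnc.enc p.2 : Tree))).lookup e.enc =
      (d.1.lookup e).map Expr.enc :=
  lookup_map (f := Expr.enc) (fun _ _ => Expr.eq_of_enc) Expr.enc e d.1

theorem getD_map_enc (o : Option Expr) (e : Expr) : (o.map Expr.enc).getD e.enc = (o.getD e).enc := by
  cases o <;> rfl

mutual
-- The tags of variables occur nowhere else among expressions and assertions, but they overlap with
-- those of ghost variable names. So at a variable the step consults the original parameters `r` and
-- ignores the values computed for them.
theorem Expr.enc_subst (d : SubstData) : ∀ e : Expr, (e.subst d.toSubst).enc = e.enc.termRec d.step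
  | .lit _ => rfl
  | .field e f => by rw [Expr.subst, Expr.enc, e.enc_subst d]; rfl
  | .static c f => by
    have h := d.lookup_enc (.static c f)
    rw [Expr.subst, SubstData.toSubst, ← getD_map_enc, ← h]; rfl
  | .stack i => by
    have h := d.lookup_enc (.stack i)
    rw [Expr.subst, SubstData.toSubst, ← getD_map_enc, ← h]; rfl
  | .loc i => by
    have h := d.lookup_enc (.loc i)
    rw [Expr.subst, SubstData.toSubst, ← getD_map_enc, ← h]; rfl
  | .ghost x => by
    have h := d.lookup_enc (.ghost x)
    rw [Expr.subst, SubstData.toSubst, ← getD_map_enc, ← h]; rfl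
  | .op o e₁ e₂ => by rw [Expr.subst, Expr.enc, e₁.enc_subst d, e₂.enc_subst d]; rfl
  | .cond a e₁ e₂ => by rw [Expr.subst, Expr.enc, a.enc_subst d, e₁.enc_subst d, e₂.enc_subst d]; rfl
  | .pair e₁ e₂ => by rw [Expr.subst, Expr.enc, e₁.enc_subst d, e₂.enc_subst d]; rfl
  | .bot => rfl
theorem Assertion.enc_subst (d : SubstData) :
    ∀ a : Assertion, (a.subst d.toSubst).enc = a.enc.termRec d.step
  | .tt => rfl
  | .ff => rfl
  | .eq e₁ e₂ => by rw [Assertion.subst, Assertion.enc, e₁.enc_subst d, e₂.enc_subst d]; rfl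
  | .rel r e₁ e₂ => by rw [Assertion.subst, Assertion.enc, e₁.enc_subst d, e₂.enc_subst d]; rfl
  | .and a b => by rw [Assertion.subst, Assertion.enc, a.enc_subst d, b.enc_subst d]; rfl
  | .not a => by rw [Assertion.subst, Assertion.enc, a.enc_subst d]; rfl
  | .hasType e c => by rw [Assertion.subst, Assertion.enc, e.enc_subst d]; rfl
end

theorem sz_node (l r : Tree) : sz (Tree.node l r) = sz l + sz r + 1 := rfl

/-- A variable is replaced by something no larger than the description of the substitution, or its
index grows by at most two bits. Growth is therefore bounded by a factor linear in `sz d`. -/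
theorem SubstData.sz_step_le (d : SubstData) (m : ℕ) (hm : sz d + 10 ≤ m) (l r v : Tree)
    (h : sz v ≤ m * sz r) : sz (d.step l r v) ≤ m * (sz l + sz r + 1) := by
  obtain ⟨k, rfl⟩ := Nat.exists_eq_add_of_le hm
  have e : (sz d + 10 + k) * (sz l + sz r + 1) =
    (sz d + k) * (sz l + sz r + 1) + 10 * sz l + 10 * sz r + 10 := by ring
  have h1 : sz l + sz v + 1 ≤ (sz d + 10 + k) * (sz l + sz r + 1) := by
    have : (sz d + 10 + k) * (sz l + sz r + 1) =
      (sz d + 10 + k) * sz r + (sz d + k) * (sz l + 1) + 10 * sz l + 10 := by ring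
    omega
  have h2 : sz d + k ≤ (sz d + k) * (sz l + sz r + 1) := Nat.le_mul_of_pos_right _ (by omega)
  rw [SubstData.step]
  cases teq l (.atom 2) || teq l (.atom 3) || teq l (.atom 4) || teq l (.atom 5) with
  | false => exact h1
  | true =>
    rw [cond_true]
    cases hl : (d.1.map fun p => ((TreeEnc.enc p.1 : Tree), (TreeEnc.enc p.2 : Tree))).lookup (.node l r) with
    | some t =>
      obtain ⟨p, hp, hpt⟩ := List.mem_map.1 (mem_of_lookup hl)
      have h3 := sz_le_of_mem hp
      have h4 : sz p = sz p.1 + sz p.2 + 1 := rfl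
      have h5 : sz d = sz d.1 + sz d.2 + 1 := rfl
      have h6 : sz t = sz p.2 := by rw [← (Prod.mk.inj hpt).2]; rfl
      rw [Option.getD_some]
      omega
    | none =>
      rw [Option.getD_none]
      cases teq l (.atom 3) with
      | false => rw [cond_false, sz_node]; omega
      | true =>
        have h3 := sz_shiftIndex_le d.2 r.fst.value
        have h4 : sz r.fst.value ≤ sz r := by
          have h5 : sz r.fst ≤ sz r := r.size_fst_le
          have h6 : sz r.fst.value ≤ sz r.fst := by
            cases r.fst with
            | atom n => exact le_rfl
            | node a b => rw [sz_node]; simp [Tree.value, sz_nat]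
          omega
        have h7 : sz (Tree.atom (shiftIndex d.2 r.fst.value)) = sz (shiftIndex d.2 r.fst.value) := rfl
        have h8 : sz (Tree.atom 0) = 1 := rfl
        rw [cond_true, sz_node, sz_node, h7, h8]
        omega

protected theorem PolyT.substTree {d : γ → SubstData} {t : γ → Tree} (hd : PolyT d) (ht : PolyT t) :
    PolyT (fun x => (t x).termRec (d x).step) := by
  have h : PolyT (fun p : SubstData × Tree => p.2.termRec p.1.step) := by
    refine PolyT.termRec (h := fun p : SubstData × Tree => p.1.step) ?_ .snd (Polynomial.X + 10)
      (fun x => by simp) fun x l r v hv => ?_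
    · unfold SubstData.step
      have h1 : PolyT (fun p : (SubstData × Tree) × Tree × Tree × Tree =>
          p.1.1.1.map fun q => ((TreeEnc.enc q.1 : Tree), (TreeEnc.enc q.2 : Tree))) :=
        .map (f := fun (_ : (SubstData × Tree) × Tree × Tree × Tree) (q : Expr × Expr) =>
            ((TreeEnc.enc q.1 : Tree), (TreeEnc.enc q.2 : Tree)))
          (.comp PolyT.fst (.comp PolyT.fst PolyT.fst))
          (.prodMk (PolyT.encoded (.comp PolyT.fst PolyT.snd)) (PolyT.encoded (.comp PolyT.snd PolyT.snd)))
      have h2 : PolyT (fun p : (SubstData × Tree) × Tree × Tree × Tree =>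
          Tree.atom (IRM.shiftIndex p.1.1.2 p.2.2.1.fst.value)) :=
        (PolyT.shiftIndex (f := fun p : (SubstData × Tree) × Tree × Tree × Tree => p.1.1.2)
          (g := fun p => p.2.2.1.fst.value) (by fun_prop) (by fun_prop)).encoded
      fun_prop
    · simp only [Polynomial.eval_add, Polynomial.eval_X, Polynomial.eval_ofNat] at hv ⊢
      have e : sz x = sz x.1 + sz x.2 + 1 := rfl
      exact x.1.sz_step_le _ (by omega) l r v hv
  exact h.comp (hd.prodMk ht)

@[fun_prop] protected theorem PolyT.exprSubst {d : γ → SubstData} {e : γ → Expr} (hd : PolyT d) (he : PolyT e) :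
    PolyT (fun x => (e x).subst (d x).toSubst) :=
  .ofTree (.substTree hd he.encoded) fun _ => Expr.enc_subst _ _
@[fun_prop] protected theorem PolyT.assertionSubst {d : γ → SubstData} {a : γ → Assertion} (hd : PolyT d)
    (ha : PolyT a) : PolyT (fun x => (a x).subst (d x).toSubst) :=
  .ofTree (.substTree hd ha.encoded) fun _ => Assertion.enc_subst _ _

/-- The step of the instantiation of contract expressions. -/
def CExpr.instStep (l r v : Tree) : Tree :=
  bif teq l (.atom 1) then .node (.atom 5) (.node (.node (.atom 0) r) (.atom 0))
  else bif teq l (.atom 2) then .node (.atom 5) (.node (.node (.atom 2) r) (.atom 0))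
  else bif teq l (.atom 3) then .node (.atom 5) (.node (.node (.atom 3) r) (.atom 0))
  else bif teq l (.atom 4) then .node (.atom 1) v
  else bif teq l (.atom 5) then .node (.atom 6) v
  else .node l v

theorem CExpr.enc_inst (e : CExpr) : (e.inst ghostPlaces).enc = e.enc.termRec CExpr.instStep := by
  induction e with
  | field e f ih => rw [CExpr.inst, Expr.enc, ih]; rfl
  | op o e₁ e₂ ih₁ ih₂ => rw [CExpr.inst, Expr.enc, ih₁, ih₂]; rfl
  | _ => rfl

theorem CExpr.sz_instStep_le (l r v : Tree) (h : sz v ≤ 20 * sz r) :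
    sz (CExpr.instStep l r v) ≤ 20 * (sz l + sz r + 1) := by
  have h0 : sz (Tree.atom 0) = 1 := rfl
  have h1 : sz (Tree.atom 1) = 2 := by decide
  have h2 : sz (Tree.atom 2) = 3 := by decide
  have h3 : sz (Tree.atom 3) = 3 := by decide
  have h5 : sz (Tree.atom 5) = 4 := by decide
  have h6 : sz (Tree.atom 6) = 4 := by decide
  rw [CExpr.instStep]
  cases teq l (.atom 1) <;> cases teq l (.atom 2) <;> cases teq l (.atom 3) <;> cases teq l (.atom 4) <;>
    cases teq l (.atom 5) <;> simp only [cond_true, cond_false, sz_node, h0, h1, h2, h3, h5, h6] <;> omega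

protected theorem PolyT.instTree {t : γ → Tree} (ht : PolyT t) :
    PolyT (fun x => (t x).termRec CExpr.instStep) :=
  .termRec (h := fun _ => CExpr.instStep) (by unfold CExpr.instStep; fun_prop) ht (Polynomial.C 20)
    (fun _ => by simp) fun _ l r v h => by
      simp only [Polynomial.eval_C] at h ⊢
      exact CExpr.sz_instStep_le l r v h

@[fun_prop] protected theorem PolyT.cexprInst {e : γ → CExpr} (he : PolyT e) :
    PolyT (fun x => (e x).inst ghostPlaces) :=
  .ofTree (.instTree he.encoded) fun _ => CExpr.enc_inst _

/-- The step of the instantiation of contract guards. -/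
def CGuard.instStep (l r v : Tree) : Tree :=
  bif teq l (.atom 0) then .node (.atom 10) v
  else bif teq l (.atom 1) then .node (.atom 11) v
  else bif teq l (.atom 2) then .node (.atom 12) ((Tree.node (.atom 6) r).termRec CExpr.instStep).snd
  else bif teq l (.atom 3) then .node (.atom 13) ((Tree.node (.atom 6) r).termRec CExpr.instStep).snd
  else bif teq l (.atom 4) then .node (.atom 14) v
  else bif teq l (.atom 5) then .node (.atom 15) v
  else .node (.atom 16) ((Tree.node (.atom 6) r).termRec CExpr.instStep).snd

/-- Tags of guards and of contract expressions overlap. At an atomic guard the step hence ignores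
the computed values and instantiates the original parameters as expressions, under the dummy tag
`6`, which instantiation leaves alone. -/
theorem CGuard.enc_inst (g : CGuard) : (g.inst ghostPlaces).enc = g.enc.termRec CGuard.instStep := by
  induction g with
  | and g₁ g₂ ih₁ ih₂ => rw [CGuard.inst, Assertion.enc, ih₁, ih₂]; rfl
  | not g ih => rw [CGuard.inst, Assertion.enc, ih]; rfl
  | eq e₁ e₂ => rw [CGuard.inst, Assertion.enc, CExpr.enc_inst, CExpr.enc_inst]; rfl
  | rel r e₁ e₂ => rw [CGuard.inst, Assertion.enc, CExpr.enc_inst, CExpr.enc_inst]; rfl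
  | hasType e c => rw [CGuard.inst, Assertion.enc, CExpr.enc_inst]; rfl
  | _ => rfl

theorem CGuard.sz_instStep_le (l r v : Tree) (h : sz v ≤ 120 * sz r) :
    sz (CGuard.instStep l r v) ≤ 120 * (sz l + sz r + 1) := by
  have h1 := (Tree.sz_termRec_le (by norm_num) CExpr.sz_instStep_le (Tree.node (.atom 6) r)).1
  have h2 : sz ((Tree.node (.atom 6) r).termRec CExpr.instStep).snd ≤ _ := Tree.size_snd_le _
  have h3 := h2.trans h1
  have h6 : sz (Tree.atom 6) = 4 := by decide
  have h10 : sz (Tree.atom 10) = 5 := by decide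
  have h11 : sz (Tree.atom 11) = 5 := by decide
  have h12 : sz (Tree.atom 12) = 5 := by decide
  have h13 : sz (Tree.atom 13) = 5 := by decide
  have h14 : sz (Tree.atom 14) = 5 := by decide
  have h15 : sz (Tree.atom 15) = 5 := by decide
  have h16 : sz (Tree.atom 16) = 6 := by decide
  have hl := one_le_sz l
  rw [sz_node, h6] at h3
  rw [CGuard.instStep]
  cases teq l (.atom 0) <;> cases teq l (.atom 1) <;> cases teq l (.atom 2) <;> cases teq l (.atom 3) <;>
    cases teq l (.atom 4) <;> cases teq l (.atom 5) <;>
    simp only [cond_true, cond_false, sz_node, h10, h11, h12, h13, h14, h15, h16] <;> omega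

@[fun_prop] protected theorem PolyT.cguardInst {g : γ → CGuard} (hg : PolyT g) :
    PolyT (fun x => (g x).inst ghostPlaces) := by
  have h : PolyT (fun p : γ × Tree × Tree × Tree =>
      ((Tree.node (.atom 6) p.2.2.1).termRec CExpr.instStep).snd) :=
    PolyT.treeSnd.comp (.instTree (by fun_prop))
  exact .ofTree (.termRec (h := fun _ => CGuard.instStep) (by unfold CGuard.instStep; fun_prop) hg.encoded
    (Polynomial.C 120) (fun _ => by simp) fun _ l r v h => by
      simp only [Polynomial.eval_C] at h ⊢
      exact CGuard.sz_instStep_le l r v h) fun _ => CGuard.enc_inst _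

end
section
variable {α γ : Type} [TreeEnc α] [TreeEnc γ]

/-! #### Class hierarchy and contracts -/

theorem paraList_eq_iterate {α β : Type} (b : β) (f : β → β) (l : List α) :
    paraList b (fun _ _ v => f v) l = f^[l.length] b := by
  induction l with
  | nil => rfl
  | cons a l ih => rw [paraList, ih, List.length_cons, Function.iterate_succ_apply']

/-- One step up the class hierarchy, in search of the class `d`. -/
def chainStep (supers : List (ℕ × ℕ)) (d : ℕ) (s : Option ℕ × Bool) : Option ℕ × Bool :=
  (s.1.bind fun c => supers.lookup c,
    s.2 || (s.1.bind fun c => supers.lookup c).elim false fun c => teq c d)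

/-- The list of superclasses is not built: only the current class and a flag, whether `d` has been
met, are kept, which bounds the state of the iteration. -/
theorem chainStep_iterate (supers : List (ℕ × ℕ)) (d k c : ℕ) (b : Bool) :
    ((chainStep supers d)^[k] (some c, b || teq c d)).2 = (b || (superChain supers k c).contains d) := by
  have hc : ∀ c : ℕ, (d == c) = teq c d := fun c => by
    rw [teq, beq_eq_decide]; exact decide_eq_decide.2 eq_comm
  induction k generalizing c b with
  | zero => simp only [Function.iterate_zero, id, superChain, List.contains_cons, List.contains_nil, hc,
      Bool.or_false]
  | succ k ih =>
    rw [Function.iterate_succ_apply, superChain, List.contains_cons, hc, chainStep]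
    simp only [Option.bind_some]
    cases supers.lookup c with
    | none =>
      have h : ∀ (k : ℕ) (b : Bool), (chainStep supers d)^[k] (none, b) = (none, b) := by
        intro k b
        induction k with
        | zero => rfl
        | succ k ih =>
          rw [Function.iterate_succ_apply]
          simpa [chainStep] using ih
      simp [h]
    | some c' =>
      rw [Option.elim, ih, Bool.or_assoc]

theorem sz_lookup_le [DecidableEq α] {k : α} {l : List (α × γ)} : sz (l.lookup k) ≤ sz l + 3 := by
  cases h : l.lookup k with
  | none => rw [sz_none]; omega
  | some b =>
    have := sz_le_of_mem (mem_of_lookup h)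
    rw [sz_pair] at this
    rw [sz_some]; omega

@[fun_prop] protected theorem PolyT.subclass {P : γ → Program} {c d : γ → ℕ} (hP : PolyT P) (hc : PolyT c)
    (hd : PolyT d) : PolyT (fun x => (P x).subclass (c x) (d x)) := by
  -- The list of superclass entries serves only as a counter; its length is the number of levels
  -- searched.
  have h : PolyT (fun x => (IRM.paraList (some (c x), IRM.teq (c x) (d x))
      (fun _ _ v => chainStep (P x).supers (d x) v) (P x).supers).2) := by
    refine PolyT.snd.comp (.paraList_of_le (b := fun x => (some (c x), IRM.teq (c x) (d x)))
      (s := fun x _ _ v => chainStep (P x).supers (d x) v) (by fun_prop)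
      (by unfold chainStep; fun_prop) (by fun_prop) (f := fun x _ => (P x).supers) (by fun_prop)
      fun x a t v => ?_)
    have h1 := sz_bool_le (chainStep (P x).supers (d x) v).2
    have h2 : sz v = sz v.1 + sz v.2 + 1 := rfl
    have h3 := one_le_sz v.1
    have h4 := one_le_sz v.2
    have h5 : sz (chainStep (P x).supers (d x) v).1 ≤ sz (P x).supers + 3 := by
      rw [chainStep]
      cases v.1 with
      | none => rw [Option.bind_none, sz_none]; omega
      | some c => exact sz_lookup_le
    have h6 : sz (chainStep (P x).supers (d x) v) =
      sz (chainStep (P x).supers (d x) v).1 + sz (chainStep (P x).supers (d x) v).2 + 1 := rfl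
    omega
  convert h using 2 with x
  rw [paraList_eq_iterate]
  have := chainStep_iterate (P x).supers (d x) (P x).supers.length (c x) false
  rw [Bool.false_or, Bool.false_or] at this
  exact this.symm

@[fun_prop] protected theorem PolyT.candidates {P : γ → Program} {c m n : γ → ℕ} (hP : PolyT P) (hc : PolyT c)
    (hm : PolyT m) (hn : PolyT n) : PolyT (fun x => candidates (P x) (c x) (m x) (n x)) := by
  have h : PolyT (fun x => (P x).unaryApi.filterMap fun q =>
      bif IRM.teq q.2.1 (m x) && IRM.teq q.2.2.1.val (n x) &&
        ((P x).subclass q.1 (c x) || (P x).subclass (c x) q.1) then some q.1 else none) := by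
    fun_prop
  convert h using 2 with x
  rw [IRM.candidates, Program.unaryApi, List.filterMap_map]
  refine List.filterMap_congr fun q _ => ?_
  simp only [Function.comp]
  by_cases h1 : q.2.1 = m x <;> by_cases h2 : q.2.2 = n x <;>
    simp [IRM.teq, h1, h2, Prod.ext_iff, Bool.cond_eq_ite]

@[fun_prop] protected theorem PolyT.spec {K : γ → Contract} {d m n : γ → ℕ} (hK : PolyT K) (hd : PolyT d)
    (hm : PolyT m) (hn : PolyT n) : PolyT (fun x => (K x).spec (d x) (m x) (n x)) := by
  have h : PolyT (fun x => (K x).specs.find? fun s =>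
      IRM.teq s.cls (d x) && (IRM.teq s.name (m x) && IRM.teq s.arity (n x))) := by fun_prop
  convert h using 2 with x
  rw [Contract.spec]
  congr 1
  funext s
  simp [IRM.teq, Bool.decide_and]

@[fun_prop] protected theorem PolyT.relevant {P : γ → Program} {K : γ → Contract} {c m n : γ → ℕ} (hP : PolyT P)
    (hK : PolyT K) (hc : PolyT c) (hm : PolyT m) (hn : PolyT n) :
    PolyT (fun x => relevant (P x) (K x) (c x) (m x) (n x)) := by
  unfold IRM.relevant; fun_prop

@[fun_prop] protected theorem PolyT.eventClauses {P : γ → Program} {K : γ → Contract}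
    {ev : MethodSpec → Option (List Clause)} {c m n : γ → ℕ} (hP : PolyT P)
    (hK : PolyT K) (hev : PolyT ev) (hc : PolyT c) (hm : PolyT m) (hn : PolyT n) :
    PolyT (fun x => eventClauses (P x) (K x) ev (c x) (m x) (n x)) := by
  unfold IRM.eventClauses
  have h : PolyT (fun p : γ × ℕ => ((K p.1).spec p.2 (m p.1) (n p.1)).bind ev) :=
    .optionBind (g := fun _ => ev) (by fun_prop) (by fun_prop)
  fun_prop

/-! #### The ghost monitor -/

/-- Separates the growth in one step of building a chain from the part built before, as the
recursion principle requires; `⊥` holds the place of the latter. -/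
theorem sz_cond_le (a : Assertion) (e f : Expr) :
    sz (Expr.cond a e f) ≤ sz f + sz (Expr.cond a e .bot) := by
  change (encTag 7 [a.enc, e.enc, f.enc]).size ≤ f.enc.size + (encTag 7 [a.enc, e.enc, Expr.enc .bot]).size
  simp only [encTag, encList, Tree.size]; omega

@[fun_prop] protected theorem PolyT.updValue {u : γ → List (ℕ × CExpr)} {v : γ → ℕ} (hu : PolyT u) (hv : PolyT v) :
    PolyT (fun x => updValue (u x) (v x)) := by
  unfold IRM.updValue
  have : PolyT (fun x => CExpr.state (v x)) := .ofTree (.encTag_one 1 hv.encoded) fun _ => rfl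
  fun_prop

@[fun_prop] protected theorem PolyT.ghostDelta {v : γ → ℕ} {l : γ → List Clause} (hv : PolyT v) (hl : PolyT l) :
    PolyT (fun x => ghostDelta (v x) (l x)) := by
  have h : PolyT (fun x => IRM.paraList Expr.bot
      (fun cl _ e => .cond (cl.guard.inst ghostPlaces) (updValue cl.update (v x)) e) (l x)) := by
    refine .paraList_of_le (b := fun _ => Expr.bot)
      (s := fun x cl _ e => .cond (cl.guard.inst ghostPlaces) (updValue cl.update (v x)) e)
      (by fun_prop) (by fun_prop) hl
      (f := fun x cl => Expr.cond (cl.guard.inst ghostPlaces) (updValue cl.update (v x)) .bot) (by fun_prop)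
      fun x cl t e => ?_
    have := sz_cond_le (cl.guard.inst ghostPlaces) (updValue cl.update (v x)) e
    omega
  convert h using 2 with x
  induction l x with
  | nil => rfl
  | cons cl l ih => rw [IRM.paraList, ← ih]; rfl

@[fun_prop] protected theorem PolyT.eventValue {v : γ → ℕ} {l : γ → List (ℕ × Option (List Clause))}
    (hv : PolyT v) (hl : PolyT l) : PolyT (fun x => eventValue (v x) (l x)) := by
  have h : PolyT (fun x => IRM.paraList (Expr.ghost (.ms (v x)))
      (fun p _ e => .cond (.hasType (.ghost .target) p.1)
        (p.2.elim (.ghost (.ms (v x))) (ghostDelta (v x))) e) (l x)) := by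
    have key : PolyT (fun p : γ × ℕ × Option (List Clause) =>
      p.2.2.elim (Expr.ghost (.ms (v p.1))) (ghostDelta (v p.1))) :=
      .optionElim (g := fun p : γ × ℕ × Option (List Clause) => ghostDelta (v p.1)) (by fun_prop) (by fun_prop) (by fun_prop)
    refine .paraList_of_le (b := fun x => Expr.ghost (.ms (v x)))
      (s := fun x p _ e => .cond (.hasType (.ghost .target) p.1)
        (p.2.elim (.ghost (.ms (v x))) (ghostDelta (v x))) e)
      (by fun_prop) ?_ hl
      (f := fun x p => Expr.cond (.hasType (.ghost .target) p.1)
        (p.2.elim (.ghost (.ms (v x))) (ghostDelta (v x))) .bot) (by fun_prop)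
      fun x p t e => ?_
    · have := key.comp (f := fun q : γ × (ℕ × Option (List Clause)) × List (ℕ × Option (List Clause)) × Expr =>
        (q.1, q.2.1)) (by fun_prop)
      fun_prop
    · have := sz_cond_le (.hasType (.ghost .target) p.1)
        (p.2.elim (.ghost (.ms (v x))) (ghostDelta (v x))) e
      omega
  convert h using 2 with x
  induction l x with
  | nil => rfl
  | cons p l ih => rw [IRM.paraList, ← ih]; rfl

@[fun_prop] protected theorem PolyT.ghostStep {K : γ → Contract} {l : γ → List (ℕ × Option (List Clause))}
    (hK : PolyT K) (hl : PolyT l) : PolyT (fun x => ghostStep (K x) (l x)) := by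
  simp only [ghostStep_eq]; fun_prop

@[fun_prop] protected theorem PolyT.stepValue {K : γ → Contract} {l : γ → List (ℕ × Option (List Clause))}
    {v : γ → ℕ} (hK : PolyT K) (hl : PolyT l) (hv : PolyT v) :
    PolyT (fun x => stepValue (K x) (l x) (v x)) := by
  unfold IRM.stepValue; fun_prop

@[fun_prop] protected theorem PolyT.argPairs {n : γ → Unary} (hn : PolyT n) : PolyT (fun x => argPairs (n x).val) := by
  unfold IRM.argPairs; fun_prop

@[fun_prop] protected theorem PolyT.stackData {n : γ → Unary} (hn : PolyT n) : PolyT (fun x => stackData (n x).val) := by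
  unfold IRM.stackData; fun_prop

@[fun_prop] protected theorem PolyT.ghostSave {n : γ → Unary} (hn : PolyT n) : PolyT (fun x => ghostSave (n x).val) := by
  have e : ∀ n, ghostSave n = (.target, .stack n) :: (argPairs n).map fun p => (.arg p.1, .stack p.2) :=
    fun n => by rw [argPairs_eq, List.map_map]; rfl
  simp only [e]; fun_prop

/-- Addition is not an elementary operation. Adding the length of a list is repeated succession, and
the result grows by at most one bit each time. -/
theorem PolyT.addLength {f : γ → ℕ} {l : γ → List α} (hf : PolyT f) (hl : PolyT l) :
    PolyT (fun x => f x + (l x).length) := by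
  have h : PolyT (fun x => IRM.paraList (f x) (fun _ _ v => v + 1) (l x)) :=
    .paraList_of_le (s := fun _ _ _ v => v + 1) hf (by fun_prop) hl (f := fun _ _ => 0) (by fun_prop)
      fun x a t v => by
        have := nat_size_succ_le v
        rw [sz_nat, sz_nat]; omega
  convert h using 2 with x
  induction l x with
  | nil => rfl
  | cons a l ih => rw [IRM.paraList, ← ih]; rfl

@[fun_prop] protected theorem PolyT.range' {f : γ → ℕ} {n : γ → Unary} (hf : PolyT f) (hn : PolyT n) :
    PolyT (fun x => List.range' (f x) (n x).val) := by
  have h : PolyT (fun p : ℕ × Unary => (IRM.paraList [] (fun (_ : ℕ) t v => (p.1 + t.length) :: v)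
      (List.replicate p.2.val 0)).reverse) := by
    refine .reverse (.paraList (b := fun _ => [])
      (s := fun (p : ℕ × Unary) (_ : ℕ) t v => (p.1 + t.length) :: v) (by fun_prop) ?_
      (PolyT.unaryList.comp .snd) ⟨2 * Polynomial.X + 1, fun p a t v => ?_⟩)
    · exact .cons (.addLength (by fun_prop) (by fun_prop)) (by fun_prop)
    · have h1 : ∀ i k : ℕ, sz (i + k) ≤ sz i + k := fun i k => by
        induction k with
        | zero => exact le_rfl
        | succ k ih =>
          have h2 : sz (i + (k + 1)) ≤ sz (i + k) + 1 := by
            rw [sz_nat, sz_nat]; exact Nat.succ_le_succ (nat_size_succ_le _)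
          omega
      have h2 := h1 p.1 t.length
      have h3 := length_le_sz t
      have h4 : sz p = sz p.1 + sz p.2 + 1 := rfl
      simp only [Polynomial.eval_add, Polynomial.eval_mul, Polynomial.eval_X, Polynomial.eval_ofNat,
        Polynomial.eval_one, sz_cons]
      omega
  have h' := h.comp (hf.prodMk hn)
  convert h' using 2 with x
  induction (n x).val with
  | zero => rfl
  | succ k ih =>
    rw [List.replicate_succ, IRM.paraList, List.reverse_cons, ← ih, List.length_replicate,
      ← List.range'_1_concat]

end
section
variable {γ : Type} [TreeEnc γ]

@[fun_prop] protected theorem PolyT.monitorInvariant {K : γ → Contract} (hK : PolyT K) :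
    PolyT (fun x => monitorInvariant (K x)) := by
  unfold IRM.monitorInvariant; fun_prop

@[fun_prop] protected theorem PolyT.stateData {K : γ → Contract} (hK : PolyT K) :
    PolyT (fun x => stateData (K x)) := by
  unfold IRM.stateData; fun_prop

@[fun_prop] protected theorem PolyT.localData {v : γ → ℕ} {n : γ → Unary} (hv : PolyT v) (hn : PolyT n) :
    PolyT (fun x => localData (v x) (n x).val) := by
  unfold IRM.localData; fun_prop

@[fun_prop] protected theorem PolyT.callInvariant {K : γ → Contract} {v : γ → ℕ} {n : γ → Unary} (hK : PolyT K)
    (hv : PolyT v) (hn : PolyT n) : PolyT (fun x => callInvariant (K x) (v x) (n x).val) := by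
  simp only [callInvariant_eq, List.map_map]
  unfold Prod.swap Function.comp
  fun_prop

@[fun_prop] protected theorem PolyT.trivialEqs {n : γ → Unary} (hn : PolyT n) :
    PolyT (fun x => trivialEqs (n x).val) := by
  unfold IRM.trivialEqs; fun_prop

@[fun_prop] protected theorem PolyT.ghostBefore {P : γ → Program} {K : γ → Contract} {c m : γ → ℕ}
    {n : γ → Unary} (hP : PolyT P) (hK : PolyT K) (hc : PolyT c) (hm : PolyT m) (hn : PolyT n) :
    PolyT (fun x => ghostBefore (P x) (K x) (c x) (m x) (n x).val) := by
  unfold IRM.ghostBefore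
  have : PolyT MethodSpec.before := .specBefore .id
  fun_prop

@[fun_prop] protected theorem PolyT.ghostAfter {P : γ → Program} {K : γ → Contract} {c m n : γ → ℕ}
    (hP : PolyT P) (hK : PolyT K) (hc : PolyT c) (hm : PolyT m) (hn : PolyT n) :
    PolyT (fun x => ghostAfter (P x) (K x) (c x) (m x) (n x)) := by
  unfold IRM.ghostAfter
  have : PolyT MethodSpec.after := .specAfter .id
  fun_prop

@[fun_prop] protected theorem PolyT.ghostExceptional {P : γ → Program} {K : γ → Contract} {c m n : γ → ℕ}
    (hP : PolyT P) (hK : PolyT K) (hc : PolyT c) (hm : PolyT m) (hn : PolyT n) :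
    PolyT (fun x => ghostExceptional (P x) (K x) (c x) (m x) (n x)) := by
  unfold IRM.ghostExceptional
  have : PolyT MethodSpec.exceptional := .specExceptional .id
  fun_prop

@[fun_prop] protected theorem PolyT.covers {h : γ → Handler} {L : γ → ℕ} (hh : PolyT h) (hL : PolyT L) :
    PolyT (fun x => (h x).covers (L x)) := by
  have e : PolyT (fun x => !decide (L x < (h x).b) && decide (L x < (h x).e)) := by fun_prop
  convert e using 2 with x
  simp only [Handler.covers, ← decide_not, Nat.not_lt]

@[fun_prop] protected theorem PolyT.firstHandler {H : γ → List Handler} {L : γ → ℕ} (hH : PolyT H)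
    (hL : PolyT L) : PolyT (fun x => firstHandler (H x) (L x)) := by
  unfold IRM.firstHandler; fun_prop

/-- A form without matching on instructions, composed of polynomial-time operations. -/
theorem ghostsAt_eq (P : Program) (K : Contract) (code : List Instr) (H : List Handler) (L : ℕ) :
    ghostsAt P K code H L = code.zipIdx.flatMap fun q =>
      bif teq q.1.tag 13 && relevant P K q.1.num q.1.num' q.1.arity.val then
        (bif teq (q.2 + 1) L then ghostAfter P K q.1.num q.1.num' q.1.arity.val else []) ++
        (bif (firstHandler H q.2).elim false fun h => teq h.target L then
          ghostExceptional P K q.1.num q.1.num' q.1.arity.val else []) ++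
        (bif teq q.2 L then ghostBefore P K q.1.num q.1.num' q.1.arity.val else [])
      else [] := by
  rw [ghostsAt]
  congr 1
  funext q
  obtain ⟨ι, i⟩ := q
  cases ι <;> try rfl
  next c m n =>
  change (if relevant P K c m n = true then _ else _) = bif relevant P K c m n then _ else _
  rw [Bool.cond_eq_ite]
  congr 1
  change _ = (bif _ then ghostAfter P K c m n else []) ++
    (bif _ then ghostExceptional P K c m n else []) ++ (bif _ then ghostBefore P K c m n else [])
  cases firstHandler H i <;> simp [teq, Bool.cond_eq_ite]

@[fun_prop] protected theorem PolyT.ghostsAt {P : γ → Program} {K : γ → Contract} {code : γ → List Instr}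
    {H : γ → List Handler} {L : γ → ℕ} (hP : PolyT P) (hK : PolyT K) (hcode : PolyT code) (hH : PolyT H)
    (hL : PolyT L) : PolyT (fun x => ghostsAt (P x) (K x) (code x) (H x) (L x)) := by
  simp only [ghostsAt_eq]
  fun_prop

/-! #### The expected formulas -/

/-- Again separates the old part `b` from the growth, with `tt` in its place. -/
theorem sz_ite_le (a b c : Assertion) :
    sz (Assertion.ite a b c) ≤ sz b + sz (Assertion.ite a .tt c) := by
  change (Assertion.enc _).size ≤ b.enc.size + (Assertion.enc _).size
  simp only [Assertion.ite, Assertion.imp, Assertion.enc, encTag, encList, Tree.size]; omega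

protected theorem PolyT.clauseFormula {G : γ → CGuard → Assertion} {F : γ → List (ℕ × CExpr) → Assertion}
    {l : γ → List Clause} (hG : PolyT (fun p : γ × CGuard => G p.1 p.2))
    (hF : PolyT (fun p : γ × List (ℕ × CExpr) => F p.1 p.2)) (hl : PolyT l) :
    PolyT (fun x => clauseFormula (G x) (F x) (l x)) := by
  have h : PolyT (fun x => IRM.paraList Assertion.tt
      (fun cl _ v => .ite (.eq (boolExpr (G x cl.guard)) (.lit 0)) v (F x cl.update)) (l x)) := by
    have hf : PolyT (fun p : γ × Clause =>
        Assertion.ite (.eq (boolExpr (G p.1 p.2.guard)) (.lit 0)) .tt (F p.1 p.2.update)) := by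
      have h1 := hG.comp (f := fun p : γ × Clause => (p.1, p.2.guard)) (by fun_prop)
      have h2 := hF.comp (f := fun p : γ × Clause => (p.1, p.2.update)) (by fun_prop)
      fun_prop
    refine .paraList_of_le (b := fun _ => Assertion.tt)
      (s := fun x cl _ v => .ite (.eq (boolExpr (G x cl.guard)) (.lit 0)) v (F x cl.update))
      (by fun_prop) ?_ hl (f := fun x cl => Assertion.ite (.eq (boolExpr (G x cl.guard)) (.lit 0)) .tt
        (F x cl.update)) hf fun x cl t v => ?_
    · have h1 := hG.comp (f := fun p : γ × Clause × List Clause × Assertion => (p.1, p.2.1.guard))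
        (by fun_prop)
      have h2 := hF.comp (f := fun p : γ × Clause × List Clause × Assertion => (p.1, p.2.1.update))
        (by fun_prop)
      fun_prop
    · exact (sz_ite_le _ _ _).trans (Nat.le_add_right _ _)
  convert h using 2 with x
  induction l x with
  | nil => rfl
  | cons cl l ih => rw [IRM.paraList, ← ih]; rfl

protected theorem PolyT.eventFormula {e : γ → Expr} {G : γ → CGuard → Assertion}
    {F : γ → List (ℕ × CExpr) → Assertion} {l : γ → List (ℕ × Option (List Clause))} (he : PolyT e)
    (hG : PolyT (fun p : γ × CGuard => G p.1 p.2))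
    (hF : PolyT (fun p : γ × List (ℕ × CExpr) => F p.1 p.2)) (hl : PolyT l) :
    PolyT (fun x => eventFormula (e x) (G x) (F x) (l x)) := by
  have hF0 : PolyT (fun x => F x []) := hF.comp (f := fun x => (x, [])) (by fun_prop)
  have h : PolyT (fun x => IRM.paraList (F x []) (fun p _ v =>
      .ite (.eq (boolExpr (.hasType (e x) p.1)) (.lit 0)) v
        (p.2.elim (F x []) (clauseFormula (G x) (F x)))) (l x)) := by
    have h0 : PolyT (fun p : γ × ℕ × Option (List Clause) =>
        p.2.2.elim (F p.1 []) (clauseFormula (G p.1) (F p.1))) := by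
      refine .optionElim (g := fun p : γ × ℕ × Option (List Clause) => clauseFormula (G p.1) (F p.1))
        (by fun_prop) (by fun_prop) (.clauseFormula
          (G := fun p : (γ × ℕ × Option (List Clause)) × List Clause => G p.1.1)
          (F := fun p => F p.1.1) ?_ ?_ .snd)
      · exact hG.comp (f := fun p : ((γ × ℕ × Option (List Clause)) × List Clause) × CGuard =>
          (p.1.1.1, p.2)) (by fun_prop)
      · exact hF.comp (f := fun p : ((γ × ℕ × Option (List Clause)) × List Clause) × List (ℕ × CExpr) =>
          (p.1.1.1, p.2)) (by fun_prop)
    have hf : PolyT (fun p : γ × ℕ × Option (List Clause) =>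
        Assertion.ite (.eq (boolExpr (.hasType (e p.1) p.2.1)) (.lit 0)) .tt
          (p.2.2.elim (F p.1 []) (clauseFormula (G p.1) (F p.1)))) := by
      fun_prop
    refine .paraList_of_le
      (s := fun x p _ v => .ite (.eq (boolExpr (.hasType (e x) p.1)) (.lit 0)) v
        (p.2.elim (F x []) (clauseFormula (G x) (F x))))
      hF0 ?_ hl (f := fun x p => Assertion.ite (.eq (boolExpr (.hasType (e x) p.1)) (.lit 0)) .tt
        (p.2.elim (F x []) (clauseFormula (G x) (F x)))) hf fun x p t v => ?_
    · have h1 := h0.comp (f := fun p : γ × (ℕ × Option (List Clause)) ×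
          List (ℕ × Option (List Clause)) × Assertion => (p.1, p.2.1)) (by fun_prop)
      fun_prop
    · exact (sz_ite_le _ _ _).trans (Nat.le_add_right _ _)
  convert h using 2 with x
  induction l x with
  | nil => rfl
  | cons p l ih => rw [IRM.paraList, ← ih]; rfl

protected theorem PolyT.leafFormula {K : γ → Contract} {l : γ → List (ℕ × Option (List Clause))}
    {θ η : γ → SubstData} {u : γ → List (ℕ × CExpr)} (hK : PolyT K) (hl : PolyT l) (hθ : PolyT θ)
    (hη : PolyT η) (hu : PolyT u) : PolyT (fun x => leafFormula (K x) (l x) (θ x) (η x) (u x)) := by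
  unfold IRM.leafFormula; fun_prop

@[fun_prop] protected theorem PolyT.expectedFormula {K : γ → Contract} {l : γ → List (ℕ × Option (List Clause))}
    {θ η : γ → SubstData} {o : γ → Option Assertion} (hK : PolyT K) (hl : PolyT l) (hθ : PolyT θ)
    (hη : PolyT η) (ho : PolyT o) :
    PolyT (fun x => expectedFormula (K x) (l x) (θ x) (η x) (o x)) := by
  unfold IRM.expectedFormula
  refine .eventFormula (G := fun x g => (g.inst ghostPlaces).subst (θ x).toSubst)
    (F := fun x u => (o x).elim (leafFormula (K x) (l x) (θ x) (η x) u)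
      (.and (leafFormula (K x) (l x) (θ x) (η x) u))) (by fun_prop) (by fun_prop) ?_ hl
  have h : PolyT (fun p : γ × List (ℕ × CExpr) => leafFormula (K p.1) (l p.1) (θ p.1) (η p.1) p.2) :=
    .leafFormula (by fun_prop) (by fun_prop) (by fun_prop) (by fun_prop) (by fun_prop)
  have h' := h.comp (f := fun q : (γ × List (ℕ × CExpr)) × Assertion => q.1) (by fun_prop)
  exact .optionElim (o := fun p => o p.1) (g := fun p : γ × List (ℕ × CExpr) =>
    .and (leafFormula (K p.1) (l p.1) (θ p.1) (η p.1) p.2)) (by fun_prop) h (.assertionAnd h' .snd)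

@[fun_prop] protected theorem PolyT.callTest {P : γ → Program} {K : γ → Contract} {a w : γ → Assertion}
    {k c m : γ → ℕ} {n : γ → Unary} (hP : PolyT P) (hK : PolyT K) (ha : PolyT a) (hw : PolyT w) (hk : PolyT k)
    (hc : PolyT c) (hm : PolyT m) (hn : PolyT n) :
    PolyT (fun x => callTest (P x) (K x) (a x) (w x) (k x) (c x) (m x) (n x).val) := by
  unfold IRM.callTest
  have h1 : PolyT MethodSpec.before := .specBefore .id
  have h2 : PolyT MethodSpec.after := .specAfter .id
  have h3 : PolyT MethodSpec.exceptional := .specExceptional .id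
  fun_prop

@[fun_prop] protected theorem PolyT.blockTest {P : γ → Program} {K : γ → Contract} {code : γ → List Instr}
    {a w : γ → Assertion} {k : γ → ℕ} (hP : PolyT P) (hK : PolyT K) (hcode : PolyT code) (ha : PolyT a)
    (hw : PolyT w) (hk : PolyT k) :
    PolyT (fun x => blockTest (P x) (K x) (code x) (a x) (w x) (k x)) := by
  have h : PolyT (fun x => (code x).any fun ι => bif IRM.teq ι.tag 13 then
      callTest (P x) (K x) (a x) (w x) (k x) ι.num ι.num' ι.arity.val else false) := by fun_prop
  convert h using 2 with x
  rw [IRM.blockTest]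
  congr 1
  funext ι
  cases ι <;> rfl

/-! #### The checker -/

@[fun_prop] protected theorem PolyT.ghostWpPair {us : γ → List GhostUpdate} {φ : γ → Assertion} (hus : PolyT us)
    (hφ : PolyT φ) : PolyT (fun x => ghostWpPair (us x) (φ x)) := by
  unfold IRM.ghostWpPair IRM.ghostData; fun_prop

@[fun_prop] protected theorem PolyT.dataTest {P : γ → Program} {K : γ → Contract} {code : γ → List Instr}
    {us : γ → List GhostUpdate} {a b : γ → Assertion} {d : γ → SubstData} {k : γ → ℕ} (hP : PolyT P)
    (hK : PolyT K) (hcode : PolyT code) (hus : PolyT us) (ha : PolyT a) (hb : PolyT b) (hd : PolyT d)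
    (hk : PolyT k) :
    PolyT (fun x => dataTest (P x) (K x) (code x) (us x) (a x) (b x) (d x) (k x)) := by
  unfold IRM.dataTest; fun_prop

@[fun_prop] protected theorem PolyT.branchTest {us : γ → List GhostUpdate} {a a₁ a₂ c : γ → Assertion}
    {k : γ → ℕ} (hus : PolyT us) (ha : PolyT a) (ha₁ : PolyT a₁) (ha₂ : PolyT a₂) (hc : PolyT c)
    (hk : PolyT k) : PolyT (fun x => branchTest (us x) (a x) (a₁ x) (a₂ x) (c x) (k x)) := by
  unfold IRM.branchTest; fun_prop

@[fun_prop] protected theorem PolyT.left {a : γ → Assertion} (ha : PolyT a) : PolyT (fun x => (a x).left) :=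
  .component (fun t => bif IRM.teq t.fst (.atom 14) then t.snd.fst else t) (by fun_prop)
    (fun a => by cases a <;> rfl) ha

/-- The straight-line instructions share the last case; the number of the local is passed on only
for loads and stores. -/
theorem instrTest_eq (P : Program) (K : Contract) (M : Method) (A : List Assertion)
    (us : List GhostUpdate) (L : ℕ) (ι : Instr) : instrTest P K M A us L ι =
    bif teq ι.tag 8 then teq (A.getD L .ff) (ghostWpPair us (A.getD ι.num .ff))
    else bif teq ι.tag 14 then teq (A.getD L .ff) (ghostWpPair us (monitorInvariant K))
    else bif teq ι.tag 15 then true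
    else bif teq ι.tag 12 then branchTest us (A.getD L .ff) (A.getD ι.num .ff) (A.getD (L + 1) .ff)
      (.eq (.stack 0) (.lit 0)) 1
    else bif teq ι.tag 11 then branchTest us (A.getD L .ff) (A.getD ι.num .ff) (A.getD (L + 1) .ff)
      (.eq (.stack 0) (.stack 1)) 2
    else bif teq ι.tag 3 then us.isEmpty && teq (A.getD L .ff) (monitorInvariant K) &&
      M.handlers.all fun h => !h.covers L || teq (A.getD h.target .ff) (monitorInvariant K)
    else bif teq ι.tag 13 then teq (A.getD L .ff) (ghostWpPair us (monitorInvariant K)) ||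
      teq (A.getD L .ff).left (ghostWpPair us (monitorInvariant K))
    else ι.data.elim false fun d => dataTest P K M.code us (A.getD L .ff) (A.getD (L + 1) .ff) d
      (bif teq ι.tag 1 || teq ι.tag 2 then ι.num else 0) := by
  cases ι <;> rfl

@[fun_prop] protected theorem PolyT.instrTest {P : γ → Program} {K : γ → Contract} {M : γ → Method}
    {A : γ → List Assertion} {us : γ → List GhostUpdate} {L : γ → ℕ} {ι : γ → Instr} (hP : PolyT P)
    (hK : PolyT K) (hM : PolyT M) (hA : PolyT A) (hus : PolyT us) (hL : PolyT L) (hι : PolyT ι) :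
    PolyT (fun x => instrTest (P x) (K x) (M x) (A x) (us x) (L x) (ι x)) := by
  simp only [instrTest_eq]; fun_prop

@[fun_prop] protected theorem PolyT.embedTest {P : γ → Program} {K : γ → Contract} {M : γ → Method}
    (hP : PolyT P) (hK : PolyT K) (hM : PolyT M) : PolyT (fun x => embedTest (P x) (K x) (M x)) := by
  have h : PolyT (fun x => (M x).code.zipIdx.all fun q => bif IRM.teq q.1.tag 13 then
      !relevant (P x) (K x) q.1.num q.1.num' q.1.arity.val ||
        (firstHandler (M x).handlers q.2).elim false fun h =>
          IRM.teq h.b q.2 && IRM.teq h.e (q.2 + 1) && IRM.teq h.cls throwable &&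
            IRM.teq ((M x).handlers.filter fun h' => IRM.teq h'.target h.target).length 1
      else true) := by
    fun_prop
  convert h using 2 with x
  rw [IRM.embedTest]
  congr 1
  funext q
  obtain ⟨ι, i⟩ := q
  cases ι <;> rfl

@[fun_prop] protected theorem PolyT.methodTest {P : γ → Program} {K : γ → Contract} {M : γ → Method} {A : γ → List Assertion}
    (hP : PolyT P) (hK : PolyT K) (hM : PolyT M) (hA : PolyT A) :
    PolyT (fun x => methodTest (P x) (K x) (M x) (A x)) := by
  unfold IRM.methodTest; fun_prop

/-- Closure properties of all constituents are registered, so the running time of the checker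
follows from its definition. -/
theorem PolyT.check : PolyT Bundle.check := by
  unfold Bundle.check; fun_prop

end
end IRM

-- The main theorem: running time, soundness and completeness combined.

theorem mainTheorem3 :
    ∃ (checker : IRM.Code) (p : Polynomial ℕ),
      (∀ B : IRM.Bundle, (checker.run B.enc).2 ≤ p.eval B.enc.size) ∧
      (∀ B : IRM.Bundle, checker.Accepts B.enc →
        B.IsAdherenceProof ∧
        ∀ φ ∈ B.vcs, ∃ n ≤ p.eval φ.size, IRM.RewritesIn n φ IRM.Assertion.tt) ∧
      (∀ (P : IRM.Program) (K : IRM.Contract), P.WF → K.WF →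
        checker.Accepts (IRM.generate P K).enc) := by
  obtain ⟨c, q, h⟩ := IRM.PolyT.check
  have accepts (B : IRM.Bundle) : c.Accepts B.enc ↔ B.check = true := by
    have h1 : (c.run B.enc).1 = IRM.Tree.ofBool B.check := (h B).1
    rw [IRM.Code.Accepts, h1]
    cases B.check <;> simp [IRM.Tree.ofBool]
  -- The sum bounds both quantities: `q` the running time, the quadratic summand the number of
  -- rewrite steps, as in `stepBound`.
  refine ⟨c, q + (Polynomial.X ^ 2 + 10 * Polynomial.X + 10), fun B => ?_, fun B hB => ?_,
    fun P K hP hK => (accepts _).2 (IRM.check_generate hP hK)⟩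
  · rw [Polynomial.eval_add]
    exact (h B).2.trans (Nat.le_add_right _ _)
  · obtain ⟨h1, h2⟩ := B.check_sound ((accepts B).1 hB)
    refine ⟨h1, fun φ hφ => ?_⟩
    obtain ⟨n, hn, hr⟩ := (h2 φ hφ).rewritesIn
    refine ⟨n, hn.trans ?_, hr⟩
    simp [IRM.stepBound]
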